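/- **Conventions.** An *$\omega$-category* is a strict globular $\omega$-category: a set with source and target maps $s_n,t_n$ and partial compositions $x*_ny$ ($n\ge 0$, defined iff $t_nx=s_ny$) satisfying the usual globular, unit, associativity and exchange axioms, in which every $x$ has a finite dimension $\dim x=\min\{n: s_nx=t_nx=x\}$. Write $d_n^-=s_n$, $d_n^+=t_n$, and let $tr^n A$ be the set of $x\in A$ with $\dim x\le n$ and $i_n:tr^{n-1}A\subset tr^nA$ the inclusion. An $\omega$-category $\mathcal C$ is *non-contracting* if $\dim s_1x=\dim t_1x=1$ whenever $\dim x\ge 1$; an $\omega$-functor between such is non-contracting if it sends $1$-dimensional morphisms to $1$-dimensional ones. Let $\omega Cat_1$ be the resulting category and $\mathcal C_0=tr^0\mathcal C$. For $\mathcal C$ in $\omega Cat_1$, let $\mathbb P\mathcal C$ be the $\omega$-category of all $x\in\mathcal C$ with $\dim x\ge1$, whose operations $s_n,t_n,*_n$ are the operations $s_{n+1},t_{n+1},*_{n+1}$ of $\mathcal C$; below, degrees are those of $\mathbb P\mathcal C$. Let $\mathbb P^-\mathcal C$ be the universal $\omega$-category equipped with an $\omega$-functor from $\mathbb P\mathcal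 C$ that identifies $x$ with $x*_0y$ (composition in $\mathcal C$) whenever $x$, $y$ and $x*_0y$ lie in $\mathbb P\mathcal C$. It is functorial in $\mathcal C$, and $s_0:\mathcal C\to\mathcal C_0$ induces a map $s_0:\mathbb P^-\mathcal C\to\mathcal C_0$. Let $\Delta^n$ be the $\omega$-category of the $n$-simplex (the $n$-th oriental), oriented so that the faces of a face $(\sigma_0<\dots<\sigma_p)$ omitting $\sigma_i$ with $i$ even lie in its source and those with $i$ odd in its target. The *branching semi-globular cut* $(\mathcal N^{gl^-},\mathbb P^-,ev)$ consists of the functor $\mathcal N^{gl^-}$ from $\omega Cat_1$ to augmented simplicial sets with $\mathcal N^{gl^-}_n(\mathcal C)=\omega Cat(\Delta^n,\mathbb P^-\mathcal C)$ for $n\ge0$ and $\mathcal N^{gl^-}_{-1}(\mathcal C)=\mathcal C_0$, augmented by $\partial_{-1}(x)=s_0x$; the functor $\mathbb P^-$; and the natural maps $ev=ev_n:\mathcal N^{gl^-}_n\to tr^n\mathbb P^-$, $ev(x)=x(0<1<\dots<n)$. More generally a *cut* $(\mathcal F,P,ev)$ is a functor $\mathcal F$ from $\omega Cat_1$ to augmented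 simplicial sets, a functor $P:\omega Cat_1\to\omega Cat$ and natural maps $ev_n:\mathcal F_n\to tr^nP$ ($n\ge 0$). For such a cut let $C_{n+1}(\mathcal C)=\mathbb Z\mathcal F_n(\mathcal C)$ ($n\ge 0$) with $\partial=\sum_i(-1)^i\partial_i$, let $M_{n+1}(\mathcal C)\subset C_{n+1}(\mathcal C)$ be the subgroup generated by the *thin* simplices $x\in\mathcal F_n(\mathcal C)$, i.e. those with $\dim ev(x)<n$ (so $M_1=0$), and let $CR_{n+1}=C_{n+1}/(M_{n+1}+\partial M_{n+2})$. **Theorem.** The branching semi-globular cut $(\mathcal F,P,ev)=(\mathcal N^{gl^-},\mathbb P^-,ev)$ is regular, that is: 1. $\mathcal F_{-1}(\mathcal C)$ depends only on $\mathcal C_0$ (the functor $\mathcal F_{-1}$ factors through $\mathcal C\mapsto\mathcal C_0$). 2. $ev_0$ is a bijection, identifying $\mathcal F_0$ with $tr^0P$. 3. $ev\circ\epsilon_i=ev$ for all degeneracies $\epsilon_i$. 4. Let $n\ge1$, let $\mu:\mathcal F_{n-1}\to\mathcal F_n$ and $\square:tr^{n-1}P\to\mathcal F_{n-1}$ be natural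 transformations with $ev_{n-1}\circ\square=\mathrm{Id}$ and $ev_n\circ\mu\circ\square=i_n$. Then there is exactly one natural transformation $\mu.\square:tr^nP\to\mathcal F_n$ with $ev_n\circ(\mu.\square)=\mathrm{Id}$ and $(\mu.\square)\circ i_n=\mu\circ\square$. 5. Let $\square_1:tr^0P\to\mathcal F_0$ be the inverse of $ev_0$ and $\square_{n+1}=\epsilon_{n-1}.\square_n:tr^nP\to\mathcal F_n$ for $n\ge1$. Then for all $n\geq 1$: (a) $\{ev\,\partial_{n-1}\square_{n+1},\,ev\,\partial_n\square_{n+1}\}=\{s_{n-1},t_{n-1}\}$ as sets of natural transformations $tr^nP\to tr^{n-1}P$; (b) for $0\le i\le n$, $p\ge0$ and $\alpha\in\{-,+\}$: if $ev\,\partial_i\square_{n+1}(u)=d_p^\alpha u$ for some $\mathcal C$ and some $u\in P\mathcal C$ with $\dim u=n$ and $s_qu\ne t_qu$ for all $q<n$, then $\partial_i\square_{n+1}=\partial_i\square_{n+1}d_p^\alpha$ as natural transformations $tr^nP\to\mathcal F_{n-1}$. 6. For all $n\ge 0$, the natural transformation $\Phi_{n+1}=\square_{n+1}\circ ev_n:\mathcal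 F_n\to\mathcal F_n$ induces the identity on $CR_{n+1}$. 7. If $0\le q<n$, $x,y,z\in\mathcal F_n(\mathcal C)$ and $ev(x)*_q ev(y)$ is defined and equal to $ev(z)$, then $x+y=z$ in $CR_{n+1}(\mathcal C)$, and functorially so: for fixed $n,q$ one can choose $\tau\in M_{n+1}(\mathcal C)$ and $\rho\in M_{n+2}(\mathcal C)$ with $x+y-z=\tau+\partial\rho$ in $C_{n+1}(\mathcal C)$ for all such $(\mathcal C,x,y,z)$, naturally with respect to the morphisms of $\omega Cat_1$. In particular there is exactly one family of natural transformations $\square^{gl^-}_{n+1}:tr^n\mathbb P^-\to\mathcal N^{gl^-}_n$ ($n\ge0$) with $ev_n\circ\square^{gl^-}_{n+1}=\mathrm{Id}$ and $\square^{gl^-}_{n+2}\circ i_{n+1}=\epsilon_n\circ\square^{gl^-}_{n+1}$ for all $n\ge0$, and hence the cut has folding operators $\Phi^{gl^-}_{n+1}=\square^{gl^-}_{n+1}\circ ev_n$. -/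

import Mathlib

open CategoryTheory Opposite

universe u v w

/-! ## Strict globular omega-categories -/

/-- An omega-category: a set with source maps `d false n = s_n`, target maps `d true n = t_n`, and
partial compositions `comp n x y = x *_n y`, defined exactly when `t_n x = s_n y`. -/
structure OmegaCat where
  /-- the underlying set of morphisms -/
  Carrier : Type u
  /-- `d false n` is the `n`-source, `d true n` is the `n`-target -/
  d : Bool → ℕ → Carrier → Carrier
  /-- the composition `x *_n y` -/
  comp : ∀ (n : ℕ) (x y : Carrier), d true n x = d false n y → Carrier
  d_d_lt : ∀ (α β : Bool) (m n : ℕ) (x : Carrier), m < n → d β m (d α n x) = d β m x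
  d_d_ge : ∀ (α β : Bool) (m n : ℕ) (x : Carrier), n ≤ m → d β m (d α n x) = d α n x
  source_comp : ∀ (n : ℕ) (x : Carrier) (h : d true n (d false n x) = d false n x),
    comp n (d false n x) x h = x
  comp_target : ∀ (n : ℕ) (x : Carrier) (h : d true n x = d false n (d true n x)),
    comp n x (d true n x) h = x
  d_source_comp : ∀ (n : ℕ) (x y : Carrier) (h : d true n x = d false n y),
    d false n (comp n x y h) = d false n x
  d_target_comp : ∀ (n : ℕ) (x y : Carrier) (h : d true n x = d false n y),
    d true n (comp n x y h) = d true n y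
  d_comp : ∀ (α : Bool) (m n : ℕ) (x y : Carrier) (h : d true n x = d false n y), m ≠ n →
    ∃ h' : d true n (d α m x) = d false n (d α m y),
      d α m (comp n x y h) = comp n (d α m x) (d α m y) h'
  assoc : ∀ (n : ℕ) (x y z : Carrier) (hxy : d true n x = d false n y)
    (hyz : d true n y = d false n z) (h₁ : d true n (comp n x y hxy) = d false n z)
    (h₂ : d true n x = d false n (comp n y z hyz)),
    comp n (comp n x y hxy) z h₁ = comp n x (comp n y z hyz) h₂
  exchange : ∀ (m n : ℕ) (x y z w : Carrier), m ≠ n →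
    ∀ (hxy : d true n x = d false n y) (hzw : d true n z = d false n w)
      (hxz : d true m x = d false m z) (hyw : d true m y = d false m w)
      (h₁ : d true m (comp n x y hxy) = d false m (comp n z w hzw))
      (h₂ : d true n (comp m x z hxz) = d false n (comp m y w hyw)),
      comp m (comp n x y hxy) (comp n z w hzw) h₁ = comp n (comp m x z hxz) (comp m y w hyw) h₂
  finite_dim : ∀ x : Carrier, ∃ n : ℕ, d false n x = x ∧ d true n x = x

namespace OmegaCat

instance : CoeSort OmegaCat.{u} (Type u) := ⟨Carrier⟩

/-- The dimension of a morphism: the smallest `n` with `s_n x = t_n x = x`. -/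
noncomputable def dim (A : OmegaCat.{u}) (x : A) : ℕ :=
  sInf {n : ℕ | A.d false n x = x ∧ A.d true n x = x}

theorem dim_le_iff (A : OmegaCat.{u}) (x : A) (n : ℕ) :
    A.dim x ≤ n ↔ ∀ α, A.d α n x = x := by
  have key : ∀ k l : ℕ, k ≤ l → A.d false k x = x → ∀ α, A.d α l x = x := by
    intro k l hkl h α
    have := A.d_d_ge false α l k x hkl
    rwa [h] at this
  constructor
  · intro h
    have hmem := Nat.sInf_mem (s := {n : ℕ | A.d false n x = x ∧ A.d true n x = x})
      (A.finite_dim x)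
    exact key _ _ h hmem.1
  · intro h
    exact Nat.sInf_le ⟨h false, h true⟩

theorem dim_d_le (A : OmegaCat.{u}) (x : A) (α : Bool) (n : ℕ) : A.dim (A.d α n x) ≤ n :=
  (A.dim_le_iff _ _).2 fun β => A.d_d_ge α β n n x le_rfl

theorem comp_congr (A : OmegaCat.{u}) {n : ℕ} {x x' y y' : A} (hx : x = x') (hy : y = y')
    (h : A.d true n x = A.d false n y) (h' : A.d true n x' = A.d false n y') :
    A.comp n x y h = A.comp n x' y' h' := by
  subst hx; subst hy; rfl

/-- In low degree both factors of a composite have the same faces. -/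
theorem d_comp_of_lt (A : OmegaCat.{u}) (α : Bool) {m n : ℕ} (hmn : m < n) (x y : A)
    (h : A.d true n x = A.d false n y) : A.d α m (A.comp n x y h) = A.d α m x := by
  rw [← A.d_d_lt false α m n _ hmn, A.d_source_comp, A.d_d_lt _ _ _ _ _ hmn]

end OmegaCat

/-- An omega-functor. -/
@[ext]
structure OmegaFunctor (A : OmegaCat.{u}) (B : OmegaCat.{v}) where
  /-- the underlying map -/
  toFun : A → B
  map_d : ∀ (α : Bool) (n : ℕ) (x : A), toFun (A.d α n x) = B.d α n (toFun x)
  map_comp : ∀ (n : ℕ) (x y : A) (h : A.d true n x = A.d false n y),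
    ∃ h' : B.d true n (toFun x) = B.d false n (toFun y),
      toFun (A.comp n x y h) = B.comp n (toFun x) (toFun y) h'

namespace OmegaFunctor

instance (A : OmegaCat.{u}) (B : OmegaCat.{v}) : CoeFun (OmegaFunctor A B) (fun _ => A → B) :=
  ⟨toFun⟩

/-- The identity omega-functor. -/
def id (A : OmegaCat.{u}) : OmegaFunctor A A where
  toFun x := x
  map_d _ _ _ := rfl
  map_comp _ _ _ h := ⟨h, rfl⟩

/-- Composition of omega-functors, in diagrammatic order. -/
def trans {A : OmegaCat.{u}} {B : OmegaCat.{v}} {C : OmegaCat.{w}} (f : OmegaFunctor A B)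
    (g : OmegaFunctor B C) : OmegaFunctor A C where
  toFun x := g (f x)
  map_d α n x := by rw [f.map_d, g.map_d]
  map_comp n x y h := by
    obtain ⟨h₁, e₁⟩ := f.map_comp n x y h
    obtain ⟨h₂, e₂⟩ := g.map_comp n _ _ h₁
    exact ⟨h₂, by rw [e₁, e₂]⟩

theorem dim_le {A : OmegaCat.{u}} {B : OmegaCat.{v}} (f : OmegaFunctor A B) (x : A) :
    B.dim (f x) ≤ A.dim x :=
  (B.dim_le_iff _ _).2 fun α => by
    rw [← f.map_d, (A.dim_le_iff x _).1 le_rfl α]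

end OmegaFunctor

/-- The category of omega-categories. -/
instance : Category OmegaCat.{u} where
  Hom A B := OmegaFunctor A B
  id A := OmegaFunctor.id A
  comp f g := OmegaFunctor.trans f g

/-- The truncation functor `tr^n`: the set of morphisms of dimension at most `n`. -/
noncomputable def OmegaCat.tr (n : ℕ) : OmegaCat.{u} ⥤ Type u where
  obj A := {x : A // A.dim x ≤ n}
  map f := TypeCat.ofHom fun x => ⟨OmegaFunctor.toFun f x.1, (OmegaFunctor.dim_le f x.1).trans x.2⟩
  map_id _ := rfl
  map_comp _ _ := rfl

/-! ## Non-contracting omega-categories and the path omega-category -/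

/-- `A` is non-contracting if `s_1 x` and `t_1 x` are `1`-dimensional for every `x` of dimension at
least `1`. -/
def OmegaCat.NonContracting (A : OmegaCat.{u}) : Prop :=
  ∀ x : A, 1 ≤ A.dim x → A.dim (A.d false 1 x) = 1 ∧ A.dim (A.d true 1 x) = 1

/-- A non-contracting omega-category. -/
structure NCOmegaCat where
  /-- the underlying omega-category -/
  cat : OmegaCat.{u}
  nonContracting : cat.NonContracting

/-- A non-contracting omega-functor: it sends `1`-dimensional morphisms to `1`-dimensional ones. -/
@[ext]
structure NCOmegaFunctor (C D : NCOmegaCat.{u}) where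
  /-- the underlying omega-functor -/
  functor : OmegaFunctor C.cat D.cat
  nonContracting : ∀ x : C.cat, C.cat.dim x = 1 → D.cat.dim (functor x) = 1

/-- The category of non-contracting omega-categories and non-contracting omega-functors. -/
instance : Category NCOmegaCat.{u} where
  Hom C D := NCOmegaFunctor C D
  id C := ⟨OmegaFunctor.id C.cat, fun _ h => h⟩
  comp f g := ⟨f.functor.trans g.functor, fun x h => g.nonContracting _ (f.nonContracting x h)⟩

namespace NCOmegaCat

theorem one_le_dim_d (C : NCOmegaCat.{u}) (α : Bool) (n : ℕ) (x : C.cat) (hx : 1 ≤ C.cat.dim x) :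
    1 ≤ C.cat.dim (C.cat.d α (n + 1) x) := by
  have h1 : ∀ β, 1 ≤ C.cat.dim (C.cat.d β 1 x) := by
    intro β
    cases β
    · exact (C.nonContracting x hx).1.ge
    · exact (C.nonContracting x hx).2.ge
  rcases Nat.eq_zero_or_pos n with rfl | hn
  · exact h1 α
  · by_contra hlt
    have h0 : C.cat.dim (C.cat.d α (n + 1) x) ≤ 1 := by omega
    have e := (C.cat.dim_le_iff _ _).1 h0 false
    rw [C.cat.d_d_lt α false 1 (n + 1) x (by omega)] at e
    have := h1 false
    rw [e] at this
    omega

theorem one_le_dim_comp (C : NCOmegaCat.{u}) (n : ℕ) (x y : C.cat)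
    (h : C.cat.d true (n + 1) x = C.cat.d false (n + 1) y) (hx : 1 ≤ C.cat.dim x) :
    1 ≤ C.cat.dim (C.cat.comp (n + 1) x y h) := by
  by_contra hlt
  have e := (C.cat.dim_le_iff (C.cat.comp (n + 1) x y h) (n + 1)).1 (by omega) false
  rw [C.cat.d_source_comp] at e
  have := C.one_le_dim_d false n x hx
  rw [e] at this
  omega

/-- The path omega-category `PC`: the morphisms of dimension at least `1`, with the `n`-source,
`n`-target and `n`-composition of `PC` being the `(n+1)`-dimensional ones of `C`. -/
noncomputable def path (C : NCOmegaCat.{u}) : OmegaCat.{u} where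
  Carrier := {x : C.cat // 1 ≤ C.cat.dim x}
  d α n x := ⟨C.cat.d α (n + 1) x.1, C.one_le_dim_d α n x.1 x.2⟩
  comp n x y h := ⟨C.cat.comp (n + 1) x.1 y.1 (congrArg Subtype.val h),
    C.one_le_dim_comp n x.1 y.1 _ x.2⟩
  d_d_lt α β m n x h := Subtype.ext (C.cat.d_d_lt α β _ _ _ (by omega))
  d_d_ge α β m n x h := Subtype.ext (C.cat.d_d_ge α β _ _ _ (by omega))
  source_comp n x h := Subtype.ext (C.cat.source_comp _ _ _)
  comp_target n x h := Subtype.ext (C.cat.comp_target _ _ _)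
  d_source_comp n x y h := Subtype.ext (C.cat.d_source_comp _ _ _ _)
  d_target_comp n x y h := Subtype.ext (C.cat.d_target_comp _ _ _ _)
  d_comp α m n x y h hmn := by
    obtain ⟨h', e⟩ := C.cat.d_comp α (m + 1) (n + 1) x.1 y.1 (congrArg Subtype.val h) (by omega)
    exact ⟨Subtype.ext h', Subtype.ext e⟩
  assoc n x y z _ _ _ _ := Subtype.ext (C.cat.assoc _ _ _ _ _ _ _ _)
  exchange m n x y z w hmn _ _ _ _ _ _ :=
    Subtype.ext (C.cat.exchange _ _ _ _ _ _ (by omega) _ _ _ _ _ _)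
  finite_dim x := by
    obtain ⟨n, _, _⟩ := C.cat.finite_dim x.1
    have key : ∀ α, C.cat.d α (n + 1) x.1 = x.1 :=
      (C.cat.dim_le_iff x.1 (n + 1)).1
        (((C.cat.dim_le_iff x.1 n).2 (by rintro (_ | _) <;> assumption)).trans (Nat.le_succ n))
    exact ⟨n, Subtype.ext (key _), Subtype.ext (key _)⟩

theorem one_le_dim_map {C D : NCOmegaCat.{u}} (f : C ⟶ D) (x : C.cat) (hx : 1 ≤ C.cat.dim x) :
    1 ≤ D.cat.dim (NCOmegaFunctor.functor f x) := by
  have h1 := NCOmegaFunctor.nonContracting f _ (C.nonContracting x hx).1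
  by_contra hlt
  have e := (D.cat.dim_le_iff (NCOmegaFunctor.functor f x) 1).1 (by omega) false
  rw [← OmegaFunctor.map_d] at e
  rw [e] at h1
  omega

/-- The path functor on morphisms. -/
noncomputable def pathMap {C D : NCOmegaCat.{u}} (f : C ⟶ D) : OmegaFunctor C.path D.path where
  toFun x := ⟨NCOmegaFunctor.functor f x.1, one_le_dim_map f x.1 x.2⟩
  map_d α n x := Subtype.ext ((NCOmegaFunctor.functor f).map_d α (n + 1) x.1)
  map_comp n x y h := by
    obtain ⟨h', e⟩ := (NCOmegaFunctor.functor f).map_comp (n + 1) x.1 y.1 (congrArg Subtype.val h)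
    exact ⟨Subtype.ext h', Subtype.ext e⟩

/-- The set `C_0` of `0`-dimensional morphisms, as a functor of `C`. -/
noncomputable def zeroCells : NCOmegaCat.{u} ⥤ Type u where
  obj C := {x : C.cat // C.cat.dim x = 0}
  map f := TypeCat.ofHom fun x => ⟨NCOmegaFunctor.functor f x.1,
    Nat.le_zero.1 ((OmegaFunctor.dim_le (NCOmegaFunctor.functor f) x.1).trans x.2.le)⟩
  map_id _ := rfl
  map_comp _ _ := rfl

/-- The generating pairs `(x, x *_0 y)`, with `x`, `y` and `x *_0 y` in `PC`, of the equivalence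
relation that defines the negative semi-path omega-category. -/
def branchRel (C : NCOmegaCat.{u}) (x z : C.path) : Prop :=
  ∃ (y : C.path) (h : C.cat.d true 0 x.1 = C.cat.d false 0 y.1), C.cat.comp 0 x.1 y.1 h = z.1

end NCOmegaCat

/-! ## Quotients of omega-categories

`A.quot r` is the universal omega-category under `A` in which `r`-related elements become equal.
Its elements are formal expressions built from elements of `A` by sources, targets and the
compositions that are defined, modulo the equations that hold in every omega-category under `A`
identifying `r`-related elements. The universal property is proved below. -/

namespace OmegaCat

/-- Formal expressions in the elements of `A`. -/
inductive QTerm (A : OmegaCat.{u}) : Type u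
  | of (x : A) : QTerm A
  | d (α : Bool) (n : ℕ) (a : QTerm A) : QTerm A
  | comp (n : ℕ) (a b : QTerm A) : QTerm A

/-- `QRel A r a b`: both expressions are meaningful and they are provably equal. In particular
`QRel A r a a` says that `a` is meaningful. -/
inductive QRel (A : OmegaCat.{u}) (r : A → A → Prop) : QTerm A → QTerm A → Prop
  | of (x : A) : QRel A r (.of x) (.of x)
  | rel (x y : A) : r x y → QRel A r (.of x) (.of y)
  | of_d (α : Bool) (n : ℕ) (x : A) : QRel A r (.of (A.d α n x)) (.d α n (.of x))
  | of_comp (n : ℕ) (x y : A) (h : A.d true n x = A.d false n y) :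
      QRel A r (.of (A.comp n x y h)) (.comp n (.of x) (.of y))
  | symm (a b : QTerm A) : QRel A r a b → QRel A r b a
  | trans (a b c : QTerm A) : QRel A r a b → QRel A r b c → QRel A r a c
  | d_congr (α : Bool) (n : ℕ) (a b : QTerm A) : QRel A r a b → QRel A r (.d α n a) (.d α n b)
  | comp_congr (n : ℕ) (a a' b b' : QTerm A) : QRel A r a a' → QRel A r b b' →
      QRel A r (.d true n a) (.d false n b) → QRel A r (.comp n a b) (.comp n a' b')
  | d_d_lt (α β : Bool) (m n : ℕ) (a : QTerm A) : m < n → QRel A r a a →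
      QRel A r (.d β m (.d α n a)) (.d β m a)
  | d_d_ge (α β : Bool) (m n : ℕ) (a : QTerm A) : n ≤ m → QRel A r a a →
      QRel A r (.d β m (.d α n a)) (.d α n a)
  | source_comp (n : ℕ) (a : QTerm A) : QRel A r a a → QRel A r (.comp n (.d false n a) a) a
  | comp_target (n : ℕ) (a : QTerm A) : QRel A r a a → QRel A r (.comp n a (.d true n a)) a
  | d_source_comp (n : ℕ) (a b : QTerm A) : QRel A r a a → QRel A r b b →
      QRel A r (.d true n a) (.d false n b) →
      QRel A r (.d false n (.comp n a b)) (.d false n a)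
  | d_target_comp (n : ℕ) (a b : QTerm A) : QRel A r a a → QRel A r b b →
      QRel A r (.d true n a) (.d false n b) →
      QRel A r (.d true n (.comp n a b)) (.d true n b)
  | d_comp (α : Bool) (m n : ℕ) (a b : QTerm A) : m ≠ n → QRel A r a a → QRel A r b b →
      QRel A r (.d true n a) (.d false n b) →
      QRel A r (.d α m (.comp n a b)) (.comp n (.d α m a) (.d α m b))
  | assoc (n : ℕ) (a b c : QTerm A) : QRel A r a a → QRel A r b b → QRel A r c c →
      QRel A r (.d true n a) (.d false n b) → QRel A r (.d true n b) (.d false n c) →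
      QRel A r (.comp n (.comp n a b) c) (.comp n a (.comp n b c))
  | exchange (m n : ℕ) (a b c e : QTerm A) : m ≠ n →
      QRel A r a a → QRel A r b b → QRel A r c c → QRel A r e e →
      QRel A r (.d true n a) (.d false n b) → QRel A r (.d true n c) (.d false n e) →
      QRel A r (.d true m a) (.d false m c) → QRel A r (.d true m b) (.d false m e) →
      QRel A r (.comp m (.comp n a b) (.comp n c e)) (.comp n (.comp m a c) (.comp m b e))

section quot

variable {A : OmegaCat.{u}} {r : A → A → Prop}

theorem QRel.left {a b : QTerm A} (h : QRel A r a b) : QRel A r a a :=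
  .trans _ _ _ h (.symm _ _ h)

theorem QRel.right {a b : QTerm A} (h : QRel A r a b) : QRel A r b b :=
  .trans _ _ _ (.symm _ _ h) h

/-- Sources and targets in high enough degree fix the expression. -/
def QStable (A : OmegaCat.{u}) (r : A → A → Prop) (a : QTerm A) : Prop :=
  ∃ N : ℕ, ∀ n, N ≤ n → ∀ α, QRel A r (.d α n a) a

theorem QStable.of (x : A) : QStable A r (.of x) := by
  refine ⟨A.dim x, fun n hn α => ?_⟩
  have h := QRel.of_d (r := r) α n x
  rw [(A.dim_le_iff x n).1 hn α] at h
  exact .symm _ _ h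

theorem QStable.d {a : QTerm A} (h : QRel A r a a) (α : Bool) (n : ℕ) :
    QStable A r (.d α n a) :=
  ⟨n, fun m hm β => .d_d_ge α β m n a hm h⟩

theorem QStable.comp {a b : QTerm A} (n : ℕ) (ha : QStable A r a) (hb : QStable A r b)
    (haa : QRel A r a a) (hbb : QRel A r b b) (h : QRel A r (.d true n a) (.d false n b)) :
    QStable A r (.comp n a b) := by
  obtain ⟨N, hN⟩ := ha
  obtain ⟨M, hM⟩ := hb
  refine ⟨max (max N M) (n + 1), fun m hm α => ?_⟩
  have hma : QRel A r (.d α m a) a := hN m (by omega) α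
  have hmb : QRel A r (.d α m b) b := hM m (by omega) α
  refine .trans _ _ _ (.d_comp α m n a b (by omega) haa hbb h) ?_
  refine .symm _ _ (.comp_congr n _ _ _ _ (.symm _ _ hma) (.symm _ _ hmb) h)

theorem QRel.comp_valid {a b : QTerm A} {n : ℕ} (ha : QRel A r a a) (hb : QRel A r b b)
    (h : QRel A r (.d true n a) (.d false n b)) : QRel A r (.comp n a b) (.comp n a b) :=
  .comp_congr n _ _ _ _ ha hb h

theorem QRel.comp_d {a b : QTerm A} {n : ℕ} (α : Bool) {m : ℕ} (hmn : m ≠ n)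
    (ha : QRel A r a a) (hb : QRel A r b b)
    (h : QRel A r (.d true n a) (.d false n b)) :
    QRel A r (.d true n (.d α m a)) (.d false n (.d α m b)) := by
  rcases lt_or_gt_of_ne hmn with hlt | hgt
  · -- both sides are the `m`-face of the common `n`-face
    have e₁ : QRel A r (.d true n (.d α m a)) (.d α m a) := .d_d_ge _ _ _ _ _ hlt.le ha
    have e₂ : QRel A r (.d false n (.d α m b)) (.d α m b) := .d_d_ge _ _ _ _ _ hlt.le hb
    have e₃ : QRel A r (.d α m (.d true n a)) (.d α m a) := .d_d_lt _ _ _ _ _ hlt ha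
    have e₄ : QRel A r (.d α m (.d false n b)) (.d α m b) := .d_d_lt _ _ _ _ _ hlt hb
    have e₅ : QRel A r (.d α m (.d true n a)) (.d α m (.d false n b)) := .d_congr _ _ _ _ h
    exact .trans _ _ _ e₁ (.trans _ _ _ (.symm _ _ e₃)
      (.trans _ _ _ e₅ (.trans _ _ _ e₄ (.symm _ _ e₂))))
  · have e₁ : QRel A r (.d true n (.d α m a)) (.d true n a) := .d_d_lt _ _ _ _ _ hgt ha
    have e₂ : QRel A r (.d false n (.d α m b)) (.d false n b) := .d_d_lt _ _ _ _ _ hgt hb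
    exact .trans _ _ _ e₁ (.trans _ _ _ h (.symm _ _ e₂))

theorem QRel.unit_left {a : QTerm A} (n : ℕ) (ha : QRel A r a a) :
    QRel A r (.d true n (.d false n a)) (.d false n a) :=
  .d_d_ge _ _ _ _ _ le_rfl ha

theorem QRel.unit_right {a : QTerm A} (n : ℕ) (ha : QRel A r a a) :
    QRel A r (.d true n a) (.d false n (.d true n a)) :=
  .symm _ _ (.d_d_ge _ _ _ _ _ le_rfl ha)

theorem QRel.comp_match {a b c e : QTerm A} {m n : ℕ} (hmn : m ≠ n)
    (ha : QRel A r a a) (hb : QRel A r b b) (hc : QRel A r c c) (he : QRel A r e e)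
    (hab : QRel A r (.d true n a) (.d false n b)) (hce : QRel A r (.d true n c) (.d false n e))
    (hac : QRel A r (.d true m a) (.d false m c)) (hbe : QRel A r (.d true m b) (.d false m e)) :
    QRel A r (.d true m (.comp n a b)) (.d false m (.comp n c e)) :=
  .trans _ _ _ (.d_comp _ _ _ _ _ hmn ha hb hab)
    (.trans _ _ _ (.comp_congr n _ _ _ _ hac hbe (QRel.comp_d _ hmn ha hb hab))
      (.symm _ _ (.d_comp _ _ _ _ _ hmn hc he hce)))

theorem QRel.stable {a b : QTerm A} (h : QRel A r a b) : QStable A r a ∧ QStable A r b := by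
  induction h with
  | of x => exact ⟨.of x, .of x⟩
  | rel x y _ => exact ⟨.of x, .of y⟩
  | of_d α n x => exact ⟨.of _, .d (.of x) α n⟩
  | of_comp n x y h =>
    refine ⟨.of _, .comp n (.of x) (.of y) (.of x) (.of y) ?_⟩
    refine .trans _ _ _ (.symm _ _ (.of_d true n x)) ?_
    rw [h]
    exact .of_d false n y
  | symm a b _ ih => exact ih.symm
  | trans a b c _ _ ih₁ ih₂ => exact ⟨ih₁.1, ih₂.2⟩
  | d_congr α n a b h _ => exact ⟨.d h.left α n, .d h.right α n⟩
  | comp_congr n a a' b b' ha hb h iha ihb _ =>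
    exact ⟨.comp n iha.1 ihb.1 ha.left hb.left h, .comp n iha.2 ihb.2 ha.right hb.right
      (.trans _ _ _ (.symm _ _ (.d_congr _ _ _ _ ha)) (.trans _ _ _ h (.d_congr _ _ _ _ hb)))⟩
  | d_d_lt α β m n a _ h _ => exact ⟨.d (.d_congr _ _ _ _ h) β m, .d h β m⟩
  | d_d_ge α β m n a _ h _ => exact ⟨.d (.d_congr _ _ _ _ h) β m, .d h α n⟩
  | source_comp n a h ih =>
    exact ⟨.comp n (.d h _ _) ih.1 (.d_congr _ _ _ _ h) h (QRel.unit_left n h), ih.1⟩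
  | comp_target n a h ih =>
    exact ⟨.comp n ih.1 (.d h _ _) h (.d_congr _ _ _ _ h) (QRel.unit_right n h), ih.1⟩
  | d_source_comp n a b ha hb h _ _ _ =>
    exact ⟨.d (QRel.comp_valid ha hb h) _ _, .d ha _ _⟩
  | d_target_comp n a b ha hb h _ _ _ =>
    exact ⟨.d (QRel.comp_valid ha hb h) _ _, .d hb _ _⟩
  | d_comp α m n a b hmn ha hb h _ _ _ =>
    exact ⟨.d (QRel.comp_valid ha hb h) _ _, .comp n (.d ha _ _) (.d hb _ _)
      (.d_congr _ _ _ _ ha) (.d_congr _ _ _ _ hb) (QRel.comp_d α hmn ha hb h)⟩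
  | assoc n a b c ha hb hc hab hbc iha ihb ihc _ _ =>
    have vab := QRel.comp_valid ha hb hab
    have vbc := QRel.comp_valid hb hc hbc
    exact ⟨.comp n (.comp n iha.1 ihb.1 ha hb hab) ihc.1 vab hc
        (.trans _ _ _ (.d_target_comp n a b ha hb hab) hbc),
      .comp n iha.1 (.comp n ihb.1 ihc.1 hb hc hbc) ha vbc
        (.trans _ _ _ hab (.symm _ _ (.d_source_comp n b c hb hc hbc)))⟩
  | exchange m n a b c e hmn ha hb hc he hab hce hac hbe iha ihb ihc ihe _ _ _ _ =>
    exact ⟨.comp m (.comp n iha.1 ihb.1 ha hb hab) (.comp n ihc.1 ihe.1 hc he hce)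
        (QRel.comp_valid ha hb hab) (QRel.comp_valid hc he hce)
        (QRel.comp_match hmn ha hb hc he hab hce hac hbe),
      .comp n (.comp m iha.1 ihc.1 ha hc hac) (.comp m ihb.1 ihe.1 hb he hbe)
        (QRel.comp_valid ha hc hac) (QRel.comp_valid hb he hbe)
        (QRel.comp_match (Ne.symm hmn) ha hc hb he hac hbe hab hce)⟩

/-- The immediate constituents of a meaningful expression are meaningful and match. -/
def QParts (A : OmegaCat.{u}) (r : A → A → Prop) : QTerm A → Prop
  | .of _ => True
  | .d _ _ a => QRel A r a a
  | .comp n a b => QRel A r a a ∧ QRel A r b b ∧ QRel A r (.d true n a) (.d false n b)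

theorem QRel.parts {a b : QTerm A} (h : QRel A r a b) : QParts A r a ∧ QParts A r b := by
  induction h with
  | of x => exact ⟨trivial, trivial⟩
  | rel x y _ => exact ⟨trivial, trivial⟩
  | of_d α n x => exact ⟨trivial, .of x⟩
  | of_comp n x y h =>
    refine ⟨trivial, .of x, .of y, .trans _ _ _ (.symm _ _ (.of_d true n x)) ?_⟩
    rw [h]
    exact .of_d false n y
  | symm a b _ ih => exact ih.symm
  | trans a b c _ _ ih₁ ih₂ => exact ⟨ih₁.1, ih₂.2⟩
  | d_congr α n a b h _ => exact ⟨h.left, h.right⟩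
  | comp_congr n a a' b b' ha hb h _ _ _ =>
    exact ⟨⟨ha.left, hb.left, h⟩, ha.right, hb.right,
      .trans _ _ _ (.symm _ _ (.d_congr _ _ _ _ ha)) (.trans _ _ _ h (.d_congr _ _ _ _ hb))⟩
  | d_d_lt α β m n a _ h _ => exact ⟨.d_congr _ _ _ _ h, h⟩
  | d_d_ge α β m n a _ h _ => exact ⟨.d_congr _ _ _ _ h, h⟩
  | source_comp n a h ih => exact ⟨⟨.d_congr _ _ _ _ h, h, QRel.unit_left n h⟩, ih.1⟩
  | comp_target n a h ih => exact ⟨⟨h, .d_congr _ _ _ _ h, QRel.unit_right n h⟩, ih.1⟩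
  | d_source_comp n a b ha hb h _ _ _ => exact ⟨QRel.comp_valid ha hb h, ha⟩
  | d_target_comp n a b ha hb h _ _ _ => exact ⟨QRel.comp_valid ha hb h, hb⟩
  | d_comp α m n a b hmn ha hb h _ _ _ =>
    exact ⟨QRel.comp_valid ha hb h, .d_congr _ _ _ _ ha, .d_congr _ _ _ _ hb,
      QRel.comp_d α hmn ha hb h⟩
  | assoc n a b c ha hb hc hab hbc _ _ _ _ _ =>
    exact ⟨⟨QRel.comp_valid ha hb hab, hc,
        .trans _ _ _ (.d_target_comp n a b ha hb hab) hbc⟩,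
      ha, QRel.comp_valid hb hc hbc,
        .trans _ _ _ hab (.symm _ _ (.d_source_comp n b c hb hc hbc))⟩
  | exchange m n a b c e hmn ha hb hc he hab hce hac hbe _ _ _ _ _ _ _ _ =>
    exact ⟨⟨QRel.comp_valid ha hb hab, QRel.comp_valid hc he hce,
        QRel.comp_match hmn ha hb hc he hab hce hac hbe⟩,
      QRel.comp_valid ha hc hac, QRel.comp_valid hb he hbe,
        QRel.comp_match (Ne.symm hmn) ha hc hb he hac hbe hab hce⟩

variable (A r)

/-- Meaningful expressions up to provable equality. -/
def qSetoid : Setoid {a : QTerm A // QRel A r a a} where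
  r a b := QRel A r a.1 b.1
  iseqv := ⟨fun a => a.2, fun h => .symm _ _ h, fun h k => .trans _ _ _ h k⟩

/-- The underlying set of the quotient. -/
def QCarrier : Type u := Quotient (qSetoid A r)

variable {A r}

/-- The class of a meaningful expression. -/
def qmk (a : QTerm A) (h : QRel A r a a) : QCarrier A r := Quotient.mk (qSetoid A r) ⟨a, h⟩

theorem qmk_eq_iff {a b : QTerm A} {ha : QRel A r a a} {hb : QRel A r b b} :
    qmk a ha = qmk b hb ↔ QRel A r a b :=
  ⟨fun h => Quotient.exact (s := qSetoid A r) h, fun h => Quotient.sound (s := qSetoid A r) h⟩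

/-- Sources and targets in the quotient. -/
def qd (α : Bool) (n : ℕ) : QCarrier A r → QCarrier A r :=
  Quotient.lift (s := qSetoid A r) (fun a => qmk (.d α n a.1) (.d_congr _ _ _ _ a.2))
    fun _ _ h => qmk_eq_iff.2 (.d_congr _ _ _ _ h)

theorem exists_rep (x : QCarrier A r) : ∃ a, ∃ ha : QRel A r a a, x = qmk a ha :=
  Quotient.ind (s := qSetoid A r) (motive := fun x => ∃ a, ∃ ha : QRel A r a a, x = qmk a ha)
    (fun a => ⟨a.1, a.2, rfl⟩) x

theorem qd_mk (α : Bool) (n : ℕ) (a : QTerm A) (ha : QRel A r a a) :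
    qd α n (qmk a ha) = qmk (.d α n a) (.d_congr _ _ _ _ ha) := rfl

/-- A representative of an element of the quotient. -/
noncomputable def qrep (x : QCarrier A r) : QTerm A := (exists_rep x).choose

theorem qrep_valid (x : QCarrier A r) : QRel A r (qrep x) (qrep x) :=
  (exists_rep x).choose_spec.choose

theorem mk_qrep (x : QCarrier A r) : qmk (qrep x) (qrep_valid x) = x :=
  (exists_rep x).choose_spec.choose_spec.symm

theorem qrep_mk (a : QTerm A) (ha : QRel A r a a) : QRel A r (qrep (qmk a ha)) a :=
  qmk_eq_iff.1 (mk_qrep (qmk a ha))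

theorem qmatch {a b : QTerm A} {ha : QRel A r a a} {hb : QRel A r b b} {n : ℕ}
    (h : qd true n (qmk a ha) = qd false n (qmk b hb)) :
    QRel A r (.d true n a) (.d false n b) := qmk_eq_iff.1 h

theorem qrep_match {n : ℕ} {x y : QCarrier A r} (h : qd true n x = qd false n y) :
    QRel A r (.d true n (qrep x)) (.d false n (qrep y)) := by
  rw [← mk_qrep x, ← mk_qrep y] at h
  exact qmatch h

/-- Composition in the quotient: compose representatives formally. -/
noncomputable def qcomp (n : ℕ) (x y : QCarrier A r) (h : qd true n x = qd false n y) :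
    QCarrier A r :=
  qmk (.comp n (qrep x) (qrep y))
    (QRel.comp_valid (qrep_valid x) (qrep_valid y) (qrep_match h))

theorem qcomp_mk (n : ℕ) (a b : QTerm A) (ha : QRel A r a a) (hb : QRel A r b b)
    (h : qd true n (qmk a ha) = qd false n (qmk b hb)) :
    qcomp n (qmk a ha) (qmk b hb) h =
      qmk (.comp n a b) (QRel.comp_valid ha hb (qmatch h)) :=
  qmk_eq_iff.2 (.symm _ _ (.comp_congr n _ _ _ _ (.symm _ _ (qrep_mk a ha))
    (.symm _ _ (qrep_mk b hb)) (qmatch h)))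

variable (A r)

/-- The universal omega-category under `A` in which `r`-related elements become equal. -/
noncomputable def quot : OmegaCat.{u} where
  Carrier := QCarrier A r
  d := qd
  comp := qcomp
  d_d_lt α β m n x hmn := by
    obtain ⟨a, ha, rfl⟩ := exists_rep x
    exact qmk_eq_iff.2 (.d_d_lt α β m n a hmn ha)
  d_d_ge α β m n x hmn := by
    obtain ⟨a, ha, rfl⟩ := exists_rep x
    exact qmk_eq_iff.2 (.d_d_ge α β m n a hmn ha)
  source_comp n x := by
    obtain ⟨a, ha, rfl⟩ := exists_rep x
    intro h
    exact (qcomp_mk n (.d false n a) a (.d_congr _ _ _ _ ha) ha h).trans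
      (qmk_eq_iff.2 (.source_comp n a ha))
  comp_target n x := by
    obtain ⟨a, ha, rfl⟩ := exists_rep x
    intro h
    exact (qcomp_mk n a (.d true n a) ha (.d_congr _ _ _ _ ha) h).trans
      (qmk_eq_iff.2 (.comp_target n a ha))
  d_source_comp n x y := by
    obtain ⟨a, ha, rfl⟩ := exists_rep x
    obtain ⟨b, hb, rfl⟩ := exists_rep y
    intro h
    rw [qcomp_mk]
    exact qmk_eq_iff.2 (.d_source_comp n a b ha hb (qmatch h))
  d_target_comp n x y := by
    obtain ⟨a, ha, rfl⟩ := exists_rep x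
    obtain ⟨b, hb, rfl⟩ := exists_rep y
    intro h
    rw [qcomp_mk]
    exact qmk_eq_iff.2 (.d_target_comp n a b ha hb (qmatch h))
  d_comp α m n x y := by
    obtain ⟨a, ha, rfl⟩ := exists_rep x
    obtain ⟨b, hb, rfl⟩ := exists_rep y
    intro h hmn
    refine ⟨qmk_eq_iff.2 (QRel.comp_d α hmn ha hb (qmatch h)), ?_⟩
    rw [qcomp_mk]
    refine Eq.trans ?_ (qcomp_mk n (.d α m a) (.d α m b) (.d_congr _ _ _ _ ha)
      (.d_congr _ _ _ _ hb) (qmk_eq_iff.2 (QRel.comp_d α hmn ha hb (qmatch h)))).symm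
    exact qmk_eq_iff.2 (.d_comp α m n a b hmn ha hb (qmatch h))
  assoc n x y z := by
    obtain ⟨a, ha, rfl⟩ := exists_rep x
    obtain ⟨b, hb, rfl⟩ := exists_rep y
    obtain ⟨c, hc, rfl⟩ := exists_rep z
    intro hxy hyz
    rw [qcomp_mk, qcomp_mk]
    intro h₁ h₂
    rw [qcomp_mk, qcomp_mk]
    exact qmk_eq_iff.2 (.assoc n a b c ha hb hc (qmatch hxy) (qmatch hyz))
  exchange m n x y z w hmn := by
    obtain ⟨a, ha, rfl⟩ := exists_rep x
    obtain ⟨b, hb, rfl⟩ := exists_rep y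
    obtain ⟨c, hc, rfl⟩ := exists_rep z
    obtain ⟨e, he, rfl⟩ := exists_rep w
    intro hxy hzw hxz hyw
    rw [qcomp_mk, qcomp_mk, qcomp_mk, qcomp_mk]
    intro h₁ h₂
    rw [qcomp_mk, qcomp_mk]
    exact qmk_eq_iff.2 (.exchange m n a b c e hmn ha hb hc he (qmatch hxy) (qmatch hzw)
      (qmatch hxz) (qmatch hyw))
  finite_dim x := by
    obtain ⟨a, ha, rfl⟩ := exists_rep x
    obtain ⟨N, hN⟩ := ha.stable.1
    exact ⟨N, qmk_eq_iff.2 (hN N le_rfl _), qmk_eq_iff.2 (hN N le_rfl _)⟩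

/-- The canonical omega-functor to the quotient. -/
noncomputable def toQuot : OmegaFunctor A (A.quot r) where
  toFun x := qmk (.of x) (.of x)
  map_d α n x := qmk_eq_iff.2 (.of_d α n x)
  map_comp n x y h := by
    have h' : QRel A r (.d true n (.of x)) (.d false n (.of y)) := by
      refine .trans _ _ _ (.symm _ _ (.of_d true n x)) ?_
      rw [h]
      exact .of_d false n y
    refine ⟨qmk_eq_iff.2 h', ?_⟩
    refine Eq.trans ?_ (qcomp_mk n _ _ (.of x) (.of y) (qmk_eq_iff.2 h')).symm
    exact qmk_eq_iff.2 (.of_comp n x y h)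

theorem toQuot_rel (x y : A) (h : r x y) : A.toQuot r x = A.toQuot r y :=
  qmk_eq_iff.2 (.rel x y h)

variable {A r}

open Classical in
/-- Partial evaluation of formal expressions along a map. -/
noncomputable def QTerm.eval {B : OmegaCat.{v}} (f : A → B) : QTerm A → Option B
  | .of x => some (f x)
  | .d α n a => (a.eval f).map (B.d α n)
  | .comp n a b => (a.eval f).bind fun x => (b.eval f).bind fun y =>
      if h : B.d true n x = B.d false n y then some (B.comp n x y h) else none

theorem eval_d {B : OmegaCat.{v}} {f : A → B} {a : QTerm A} {x : B} (h : a.eval f = some x)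
    (α : Bool) (n : ℕ) : (QTerm.d α n a).eval f = some (B.d α n x) := by
  simp [QTerm.eval, h]

theorem eval_comp {B : OmegaCat.{v}} {f : A → B} {a b : QTerm A} {x y : B}
    (hx : a.eval f = some x) (hy : b.eval f = some y) (n : ℕ)
    (h : B.d true n x = B.d false n y) :
    (QTerm.comp n a b).eval f = some (B.comp n x y h) := by
  simp [QTerm.eval, hx, hy, h]

theorem eval_match {B : OmegaCat.{v}} {f : A → B} {a b : QTerm A} {x y : B} {α β : Bool} {n : ℕ}
    (hx : a.eval f = some x) (hy : b.eval f = some y)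
    (h : ∃ v, (QTerm.d α n a).eval f = some v ∧ (QTerm.d β n b).eval f = some v) :
    B.d α n x = B.d β n y := by
  obtain ⟨v, h₁, h₂⟩ := h
  rw [eval_d hx] at h₁
  rw [eval_d hy] at h₂
  exact (Option.some.inj h₁).trans (Option.some.inj h₂).symm

theorem eval_of_rel {B : OmegaCat.{v}} (f : OmegaFunctor A B)
    (hf : ∀ x y, r x y → f x = f y) {a b : QTerm A} (h : QRel A r a b) :
    ∃ v, a.eval f = some v ∧ b.eval f = some v := by
  induction h with
  | of x => exact ⟨_, rfl, rfl⟩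
  | rel x y h => exact ⟨_, rfl, by rw [hf x y h]; rfl⟩
  | of_d α n x => exact ⟨_, rfl, by rw [f.map_d]; rfl⟩
  | of_comp n x y h =>
    obtain ⟨h', e⟩ := f.map_comp n x y h
    exact ⟨_, rfl, by rw [e]; exact eval_comp rfl rfl n h'⟩
  | symm a b _ ih => obtain ⟨v, h₁, h₂⟩ := ih; exact ⟨v, h₂, h₁⟩
  | trans a b c _ _ ih₁ ih₂ =>
    obtain ⟨v, h₁, h₂⟩ := ih₁
    obtain ⟨w, h₃, h₄⟩ := ih₂
    exact ⟨v, h₁, by rw [h₄, ← h₃, h₂]⟩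
  | d_congr α n a b _ ih =>
    obtain ⟨v, h₁, h₂⟩ := ih
    exact ⟨_, eval_d h₁ α n, eval_d h₂ α n⟩
  | comp_congr n a a' b b' _ _ _ iha ihb ih =>
    obtain ⟨x, h₁, h₂⟩ := iha
    obtain ⟨y, h₃, h₄⟩ := ihb
    have hxy := eval_match h₁ h₃ ih
    exact ⟨_, eval_comp h₁ h₃ n hxy, eval_comp h₂ h₄ n hxy⟩
  | d_d_lt α β m n a hmn _ ih =>
    obtain ⟨x, h, _⟩ := ih
    exact ⟨_, eval_d (eval_d h α n) β m, by rw [eval_d h, B.d_d_lt _ _ _ _ _ hmn]⟩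
  | d_d_ge α β m n a hmn _ ih =>
    obtain ⟨x, h, _⟩ := ih
    exact ⟨_, eval_d (eval_d h α n) β m, by rw [eval_d h, B.d_d_ge _ _ _ _ _ hmn]⟩
  | source_comp n a _ ih =>
    obtain ⟨x, h, _⟩ := ih
    exact ⟨_, eval_comp (eval_d h false n) h n (B.d_d_ge _ _ _ _ _ le_rfl),
      by rw [h, B.source_comp]⟩
  | comp_target n a _ ih =>
    obtain ⟨x, h, _⟩ := ih
    exact ⟨_, eval_comp h (eval_d h true n) n (B.d_d_ge _ _ _ _ _ le_rfl).symm,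
      by rw [h, B.comp_target]⟩
  | d_source_comp n a b _ _ _ iha ihb ih =>
    obtain ⟨x, hx, _⟩ := iha
    obtain ⟨y, hy, _⟩ := ihb
    have hxy := eval_match hx hy ih
    exact ⟨_, eval_d (eval_comp hx hy n hxy) _ _, by rw [eval_d hx, B.d_source_comp]⟩
  | d_target_comp n a b _ _ _ iha ihb ih =>
    obtain ⟨x, hx, _⟩ := iha
    obtain ⟨y, hy, _⟩ := ihb
    have hxy := eval_match hx hy ih
    exact ⟨_, eval_d (eval_comp hx hy n hxy) _ _, by rw [eval_d hy, B.d_target_comp]⟩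
  | d_comp α m n a b hmn _ _ _ iha ihb ih =>
    obtain ⟨x, hx, _⟩ := iha
    obtain ⟨y, hy, _⟩ := ihb
    have hxy := eval_match hx hy ih
    obtain ⟨h', e⟩ := B.d_comp α m n x y hxy hmn
    exact ⟨_, eval_d (eval_comp hx hy n hxy) _ _,
      by rw [e]; exact eval_comp (eval_d hx α m) (eval_d hy α m) n h'⟩
  | assoc n a b c _ _ _ _ _ iha ihb ihc ihab ihbc =>
    obtain ⟨x, hx, _⟩ := iha
    obtain ⟨y, hy, _⟩ := ihb
    obtain ⟨z, hz, _⟩ := ihc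
    have hxy := eval_match hx hy ihab
    have hyz := eval_match hy hz ihbc
    have h₁ : B.d true n (B.comp n x y hxy) = B.d false n z := by rw [B.d_target_comp, hyz]
    have h₂ : B.d true n x = B.d false n (B.comp n y z hyz) := by rw [B.d_source_comp, hxy]
    refine ⟨_, eval_comp (eval_comp hx hy n hxy) hz n h₁, ?_⟩
    rw [eval_comp hx (eval_comp hy hz n hyz) n h₂, B.assoc]
  | exchange m n a b c e hmn _ _ _ _ _ _ _ _ iha ihb ihc ihe ihab ihce ihac ihbe =>
    obtain ⟨x, hx, _⟩ := iha
    obtain ⟨y, hy, _⟩ := ihb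
    obtain ⟨z, hz, _⟩ := ihc
    obtain ⟨w, hw, _⟩ := ihe
    have hxy := eval_match hx hy ihab
    have hzw := eval_match hz hw ihce
    have hxz := eval_match hx hz ihac
    have hyw := eval_match hy hw ihbe
    have h₁ : B.d true m (B.comp n x y hxy) = B.d false m (B.comp n z w hzw) := by
      obtain ⟨k₁, e₁⟩ := B.d_comp true m n x y hxy hmn
      obtain ⟨k₂, e₂⟩ := B.d_comp false m n z w hzw hmn
      rw [e₁, e₂]
      exact B.comp_congr hxz hyw _ _
    have h₂ : B.d true n (B.comp m x z hxz) = B.d false n (B.comp m y w hyw) := by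
      obtain ⟨k₁, e₁⟩ := B.d_comp true n m x z hxz (Ne.symm hmn)
      obtain ⟨k₂, e₂⟩ := B.d_comp false n m y w hyw (Ne.symm hmn)
      rw [e₁, e₂]
      exact B.comp_congr hxy hzw _ _
    refine ⟨_, eval_comp (eval_comp hx hy n hxy) (eval_comp hz hw n hzw) m h₁, ?_⟩
    rw [eval_comp (eval_comp hx hz m hxz) (eval_comp hy hw m hyw) n h₂,
      B.exchange m n x y z w hmn hxy hzw hxz hyw h₁ h₂]

theorem exists_eval {B : OmegaCat.{v}} (f : OmegaFunctor A B)
    (hf : ∀ x y, r x y → f x = f y) (X : A.quot r) :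
    ∃ v : B, ∀ a ha, X = qmk a ha → a.eval f = some v := by
  obtain ⟨a, ha, rfl⟩ := exists_rep X
  obtain ⟨v, hv, _⟩ := eval_of_rel f hf ha
  refine ⟨v, fun b hb hab => ?_⟩
  obtain ⟨w, hw, hw'⟩ := eval_of_rel f hf (qmk_eq_iff.1 hab)
  rw [hw', ← hv, hw]

/-- The omega-functor out of the quotient induced by an omega-functor that identifies `r`-related
elements. -/
noncomputable def quotLift {B : OmegaCat.{v}} (f : OmegaFunctor A B)
    (hf : ∀ x y, r x y → f x = f y) : OmegaFunctor (A.quot r) B where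
  toFun X := (exists_eval f hf X).choose
  map_d α n X := by
    obtain ⟨a, ha, rfl⟩ := exists_rep X
    have h₁ := (exists_eval f hf (qmk a ha)).choose_spec a ha rfl
    have h₂ := (exists_eval f hf ((A.quot r).d α n (qmk a ha))).choose_spec (.d α n a)
      (.d_congr _ _ _ _ ha) rfl
    rw [eval_d h₁] at h₂
    exact (Option.some.inj h₂).symm
  map_comp n X Y h := by
    obtain ⟨a, ha, rfl⟩ := exists_rep X
    obtain ⟨b, hb, rfl⟩ := exists_rep Y
    have h₁ := (exists_eval f hf (qmk a ha)).choose_spec a ha rfl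
    have h₂ := (exists_eval f hf (qmk b hb)).choose_spec b hb rfl
    have hm := eval_match h₁ h₂ (eval_of_rel f hf (qmatch h))
    refine ⟨hm, ?_⟩
    have h₃ := (exists_eval f hf ((A.quot r).comp n (qmk a ha) (qmk b hb) h)).choose_spec
      (.comp n a b) (QRel.comp_valid ha hb (qmatch h)) (qcomp_mk n a b ha hb h)
    rw [eval_comp h₁ h₂ n hm] at h₃
    exact (Option.some.inj h₃).symm

theorem quotLift_toQuot {B : OmegaCat.{v}} (f : OmegaFunctor A B)
    (hf : ∀ x y, r x y → f x = f y) (x : A) : quotLift f hf (A.toQuot r x) = f x :=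
  (Option.some.inj ((exists_eval f hf (A.toQuot r x)).choose_spec (.of x) (.of x) rfl)).symm

/-- An omega-functor out of the quotient is determined by its restriction along `toQuot`. -/
theorem quot_hom_ext {B : OmegaCat.{v}} {F G : OmegaFunctor (A.quot r) B}
    (h : ∀ x, F (A.toQuot r x) = G (A.toQuot r x)) : F = G := by
  have hd : ∀ (α : Bool) (n : ℕ) (a : QTerm A) (ha : QRel A r a a),
      F (qmk a ha) = G (qmk a ha) → ∀ hb, F (qmk (.d α n a) hb) = G (qmk (.d α n a) hb) := by
    intro α n a ha e hb
    have h₁ := F.map_d α n (qmk a ha)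
    have h₂ := G.map_d α n (qmk a ha)
    rw [← e] at h₂
    exact h₁.trans h₂.symm
  have hc : ∀ (n : ℕ) (a b : QTerm A) (ha : QRel A r a a) (hb : QRel A r b b),
      QRel A r (.d true n a) (.d false n b) →
      F (qmk a ha) = G (qmk a ha) → F (qmk b hb) = G (qmk b hb) →
      ∀ hab, F (qmk (.comp n a b) hab) = G (qmk (.comp n a b) hab) := by
    intro n a b ha hb hm ea eb hab
    have hm' : (A.quot r).d true n (qmk a ha) = (A.quot r).d false n (qmk b hb) :=
      qmk_eq_iff.2 hm
    obtain ⟨k₁, e₁⟩ := F.map_comp n _ _ hm'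
    obtain ⟨k₂, e₂⟩ := G.map_comp n _ _ hm'
    have e₃ : (A.quot r).comp n (qmk a ha) (qmk b hb) hm' = qmk (.comp n a b) hab :=
      qcomp_mk n a b ha hb hm'
    rw [e₃] at e₁ e₂
    rw [e₁, e₂]
    exact B.comp_congr ea eb _ _
  have main : ∀ a : QTerm A, ∀ ha : QRel A r a a, F (qmk a ha) = G (qmk a ha) := by
    intro a
    induction a with
    | of x => exact fun _ => h x
    | d α n a iha =>
      intro hb
      have ha : QRel A r a a := hb.parts.1
      exact hd α n a ha (iha ha) hb
    | comp n a b iha ihb =>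
      intro hab
      obtain ⟨ha, hb, hm⟩ := hab.parts.1
      exact hc n a b ha hb hm (iha ha) (ihb hb) hab
  ext X
  obtain ⟨a, ha, rfl⟩ := exists_rep X
  exact main a ha

end quot

end OmegaCat

/-! ## The negative semi-path omega-category -/

/-- The discrete omega-category on a set. -/
def OmegaCat.discrete (S : Type u) : OmegaCat.{u} where
  Carrier := S
  d _ _ x := x
  comp _ x _ _ := x
  d_d_lt _ _ _ _ _ _ := rfl
  d_d_ge _ _ _ _ _ _ := rfl
  source_comp _ _ _ := rfl
  comp_target _ _ _ := rfl
  d_source_comp _ _ _ _ := rfl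
  d_target_comp _ _ _ h := h
  d_comp _ _ _ _ _ h _ := ⟨h, rfl⟩
  assoc _ _ _ _ _ _ _ _ := rfl
  exchange _ _ _ _ _ _ _ _ _ _ _ _ _ := rfl
  finite_dim _ := ⟨0, rfl, rfl⟩

namespace NCOmegaCat

/-- The equivalence relation on `PC` generated by the pairs `(x, x *_0 y)`. -/
def branchEqv (C : NCOmegaCat.{u}) : C.path → C.path → Prop := Relation.EqvGen C.branchRel

theorem eq_of_branchEqv (C : NCOmegaCat.{u}) {S : Type v} (f : C.path → S)
    (hf : ∀ x z, C.branchRel x z → f x = f z) (x z : C.path) (h : C.branchEqv x z) :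
    f x = f z := by
  induction h with
  | rel x z h => exact hf x z h
  | refl x => rfl
  | symm x z _ ih => exact ih.symm
  | trans x y z _ _ ih₁ ih₂ => exact ih₁.trans ih₂

/-- The negative semi-path omega-category: the universal omega-category under `PC` in which
`x` and `x *_0 y` become equal. Like for `PC`, its degree `n` operations are those that
correspond to degree `n + 1` in `C`. -/
noncomputable def semiPath (C : NCOmegaCat.{u}) : OmegaCat.{u} := C.path.quot C.branchEqv

/-- The canonical omega-functor from `PC` to the negative semi-path omega-category. -/
noncomputable def germ (C : NCOmegaCat.{u}) : OmegaFunctor C.path C.semiPath :=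
  C.path.toQuot C.branchEqv

/-- The universal property of the negative semi-path omega-category. -/
theorem semiPath_universal (C : NCOmegaCat.{u}) (D : OmegaCat.{v}) (f : OmegaFunctor C.path D)
    (hf : ∀ x z, C.branchEqv x z → f x = f z) :
    ∃! g : OmegaFunctor C.semiPath D, C.germ.trans g = f := by
  refine ⟨OmegaCat.quotLift f hf, ?_, ?_⟩
  · ext x
    exact OmegaCat.quotLift_toQuot f hf x
  · intro g hg
    refine OmegaCat.quot_hom_ext fun x => ?_
    exact (congrArg (fun k => OmegaFunctor.toFun k x) hg).trans
      (OmegaCat.quotLift_toQuot f hf x).symm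

theorem branchRel_map {C D : NCOmegaCat.{u}} (f : C ⟶ D) (x z : C.path) (h : C.branchRel x z) :
    D.branchRel (pathMap f x) (pathMap f z) := by
  obtain ⟨y, h, e⟩ := h
  obtain ⟨h', e'⟩ := (NCOmegaFunctor.functor f).map_comp 0 x.1 y.1 h
  exact ⟨pathMap f y, h', by rw [e] at e'; exact e'.symm⟩

theorem germ_map_eq {C D : NCOmegaCat.{u}} (f : C ⟶ D) (x z : C.path) (h : C.branchEqv x z) :
    (pathMap f).trans D.germ x = (pathMap f).trans D.germ z :=
  C.eq_of_branchEqv _ (fun x z h =>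
    OmegaCat.toQuot_rel D.path _ _ _ (.rel _ _ (branchRel_map f x z h))) x z h

/-- The functor of negative semi-path omega-categories on morphisms. -/
noncomputable def semiPathMap {C D : NCOmegaCat.{u}} (f : C ⟶ D) :
    OmegaFunctor C.semiPath D.semiPath :=
  OmegaCat.quotLift ((pathMap f).trans D.germ) (germ_map_eq f)

theorem semiPathMap_germ {C D : NCOmegaCat.{u}} (f : C ⟶ D) (x : C.path) :
    semiPathMap f (C.germ x) = D.germ (pathMap f x) :=
  OmegaCat.quotLift_toQuot _ _ x

/-- The functor sending `C` to its negative semi-path omega-category. -/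
noncomputable def semiPathFunctor : NCOmegaCat.{u} ⥤ OmegaCat.{u} where
  obj C := C.semiPath
  map f := semiPathMap f
  map_id C := OmegaCat.quot_hom_ext fun x => semiPathMap_germ (𝟙 C) x
  map_comp {C D E} f g := OmegaCat.quot_hom_ext fun x => by
    refine (semiPathMap_germ (f ≫ g) x).trans ?_
    refine Eq.trans ?_ (congrArg (semiPathMap g) (semiPathMap_germ f x)).symm
    exact (semiPathMap_germ g (pathMap f x)).symm

/-- The `0`-source on `PC`, as an omega-functor to the discrete omega-category on `C_0`. -/
noncomputable def pathStart (C : NCOmegaCat.{u}) :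
    OmegaFunctor C.path (OmegaCat.discrete (zeroCells.obj C)) where
  toFun x := ⟨C.cat.d false 0 x.1, Nat.le_zero.1 (C.cat.dim_d_le x.1 false 0)⟩
  map_d α n x := Subtype.ext (C.cat.d_d_lt α false 0 (n + 1) x.1 (Nat.succ_pos n))
  map_comp n x y h := by
    have h' : C.cat.d true (n + 1) x.1 = C.cat.d false (n + 1) y.1 := congrArg Subtype.val h
    refine ⟨Subtype.ext ?_, Subtype.ext (C.cat.d_comp_of_lt false (Nat.succ_pos n) x.1 y.1 h')⟩
    show C.cat.d false 0 x.1 = C.cat.d false 0 y.1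
    rw [← C.cat.d_d_lt true false 0 (n + 1) x.1 (Nat.succ_pos n), h',
      C.cat.d_d_lt false false 0 (n + 1) y.1 (Nat.succ_pos n)]

theorem pathStart_eq (C : NCOmegaCat.{u}) (x z : C.path) (h : C.branchEqv x z) :
    C.pathStart x = C.pathStart z := by
  refine C.eq_of_branchEqv _ (fun x z h => ?_) x z h
  obtain ⟨y, h, e⟩ := h
  refine Subtype.ext ?_
  show C.cat.d false 0 x.1 = C.cat.d false 0 z.1
  rw [← e, C.cat.d_source_comp]

/-- The `0`-source map `s_0` from the negative semi-path omega-category to `C_0`; it sends the class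
of `x` to `s_0 x`, and all the operations of the semi-path omega-category preserve it. -/
noncomputable def semiPathStart (C : NCOmegaCat.{u}) :
    OmegaFunctor C.semiPath (OmegaCat.discrete (zeroCells.obj C)) :=
  OmegaCat.quotLift C.pathStart C.pathStart_eq

theorem semiPathStart_germ (C : NCOmegaCat.{u}) (x : C.path) :
    C.semiPathStart (C.germ x) = C.pathStart x :=
  OmegaCat.quotLift_toQuot _ _ x

theorem semiPathStart_map {C D : NCOmegaCat.{u}} (f : C ⟶ D) (X : C.semiPath) :
    D.semiPathStart (semiPathMap f X) = zeroCells.map f (C.semiPathStart X) := by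
  let φ : OmegaFunctor (OmegaCat.discrete (zeroCells.obj C))
      (OmegaCat.discrete (zeroCells.obj D)) :=
    { toFun := fun x => zeroCells.map f x
      map_d := fun _ _ _ => rfl
      map_comp := fun _ _ _ h => ⟨congrArg (fun x => zeroCells.map f x) h, rfl⟩ }
  have key : (semiPathMap f).trans D.semiPathStart = C.semiPathStart.trans φ := by
    refine OmegaCat.quot_hom_ext fun x => ?_
    refine (congrArg D.semiPathStart (semiPathMap_germ f x)).trans ?_
    refine (semiPathStart_germ D (pathMap f x)).trans ?_
    refine Eq.trans ?_ (congrArg φ (semiPathStart_germ C x)).symm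
    exact Subtype.ext ((NCOmegaFunctor.functor f).map_d false 0 x.1).symm
  exact congrArg (fun k => OmegaFunctor.toFun k X) key

end NCOmegaCat

/-! ## The omega-category of the simplex

The omega-category of the `n`-simplex (the `n`-th oriental) is presented through Steiner's chain
description. A morphism `X` is a table of nonnegative integral chains `x_q^-`, `x_q^+` of `q`-faces
with `ε x_0^α = 1` and `∂ x_{q+1}^α = x_q^- - x_q^+`; the chain `x_q^α` is the formal sum of the
`q`-dimensional faces of which `d_q^α X` is composed. The orientation is the one in which the
`(p-1)`-source of a face `σ_0 < ... < σ_p` is made of the faces that omit a `σ_i` with `i` even,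
and its `(p-1)`-target of those that omit a `σ_i` with `i` odd. -/

namespace Simplex

/-- Integral chains on the faces of the `n`-simplex. The empty face is included, in degree `-1`. -/
abbrev Chain (n : ℕ) : Type := Finset (Fin (n + 1)) →₀ ℤ

/-- The sign `(-1)^i`, where `i` is the number of vertices of `σ` that precede `j`. -/
def sgn {n : ℕ} (σ : Finset (Fin (n + 1))) (j : Fin (n + 1)) : ℤ :=
  (-1) ^ (σ.filter (· < j)).card

/-- The augmented simplicial boundary, `∂ σ = ∑_i (-1)^i (σ without its i-th vertex)`; on vertices
it is the augmentation. -/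
noncomputable def bd (n : ℕ) : Chain n →ₗ[ℤ] Chain n :=
  Finsupp.linearCombination ℤ fun σ => ∑ j ∈ σ, Finsupp.single (σ.erase j) (sgn σ j)

open Classical in
/-- The map of chains induced by a map of vertices: degenerate images are sent to zero. -/
noncomputable def push {m n : ℕ} (f : Fin (m + 1) → Fin (n + 1)) : Chain m →ₗ[ℤ] Chain n :=
  Finsupp.linearCombination ℤ fun σ =>
    if Set.InjOn f σ then Finsupp.single (σ.image f) (1 : ℤ) else 0

/-- A morphism of the omega-category of the `n`-simplex. -/
@[ext]
structure Cell (n : ℕ) where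
  /-- `chain false q = x_q^-` and `chain true q = x_q^+` -/
  chain : Bool → ℕ → Chain n
  card_eq : ∀ α q σ, chain α q σ ≠ 0 → σ.card = q + 1
  nonneg : ∀ α q σ, 0 ≤ chain α q σ
  aug : ∀ α, bd n (chain α 0) = Finsupp.single ∅ 1
  bd_succ : ∀ α q, bd n (chain α (q + 1)) = chain false q - chain true q

theorem Cell.chain_eq_zero {n : ℕ} (x : Cell n) (α : Bool) (q : ℕ) (hq : n < q) :
    x.chain α q = 0 := by
  ext σ
  by_contra h
  have h₁ := x.card_eq α q σ h
  have h₂ := Finset.card_le_univ σ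
  rw [Fintype.card_fin] at h₂
  omega

/-- The `k`-source and `k`-target of a morphism. -/
noncomputable def Cell.d {n : ℕ} (α : Bool) (k : ℕ) (x : Cell n) : Cell n where
  chain β q := if q < k then x.chain β q else if q = k then x.chain α k else 0
  card_eq β q σ h := by
    split_ifs at h with h₁ h₂
    · exact x.card_eq _ _ _ h
    · subst h₂; exact x.card_eq _ _ _ h
    · simp at h
  nonneg β q σ := by
    split_ifs
    · exact x.nonneg _ _ _
    · exact x.nonneg _ _ _
    · simp
  aug β := by
    rcases Nat.eq_zero_or_pos k with rfl | hk
    · simpa using x.aug α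
    · simpa [hk] using x.aug β
  bd_succ β q := by
    rcases lt_trichotomy (q + 1) k with h | h | h
    · simp [h, show q < k by omega, x.bd_succ]
    · subst h
      simp [x.bd_succ]
    · rcases Nat.lt_or_eq_of_le (Nat.lt_succ_iff.1 h) with h' | h'
      · simp [show ¬ q + 1 < k by omega, show ¬ q + 1 = k by omega, show ¬ q < k by omega,
          show ¬ q = k by omega]
      · subst h'
        simp

theorem Cell.chain_d_eq {n : ℕ} {k : ℕ} {x y : Cell n} (h : x.d true k = y.d false k) :
    (∀ β q, q < k → x.chain β q = y.chain β q) ∧ x.chain true k = y.chain false k := by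
  constructor
  · intro β q hq
    have := congrFun (congrFun (congrArg Cell.chain h) β) q
    simpa [Cell.d, hq] using this
  · have := congrFun (congrFun (congrArg Cell.chain h) true) k
    simpa [Cell.d] using this

/-- The composition of two morphisms. Below degree `k` the two tables agree, in degree `k` one takes
the source of the first and the target of the second, above degree `k` the tables are added. -/
noncomputable def Cell.comp {n : ℕ} (k : ℕ) (x y : Cell n) (h : x.d true k = y.d false k) :
    Cell n where
  chain β q := if q < k then x.chain β q else
    if q = k then (if β then y.chain true k else x.chain false k) else x.chain β q + y.chain β q
  card_eq β q σ hσ := by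
    split_ifs at hσ with h₁ h₂ h₃
    · exact x.card_eq _ _ _ hσ
    · subst h₂; exact y.card_eq _ _ _ hσ
    · subst h₂; exact x.card_eq _ _ _ hσ
    · by_cases hx : x.chain β q σ = 0
      · rw [Finsupp.add_apply, hx, zero_add] at hσ
        exact y.card_eq _ _ _ hσ
      · exact x.card_eq _ _ _ hx
  nonneg β q σ := by
    split_ifs
    · exact x.nonneg _ _ _
    · exact y.nonneg _ _ _
    · exact x.nonneg _ _ _
    · exact add_nonneg (x.nonneg _ _ _) (y.nonneg _ _ _)
  aug β := by
    rcases Nat.eq_zero_or_pos k with rfl | hk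
    · cases β
      · simpa using x.aug false
      · simpa using y.aug true
    · simpa [hk] using x.aug β
  bd_succ β q := by
    obtain ⟨hlt, heq⟩ := Cell.chain_d_eq h
    rcases lt_trichotomy (q + 1) k with h | h | h
    · simp [h, show q < k by omega, x.bd_succ]
    · subst h
      cases β
      · simp [x.bd_succ]
      · simp [y.bd_succ, hlt]
    · rcases Nat.lt_or_eq_of_le (Nat.lt_succ_iff.1 h) with h' | h'
      · simp only [show ¬ q + 1 < k by omega, show ¬ q + 1 = k by omega, show ¬ q < k by omega,
          show ¬ q = k by omega, if_false, map_add, x.bd_succ, y.bd_succ]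
        abel
      · subst h'
        simp [x.bd_succ, y.bd_succ, heq]

theorem Cell.d_d_lt {n : ℕ} (α β : Bool) (k l : ℕ) (x : Cell n) (h : k < l) :
    (x.d α l).d β k = x.d β k := by
  ext γ q σ
  simp only [Cell.d]
  split_ifs <;> first | rfl | omega

theorem Cell.d_d_ge {n : ℕ} (α β : Bool) (k l : ℕ) (x : Cell n) (h : l ≤ k) :
    (x.d α l).d β k = x.d α l := by
  ext γ q σ
  simp only [Cell.d]
  split_ifs <;> first | rfl | omega


/-- The omega-category of the `n`-simplex. -/
noncomputable def omegaCat (n : ℕ) : OmegaCat.{0} where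
  Carrier := Cell n
  d α k x := x.d α k
  comp k x y h := x.comp k y h
  d_d_lt α β k l x h := Cell.d_d_lt α β k l x h
  d_d_ge α β k l x h := Cell.d_d_ge α β k l x h
  source_comp k x h := by
    ext β q σ
    simp only [Cell.comp, Cell.d]
    split_ifs <;> first | rfl | omega | simp_all
  comp_target k x h := by
    ext β q σ
    simp only [Cell.comp, Cell.d]
    split_ifs <;> first | rfl | omega | simp_all
  d_source_comp k x y h := by
    ext β q σ
    simp only [Cell.comp, Cell.d]
    split_ifs <;> first | rfl | omega | simp_all
  d_target_comp k x y h := by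
    obtain ⟨hlt, heq⟩ := Cell.chain_d_eq h
    ext β q σ
    simp only [Cell.comp, Cell.d]
    split_ifs with h₁ <;> first | rfl | omega | (rw [hlt _ _ h₁])
  d_comp α m k x y h hmk := by
    have h' : (x.d α m).d true k = (y.d α m).d false k := by
      rcases lt_or_gt_of_ne hmk with hl | hl
      · rw [Cell.d_d_ge _ _ _ _ _ hl.le, Cell.d_d_ge _ _ _ _ _ hl.le,
          ← Cell.d_d_lt true α m k x hl, h, Cell.d_d_lt false α m k y hl]
      · rw [Cell.d_d_lt _ _ _ _ _ hl, Cell.d_d_lt _ _ _ _ _ hl, h]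
    refine ⟨h', ?_⟩
    ext β q σ
    simp only [Cell.comp, Cell.d]
    split_ifs <;> first | rfl | omega
  assoc k x y z _ _ _ _ := by
    ext β q σ
    simp only [Cell.comp]
    split_ifs <;> first | rfl | omega | simp_all [add_assoc]
  exchange m k x y z w hmk hxy hzw hxz hyw _ _ := by
    have e₁ := (Cell.chain_d_eq hxy).1
    have e₂ := (Cell.chain_d_eq hxz).1
    have e₃ := (Cell.chain_d_eq hzw).1
    have e₄ := (Cell.chain_d_eq hyw).1
    ext β q σ
    simp only [Cell.comp]
    split_ifs <;> first | rfl | omega | (simp only [Finsupp.add_apply]; ring1)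
  finite_dim x := by
    refine ⟨n + 1, ?_, ?_⟩ <;>
    · ext β q σ
      simp only [Cell.d]
      split_ifs <;> first | rfl | (rw [x.chain_eq_zero _ _ (by omega), x.chain_eq_zero _ _ (by omega)]) | (rw [x.chain_eq_zero _ _ (by omega)])

theorem dim_le (n : ℕ) (x : omegaCat n) : (omegaCat n).dim x ≤ n := by
  have key : ∀ q, n ≤ q → Cell.chain x false q = Cell.chain x true q := by
    intro q hq
    have h := Cell.bd_succ x false q
    rw [Cell.chain_eq_zero x _ _ (by omega), map_zero] at h
    exact sub_eq_zero.1 h.symm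
  refine ((omegaCat n).dim_le_iff _ _).2 fun α => ?_
  refine Cell.ext ?_
  funext β q
  show (if q < n then Cell.chain x β q else if q = n then Cell.chain x α n else 0) = _
  split_ifs with h₁ h₂
  · rfl
  · subst h₂
    cases α <;> cases β <;> simp [key]
  · exact (Cell.chain_eq_zero x _ _ (by omega)).symm

theorem bd_single {n : ℕ} (σ : Finset (Fin (n + 1))) :
    bd n (Finsupp.single σ 1) = ∑ j ∈ σ, Finsupp.single (σ.erase j) (sgn σ j) := by
  simp [bd]

open Classical in
theorem push_single {m n : ℕ} (f : Fin (m + 1) → Fin (n + 1)) (σ : Finset (Fin (m + 1))) :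
    push f (Finsupp.single σ 1) =
      if Set.InjOn f σ then Finsupp.single (σ.image f) 1 else 0 := by
  simp [push]

theorem smul_single_sgn {n : ℕ} (σ τ : Finset (Fin (n + 1))) (j : Fin (n + 1)) :
    Finsupp.single τ (sgn σ j) = sgn σ j • Finsupp.single τ (1 : ℤ) := by
  simp

/-- A monotone map of vertices induces a chain map. -/
theorem push_bd {m n : ℕ} (f : Fin (m + 1) →o Fin (n + 1)) (c : Chain m) :
    bd n (push f c) = push f (bd m c) := by
  classical
  suffices h : (bd n).comp (push f) = (push f).comp (bd m) from LinearMap.congr_fun h c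
  refine Finsupp.lhom_ext' fun σ => LinearMap.ext_ring ?_
  simp only [LinearMap.comp_apply, Finsupp.lsingle_apply]
  rw [push_single, bd_single, map_sum]
  by_cases hf : Set.InjOn f σ
  · rw [if_pos hf, bd_single, Finset.sum_image hf]
    refine Finset.sum_congr rfl fun j hj => ?_
    have hsub : Set.InjOn f (σ.erase j : Finset _) :=
      hf.mono (by exact_mod_cast Finset.erase_subset j σ)
    rw [smul_single_sgn σ, map_smul, push_single, if_pos hsub]
    have e₁ : (σ.image f).erase (f j) = (σ.erase j).image f := by
      ext k
      simp only [Finset.mem_erase, Finset.mem_image]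
      constructor
      · rintro ⟨hk, i, hi, rfl⟩
        exact ⟨i, ⟨fun e => hk (by rw [e]), hi⟩, rfl⟩
      · rintro ⟨i, ⟨hij, hi⟩, rfl⟩
        exact ⟨fun e => hij (hf hi hj e), i, hi, rfl⟩
    have e₂ : sgn (σ.image f) (f j) = sgn σ j := by
      unfold sgn
      have : (σ.image f).filter (· < f j) = (σ.filter (· < j)).image f := by
        ext k
        simp only [Finset.mem_filter, Finset.mem_image]
        constructor
        · rintro ⟨⟨i, hi, rfl⟩, hlt⟩
          exact ⟨i, ⟨hi, lt_of_not_ge fun hge => absurd (f.monotone hge) (not_le.2 hlt)⟩, rfl⟩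
        · rintro ⟨i, ⟨hi, hlt⟩, rfl⟩
          refine ⟨⟨i, hi, rfl⟩, lt_of_le_of_ne (f.monotone hlt.le) fun e => ?_⟩
          exact hlt.ne (hf hi hj e)
      rw [this, Finset.card_image_of_injOn]
      exact hf.mono (by exact_mod_cast Finset.filter_subset _ σ)
    rw [e₁, e₂]
    simp
  · rw [if_neg hf, map_zero]
    -- choose two vertices with the same image, the first one as large as possible
    have hne : (σ.filter fun i => ∃ k ∈ σ, i < k ∧ f i = f k).Nonempty := by
      simp only [Set.InjOn, not_forall] at hf
      obtain ⟨i, hi, k, hk, hik, hne⟩ := hf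
      rcases lt_or_gt_of_ne hne with h | h
      · exact ⟨i, by simp only [Finset.mem_filter]; exact ⟨hi, k, hk, h, hik⟩⟩
      · exact ⟨k, by simp only [Finset.mem_filter]; exact ⟨hk, i, hi, h, hik.symm⟩⟩
    obtain ⟨i, hi, hmax⟩ := Finset.exists_max_image _ id hne
    simp only [Finset.mem_filter, id] at hi hmax
    obtain ⟨hi, k, hk, hik, hfik⟩ := hi
    have hadj : ∀ l ∈ σ, i < l → k ≤ l := by
      intro l hl hil
      by_contra hlt
      push Not at hlt
      have hfl : f l = f k :=
        le_antisymm (f.monotone hlt.le) (hfik ▸ f.monotone hil.le)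
      exact absurd (hmax l ⟨hl, k, hk, hlt, hfl⟩) (not_le.2 hil)
    have hzero : ∀ j ∈ σ, j ∉ ({i, k} : Finset _) →
        push f (Finsupp.single (σ.erase j) (sgn σ j)) = 0 := by
      intro j _ hj
      simp only [Finset.mem_insert, Finset.mem_singleton, not_or] at hj
      rw [smul_single_sgn σ, map_smul, push_single, if_neg, smul_zero]
      intro hinj
      refine hik.ne (hinj ?_ ?_ hfik)
      · simp [Ne.symm hj.1, hi]
      · simp [Ne.symm hj.2, hk]
    rw [← Finset.sum_subset (s₁ := {i, k}) (by
      intro j hj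
      simp only [Finset.mem_insert, Finset.mem_singleton] at hj
      rcases hj with rfl | rfl <;> assumption) hzero, Finset.sum_pair hik.ne]
    have hs : sgn σ k = - sgn σ i := by
      unfold sgn
      have : σ.filter (· < k) = insert i (σ.filter (· < i)) := by
        ext l
        simp only [Finset.mem_filter, Finset.mem_insert]
        constructor
        · rintro ⟨hl, hlk⟩
          rcases lt_trichotomy l i with h | h | h
          · exact Or.inr ⟨hl, h⟩
          · exact Or.inl h
          · exact absurd (hadj l hl h) (not_le.2 hlk)
        · rintro (rfl | ⟨hl, hli⟩)
          · exact ⟨hi, hik⟩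
          · exact ⟨hl, hli.trans hik⟩
      rw [this, Finset.card_insert_of_notMem (by simp), pow_succ]
      ring
    have himg : (σ.erase i).image f = (σ.erase k).image f := by
      ext l
      simp only [Finset.mem_image, Finset.mem_erase]
      constructor
      · rintro ⟨a, ⟨_, ha⟩, rfl⟩
        by_cases hak : a = k
        · exact ⟨i, ⟨hik.ne, hi⟩, by rw [hak, hfik]⟩
        · exact ⟨a, ⟨hak, ha⟩, rfl⟩
      · rintro ⟨a, ⟨_, ha⟩, rfl⟩
        by_cases hai : a = i
        · exact ⟨k, ⟨hik.ne', hk⟩, by rw [hai, hfik]⟩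
        · exact ⟨a, ⟨hai, ha⟩, rfl⟩
    have hinj : Set.InjOn f (σ.erase i : Finset _) ↔ Set.InjOn f (σ.erase k : Finset _) := by
      rw [← Finset.card_image_iff, ← Finset.card_image_iff, himg, Finset.card_erase_of_mem hi,
        Finset.card_erase_of_mem hk]
    rw [smul_single_sgn σ, smul_single_sgn σ, map_smul, map_smul, push_single, push_single, hs,
      himg]
    by_cases hc : Set.InjOn f (σ.erase k : Finset _)
    · rw [if_pos hc, if_pos (hinj.2 hc)]
      simp
    · rw [if_neg hc, if_neg (fun h => hc (hinj.1 h))]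
      simp

theorem push_apply {m n : ℕ} (f : Fin (m + 1) → Fin (n + 1)) (c : Chain m)
    (τ : Finset (Fin (n + 1))) : push f c τ =
      ∑ σ : Finset (Fin (m + 1)), open Classical in
        c σ * (if Set.InjOn f σ ∧ σ.image f = τ then 1 else 0) := by
  classical
  rw [push, Finsupp.linearCombination_apply, Finsupp.sum_fintype _ _ (by simp),
    Finsupp.finsetSum_apply]
  refine Finset.sum_congr rfl fun σ _ => ?_
  by_cases h : Set.InjOn f σ
  · by_cases h' : σ.image f = τ <;> simp [h, h']
  · simp [h]

theorem push_id {n : ℕ} (c : Chain n) : push (_root_.id : Fin (n + 1) → Fin (n + 1)) c = c := by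
  classical
  suffices h : push (_root_.id : Fin (n + 1) → Fin (n + 1)) = LinearMap.id from
    LinearMap.congr_fun h c
  refine Finsupp.lhom_ext' fun σ => LinearMap.ext_ring ?_
  simp only [LinearMap.comp_apply, Finsupp.lsingle_apply]
  rw [push_single]
  simp

theorem push_push {l m n : ℕ} (f : Fin (l + 1) → Fin (m + 1)) (g : Fin (m + 1) → Fin (n + 1))
    (c : Chain l) : push g (push f c) = push (g ∘ f) c := by
  classical
  suffices h : (push g).comp (push f) = push (g ∘ f) from LinearMap.congr_fun h c
  refine Finsupp.lhom_ext' fun σ => LinearMap.ext_ring ?_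
  simp only [LinearMap.comp_apply, Finsupp.lsingle_apply]
  rw [push_single, push_single]
  by_cases hf : Set.InjOn f σ
  · rw [if_pos hf, push_single, Finset.image_image]
    have : Set.InjOn g (σ.image f : Finset _) ↔ Set.InjOn (g ∘ f) σ := by
      rw [Finset.coe_image]
      exact (hf.comp_iff).symm
    by_cases hg : Set.InjOn (g ∘ f) σ
    · rw [if_pos hg, if_pos (this.2 hg)]
    · rw [if_neg hg, if_neg (fun h => hg (this.1 h))]
  · rw [if_neg hf, map_zero, if_neg fun h => hf fun a ha b hb e => h ha hb (congrArg g e)]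

/-- The action of a monotone map of vertices on morphisms. -/
noncomputable def Cell.map {m n : ℕ} (f : Fin (m + 1) →o Fin (n + 1)) (x : Cell m) : Cell n where
  chain α q := push f (x.chain α q)
  card_eq α q τ h := by
    classical
    rw [push_apply] at h
    obtain ⟨σ, _, hσ⟩ := Finset.exists_ne_zero_of_sum_ne_zero h
    have h₁ : x.chain α q σ ≠ 0 := left_ne_zero_of_mul hσ
    have h₂ := right_ne_zero_of_mul hσ
    simp only [ne_eq, ite_eq_right_iff, one_ne_zero, imp_false, not_not] at h₂
    rw [← h₂.2, Finset.card_image_of_injOn h₂.1, x.card_eq α q σ h₁]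
  nonneg α q τ := by
    classical
    rw [push_apply]
    refine Finset.sum_nonneg fun σ _ => mul_nonneg (x.nonneg _ _ _) ?_
    split_ifs <;> simp
  aug α := by
    classical
    rw [push_bd, x.aug, push_single]
    simp
  bd_succ α q := by rw [push_bd, x.bd_succ, map_sub]

/-- The omega-functor induced by a monotone map of vertices. -/
noncomputable def map {m n : ℕ} (f : Fin (m + 1) →o Fin (n + 1)) :
    OmegaFunctor (omegaCat m) (omegaCat n) where
  toFun x := Cell.map f x
  map_d α k x := by
    refine Cell.ext ?_
    funext β q
    show push f (if q < k then Cell.chain x β q else if q = k then Cell.chain x α k else 0) =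
      if q < k then push f (Cell.chain x β q) else if q = k then push f (Cell.chain x α k) else 0
    split_ifs <;> simp
  map_comp k x y h := by
    have hd : ∀ (α : Bool) (z : Cell m), (Cell.map f z).d α k = Cell.map f (z.d α k) := by
      intro α z
      refine Cell.ext ?_
      funext β q
      show (if q < k then push f (z.chain β q) else if q = k then push f (z.chain α k) else 0) =
        push f (if q < k then z.chain β q else if q = k then z.chain α k else 0)
      split_ifs <;> simp
    refine ⟨(hd true x).trans ((congrArg (Cell.map f) h).trans (hd false y).symm), ?_⟩
    refine Cell.ext ?_
    funext β q
    show push f (if q < k then Cell.chain x β q else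
        if q = k then (if β then Cell.chain y true k else Cell.chain x false k)
        else Cell.chain x β q + Cell.chain y β q) =
      if q < k then push f (Cell.chain x β q) else
        if q = k then (if β then push f (Cell.chain y true k) else push f (Cell.chain x false k))
        else push f (Cell.chain x β q) + push f (Cell.chain y β q)
    split_ifs <;> simp

theorem map_id_apply {n : ℕ} (x : omegaCat n) : map OrderHom.id x = x :=
  Cell.ext (funext fun _ => funext fun _ => push_id _)

theorem map_map_apply {l m n : ℕ} (f : Fin (l + 1) →o Fin (m + 1)) (g : Fin (m + 1) →o Fin (n + 1))
    (x : omegaCat l) : map g (map f x) = map (g.comp f) x :=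
  Cell.ext (funext fun _ => funext fun _ => push_push _ _ _)

/-- The faces `σ` of dimension `q` such that every vertex outside `σ` is preceded by an even number
(for `α = false`), respectively an odd number (for `α = true`), of vertices of `σ`. -/
def topFaces (n : ℕ) (α : Bool) (q : ℕ) : Finset (Finset (Fin (n + 1))) :=
  Finset.univ.filter fun σ => σ.card = q + 1 ∧
    ∀ j, j ∉ σ → (Odd (σ.filter (· < j)).card ↔ α = true)

/-- The chain of the faces that form the `q`-source or the `q`-target of the `n`-simplex. -/
noncomputable def topChain (n : ℕ) (α : Bool) (q : ℕ) : Chain n :=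
  ∑ σ ∈ topFaces n α q, Finsupp.single σ 1

theorem topChain_apply (n : ℕ) (α : Bool) (q : ℕ) (σ : Finset (Fin (n + 1))) :
    topChain n α q σ = if σ ∈ topFaces n α q then 1 else 0 := by
  simp [topChain, Finsupp.finsetSum_apply, Finsupp.single_apply]

theorem bd_apply {n : ℕ} (c : Chain n) (τ : Finset (Fin (n + 1))) :
    bd n c τ = ∑ j ∈ τᶜ, sgn τ j * c (insert j τ) := by
  let ev : Finset (Fin (n + 1)) → Chain n →ₗ[ℤ] ℤ := fun τ => Finsupp.lapply τ
  suffices h : (ev τ).comp (bd n) = ∑ j ∈ τᶜ, sgn τ j • ev (insert j τ) by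
    have := LinearMap.congr_fun h c
    simpa [ev, LinearMap.sum_apply] using this
  refine Finsupp.lhom_ext' fun σ => LinearMap.ext_ring ?_
  simp only [LinearMap.comp_apply, Finsupp.lsingle_apply, LinearMap.sum_apply,
    LinearMap.smul_apply, ev, Finsupp.lapply_apply, bd_single, Finsupp.finsetSum_apply,
    Finsupp.single_apply, smul_eq_mul, mul_ite, mul_one, mul_zero]
  rw [← Finset.sum_filter, ← Finset.sum_filter]
  refine Finset.sum_congr ?_ ?_
  · ext j
    simp only [Finset.mem_filter, Finset.mem_compl]
    constructor
    · rintro ⟨hj, rfl⟩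
      exact ⟨Finset.notMem_erase j σ, (Finset.insert_erase hj).symm⟩
    · rintro ⟨hj, rfl⟩
      exact ⟨Finset.mem_insert_self j τ, Finset.erase_insert hj⟩
  · intro j hj
    simp only [Finset.mem_filter, Finset.mem_compl] at hj
    obtain ⟨_, rfl⟩ := hj
    unfold sgn
    rw [Finset.filter_insert, if_neg (lt_irrefl j)]

theorem alternating_sum {ι : Type*} [LinearOrder ι] (p : ι → Prop) [DecidablePred p]
    (T : Finset ι) :
    (∑ j ∈ T, if (∀ k ∈ T, k < j → ¬ p k) ∧ (∀ k ∈ T, j < k → p k)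
      then (if p j then (-1 : ℤ) else 1) else 0) =
      (if ∀ k ∈ T, ¬ p k then 1 else 0) - (if ∀ k ∈ T, p k then 1 else 0) := by
  induction T using Finset.induction_on_max with
  | empty => simp
  | insert m T hm ih =>
    have hmT : m ∉ T := fun h => lt_irrefl m (hm m h)
    rw [Finset.sum_insert hmT]
    have e₁ : ((∀ k ∈ insert m T, k < m → ¬ p k) ∧ (∀ k ∈ insert m T, m < k → p k)) ↔
        ∀ k ∈ T, ¬ p k := by
      constructor
      · exact fun h k hk => h.1 k (Finset.mem_insert_of_mem hk) (hm k hk)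
      · refine fun h => ⟨fun k hk hlt => ?_, fun k hk hlt => ?_⟩
        · rcases Finset.mem_insert.1 hk with rfl | hk
          · exact absurd hlt (lt_irrefl _)
          · exact h k hk
        · rcases Finset.mem_insert.1 hk with rfl | hk
          · exact absurd hlt (lt_irrefl _)
          · exact absurd hlt (hm k hk).asymm
    have e₂ : ∀ j ∈ T, ((∀ k ∈ insert m T, k < j → ¬ p k) ∧ (∀ k ∈ insert m T, j < k → p k)) ↔
        (((∀ k ∈ T, k < j → ¬ p k) ∧ (∀ k ∈ T, j < k → p k)) ∧ p m) := by
      intro j hj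
      simp only [Finset.forall_mem_insert, hm j hj, (hm j hj).asymm, false_imp_iff, true_and,
        true_imp_iff]
      tauto
    have e₃ : (∑ j ∈ T, if (∀ k ∈ insert m T, k < j → ¬ p k) ∧ (∀ k ∈ insert m T, j < k → p k)
        then (if p j then (-1 : ℤ) else 1) else 0) = if p m then
        (∑ j ∈ T, if (∀ k ∈ T, k < j → ¬ p k) ∧ (∀ k ∈ T, j < k → p k)
          then (if p j then (-1 : ℤ) else 1) else 0) else 0 := by
      by_cases hpm : p m
      · rw [if_pos hpm]
        refine Finset.sum_congr rfl fun j hj => ?_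
        simp only [e₂ j hj, hpm, and_true]
      · rw [if_neg hpm]
        refine Finset.sum_eq_zero fun j hj => ?_
        simp only [e₂ j hj, hpm, and_false, if_false]
    rw [e₃, ih]
    simp only [e₁]
    simp only [Finset.forall_mem_insert]
    by_cases hpm : p m
    · simp only [hpm, if_true, not_true, false_and, if_false, true_and]
      split_ifs <;> simp
    · simp [hpm]

theorem mem_topFaces_insert {n : ℕ} (α : Bool) (q : ℕ) (τ : Finset (Fin (n + 1)))
    (hτ : τ.card = q) (j : Fin (n + 1)) (hj : j ∈ τᶜ) :
    insert j τ ∈ topFaces n α q ↔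
      (∀ k ∈ τᶜ, k < j → (Odd (τ.filter (· < k)).card ↔ α = true)) ∧
      (∀ k ∈ τᶜ, j < k → ¬ (Odd (τ.filter (· < k)).card ↔ α = true)) := by
  rw [Finset.mem_compl] at hj
  simp only [topFaces, Finset.mem_filter, Finset.mem_univ, true_and,
    Finset.card_insert_of_notMem hj, hτ, Finset.mem_insert, not_or, Finset.mem_compl]
  have hlow : ∀ k, k < j → (insert j τ).filter (· < k) = τ.filter (· < k) := by
    intro k hk
    rw [Finset.filter_insert, if_neg hk.asymm]
  have hhigh : ∀ k, j < k → ((insert j τ).filter (· < k)).card = (τ.filter (· < k)).card + 1 := by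
    intro k hk
    rw [Finset.filter_insert, if_pos hk, Finset.card_insert_of_notMem (by simp [hj])]
  constructor
  · refine fun h => ⟨fun k hk hlt => ?_, fun k hk hlt => ?_⟩
    · have := h k ⟨hlt.ne, hk⟩
      rwa [hlow k hlt] at this
    · have := h k ⟨hlt.ne', hk⟩
      rw [hhigh k hlt, Nat.odd_add_one] at this
      tauto
  · rintro ⟨h₁, h₂⟩ k ⟨hkj, hk⟩
    rcases lt_or_gt_of_ne hkj with hlt | hgt
    · rw [hlow k hlt]
      exact h₁ k hk hlt
    · have := h₂ k hk hgt
      rw [hhigh k hgt, Nat.odd_add_one]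
      tauto

theorem bd_topChain_apply (n : ℕ) (α : Bool) (q : ℕ) (τ : Finset (Fin (n + 1)))
    (hτ : τ.card = q) : bd n (topChain n α q) τ =
      (if ∀ k ∈ τᶜ, ¬ Odd (τ.filter (· < k)).card then 1 else 0) -
      (if ∀ k ∈ τᶜ, Odd (τ.filter (· < k)).card then 1 else 0) := by
  rw [bd_apply]
  have hs : ∀ j, sgn τ j = if Odd (τ.filter (· < j)).card then (-1 : ℤ) else 1 := by
    intro j
    unfold sgn
    split_ifs with h
    · exact h.neg_one_pow
    · exact (Nat.not_odd_iff_even.1 h).neg_one_pow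
  cases α
  · refine Eq.trans ?_ ((alternating_sum (fun k => Odd (τ.filter (· < k)).card) τᶜ).trans
      (by congr))
    refine Finset.sum_congr rfl fun j hj => ?_
    rw [topChain_apply, hs]
    have e := mem_topFaces_insert false q τ hτ j hj
    simp only [Bool.false_eq_true, iff_false, not_not] at e
    simp only [e, mul_ite, mul_one, mul_zero]
    congr
  · rw [← neg_sub]
    refine Eq.trans ?_ (congrArg Neg.neg
      ((alternating_sum (fun k => ¬ Odd (τ.filter (· < k)).card) τᶜ).trans
        (by simp only [not_not]; congr)))
    rw [← Finset.sum_neg_distrib]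
    refine Finset.sum_congr rfl fun j hj => ?_
    rw [topChain_apply, hs]
    have e := mem_topFaces_insert true q τ hτ j hj
    simp only [iff_true] at e
    simp only [e, not_not, mul_ite, mul_one, mul_zero]
    by_cases hp : Odd (τ.filter (· < j)).card <;> simp only [hp, not_true, not_false_iff, if_true,
      if_false] <;> split_ifs <;> simp

theorem bd_topChain_eq_zero (n : ℕ) (α : Bool) (q : ℕ) (τ : Finset (Fin (n + 1)))
    (hτ : τ.card ≠ q) : bd n (topChain n α q) τ = 0 := by
  rw [bd_apply]
  refine Finset.sum_eq_zero fun j hj => ?_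
  rw [Finset.mem_compl] at hj
  rw [topChain_apply, if_neg, mul_zero]
  simp only [topFaces, Finset.mem_filter, Finset.card_insert_of_notMem hj]
  omega

/-- The top-dimensional face of the `n`-simplex, as a morphism of its omega-category. -/
noncomputable def top (n : ℕ) : omegaCat n where
  chain := topChain n
  card_eq α q σ h := by
    rw [topChain_apply] at h
    simp only [topFaces, Finset.mem_filter] at h
    by_contra hc
    simp [hc] at h
  nonneg α q σ := by
    rw [topChain_apply]
    split_ifs <;> simp
  aug α := by
    ext τ
    by_cases hτ : τ = ∅
    · subst hτ
      rw [bd_topChain_apply n α 0 ∅ rfl]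
      simp
    · rw [bd_topChain_eq_zero n α 0 τ (by simpa using hτ), Finsupp.single_apply,
        if_neg (Ne.symm hτ)]
  bd_succ α q := by
    ext τ
    rw [Finsupp.sub_apply, topChain_apply, topChain_apply]
    by_cases hτ : τ.card = q + 1
    · rw [bd_topChain_apply n α (q + 1) τ hτ]
      simp [topFaces, hτ]
    · rw [bd_topChain_eq_zero n α (q + 1) τ hτ]
      simp [topFaces, hτ]

/-- The vertex `i` of the `n`-simplex. -/
noncomputable def vertex (n : ℕ) (i : Fin (n + 1)) : omegaCat n :=
  map (OrderHom.const (Fin (0 + 1)) i) (top 0)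

theorem map_vertex {m n : ℕ} (f : Fin (m + 1) →o Fin (n + 1)) (i : Fin (m + 1)) :
    map f (vertex m i) = vertex n (f i) :=
  map_map_apply _ _ _

theorem topFaces_zero (n : ℕ) (α : Bool) :
    topFaces n α 0 = {{if α then 0 else Fin.last n}} := by
  ext σ
  simp only [topFaces, Finset.mem_filter, Finset.mem_univ, true_and, zero_add,
    Finset.mem_singleton]
  constructor
  · rintro ⟨hc, h⟩
    obtain ⟨v, rfl⟩ := Finset.card_eq_one.1 hc
    cases α
    · by_contra hv
      have hne : Fin.last n ∉ ({v} : Finset _) := by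
        simpa [eq_comm] using hv
      have h' := h _ hne
      have hlt : v < Fin.last n := lt_of_le_of_ne (Fin.le_last v) (by simpa [eq_comm] using hne)
      rw [Finset.filter_singleton, if_pos hlt] at h'
      simp at h'
    · by_contra hv
      have hne : (0 : Fin (n + 1)) ∉ ({v} : Finset _) := by
        simpa [eq_comm] using hv
      have h' := h _ hne
      rw [Finset.filter_singleton, if_neg (by simp)] at h'
      simp at h'
  · rintro rfl
    refine ⟨Finset.card_singleton _, fun j hj => ?_⟩
    rw [Finset.mem_singleton] at hj
    cases α
    · rw [Finset.filter_singleton, if_neg (by simpa using Fin.le_last j)]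
      simp
    · have : (0 : Fin (n + 1)) < j := Fin.pos_iff_ne_zero.2 (by simpa using hj)
      rw [Finset.filter_singleton, if_pos (by simpa using this)]
      simp

theorem topChain_zero (n : ℕ) (α : Bool) :
    topChain n α 0 = Finsupp.single {if α then 0 else Fin.last n} 1 := by
  rw [topChain, topFaces_zero, Finset.sum_singleton]

theorem d_zero_top (n : ℕ) (α : Bool) :
    (omegaCat n).d α 0 (top n) = vertex n (if α then 0 else Fin.last n) := by
  classical
  refine Cell.ext ?_
  funext β q
  show (if q < 0 then topChain n β q else if q = 0 then topChain n α 0 else 0) =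
    push _ (topChain 0 β q)
  rcases Nat.eq_zero_or_pos q with rfl | hq
  · rw [if_neg (lt_irrefl 0), if_pos rfl, topChain_zero, topChain_zero, push_single]
    have hinj : ∀ S : Set (Fin (0 + 1)),
        Set.InjOn (OrderHom.const (Fin (0 + 1)) (if α = true then (0 : Fin (n + 1)) else Fin.last n))
          S := fun _ a _ b _ _ => Fin.ext (by omega)
    rw [if_pos (hinj _)]
    rw [Finset.image_singleton]
    rfl
  · rw [if_neg (Nat.not_lt_zero q), if_neg hq.ne']
    have h : topChain 0 β q = 0 := Cell.chain_eq_zero (top 0) β q hq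
    rw [h, map_zero]

/-- A map to a set that is constant along all sources and targets takes the same value on all the
faces of a simplex. -/
theorem top_connected {S : Type u} {m n : ℕ} (g : omegaCat n → S)
    (hg : ∀ α k x, g ((omegaCat n).d α k x) = g x) (f : Fin (m + 1) →o Fin (n + 1)) :
    g (map f (top m)) = g (top n) := by
  have hv : ∀ (l : ℕ) (e : Fin (l + 1) →o Fin (n + 1)) (α : Bool),
      g (map e (top l)) = g (vertex n (e (if α then 0 else Fin.last l))) := by
    intro l e α
    rw [← hg α 0, ← (map e).map_d, d_zero_top, map_vertex]
  have hlast : ∀ i : Fin (n + 1), g (vertex n i) = g (vertex n (Fin.last n)) := by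
    intro i
    let e : Fin (1 + 1) →o Fin (n + 1) :=
      ⟨fun j => if j = 0 then i else Fin.last n, by
        intro a b hab
        by_cases hb : b = 0
        · have ha : a = 0 := le_antisymm (hb ▸ hab) (Fin.zero_le a)
          simp [ha, hb]
        · simp only [hb, if_false]
          exact Fin.le_last _⟩
    have h₁ := hv 1 e true
    have h₂ := hv 1 e false
    rw [h₁] at h₂
    have e₀ : e 0 = i := by
      show (if (0 : Fin (1 + 1)) = 0 then i else Fin.last n) = i
      exact if_pos rfl
    have e₁ : e (Fin.last 1) = Fin.last n := by
      show (if Fin.last 1 = (0 : Fin (1 + 1)) then i else Fin.last n) = Fin.last n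
      exact if_neg (by decide)
    simpa only [if_true, Bool.false_eq_true, if_false, e₀, e₁] using h₂
  rw [hv m f true, hlast, ← hg false 0 (top n), d_zero_top]
  simp

end Simplex

/-! ## The branching semi-globular nerve -/

namespace NCOmegaCat

/-- The cosimplicial structure of the omega-categories of the simplices, contravariantly on
omega-functors out of them. -/
noncomputable def simplexPrecomp {E : OmegaCat.{u}} {a b : SimplexCategory} (f : a ⟶ b)
    (x : OmegaFunctor (Simplex.omegaCat b.len) E) : OmegaFunctor (Simplex.omegaCat a.len) E :=
  (Simplex.map f.toOrderHom).trans x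

theorem simplexPrecomp_id {E : OmegaCat.{u}} {a : SimplexCategory}
    (x : OmegaFunctor (Simplex.omegaCat a.len) E) : simplexPrecomp (𝟙 a) x = x := by
  refine OmegaFunctor.ext (funext fun y => ?_)
  exact congrArg x (Simplex.map_id_apply y)

theorem simplexPrecomp_comp {E : OmegaCat.{u}} {a b c : SimplexCategory} (f : a ⟶ b) (g : b ⟶ c)
    (x : OmegaFunctor (Simplex.omegaCat c.len) E) :
    simplexPrecomp (f ≫ g) x = simplexPrecomp f (simplexPrecomp g x) := by
  refine OmegaFunctor.ext (funext fun y => ?_)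
  exact congrArg x (Simplex.map_map_apply f.toOrderHom g.toOrderHom y).symm

/-- The simplicial nerve of an omega-category: its `n`-simplices are the omega-functors from the
omega-category of the `n`-simplex. -/
noncomputable def nerve (E : OmegaCat.{u}) : SimplicialObject (Type u) where
  obj a := OmegaFunctor (Simplex.omegaCat a.unop.len) E
  map f := TypeCat.ofHom fun x => simplexPrecomp f.unop x
  map_id a := by
    refine ConcreteCategory.hom_ext _ _ fun x => ?_
    exact simplexPrecomp_id x
  map_comp f g := by
    refine ConcreteCategory.hom_ext _ _ fun x => ?_
    exact simplexPrecomp_comp g.unop f.unop x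

theorem semiPathStart_const (C : NCOmegaCat.{u}) {m n : ℕ} (f : Fin (m + 1) →o Fin (n + 1))
    (x : OmegaFunctor (Simplex.omegaCat n) C.semiPath) :
    C.semiPathStart (x (Simplex.map f (Simplex.top m))) = C.semiPathStart (x (Simplex.top n)) := by
  refine Simplex.top_connected (fun y => C.semiPathStart (x y)) (fun α k y => ?_) f
  exact (x.trans C.semiPathStart).map_d α k y

/-- The branching semi-globular nerve of `C`: the simplicial nerve of the negative semi-path
omega-category, augmented over `C_0` by `s_0`. -/
noncomputable def branchingNerve (C : NCOmegaCat.{u}) : SimplicialObject.Augmented (Type u) where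
  left := nerve C.semiPath
  right := zeroCells.obj C
  hom :=
    { app := fun a => TypeCat.ofHom
        fun x : OmegaFunctor (Simplex.omegaCat a.unop.len) C.semiPath =>
          C.semiPathStart (x (Simplex.top a.unop.len))
      naturality := fun a b f => by
        refine ConcreteCategory.hom_ext _ _ fun x => ?_
        exact C.semiPathStart_const f.unop.toOrderHom x }

/-- The functor sending `C` to its branching semi-globular nerve. -/
noncomputable def branchingNerveFunctor :
    NCOmegaCat.{u} ⥤ SimplicialObject.Augmented (Type u) where
  obj C := C.branchingNerve
  map {C D} f :=
    { left :=
        { app := fun a => TypeCat.ofHom fun x => x.trans (semiPathMap f)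
          naturality := fun _ _ _ => rfl }
      right := zeroCells.map f
      w := by
        refine NatTrans.ext (funext fun a => ConcreteCategory.hom_ext _ _ fun x => ?_)
        exact semiPathStart_map f _ }
  map_id C := by
    have h : semiPathMap (𝟙 C) = OmegaFunctor.id C.semiPath := semiPathFunctor.map_id C
    refine SimplicialObject.Augmented.hom_ext _ _ ?_ rfl
    ext a x
    exact congrArg (OmegaFunctor.trans x) h
  map_comp {C D E} f g := by
    have h : semiPathMap (f ≫ g) = (semiPathMap f).trans (semiPathMap g) :=
      semiPathFunctor.map_comp f g
    refine SimplicialObject.Augmented.hom_ext _ _ ?_ rfl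
    ext a x
    exact congrArg (OmegaFunctor.trans x) h

end NCOmegaCat

/-! ## Cuts and regular cuts -/

/-- The functor of `n`-simplices of a functor to augmented simplicial sets. -/
def simplices (F : NCOmegaCat.{u} ⥤ SimplicialObject.Augmented (Type u)) (n : ℕ) :
    NCOmegaCat.{u} ⥤ Type u :=
  F ⋙ SimplicialObject.Augmented.drop ⋙
    (evaluation SimplexCategoryᵒᵖ (Type u)).obj (op (SimplexCategory.mk n))

/-- The face map `∂_i`, as a natural transformation. -/
def faceMap (F : NCOmegaCat.{u} ⥤ SimplicialObject.Augmented (Type u)) (n : ℕ) (i : Fin (n + 2)) :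
    simplices F (n + 1) ⟶ simplices F n :=
  Functor.whiskerLeft F (Functor.whiskerLeft SimplicialObject.Augmented.drop
    ((evaluation SimplexCategoryᵒᵖ (Type u)).map (SimplexCategory.δ i).op))

/-- The degeneracy map `ε_i`, as a natural transformation. -/
def degeneracyMap (F : NCOmegaCat.{u} ⥤ SimplicialObject.Augmented (Type u)) (n : ℕ)
    (i : Fin (n + 1)) : simplices F n ⟶ simplices F (n + 1) :=
  Functor.whiskerLeft F (Functor.whiskerLeft SimplicialObject.Augmented.drop
    ((evaluation SimplexCategoryᵒᵖ (Type u)).map (SimplexCategory.σ i).op))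

theorem OmegaCat.dim_d_le_dim (A : OmegaCat.{u}) (x : A) (α : Bool) (k : ℕ) :
    A.dim (A.d α k x) ≤ A.dim x := by
  rcases le_total (A.dim x) k with h | h
  · rw [(A.dim_le_iff x k).1 h α]
  · exact (A.dim_d_le x α k).trans h

/-- The inclusion of `tr^n` in `tr^{n+1}`. -/
noncomputable def OmegaCat.trIncl (n : ℕ) : OmegaCat.tr.{u} n ⟶ OmegaCat.tr.{u} (n + 1) where
  app _ := TypeCat.ofHom fun x => ⟨x.1, x.2.trans (Nat.le_succ n)⟩
  naturality _ _ _ := rfl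

/-- The `n`-source or `n`-target, as a natural transformation from `tr^{n+1}` to `tr^n`. -/
noncomputable def OmegaCat.trBd (α : Bool) (n : ℕ) :
    OmegaCat.tr.{u} (n + 1) ⟶ OmegaCat.tr.{u} n where
  app A := TypeCat.ofHom fun x => ⟨A.d α n x.1, A.dim_d_le x.1 α n⟩
  naturality _ _ f := by
    ext x
    exact Subtype.ext (OmegaFunctor.map_d f α n x.1).symm

/-- The `k`-source or `k`-target, as a natural transformation from `tr^n` to itself. -/
noncomputable def OmegaCat.trD (α : Bool) (k n : ℕ) :
    OmegaCat.tr.{u} n ⟶ OmegaCat.tr.{u} n where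
  app A := TypeCat.ofHom fun x => ⟨A.d α k x.1, (A.dim_d_le_dim x.1 α k).trans x.2⟩
  naturality _ _ f := by
    ext x
    exact Subtype.ext (OmegaFunctor.map_d f α k x.1).symm

/-- A cut: a functor `F` to augmented simplicial sets, a functor `P` to omega-categories, and
natural maps `ev_n` from the `n`-simplices of `F` to `tr^n P`. -/
structure Cut where
  /-- the augmented simplicial nerve -/
  F : NCOmegaCat.{u} ⥤ SimplicialObject.Augmented (Type u)
  /-- the omega-category in which simplices are evaluated -/
  P : NCOmegaCat.{u} ⥤ OmegaCat.{u}
  /-- the evaluation maps -/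
  ev : ∀ n : ℕ, simplices F n ⟶ P ⋙ OmegaCat.tr n

namespace Cut

variable (K : Cut.{u})

/-- The functor `F_n`. -/
abbrev simp (n : ℕ) : NCOmegaCat.{u} ⥤ Type u := simplices K.F n

/-- The functor `tr^n P`. -/
noncomputable abbrev trP (n : ℕ) : NCOmegaCat.{u} ⥤ Type u := K.P ⋙ OmegaCat.tr n

/-- The inclusion of `tr^n P` in `tr^{n+1} P`. -/
noncomputable def incl (n : ℕ) : K.trP n ⟶ K.trP (n + 1) :=
  Functor.whiskerLeft K.P (OmegaCat.trIncl n)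

/-- The group `C_{n+1} = ℤ F_n(C)` of chains, generated by the `n`-simplices. -/
abbrev Chains (n : ℕ) (C : NCOmegaCat.{u}) : Type u := (K.simp n).obj C →₀ ℤ

/-- The map of chains induced by a map of simplices. -/
noncomputable def chainMap {S T : Type u} (f : S → T) : (S →₀ ℤ) →+ (T →₀ ℤ) :=
  Finsupp.mapDomain.addMonoidHom f

/-- The simplicial differential `∑_i (-1)^i ∂_i`. -/
noncomputable def boundary (n : ℕ) (C : NCOmegaCat.{u}) :
    K.Chains (n + 1) C →+ K.Chains n C :=
  ∑ i : Fin (n + 2), ((-1 : ℤ) ^ (i : ℕ)) • chainMap ((faceMap K.F n i).app C)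

/-- The subgroup `M_{n+1}` of thin elements: it is generated by the `n`-simplices `x` with `ev x` of
dimension less than `n`. It is zero for `n = 0`. -/
noncomputable def thin (n : ℕ) (C : NCOmegaCat.{u}) : AddSubgroup (K.Chains n C) :=
  AddSubgroup.closure {c | ∃ x : (K.simp n).obj C,
    (K.P.obj C).dim ((K.ev n).app C x).1 < n ∧ c = Finsupp.single x 1}

/-- The subgroup `M_{n+1} + ∂ M_{n+2}`. -/
noncomputable def degenerate (n : ℕ) (C : NCOmegaCat.{u}) : AddSubgroup (K.Chains n C) :=
  K.thin n C ⊔ (K.thin (n + 1) C).map (K.boundary n C)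

/-- The group `CR_{n+1} = C_{n+1} / (M_{n+1} + ∂ M_{n+2})` of the reduced complex. -/
abbrev Reduced (n : ℕ) (C : NCOmegaCat.{u}) : Type u := K.Chains n C ⧸ K.degenerate n C

/-- The class of a chain in the reduced complex. -/
noncomputable def toReduced (n : ℕ) (C : NCOmegaCat.{u}) : K.Chains n C →+ K.Reduced n C :=
  QuotientAddGroup.mk' (K.degenerate n C)

/-- The operators `□_{n+1}` (here `sq n`), natural maps from `tr^n P` to `F_n`: they are sections of
the evaluation maps (so that `□_1` is the identification of `tr^0 P` with `F_0` when `ev_0` is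
bijective), and `□_{n+2}` extends `ε_n □_{n+1}`. -/
structure IsSquare (sq : ∀ n : ℕ, K.trP n ⟶ K.simp n) : Prop where
  sq_ev : ∀ n, sq n ≫ K.ev n = 𝟙 (K.trP n)
  incl_sq : ∀ n, K.incl n ≫ sq (n + 1) = sq n ≫ degeneracyMap K.F n (Fin.last n)

/-- The folding operator `Φ_{n+1} = □_{n+1} ∘ ev`, a natural map from `F_n` to itself. -/
noncomputable def folding (sq : ∀ n : ℕ, K.trP n ⟶ K.simp n) (n : ℕ) : K.simp n ⟶ K.simp n :=
  K.ev n ≫ sq n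

/-- `ev x *_q ev y = ev z` in `PC`. -/
def Composes (n q : ℕ) (C : NCOmegaCat.{u}) (x y z : (K.simp n).obj C) : Prop :=
  ∃ h : (K.P.obj C).d true q ((K.ev n).app C x).1 = (K.P.obj C).d false q ((K.ev n).app C y).1,
    (K.P.obj C).comp q ((K.ev n).app C x).1 ((K.ev n).app C y).1 h = ((K.ev n).app C z).1

/-- Regular cuts. The degrees of sources, targets and compositions are those of the omega-category
`PC`, which are one less than the corresponding degrees in `C`. -/
structure IsRegular : Prop where
  /-- `F_{-1}(C)` depends only on `C_0`. -/
  point : ∃ G : Type u ⥤ Type u,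
    K.F ⋙ SimplicialObject.Augmented.point = NCOmegaCat.zeroCells ⋙ G
  /-- `F_0 = tr^0 P`, the identification being `ev_0`. -/
  ev_zero : ∀ C : NCOmegaCat.{u}, Function.Bijective ((K.ev 0).app C)
  /-- `ev ∘ ε_i = ev`. -/
  degeneracy_ev : ∀ (n : ℕ) (i : Fin (n + 1)),
    degeneracyMap K.F n i ≫ K.ev (n + 1) = K.ev n ≫ K.incl n
  /-- Existence and uniqueness of `μ.□`, for `μ` compatible with `□` and the evaluation maps. -/
  dot : ∀ (n : ℕ) (μ : K.simp n ⟶ K.simp (n + 1)) (sq : K.trP n ⟶ K.simp n),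
    sq ≫ K.ev n = 𝟙 (K.trP n) → sq ≫ μ ≫ K.ev (n + 1) = K.incl n →
      ∃! ν : K.trP (n + 1) ⟶ K.simp (n + 1),
        ν ≫ K.ev (n + 1) = 𝟙 (K.trP (n + 1)) ∧ K.incl n ≫ ν = sq ≫ μ
  /-- The last two faces of `□ u` evaluate to the source and the target of `u`. -/
  last_faces : ∀ sq, K.IsSquare sq → ∀ n : ℕ,
    ({sq (n + 1) ≫ faceMap K.F n (Fin.last n).castSucc ≫ K.ev n,
      sq (n + 1) ≫ faceMap K.F n (Fin.last (n + 1)) ≫ K.ev n} :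
        Set (K.trP (n + 1) ⟶ K.trP n)) =
      {Functor.whiskerLeft K.P (OmegaCat.trBd false n),
        Functor.whiskerLeft K.P (OmegaCat.trBd true n)}
  /-- If `ev ∂_i □ u = d_p^α u` for one `u` of dimension `n + 1` whose sources and targets in each
  lower degree are distinct, then `∂_i □ = ∂_i □ d_p^α`. -/
  faces : ∀ sq, K.IsSquare sq → ∀ (n : ℕ) (i : Fin (n + 2)) (p : ℕ) (α : Bool),
    (∃ (C : NCOmegaCat.{u}) (u : (K.trP (n + 1)).obj C), (K.P.obj C).dim u.1 = n + 1 ∧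
      (∀ q, q ≤ n → (K.P.obj C).d false q u.1 ≠ (K.P.obj C).d true q u.1) ∧
      ((sq (n + 1) ≫ faceMap K.F n i ≫ K.ev n).app C u).1 = (K.P.obj C).d α p u.1) →
    sq (n + 1) ≫ faceMap K.F n i =
      Functor.whiskerLeft K.P (OmegaCat.trD α p (n + 1)) ≫ sq (n + 1) ≫ faceMap K.F n i
  /-- The folding operators induce the identity on the reduced complex. -/
  folding_eq : ∀ sq, K.IsSquare sq → ∀ (n : ℕ) (C : NCOmegaCat.{u}) (c : K.Chains n C),
    K.toReduced n C (chainMap ((K.folding sq n).app C) c) = K.toReduced n C c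
  /-- If `ev x *_q ev y = ev z` then `x + y = z` in the reduced complex. -/
  add_eq : ∀ (n q : ℕ), q < n → ∀ (C : NCOmegaCat.{u}) (x y z : (K.simp n).obj C),
    K.Composes n q C x y z →
      K.toReduced n C (Finsupp.single x 1) + K.toReduced n C (Finsupp.single y 1) =
        K.toReduced n C (Finsupp.single z 1)
  /-- The thin elements that witness the preceding equality can be chosen functorially. -/
  add_eq_natural : ∀ (n q : ℕ), q < n →
    ∃ (τ : ∀ (C : NCOmegaCat.{u}) (x y z : (K.simp n).obj C), K.Composes n q C x y z →
        K.Chains n C)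
      (ρ : ∀ (C : NCOmegaCat.{u}) (x y z : (K.simp n).obj C), K.Composes n q C x y z →
        K.Chains (n + 1) C),
      (∀ C x y z h, τ C x y z h ∈ K.thin n C ∧ ρ C x y z h ∈ K.thin (n + 1) C ∧
        Finsupp.single x 1 + Finsupp.single y 1 - Finsupp.single z 1 =
          τ C x y z h + K.boundary n C (ρ C x y z h)) ∧
      ∀ (C D : NCOmegaCat.{u}) (f : C ⟶ D) x y z h h',
        τ D ((K.simp n).map f x) ((K.simp n).map f y) ((K.simp n).map f z) h' =
            chainMap ((K.simp n).map f) (τ C x y z h) ∧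
          ρ D ((K.simp n).map f x) ((K.simp n).map f y) ((K.simp n).map f z) h' =
            chainMap ((K.simp (n + 1)).map f) (ρ C x y z h)

end Cut

/-- The branching semi-globular cut: the branching semi-globular nerve, the negative semi-path
omega-category, and the evaluation of simplices at the top-dimensional face. -/
noncomputable def branchingSemiGlobularCut : Cut.{u} where
  F := NCOmegaCat.branchingNerveFunctor
  P := NCOmegaCat.semiPathFunctor
  ev n :=
    { app := fun C => TypeCat.ofHom fun x : OmegaFunctor (Simplex.omegaCat n) C.semiPath =>
        ⟨x (Simplex.top n), (OmegaFunctor.dim_le x _).trans (Simplex.dim_le n _)⟩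
      naturality := fun _ _ _ => rfl }

/-! The proof combines a Yoneda description of natural transformations, a linear description of
omega-functors from simplices to globes, and explicit thin simplices in universal situations.

Yoneda. Natural transformations from `tr^n P^-` to the `m`-simplices of the nerve are the
omega-functors from the `m`-simplex to the `n`-globe (`exists_natOf`, `natOf_injective`). The
universal element is the top cell of the globe, seen as an arrow of the suspension of the globe. An
element `u` of `P^-C` is only a formal composite of germs, so the suspension need not map to `C` in
a way that hits `u`. It does map to the extension of `C` by one new vertex, the arrows to which are
the branches of `C`. There `u` becomes the germ of a single arrow, and a retraction shows that
`P^-C` embeds in the semi-path omega-category of the extension. Naturality along the two functors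
then computes the transformation at `u`.

Linearity. A morphism of a globe is a table of nonnegative coefficients obeying the same boundary
equations as the morphisms of the simplex (`exists_tab_eq`). An omega-functor from a simplex to a
globe is thus given by nonnegative coefficients on faces (`GlobeRep`), and every omega-functor is of
this kind (`tab_functor`), because the simplex is generated by its faces (`cell_induction`).
Generation rests on a key on faces for which source faces precede a face and target faces follow it:
a face of minimal key can always be split off.

With coefficients, an omega-functor to the `n`-globe that preserves the top lifts uniquely to the
`(n+1)`-globe (`existsUnique_lift`): each face of codimension one must go to the side on which it
lies. This gives the operations `μ.□` and shows that the operators `□` are those of the explicit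
folding `psi`. The values of `psi` on the faces of the simplex can be read off its coefficients.

Folding and the reduced complex. It suffices to treat the identity of the `n`-simplex. It is
deformed by elementary moves, each realized by a thin simplex only two faces of which are not known
to be thin (`PosMap.moveE_null`). After finitely many moves it is straight at every vertex before
the last, and a straight map that preserves the top is the folding (`PosMap.Straight.functor_eq`).

Additivity. By the preceding point only folded simplices matter. Two foldings precomposed with
suitable degeneracies glue along a `q`-cell to a thin simplex whose full faces give `U + V = U *_q
V`, up to a composite of a proper face of one factor with the other factor; a second thin simplex
removes it (`add_sub_comp_mem_naturalNull`). All chains come from universal ones, so working with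
families of chains gives functoriality at the same time. -/

namespace OmegaCat

theorem comp_of_left_eq (A : OmegaCat.{u}) {n : ℕ} {x y : A} (h : A.d true n x = A.d false n y)
    (hx : x = A.d false n y) : A.comp n x y h = y := by
  subst hx
  exact A.source_comp n y h

theorem comp_of_right_eq (A : OmegaCat.{u}) {n : ℕ} {x y : A} (h : A.d true n x = A.d false n y)
    (hy : y = A.d true n x) : A.comp n x y h = x := by
  subst hy
  exact A.comp_target n x h

end OmegaCat

/-! ## Adjoining a terminal object along a branching module -/

/-- An omega-category under `PC` and over `C_0` in which `x` and `x *_0 y` are identified, and whose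
fibre over `s_0 x` is a point as soon as `x` has a right inverse for `*_0`. -/
structure BranchModule (C : NCOmegaCat.{u}) where
  /-- the omega-category of the branches -/
  cat : OmegaCat.{u}
  /-- the vertex at which a branch starts -/
  start : OmegaFunctor cat (OmegaCat.discrete (NCOmegaCat.zeroCells.obj C))
  /-- the branch of a path -/
  germ : OmegaFunctor C.path cat
  start_germ : ∀ x : C.path, (start (germ x)).1 = C.cat.d false 0 x.1
  germ_comp : ∀ x z : C.path, C.branchRel x z → germ x = germ z
  eq_germ : ∀ (x y : C.path) (h : C.cat.d true 0 x.1 = C.cat.d false 0 y.1),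
    C.cat.dim (C.cat.comp 0 x.1 y.1 h) = 0 → ∀ u : cat, (start u).1 = C.cat.d false 0 x.1 →
      u = germ x

namespace BranchModule

variable {C : NCOmegaCat.{u}} (M : BranchModule C)

/-- The elements of `C`, the branches, and a new vertex in which all branches end. -/
inductive Ext : Type u
  | base (x : C.cat) : Ext
  | arr (a : M.cat) : Ext
  | pt : Ext

open Classical in
/-- Composition of an element of `C` and a branch. -/
noncomputable def act (x : C.cat) (a : M.cat) : M.cat :=
  if h : 1 ≤ C.cat.dim x then M.germ ⟨x, h⟩ else a

theorem act_pos {x : C.cat} (h : 1 ≤ C.cat.dim x) (a : M.cat) : M.act x a = M.germ ⟨x, h⟩ :=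
  dif_pos h

theorem act_neg {x : C.cat} (h : ¬ 1 ≤ C.cat.dim x) (a : M.cat) : M.act x a = a := dif_neg h

theorem d_of_not {x : C.cat} (h : ¬ 1 ≤ C.cat.dim x) (α : Bool) (n : ℕ) : C.cat.d α n x = x :=
  (C.cat.dim_le_iff x n).1 (by omega) α

theorem act_start (a : M.cat) : M.act (M.start a).1 a = a :=
  M.act_neg (by rw [(M.start a).2]; omega) a

theorem start_act {x : C.cat} {a : M.cat} (h : C.cat.d true 0 x = (M.start a).1) :
    (M.start (M.act x a)).1 = C.cat.d false 0 x := by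
  by_cases hx : 1 ≤ C.cat.dim x
  · rw [M.act_pos hx]
    exact M.start_germ _
  · rw [M.act_neg hx, ← h, d_of_not hx, d_of_not hx]

theorem act_d (α : Bool) (n : ℕ) (x : C.cat) (a : M.cat) :
    M.act (C.cat.d α (n + 1) x) (M.cat.d α n a) = M.cat.d α n (M.act x a) := by
  by_cases hx : 1 ≤ C.cat.dim x
  · rw [M.act_pos hx, M.act_pos (C.one_le_dim_d α n x hx)]
    exact M.germ.map_d α n ⟨x, hx⟩
  · rw [d_of_not hx, M.act_neg hx, M.act_neg hx]

theorem start_d (α : Bool) (n : ℕ) (a : M.cat) : M.start (M.cat.d α n a) = M.start a :=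
  M.start.map_d α n a

theorem start_comp (n : ℕ) (a b : M.cat) (h : M.cat.d true n a = M.cat.d false n b) :
    M.start (M.cat.comp n a b h) = M.start a := by
  rw [← M.start_d false n, M.cat.d_source_comp, M.start_d]

/-- Both identification axioms of a branch module enter here. If `x`, `y` and the composite have
positive dimension, the two sides are germs that `germ_comp` identifies. If the composite collapses
to a vertex, it acts trivially while `x` still acts by its germ, and `eq_germ` says that no other
branch starts there. If `x` or `y` is a vertex, a unit law applies. -/
theorem act_comp (x y : C.cat) (h : C.cat.d true 0 x = C.cat.d false 0 y) (a : M.cat)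
    (ha : C.cat.d true 0 y = (M.start a).1) :
    M.act (C.cat.comp 0 x y h) a = M.act x (M.act y a) := by
  by_cases hx : 1 ≤ C.cat.dim x
  · rw [M.act_pos hx]
    by_cases hy : 1 ≤ C.cat.dim y
    · by_cases hz : 1 ≤ C.cat.dim (C.cat.comp 0 x y h)
      · rw [M.act_pos hz]
        exact (M.germ_comp ⟨x, hx⟩ ⟨_, hz⟩ ⟨⟨y, hy⟩, h, rfl⟩).symm
      · rw [M.act_neg hz]
        refine M.eq_germ ⟨x, hx⟩ ⟨y, hy⟩ h (Nat.lt_one_iff.1 (not_le.1 hz)) a ?_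
        rw [← ha]
        have e₁ := C.cat.d_target_comp 0 x y h
        have e₂ := C.cat.d_source_comp 0 x y h
        rw [d_of_not hz] at e₁ e₂
        rw [← e₁, e₂]
    · have hy' : y = C.cat.d true 0 x := by rw [h, d_of_not hy]
      subst hy'
      rw [C.cat.comp_target, M.act_pos hx]
  · have hx' : x = C.cat.d false 0 y := by rw [← h, d_of_not hx]
    subst hx'
    rw [C.cat.source_comp, M.act_neg hx]

/-- Since `C` is non-contracting, positive dimension is inherited by the faces of degree `n + 1`,
and these two elements share one. So either both act through their germs, and `germ` is an
omega-functor, or both are vertices and act trivially. -/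
theorem act_comp_comp (n : ℕ) (x y : C.cat) (h : C.cat.d true (n + 1) x = C.cat.d false (n + 1) y)
    (a b : M.cat) (hab : M.cat.d true n a = M.cat.d false n b)
    (h' : M.cat.d true n (M.act x a) = M.cat.d false n (M.act y b)) :
    M.act (C.cat.comp (n + 1) x y h) (M.cat.comp n a b hab) =
      M.cat.comp n (M.act x a) (M.act y b) h' := by
  by_cases hx : 1 ≤ C.cat.dim x
  · have hy : 1 ≤ C.cat.dim y := by
      by_contra hy
      have := C.one_le_dim_d true n x hx
      rw [h, d_of_not hy] at this
      exact hy this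
    rw [M.act_pos (C.one_le_dim_comp n x y h hx)]
    obtain ⟨k, e⟩ := M.germ.map_comp n ⟨x, hx⟩ ⟨y, hy⟩ (Subtype.ext h)
    exact e.trans (M.cat.comp_congr (M.act_pos hx a).symm (M.act_pos hy b).symm _ _)
  · have hy : ¬ 1 ≤ C.cat.dim y := by
      intro hy
      have := C.one_le_dim_d false n y hy
      rw [← h, d_of_not hx] at this
      exact hx this
    have hxy : x = C.cat.d false (n + 1) y := by rw [← h, d_of_not hx]
    subst hxy
    rw [C.cat.source_comp, M.act_neg hy]
    exact M.cat.comp_congr (M.act_neg hx a).symm (M.act_neg hy b).symm _ _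

/-- Faces in the extension. -/
def extD (α : Bool) : ℕ → M.Ext → M.Ext
  | n, .base x => .base (C.cat.d α n x)
  | 0, .arr a => if α then .pt else .base (M.start a).1
  | n + 1, .arr a => .arr (M.cat.d α n a)
  | _, .pt => .pt

/-- Compositions in the extension. -/
noncomputable def extComp : ∀ (n : ℕ) (x y : M.Ext), M.extD true n x = M.extD false n y → M.Ext
  | n, .base x, .base y, h => .base (C.cat.comp n x y (by simpa [extD] using h))
  | 0, .base x, .arr a, _ => .arr (M.act x a)
  -- Apart from `.pt` composed with itself, the clauses with value `.pt` have contradictory matching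
  -- faces; the value is a filler.
  | _ + 1, .base _, .arr _, _ => .pt
  | _, .base _, .pt, _ => .pt
  | _, .arr _, .base _, _ => .pt
  | 0, .arr a, .pt, _ => .arr a
  | _ + 1, .arr _, .pt, _ => .pt
  | 0, .arr _, .arr _, _ => .pt
  | n + 1, .arr a, .arr b, h => .arr (M.cat.comp n a b (by simpa [extD] using h))
  | _, .pt, _, _ => .pt

theorem d_start (α : Bool) (n : ℕ) (a : M.cat) : C.cat.d α n (M.start a).1 = (M.start a).1 :=
  d_of_not (by rw [(M.start a).2]; omega) α n

theorem extD_base (α : Bool) (n : ℕ) (x : C.cat) :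
    M.extD α n (.base x) = .base (C.cat.d α n x) := by cases n <;> rfl

theorem extD_pt (α : Bool) (n : ℕ) : M.extD α n .pt = .pt := by cases n <;> rfl

theorem extComp_base (n : ℕ) (x y : C.cat) (h : M.extD true n (.base x) = M.extD false n (.base y))
    (h' : C.cat.d true n x = C.cat.d false n y) :
    M.extComp n (.base x) (.base y) h = .base (C.cat.comp n x y h') := by cases n <;> rfl

theorem extComp_pt (n : ℕ) (x : M.Ext) (h : M.extD true n .pt = M.extD false n x) :
    M.extComp n .pt x h = .pt := by cases n <;> cases x <;> rfl

/-- The extension of `C` by a new vertex, the morphisms to it being the branches. -/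
noncomputable def extCat : OmegaCat.{u} where
  Carrier := M.Ext
  d α n x := M.extD α n x
  comp := M.extComp
  d_d_lt α β m n x h := by
    obtain _ | n := n
    · omega
    · cases m <;> cases x <;> simp [extD]
      · exact C.cat.d_d_lt _ _ _ _ _ h
      · cases β <;> simp [M.start_d]
      · exact C.cat.d_d_lt _ _ _ _ _ h
      · exact M.cat.d_d_lt _ _ _ _ _ (by omega)
  d_d_ge α β m n x h := by
    cases x with
    | base x => rw [extD_base, extD_base, C.cat.d_d_ge _ _ _ _ _ h]
    | pt => rw [extD_pt, extD_pt]
    | arr a =>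
      cases n with
      | zero => cases α <;> cases m <;> simp [extD, d_start]
      | succ n =>
        obtain _ | m := m
        · omega
        · simp only [extD]
          rw [M.cat.d_d_ge _ _ _ _ _ (by omega)]
  source_comp n x h := by
    cases x with
    | base x =>
      exact (M.extComp_base n _ _ _ (C.cat.d_d_ge _ _ _ _ _ le_rfl)).trans
        (congrArg _ (C.cat.source_comp _ _ _))
    | pt => simp only [extD_pt, extComp_pt]
    | arr a =>
      cases n
      · simp [extD, extComp, act_start]
      · simp [extD, extComp, M.cat.source_comp]
  comp_target n x h := by
    cases x with
    | base x =>
      exact (M.extComp_base n _ _ _ (C.cat.d_d_ge _ _ _ _ _ le_rfl).symm).trans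
        (congrArg _ (C.cat.comp_target _ _ _))
    | pt => simp only [extComp_pt]
    | arr a =>
      cases n
      · simp [extD, extComp]
      · simp [extD, extComp, M.cat.comp_target]
  d_source_comp n x y h := by
    cases x <;> cases y <;> cases n <;> simp [extD, extComp] at h ⊢
    · exact C.cat.d_source_comp _ _ _ _
    · exact C.cat.d_source_comp _ _ _ _
    · exact M.start_act h
    · exact M.cat.d_source_comp _ _ _ _
  d_target_comp n x y h := by
    cases x <;> cases y <;> cases n <;> simp [extD, extComp] at h ⊢
    · exact C.cat.d_target_comp _ _ _ _
    · exact C.cat.d_target_comp _ _ _ _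
    · exact M.cat.d_target_comp _ _ _ _
  d_comp α m n x y h hmn := by
    cases x <;> cases y <;> cases n <;> simp [extD] at h
    · obtain ⟨h', e⟩ := C.cat.d_comp α m 0 _ _ h hmn
      exact ⟨by simp only [extD_base]; rw [h'], by simp only [extD_base, M.extComp_base _ _ _ _ h, M.extComp_base _ _ _ _ h', e]⟩
    · obtain ⟨h', e⟩ := C.cat.d_comp α m _ _ _ h hmn
      exact ⟨by simp only [extD_base]; rw [h'], by simp only [extD_base, M.extComp_base _ _ _ _ h, M.extComp_base _ _ _ _ h', e]⟩
    · obtain _ | m := m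
      · omega
      simp [extD, extComp, act_d, M.start_d, C.cat.d_d_lt, h]
    · cases m with
      | zero =>
        rename_i a b n _
        cases α
        · have e : M.start a = M.start b := by rw [← M.start_d true n, h, M.start_d]
          have h' : C.cat.d true (n + 1) (M.start a).1 = C.cat.d false (n + 1) (M.start b).1 := by
            rw [d_start, d_start, e]
          refine ⟨by simpa [extD] using h', ?_⟩
          refine (congrArg Ext.base ?_).trans (M.extComp_base _ _ _ _ h').symm
          rw [M.start_comp, C.cat.comp_of_left_eq h' (by rw [d_start, e]), e]
        · exact ⟨rfl, rfl⟩
      | succ m =>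
        obtain ⟨h', e⟩ := M.cat.d_comp α m _ _ _ h (by omega)
        exact ⟨congrArg Ext.arr h', congrArg Ext.arr e⟩
    · obtain _ | m := m
      · omega
      exact ⟨rfl, rfl⟩
    · exact ⟨by simp only [extD_pt], by simp only [extD_pt, extComp_pt]⟩
    · exact ⟨by simp only [extD_pt], by simp only [extD_pt, extComp_pt]⟩
  assoc n x y z hxy hyz h₁ h₂ := by
    cases x <;> cases y <;> cases z <;> cases n <;> simp [extD] at hxy hyz
    · simp only [extComp]; rw [C.cat.assoc]
    · simp only [extComp]; rw [C.cat.assoc]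
    · simp only [extComp]; rw [M.act_comp _ _ _ _ hyz]
    · rfl
    · simp only [extComp]; rw [M.cat.assoc]
    · rfl
    · rfl
    · rfl
  exchange m n x y z w hmn hxy hzw hxz hyw h₁ h₂ := by
    cases m <;> cases n <;> first | omega | skip
    all_goals cases x <;> cases y <;> simp [extD] at hxy
    all_goals cases z <;> simp [extD] at hxz
    all_goals cases w <;> simp [extD] at hyw hzw
    · exact congrArg Ext.base (C.cat.exchange _ _ _ _ _ _ hmn _ _ _ _ _ _)
    -- The mixed case: exchange of `*_0` with a higher composition, for two elements of `C` acting
    -- on two branches.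
    · exact congrArg Ext.arr (M.act_comp_comp _ _ _ hxy _ _ hzw _)
    · rfl
    · rfl
    · exact congrArg Ext.base (C.cat.exchange _ _ _ _ _ _ hmn _ _ _ _ _ _)
    · exact (congrArg Ext.arr (M.act_comp_comp _ _ _ hxz _ _ hyw _)).symm
    · rfl
    · rfl
    · exact congrArg Ext.base (C.cat.exchange _ _ _ _ _ _ hmn _ _ _ _ _ _)
    · exact congrArg Ext.arr (M.cat.exchange _ _ _ _ _ _ (by omega) _ _ _ _ _ _)
    · rfl
  finite_dim x := by
    cases x with
    | base x =>
      obtain ⟨n, h₁, h₂⟩ := C.cat.finite_dim x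
      exact ⟨n, by rw [extD_base, h₁], by rw [extD_base, h₂]⟩
    | pt => exact ⟨0, rfl, rfl⟩
    | arr x =>
      obtain ⟨n, h₁, h₂⟩ := M.cat.finite_dim x
      exact ⟨n + 1, congrArg Ext.arr h₁, congrArg Ext.arr h₂⟩
end BranchModule

/-! ### Sums -/

namespace OmegaCat

/-- The disjoint union of an omega-category and a set. -/
noncomputable def addPoints (A : OmegaCat.{u}) (S : Type u) : OmegaCat.{u} where
  Carrier := A.Carrier ⊕ S
  d α n := Sum.map (A.d α n) id
  comp n
    | .inl x, .inl y, h => .inl (A.comp n x y (Sum.inl.inj h))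
    | .inl x, .inr _, _ => .inl x
    | .inr s, _, _ => .inr s
  d_d_lt α β m n x h := by
    cases x <;> simp [A.d_d_lt _ _ _ _ _ h]
  d_d_ge α β m n x h := by
    cases x <;> simp [A.d_d_ge _ _ _ _ _ h]
  source_comp n x h := by
    cases x <;> simp [A.source_comp]
  comp_target n x h := by
    cases x <;> simp [A.comp_target]
  d_source_comp n x y h := by
    cases x <;> cases y <;> simp at h ⊢
    exact A.d_source_comp _ _ _ _
  d_target_comp n x y h := by
    cases x <;> cases y <;> simp at h ⊢
    · exact A.d_target_comp _ _ _ _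
    · exact h
  d_comp α m n x y h hmn := by
    cases x <;> cases y <;> simp at h ⊢
    · exact A.d_comp _ _ _ _ _ h hmn
    · exact h
  assoc n x y z hxy hyz _ _ := by
    cases x <;> cases y <;> cases z <;> simp at hxy hyz ⊢
    exact A.assoc _ _ _ _ _ _ _ _
  exchange m n x y z w hmn hxy hzw hxz hyw _ _ := by
    cases x <;> cases y <;> cases z <;> cases w <;> simp at hxy hzw hxz hyw ⊢
    exact A.exchange _ _ _ _ _ _ hmn _ _ _ _ _ _
  finite_dim x := by
    cases x with
    | inl x =>
      obtain ⟨n, h₁, h₂⟩ := A.finite_dim x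
      exact ⟨n, congrArg Sum.inl h₁, congrArg Sum.inl h₂⟩
    | inr s => exact ⟨0, rfl, rfl⟩

/-- The inclusion of an omega-category in its union with a set. -/
noncomputable def toAddPoints (A : OmegaCat.{u}) (S : Type u) :
    OmegaFunctor A (A.addPoints S) where
  toFun := Sum.inl
  map_d _ _ _ := rfl
  map_comp _ _ _ h := ⟨congrArg Sum.inl h, rfl⟩

/-- Extending a functor to a discrete omega-category to a union with a set. -/
noncomputable def addPointsDesc {A : OmegaCat.{u}} {S T : Type u}
    (f : OmegaFunctor A (discrete T)) (g : S → T) : OmegaFunctor (A.addPoints S) (discrete T) where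
  toFun := Sum.elim f g
  map_d α n x := by
    cases x
    · exact f.map_d _ _ _
    · rfl
  map_comp n x y h := by
    cases x <;> cases y <;> simp [addPoints] at h
    · exact f.map_comp _ _ _ h
    · exact ⟨congrArg g h, rfl⟩

end OmegaCat

/-! ### The extension as a non-contracting omega-category, and its retraction onto branches -/

namespace BranchModule

variable {C : NCOmegaCat.{u}} (M : BranchModule C)

theorem dim_base (x : C.cat) : M.extCat.dim (.base x) = C.cat.dim x := by
  refine le_antisymm ((M.extCat.dim_le_iff _ _).2 fun α => ?_) ((C.cat.dim_le_iff _ _).2 fun α => ?_)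
  · exact (M.extD_base _ _ _).trans (congrArg _ ((C.cat.dim_le_iff _ _).1 le_rfl α))
  · have := (M.extCat.dim_le_iff (.base x) _).1 le_rfl α
    exact Ext.base.inj ((M.extD_base _ _ _).symm.trans this)

theorem dim_pt : M.extCat.dim .pt = 0 :=
  Nat.le_zero.1 ((M.extCat.dim_le_iff _ _).2 fun α => M.extD_pt α 0)

theorem one_le_dim_arr (a : M.cat) : 1 ≤ M.extCat.dim (.arr a) := by
  by_contra h
  have := (M.extCat.dim_le_iff (.arr a) 0).1 (by omega) true
  cases this

theorem dim_arr_d (α : Bool) (a : M.cat) : M.extCat.dim (.arr (M.cat.d α 0 a)) = 1 :=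
  le_antisymm ((M.extCat.dim_le_iff _ _).2 fun _ =>
    congrArg Ext.arr (M.cat.d_d_ge _ _ _ _ _ le_rfl)) (M.one_le_dim_arr _)

/-- The extension as a non-contracting omega-category. -/
noncomputable def ext : NCOmegaCat.{u} where
  cat := M.extCat
  nonContracting x hx := by
    cases x with
    | base x =>
      rw [M.dim_base] at hx
      exact ⟨(M.dim_base _).trans (C.nonContracting x hx).1,
        (M.dim_base _).trans (C.nonContracting x hx).2⟩
    | arr a => exact ⟨M.dim_arr_d _ a, M.dim_arr_d _ a⟩
    | pt =>
      rw [M.dim_pt] at hx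
      omega

/-- The inclusion of `C` in its extension. -/
noncomputable def toExt : C ⟶ M.ext :=
  NCOmegaFunctor.mk
    { toFun := Ext.base
      map_d := fun α n x => (M.extD_base α n x).symm
      map_comp := fun n x y h =>
        have h' : M.extD true n (.base x) = M.extD false n (.base y) := by
          rw [extD_base, extD_base, h]
        ⟨h', (M.extComp_base n x y h' h).symm⟩ }
    (fun x hx => (M.dim_base x).trans hx)

/-- A branch as an element of the path omega-category of the extension. -/
noncomputable def arrPath (a : M.cat) : M.ext.path := ⟨.arr a, M.one_le_dim_arr a⟩

theorem path_cases {p : M.ext.path → Prop}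
    (base : ∀ x : C.path, p (NCOmegaCat.pathMap M.toExt x)) (arr : ∀ a, p (M.arrPath a)) (x) : p x := by
  obtain ⟨x, hx⟩ := x
  cases x with
  | base x => exact base ⟨x, hx.trans (M.dim_base x).le⟩
  | arr a => exact arr a
  | pt => exact absurd (hx.trans (M.dim_pt).le) (by omega)

/-- The branch of an element of the path omega-category of the extension. -/
noncomputable def pathBranch : OmegaFunctor M.ext.path M.cat where
  toFun x := match x with
    | ⟨.base x, hx⟩ => M.germ ⟨x, hx.trans (M.dim_base x).le⟩
    | ⟨.arr a, _⟩ => a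
    | ⟨.pt, hx⟩ => absurd (hx.trans (M.dim_pt).le) (by omega)
  map_d α n x := by
    induction x using M.path_cases with
    | base x => exact M.germ.map_d α n x
    | arr a => rfl
  map_comp n x y := by
    induction x using M.path_cases <;> induction y using M.path_cases
    · rename_i x y
      intro h
      exact M.germ.map_comp n x y (Subtype.ext (Ext.base.inj (congrArg Subtype.val h)))
    · intro h
      cases congrArg Subtype.val h
    · intro h
      cases congrArg Subtype.val h
    · intro h
      exact ⟨Ext.arr.inj (congrArg Subtype.val h), rfl⟩

/-- Nothing of positive dimension can follow an arrow to the new vertex, so a generating relation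
starts from some `x` in `C`. It prolongs `x` inside `C`, which is `germ_comp`, or by an arrow `b`,
and then the composite is the arrow of `act x b`, the germ of `x`. -/
theorem pathBranch_eq (x z : M.ext.path) (h : M.ext.branchRel x z) :
    M.pathBranch x = M.pathBranch z := by
  obtain ⟨y, h, e⟩ := h
  revert h e
  induction x using M.path_cases <;> induction y using M.path_cases <;>
    induction z using M.path_cases <;> intro h e
  · rename_i x y z
    exact M.germ_comp _ _ ⟨y, Ext.base.inj h, Ext.base.inj e⟩
  · cases e
  · cases e
  · rename_i b _
    exact (M.act_pos _ b).symm.trans (Ext.arr.inj e)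
  · cases h
  · cases h
  · cases h
  · cases h

/-- The branch of a germ of the extension. -/
noncomputable def branch : OmegaFunctor M.ext.semiPath M.cat :=
  OmegaCat.quotLift M.pathBranch (M.ext.eq_of_branchEqv _ M.pathBranch_eq)

theorem branch_germ (x : M.ext.path) : M.branch (M.ext.germ x) = M.pathBranch x :=
  OmegaCat.quotLift_toQuot _ _ x

end BranchModule

/-! ## Globes -/

/-- A morphism of the `n`-globe: its dimension, and whether it is on the source or on the target
side; the top-dimensional morphism is on the source side. -/
@[ext]
structure GlobeCell (n : ℕ) : Type u where
  /-- the dimension -/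
  dim : ℕ
  /-- the side -/
  side : Bool
  le : dim ≤ n
  side_top : dim = n → side = false

namespace GlobeCell

variable {n : ℕ}

/-- The `k`-source and `k`-target. -/
def d (α : Bool) (k : ℕ) (x : GlobeCell.{u} n) : GlobeCell.{u} n :=
  if h : k < x.dim then ⟨k, α, h.le.trans x.le, fun e => absurd x.le (by omega)⟩ else x

theorem d_of_lt (α : Bool) {k : ℕ} {x : GlobeCell.{u} n} (h : k < x.dim) :
    x.d α k = ⟨k, α, h.le.trans x.le, fun e => absurd x.le (by omega)⟩ := dif_pos h

theorem d_of_ge (α : Bool) {k : ℕ} {x : GlobeCell.{u} n} (h : x.dim ≤ k) : x.d α k = x :=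
  dif_neg (by omega)

theorem dim_d (α : Bool) (k : ℕ) (x : GlobeCell.{u} n) : (x.d α k).dim = min k x.dim := by
  rcases lt_or_ge k x.dim with h | h
  · rw [d_of_lt α h, min_eq_left h.le]
  · rw [d_of_ge α h, min_eq_right h]

theorem d_d_lt (α β : Bool) (k l : ℕ) (x : GlobeCell.{u} n) (h : k < l) :
    (x.d α l).d β k = x.d β k := by
  rcases lt_or_ge l x.dim with h' | h'
  · rw [d_of_lt α h', d_of_lt β h, d_of_lt β (h.trans h')]
  · rw [d_of_ge α h']

theorem d_d_ge (α β : Bool) (k l : ℕ) (x : GlobeCell.{u} n) (h : l ≤ k) :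
    (x.d α l).d β k = x.d α l :=
  d_of_ge β (by rw [dim_d]; omega)

/-- Of two composable morphisms one is a unit. -/
theorem unit_of_match {k : ℕ} {x y : GlobeCell.{u} n} (h : x.d true k = y.d false k) :
    (x.dim ≤ k ∧ x = y.d false k) ∨ (k < x.dim ∧ y.dim ≤ k ∧ y = x.d true k) := by
  rcases lt_or_ge k x.dim with hx | hx
  · rcases lt_or_ge k y.dim with hy | hy
    · rw [d_of_lt _ hx, d_of_lt _ hy] at h
      cases congrArg side h
    · rw [d_of_ge _ hy] at h
      exact Or.inr ⟨hx, hy, h.symm⟩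
  · rw [d_of_ge _ hx] at h
    exact Or.inl ⟨hx, h⟩

/-- The composition of two morphisms, one of which is a unit. -/
def comp (k : ℕ) (x y : GlobeCell.{u} n) : GlobeCell.{u} n := if x.dim ≤ k then y else x

theorem comp_left {k : ℕ} {x : GlobeCell.{u} n} (h : x.dim ≤ k) (y : GlobeCell.{u} n) :
    comp k x y = y := if_pos h

theorem comp_right {k : ℕ} {x : GlobeCell.{u} n} (h : k < x.dim) (y : GlobeCell.{u} n) :
    comp k x y = x := if_neg (by omega)

end GlobeCell

/-- The `n`-globe. -/
def Globe (n : ℕ) : OmegaCat.{u} where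
  Carrier := GlobeCell.{u} n
  d α k x := x.d α k
  comp k x y _ := GlobeCell.comp k x y
  d_d_lt α β k l x h := GlobeCell.d_d_lt α β k l x h
  d_d_ge α β k l x h := GlobeCell.d_d_ge α β k l x h
  source_comp k x h := GlobeCell.comp_left (by rw [GlobeCell.dim_d]; omega) x
  comp_target k x h := by
    rcases lt_or_ge k x.dim with h | h
    · exact GlobeCell.comp_right h _
    · rw [GlobeCell.comp_left h, GlobeCell.d_of_ge _ h]
  d_source_comp k x y h := by
    rcases GlobeCell.unit_of_match h with ⟨h₁, e⟩ | ⟨h₁, h₂, e⟩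
    · rw [GlobeCell.comp_left h₁, ← e, GlobeCell.d_of_ge _ h₁]
    · rw [GlobeCell.comp_right h₁]
  d_target_comp k x y h := by
    rcases GlobeCell.unit_of_match h with ⟨h₁, e⟩ | ⟨h₁, h₂, e⟩
    · rw [GlobeCell.comp_left h₁]
    · rw [GlobeCell.comp_right h₁, h, GlobeCell.d_of_ge _ h₂, GlobeCell.d_of_ge _ h₂]
  d_comp α m k x y h hmk := by
    rcases lt_or_gt_of_ne hmk with hlt | hlt
    · have e : x.d α m = y.d α m := by
        rw [← GlobeCell.d_d_lt true α m k x hlt, h, GlobeCell.d_d_lt false α m k y hlt]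
      have hx : (x.d α m).dim ≤ k := by rw [GlobeCell.dim_d]; omega
      refine ⟨by rw [e, ← e, GlobeCell.d_of_ge _ hx, GlobeCell.d_of_ge _ hx], ?_⟩
      rw [GlobeCell.comp_left hx]
      unfold GlobeCell.comp
      split_ifs
      · rfl
      · exact e
    · refine ⟨by rw [GlobeCell.d_d_lt _ _ _ _ _ hlt, h, GlobeCell.d_d_lt _ _ _ _ _ hlt], ?_⟩
      unfold GlobeCell.comp
      rw [GlobeCell.dim_d]
      split_ifs <;> first | rfl | omega
  assoc k x y z hxy hyz _ _ := by
    unfold GlobeCell.comp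
    split_ifs <;> rfl
  exchange m k x y z w hmk hxy hzw hxz hyw _ _ := by
    have h₁ := GlobeCell.unit_of_match hxy
    have h₂ := GlobeCell.unit_of_match hzw
    have h₃ := GlobeCell.unit_of_match hxz
    have h₄ := GlobeCell.unit_of_match hyw
    unfold GlobeCell.comp
    -- Each side selects one of the four cells; wherever the selections differ, the unit conditions
    -- contradict each other.
    split_ifs <;> first | rfl | (exfalso; grind [GlobeCell.dim_d])
  finite_dim x := ⟨x.dim, GlobeCell.d_of_ge _ le_rfl, GlobeCell.d_of_ge _ le_rfl⟩

namespace Globe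

/-- The top-dimensional morphism of the globe. -/
def top (n : ℕ) : Globe.{u} n := ⟨n, false, le_rfl, fun _ => rfl⟩

theorem dim_eq {n : ℕ} (x : Globe.{u} n) : (Globe n).dim x = GlobeCell.dim x := by
  refine le_antisymm (((Globe n).dim_le_iff _ _).2 fun α => GlobeCell.d_of_ge α le_rfl) ?_
  have h := ((Globe n).dim_le_iff x _).1 le_rfl false
  have := GlobeCell.dim_d false ((Globe n).dim x) x
  rw [show GlobeCell.d false ((Globe n).dim x) x = x from h] at this
  omega

theorem dim_le {n : ℕ} (x : Globe.{u} n) : (Globe n).dim x ≤ n :=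
  (dim_eq x).trans_le (GlobeCell.le x)

/-- The face of a morphism that corresponds to a morphism of the globe. -/
def face {n : ℕ} {E : OmegaCat.{v}} (u : E) (x : GlobeCell.{u} n) : E := E.d x.side x.dim u

theorem face_d {n : ℕ} {E : OmegaCat.{v}} (u : E) (α : Bool) (k : ℕ) (x : GlobeCell.{u} n) :
    face u (x.d α k) = E.d α k (face u x) := by
  unfold face
  rcases lt_or_ge k x.dim with h | h
  · rw [GlobeCell.d_of_lt α h, E.d_d_lt _ _ _ _ _ h]
  · rw [GlobeCell.d_of_ge α h, E.d_d_ge _ _ _ _ _ h]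

theorem face_comp {n : ℕ} {E : OmegaCat.{v}} (u : E) (k : ℕ) (x y : GlobeCell.{u} n)
    (h : x.d true k = y.d false k) (h' : E.d true k (face u x) = E.d false k (face u y)) :
    face u (GlobeCell.comp k x y) = E.comp k (face u x) (face u y) h' := by
  have e : ∀ x : GlobeCell.{u} n, x.dim ≤ k → ∀ α, E.d α k (face u x) = face u x :=
    fun x hx α => E.d_d_ge _ _ _ _ _ hx
  rcases GlobeCell.unit_of_match h with ⟨h₁, _⟩ | ⟨h₁, h₂, _⟩
  · rw [GlobeCell.comp_left h₁]
    exact (E.comp_of_left_eq h' ((e x h₁ true).symm.trans h')).symm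
  · rw [GlobeCell.comp_right h₁]
    exact (E.comp_of_right_eq h' ((e y h₂ false).symm.trans h'.symm)).symm

/-- The omega-functor from the globe that classifies a morphism. -/
def desc {n : ℕ} {E : OmegaCat.{v}} (u : E) : OmegaFunctor (Globe.{u} n) E where
  toFun x := face u x
  map_d α k x := face_d u α k x
  map_comp k x y h :=
    have h' : E.d true k (face u x) = E.d false k (face u y) :=
      (face_d u true k x).symm.trans ((congrArg (face u) h).trans (face_d u false k y))
    ⟨h', face_comp u k x y h h'⟩

theorem desc_top {n : ℕ} {E : OmegaCat.{v}} (u : E) (hu : E.dim u ≤ n) :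
    desc.{u} u (top n) = u := (E.dim_le_iff _ _).1 hu _

/-- The top cell classifies the identity. With `map_desc` this is the Yoneda argument for globes. -/
theorem desc_self (n : ℕ) (x : Globe.{u} n) : desc (top n) x = x := by
  rcases lt_or_ge (GlobeCell.dim x) n with h | h
  · exact GlobeCell.d_of_lt _ h
  · have e := le_antisymm (GlobeCell.le x) h
    refine (GlobeCell.d_of_ge _ h).trans (GlobeCell.ext e.symm (GlobeCell.side_top x e).symm)

theorem map_desc {n : ℕ} {E : OmegaCat.{v}} {F : OmegaCat.{w}} (f : OmegaFunctor E F) (u : E)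
    (x : Globe.{u} n) : f (desc u x) = desc (f u) x := f.map_d _ _ _

end Globe

namespace OmegaCat

/-- Induction on the elements of a quotient. -/
theorem quot_induction {A : OmegaCat.{u}} {r : A → A → Prop} {p : A.quot r → Prop}
    (of : ∀ x, p (A.toQuot r x)) (d : ∀ α n x, p x → p ((A.quot r).d α n x))
    (comp : ∀ n x y h, p x → p y → p ((A.quot r).comp n x y h)) (x : A.quot r) : p x := by
  obtain ⟨a, ha, rfl⟩ := exists_rep x
  induction a with
  | of x => exact of x
  | d α n a iha => exact d α n _ (iha ha.parts.1)
  | comp n a b iha ihb =>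
    obtain ⟨ha', hb', hm⟩ := ha.parts.1
    have hm' : (A.quot r).d true n (qmk a ha') = (A.quot r).d false n (qmk b hb') := qmk_eq_iff.2 hm
    exact (qcomp_mk n a b ha' hb' hm') ▸ comp n _ _ hm' (iha ha') (ihb hb')

end OmegaCat

/-! ### The module of the branches of an omega-category -/

namespace NCOmegaCat

variable (C : NCOmegaCat.{u})

theorem germ_eq_of_branchRel (x z : C.path) (h : C.branchRel x z) : C.germ x = C.germ z :=
  OmegaCat.toQuot_rel C.path _ _ _ (.rel _ _ h)

/-- Since `x *_0 y` is the unit at the start of `z`, associativity gives `z = x *_0 (y *_0 z)`.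
Hence `z` prolongs `x` and has the same germ, unless `y *_0 z` is a vertex, and then `z = x`. -/
theorem germ_eq_of_inverse (x y : C.path) (h : C.cat.d true 0 x.1 = C.cat.d false 0 y.1)
    (hxy : C.cat.dim (C.cat.comp 0 x.1 y.1 h) = 0) (z : C.path)
    (hz : C.cat.d false 0 z.1 = C.cat.d false 0 x.1) : C.germ z = C.germ x := by
  have e := (C.cat.dim_le_iff _ 0).1 hxy.le
  have e₁ : C.cat.comp 0 x.1 y.1 h = C.cat.d false 0 z.1 := by
    rw [← e false, C.cat.d_source_comp, hz]
  have e₂ : C.cat.d true 0 y.1 = C.cat.d false 0 z.1 := by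
    rw [← e₁, ← e true, C.cat.d_target_comp]
  have h₁ : C.cat.d true 0 (C.cat.comp 0 x.1 y.1 h) = C.cat.d false 0 z.1 := by
    rw [C.cat.d_target_comp, e₂]
  have h₂ : C.cat.d true 0 x.1 = C.cat.d false 0 (C.cat.comp 0 y.1 z.1 e₂) := by
    rw [C.cat.d_source_comp, h]
  have e₃ := C.cat.assoc 0 x.1 y.1 z.1 h e₂ h₁ h₂
  rw [C.cat.comp_of_left_eq h₁ e₁] at e₃
  by_cases hd : 1 ≤ C.cat.dim (C.cat.comp 0 y.1 z.1 e₂)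
  · exact (C.germ_eq_of_branchRel x z ⟨⟨_, hd⟩, h₂, e₃.symm⟩).symm
  · rw [C.cat.comp_of_right_eq h₂] at e₃
    · exact congrArg C.germ (Subtype.ext e₃)
    · rw [h₂, (C.cat.dim_le_iff _ 0).1 (by omega)]

theorem semiPathStart_germ_val (x : C.path) :
    (C.semiPathStart (C.germ x)).1 = C.cat.d false 0 x.1 :=
  congrArg Subtype.val (C.semiPathStart_germ x)

/-- All generators over this vertex equal `germ x` by `germ_eq_of_inverse`, which is therefore fixed
by every source and target. The operations of the quotient preserve the starting vertex, so nothing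
else arises over it. -/
theorem eq_germ_of_inverse (x y : C.path) (h : C.cat.d true 0 x.1 = C.cat.d false 0 y.1)
    (hxy : C.cat.dim (C.cat.comp 0 x.1 y.1 h) = 0) (u : C.semiPath)
    (hu : (C.semiPathStart u).1 = C.cat.d false 0 x.1) : u = C.germ x := by
  have hd : ∀ α n, C.semiPath.d α n (C.germ x) = C.germ x := fun α n => by
    rw [← C.germ.map_d]
    exact C.germ_eq_of_inverse x y h hxy _ (C.cat.d_d_lt α false 0 (n + 1) x.1 (Nat.succ_pos n))
  induction u using OmegaCat.quot_induction with
  | of z => exact C.germ_eq_of_inverse x y h hxy z ((C.semiPathStart_germ_val z).symm.trans hu)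
  | d α n u ih =>
    have := ih ((congrArg Subtype.val (C.semiPathStart.map_d α n u)).symm.trans hu)
    exact (congrArg (C.semiPath.d α n) this).trans (hd α n)
  | comp n a b h ha hb =>
    obtain ⟨h', e⟩ := C.semiPathStart.map_comp n a b h
    have ha' := ha ((congrArg Subtype.val e).symm.trans hu)
    have hb' := hb ((congrArg Subtype.val (e.trans h')).symm.trans hu)
    exact (C.semiPath.comp_congr ha' hb' h ((hd _ _).trans (hd _ _).symm)).trans
      (C.semiPath.comp_of_left_eq _ (hd _ _).symm)

/-- The vertices at which no branch starts. -/
def deadEnds : Type u := {b : zeroCells.obj C // ∀ u, C.semiPathStart u ≠ b}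

/-- The branches of `C`, with one more branch at each vertex where there was none. -/
noncomputable def branchModule : BranchModule C where
  -- Every vertex must start some branch: in `semiPathMap_toExt` each path of `C` is prolonged by an
  -- arrow that starts at its target.
  cat := C.semiPath.addPoints C.deadEnds
  start := OmegaCat.addPointsDesc C.semiPathStart Subtype.val
  germ := C.germ.trans (C.semiPath.toAddPoints _)
  start_germ x := C.semiPathStart_germ_val x
  germ_comp x z h := congrArg Sum.inl (C.germ_eq_of_branchRel x z h)
  eq_germ x y h hxy u hu := by
    cases u with
    | inl u => exact congrArg Sum.inl (C.eq_germ_of_inverse x y h hxy u hu)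
    | inr b => exact absurd (Subtype.ext ((C.semiPathStart_germ_val x).trans hu.symm)) (b.2 (C.germ x))

theorem exists_start_eq (b : zeroCells.obj C) : ∃ a, C.branchModule.start a = b := by
  by_cases h : ∀ u, C.semiPathStart u ≠ b
  · exact ⟨Sum.inr ⟨b, h⟩, rfl⟩
  · push Not at h
    obtain ⟨u, hu⟩ := h
    exact ⟨Sum.inl u, hu⟩

/-- The omega-category with one morphism. -/
noncomputable def point : NCOmegaCat.{u} where
  cat := OmegaCat.discrete PUnit
  nonContracting x hx := by
    have := ((OmegaCat.discrete PUnit.{u+1}).dim_le_iff x 0).2 fun _ => rfl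
    omega

theorem point_path_elim (x : point.{u}.path) : False := by
  have := ((OmegaCat.discrete PUnit.{u+1}).dim_le_iff x.1 0).2 fun _ => rfl
  have h := x.2
  exact absurd (h.trans this) (by omega)

end NCOmegaCat

/-! ### Suspensions and their functors to extensions -/

namespace BranchModule

/-- Any omega-category as branches over a point. -/
noncomputable def ofCat (E : OmegaCat.{u}) : BranchModule NCOmegaCat.point.{u} where
  cat := E
  start :=
    { toFun := fun _ => ⟨PUnit.unit,
        Nat.le_zero.1 ((OmegaCat.dim_le_iff (OmegaCat.discrete PUnit) _ 0).2 fun _ => rfl)⟩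
      map_d := fun _ _ _ => rfl
      map_comp := fun _ _ _ _ => ⟨rfl, rfl⟩ }
  germ :=
    { toFun := fun x => (NCOmegaCat.point_path_elim x).elim
      map_d := fun _ _ x => (NCOmegaCat.point_path_elim x).elim
      map_comp := fun _ x => (NCOmegaCat.point_path_elim x).elim }
  start_germ x := (NCOmegaCat.point_path_elim x).elim
  germ_comp x := (NCOmegaCat.point_path_elim x).elim
  eq_germ x := (NCOmegaCat.point_path_elim x).elim

variable {C : NCOmegaCat.{u}} (M : BranchModule C)

/-- The functor from a suspension to the extension given by branches with a common start. -/
noncomputable def ofCatExt {E : OmegaCat.{u}} (b : NCOmegaCat.zeroCells.obj C)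
    (f : OmegaFunctor E M.cat) (hf : ∀ a, M.start (f a) = b) : (ofCat E).ext ⟶ M.ext :=
  NCOmegaFunctor.mk
    { toFun := fun x => match x with
        | .base _ => .base b.1
        | .arr a => .arr (f a)
        | .pt => .pt
      map_d := fun α n x => by
        have hb : ∀ α n, C.cat.d α n b.1 = b.1 :=
          fun α n => d_of_not (by rw [b.2]; omega) α n
        cases x with
        | base x => exact (congrArg Ext.base (hb α n).symm).trans (M.extD_base α n b.1).symm
        | arr a =>
          cases n with
          | zero =>
            cases α
            · exact congrArg (fun b : NCOmegaCat.zeroCells.obj C => Ext.base b.1) (hf a).symm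
            · rfl
          | succ n => exact congrArg Ext.arr (f.map_d α n a)
        | pt => exact (M.extD_pt α n).symm
      map_comp := fun n x y h => by
        have hb : ∀ α n, C.cat.d α n b.1 = b.1 :=
          fun α n => d_of_not (by rw [b.2]; omega) α n
        have hb' : M.extD true n (.base b.1) = M.extD false n (.base b.1) := by
          rw [M.extD_base, M.extD_base, hb, hb]
        cases x <;> cases y <;> cases n <;> simp [ext, extCat, extD] at h
        · exact ⟨hb', congrArg Ext.base (C.cat.comp_of_left_eq _ (hb _ _).symm).symm⟩
        · exact ⟨hb', congrArg Ext.base (C.cat.comp_of_left_eq _ (hb _ _).symm).symm⟩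
        · rename_i x a _
          refine ⟨congrArg Ext.base ((hb true 0).trans (congrArg Subtype.val (hf a).symm)), ?_⟩
          have hx : ¬ 1 ≤ NCOmegaCat.point.cat.dim x := by
            have := (OmegaCat.dim_le_iff (OmegaCat.discrete PUnit) x 0).2 fun _ => rfl
            exact not_le.2 (Nat.lt_succ_of_le this)
          exact congrArg Ext.arr ((congrArg f ((ofCat E).act_neg hx a)).trans
            (M.act_neg (by rw [b.2]; omega) (f a)).symm)
        · obtain ⟨h', e⟩ := f.map_comp _ _ _ h
          exact ⟨congrArg Ext.arr h', congrArg Ext.arr e⟩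
        · exact ⟨rfl, rfl⟩
        · exact ⟨rfl, rfl⟩
        · exact ⟨rfl, rfl⟩ }
    (fun x hx => by
      cases x with
      | base x =>
        have := (OmegaCat.dim_le_iff (OmegaCat.discrete PUnit) x 0).2 fun _ => rfl
        exact absurd ((hx.symm.trans ((ofCat E).dim_base x)).trans_le this) (by omega)
      | arr a =>
        refine le_antisymm ((M.extCat.dim_le_iff _ _).2 fun α => ?_) (M.one_le_dim_arr _)
        have h := ((ofCat E).extCat.dim_le_iff (.arr a) 1).1 hx.le α
        exact congrArg Ext.arr ((f.map_d α 0 a).symm.trans (congrArg f (Ext.arr.inj h)))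
      | pt =>
        exact absurd (hx.symm.trans (ofCat E).dim_pt) (by omega))

theorem ofCat_path_cases {E : OmegaCat.{u}} {p : (ofCat E).ext.path → Prop}
    (arr : ∀ a, p ((ofCat E).arrPath a)) (x) : p x :=
  (ofCat E).path_cases (fun x => (NCOmegaCat.point_path_elim x).elim) arr x

/-- The germ of a branch in the extension. -/
noncomputable def arrGerm : OmegaFunctor M.cat M.ext.semiPath where
  toFun a := M.ext.germ (M.arrPath a)
  map_d α n a := M.ext.germ.map_d α n (M.arrPath a)
  map_comp n a b h :=
    M.ext.germ.map_comp n (M.arrPath a) (M.arrPath b) (Subtype.ext (congrArg Ext.arr h))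

theorem branch_arrGerm (a : M.cat) : M.branch (M.arrGerm a) = a := M.branch_germ (M.arrPath a)

end BranchModule

/-! ### Natural maps to the simplices of the nerve -/

namespace NCOmegaCat

variable {C : NCOmegaCat.{u}}

/-- In the extension a path `x` of `C` can be followed by some arrow `a` from its target, and `x *_0
a` is the arrow of the germ of `x`. So `x` and that arrow have the same germ; the general case
follows because a functor out of a quotient is determined by the generators. -/
theorem semiPathMap_toExt (u : C.semiPath) :
    semiPathMap C.branchModule.toExt u = C.branchModule.arrGerm (Sum.inl u) := by
  have h : semiPathMap C.branchModule.toExt =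
      (C.semiPath.toAddPoints C.deadEnds).trans C.branchModule.arrGerm := by
    refine OmegaCat.quot_hom_ext fun x => (semiPathMap_germ C.branchModule.toExt x).trans ?_
    obtain ⟨a, ha⟩ := C.exists_start_eq
      ⟨C.cat.d true 0 x.1, Nat.le_zero.1 (C.cat.dim_d_le x.1 true 0)⟩
    refine germ_eq_of_branchRel _ _ _ ⟨C.branchModule.arrPath a, ?_, ?_⟩
    · exact congrArg BranchModule.Ext.base (congrArg Subtype.val ha.symm)
    · exact congrArg BranchModule.Ext.arr (C.branchModule.act_pos x.2 a)
  exact congrArg (fun k => OmegaFunctor.toFun k u) h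

/-- Passing to the extension loses nothing: `branch` undoes the map induced on semi-path
omega-categories, which is therefore injective. -/
theorem branch_semiPathMap_toExt (u : C.semiPath) :
    C.branchModule.branch (semiPathMap C.branchModule.toExt u) = Sum.inl u := by
  exact (congrArg _ (semiPathMap_toExt u)).trans (C.branchModule.branch_arrGerm _)

end NCOmegaCat

theorem BranchModule.branch_semiPathMap_ofCatExt {C : NCOmegaCat.{u}} (M : BranchModule C)
    {E : OmegaCat.{u}} (b : NCOmegaCat.zeroCells.obj C) (f : OmegaFunctor E M.cat)
    (hf : ∀ a, M.start (f a) = b) (x : (ofCat E).ext.semiPath) :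
    M.branch (NCOmegaCat.semiPathMap (M.ofCatExt b f hf) x) = f ((ofCat E).branch x) := by
  have h : (NCOmegaCat.semiPathMap (M.ofCatExt b f hf)).trans M.branch =
      (ofCat E).branch.trans f := by
    refine OmegaCat.quot_hom_ext fun x => ?_
    induction x using ofCat_path_cases with
    | arr a =>
      refine (congrArg M.branch (NCOmegaCat.semiPathMap_germ (M.ofCatExt b f hf) _)).trans ?_
      exact (M.branch_germ _).trans (congrArg f ((ofCat E).branch_arrGerm a)).symm
  exact congrArg (fun k => OmegaFunctor.toFun k x) h

namespace Simplex

/-- The natural map from the morphisms of dimension at most `n` to `m`-simplices that is given by an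
omega-functor from the `m`-simplex to the `n`-globe. -/
noncomputable def natOf {m n : ℕ} (φ : OmegaFunctor (omegaCat m) (Globe.{u} n)) :
    branchingSemiGlobularCut.{u}.trP n ⟶ branchingSemiGlobularCut.{u}.simp m where
  app _ := TypeCat.ofHom fun u => φ.trans (Globe.desc u.1)
  naturality C D f := by
    ext u
    exact OmegaFunctor.ext (funext fun x =>
      (Globe.map_desc (NCOmegaCat.semiPathMap f) u.1 (φ x)).symm)

/-- A Yoneda argument with universal element `T`, the top cell of the globe as an arrow of its
suspension. No functor from the suspension to `C` need carry `T` to `u`, but one to the extension of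
`C` does, and the extension detects equality of simplices of `P^-C`. Naturality along both functors
expresses `ν` at `u` through `ν` at `T`. -/
theorem exists_natOf {m n : ℕ}
    (ν : branchingSemiGlobularCut.{u}.trP n ⟶ branchingSemiGlobularCut.{u}.simp m) :
    ∃ φ : OmegaFunctor (omegaCat m) (Globe.{u} n), ν = natOf φ := by
  let S := BranchModule.ofCat (Globe.{u} n)
  let T : (branchingSemiGlobularCut.{u}.trP n).obj S.ext :=
    ⟨S.arrGerm (Globe.top n), (S.arrGerm.dim_le _).trans (Globe.dim_le _)⟩
  let ξ : OmegaFunctor (omegaCat m) S.ext.semiPath := ν.app S.ext T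
  refine ⟨ξ.trans S.branch, ?_⟩
  ext C u
  let M := C.branchModule
  let f : OmegaFunctor (Globe.{u} n) M.cat := (Globe.desc u.1).trans (C.semiPath.toAddPoints _)
  have hf : ∀ a, M.start (f a) = C.semiPathStart u.1 := fun a => C.semiPathStart.map_d _ _ _
  have h₁ : ν.app M.ext ((branchingSemiGlobularCut.trP n).map M.toExt u) =
      OmegaFunctor.trans (ν.app C u) (NCOmegaCat.semiPathMap M.toExt) :=
    NatTrans.naturality_apply ν M.toExt u
  have h₂ : ν.app M.ext ((branchingSemiGlobularCut.trP n).map (M.ofCatExt _ f hf) T) =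
      ξ.trans (NCOmegaCat.semiPathMap (M.ofCatExt _ f hf)) :=
    NatTrans.naturality_apply ν (M.ofCatExt _ f hf) T
  -- Pushed to the extension, `u` becomes the germ of one arrow, so it is the image of the universal
  -- element.
  have h₃ : (branchingSemiGlobularCut.trP n).map M.toExt u =
      (branchingSemiGlobularCut.trP n).map (M.ofCatExt _ f hf) T := by
    refine Subtype.ext ((NCOmegaCat.semiPathMap_toExt u.1).trans ?_)
    refine Eq.trans ?_ (NCOmegaCat.semiPathMap_germ (M.ofCatExt _ f hf) _).symm
    exact congrArg M.arrGerm (congrArg Sum.inl (Globe.desc_top u.1 u.2).symm)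
  have h₄ := h₁.symm.trans ((congrArg _ h₃).trans h₂)
  refine OmegaFunctor.ext (funext fun x => Sum.inl_injective (β := C.deadEnds) ?_)
  refine (NCOmegaCat.branch_semiPathMap_toExt _).symm.trans ?_
  refine (congrArg (fun k : OmegaFunctor (omegaCat m) M.ext.semiPath => M.branch (k x)) h₄).trans ?_
  exact M.branch_semiPathMap_ofCatExt _ f hf (ξ x)

/-- Evaluate at the universal element, then retract the semi-path omega-category of the suspension
onto the globe. -/
theorem natOf_injective {m n : ℕ} : Function.Injective (natOf.{u} (m := m) (n := n)) := by
  intro φ ψ h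
  let S := BranchModule.ofCat (Globe.{u} n)
  let T : (branchingSemiGlobularCut.{u}.trP n).obj S.ext :=
    ⟨S.arrGerm (Globe.top n), (S.arrGerm.dim_le _).trans (Globe.dim_le _)⟩
  have key : ∀ (φ : OmegaFunctor (omegaCat m) (Globe.{u} n)) x,
      S.branch (OmegaFunctor.toFun (A := omegaCat m) (B := S.ext.semiPath)
        ((natOf φ).app S.ext T) x) = φ x := by
    intro φ x
    refine (congrArg S.branch (Globe.map_desc S.arrGerm (Globe.top n) (φ x)).symm).trans ?_
    exact (S.branch_arrGerm _).trans (Globe.desc_self n (φ x))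
  refine OmegaFunctor.ext (funext fun x => ?_)
  rw [← key φ, h, key ψ]

end Simplex

/-! ### Coefficient tables of the morphisms of a globe -/

namespace GlobeCell

variable {n : ℕ}

/-- The coefficient of the `q`-dimensional morphism of side `δ` in the `q`-source (`β = false`) or
the `q`-target (`β = true`) of `x`. -/
def tab (x : GlobeCell.{u} n) (β : Bool) (q : ℕ) (δ : Bool) : ℤ :=
  if q < x.dim then (if δ = β then 1 else 0)
  else if q = x.dim then (if δ = x.side then 1 else 0) else 0

theorem tab_of_lt {x : GlobeCell.{u} n} {q : ℕ} (h : q < x.dim) (β δ : Bool) :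
    x.tab β q δ = if δ = β then 1 else 0 := if_pos h

theorem tab_dim (x : GlobeCell.{u} n) (β δ : Bool) :
    x.tab β x.dim δ = if δ = x.side then 1 else 0 := by
  rw [tab, if_neg (lt_irrefl _), if_pos rfl]

theorem tab_of_gt {x : GlobeCell.{u} n} {q : ℕ} (h : x.dim < q) (β δ : Bool) :
    x.tab β q δ = 0 := by
  rw [tab, if_neg (by omega), if_neg (by omega)]

theorem dim_le_of_tab {x y : GlobeCell.{u} n} (h : ∀ β q δ, x.tab β q δ = y.tab β q δ) :
    x.dim ≤ y.dim := by
  by_contra hlt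
  have := h false x.dim x.side
  rw [tab_dim, if_pos rfl, tab_of_gt (by omega)] at this
  omega

theorem tab_injective {x y : GlobeCell.{u} n} (h : ∀ β q δ, x.tab β q δ = y.tab β q δ) : x = y := by
  have hd : x.dim = y.dim := le_antisymm (dim_le_of_tab h) (dim_le_of_tab fun _ _ _ => (h _ _ _).symm)
  refine GlobeCell.ext hd ?_
  have := h false x.dim x.side
  rw [tab_dim, if_pos rfl, hd, tab_dim] at this
  by_contra hs
  rw [if_neg hs] at this
  omega

theorem tab_d (α : Bool) (k : ℕ) (x : GlobeCell.{u} n) (β : Bool) (q : ℕ) (δ : Bool) :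
    (x.d α k).tab β q δ = if q < k then x.tab β q δ else if q = k then x.tab α k δ else 0 := by
  rcases lt_or_ge k x.dim with h | h
  · rw [d_of_lt α h]
    simp only [tab]
    split_ifs <;> first | rfl | omega
  · rw [d_of_ge α h]
    simp only [tab]
    split_ifs <;> first | rfl | omega

theorem tab_comp {k : ℕ} {x y : GlobeCell.{u} n} (h : x.d true k = y.d false k) (β : Bool) (q : ℕ)
    (δ : Bool) : (comp k x y).tab β q δ = if q < k then x.tab β q δ else
      if q = k then (if β then y.tab true k δ else x.tab false k δ)
      else x.tab β q δ + y.tab β q δ := by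
  have hlt : ∀ (x : GlobeCell.{u} n) α q, q < k → (x.d α k).tab β q δ = x.tab β q δ := by
    intro x α q hq
    rw [tab_d, if_pos hq]
  have heq : ∀ (x : GlobeCell.{u} n) α β, (x.d α k).tab β k δ = x.tab α k δ := by
    intro x α β
    rw [tab_d, if_neg (lt_irrefl k), if_pos rfl]
  have hxy := fun q hq => (hlt x true q hq).symm.trans ((congrArg (fun z => tab z β q δ) h).trans
    (hlt y false q hq))
  have hk := fun β => (heq x true β).symm.trans ((congrArg (fun z => tab z β k δ) h).trans
    (heq y false β))
  rcases unit_of_match h with ⟨h₁, e⟩ | ⟨h₁, h₂, e⟩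
  · rw [comp_left h₁]
    rcases lt_trichotomy q k with hq | rfl | hq
    · rw [if_pos hq, hxy q hq]
    · rw [if_neg (lt_irrefl _), if_pos rfl]
      cases β
      · rw [e, heq]; rfl
      · rfl
    · rw [if_neg (by omega), if_neg (by omega), tab_of_gt (x := x) (by omega), zero_add]
  · rw [comp_right h₁]
    rcases lt_trichotomy q k with hq | rfl | hq
    · rw [if_pos hq]
    · rw [if_neg (lt_irrefl _), if_pos rfl]
      cases β
      · rfl
      · rw [e, heq]; rfl
    · rw [if_neg (by omega), if_neg (by omega), tab_of_gt (x := y) (by omega), add_zero]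

/-- The sign of the `q`-dimensional morphism of side `δ` in the boundary of those of dimension
`q + 1`. -/
def sign (δ : Bool) : ℤ := if δ then -1 else 1

/-- The tables that come from morphisms of the globe. -/
theorem exists_tab_eq (T : Bool → ℕ → Bool → ℤ) (nonneg : ∀ β q δ, 0 ≤ T β q δ)
    (aug : ∀ β, T β 0 false + T β 0 true = 1)
    (bd : ∀ β q δ, T false q δ - T true q δ = sign δ * (T β (q + 1) false + T β (q + 1) true))
    (large : ∀ β q δ, n < q → T β q δ = 0) (top : ∀ β, T β n true = 0) :
    ∃ x : GlobeCell.{u} n, ∀ β q δ, x.tab β q δ = T β q δ := by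
  have hS : ∃ q, T false q false + T false q true = 0 :=
    ⟨n + 1, by rw [large _ _ _ (Nat.lt_succ_self n), large _ _ _ (Nat.lt_succ_self n), add_zero]⟩
  have b₁ : ∀ β q, T false q false - T true q false = T β (q + 1) false + T β (q + 1) true :=
    fun β q => (bd β q false).trans (by simp [sign])
  have b₂ : ∀ β q, T false q true - T true q true = -(T β (q + 1) false + T β (q + 1) true) :=
    fun β q => (bd β q true).trans (by simp [sign])
  classical
  -- `N` is the first degree in which the source row has total mass `0`; the cell to be found has
  -- dimension `N - 1`.
  set N := Nat.find hS with hN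
  have hN0 : N ≠ 0 := fun h => by
    have := Nat.find_spec hS
    rw [← hN, h, aug false] at this
    omega
  obtain ⟨j, hj⟩ := Nat.exists_eq_succ_of_ne_zero hN0
  -- The boundary equation bounds the mass in degree `q + 1` by the mass `1` in degree `q` and makes
  -- it the same for both rows; below `N` it is nonzero, so it stays `1`.
  have below : ∀ q, q < N → ∀ β, T β q false + T β q true = 1 := by
    intro q
    induction q with
    | zero => exact fun _ β => aug β
    | succ q ih =>
      intro hq β
      have h₁ := ih (by omega) false
      have h₂ := b₁ β q
      have h₃ := b₁ false q
      have h₄ := Nat.find_min hS (hN ▸ hq)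
      have := nonneg true q false
      have := nonneg false q true
      have := nonneg false (q + 1) false
      have := nonneg false (q + 1) true
      omega
  -- Once the source row is empty, a mass in the next degree would be minus a nonnegative entry. So
  -- it is zero, and the target row vanishes as well.
  have above : ∀ q, N ≤ q → ∀ β δ, T β q δ = 0 := by
    intro q hq
    have key : T false q false + T false q true = 0 := by
      induction q, hq using Nat.le_induction with
      | base => exact Nat.find_spec hS
      | succ q hq ih =>
        have := b₁ false q
        have := nonneg true q false
        have := nonneg false q false
        have := nonneg false q true
        have := nonneg false (q + 1) false
        have := nonneg false (q + 1) true
        omega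
    have h₁ := b₁ false q
    have h₂ := b₂ false q
    have := nonneg false q false
    have := nonneg false q true
    have := nonneg true q false
    have := nonneg true q true
    have := nonneg false (q + 1) false
    have := nonneg false (q + 1) true
    intro β δ
    cases β <;> cases δ <;> omega
  have hjn : j ≤ n := by
    by_contra h
    have := below j (by omega) false
    rw [large _ _ _ (by omega), large _ _ _ (by omega)] at this
    omega
  have hj₁ := below j (by omega)
  -- Degree `j + 1` is empty, so source and target agree in degree `j`: there is one cell, whose
  -- side is read off the table.
  have hside : ∀ δ, T true j δ = T false j δ := by
    intro δ
    have h := bd false j δ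
    rw [above (j + 1) (by omega), above (j + 1) (by omega), add_zero, mul_zero] at h
    omega
  refine ⟨⟨j, decide (T false j true = 1), hjn, fun e => ?_⟩, fun β q δ => ?_⟩
  · subst e
    rw [top]
    rfl
  · have hp := nonneg false j false
    have hp' := nonneg false j true
    rcases lt_trichotomy q j with hq | rfl | hq
    · rw [tab_of_lt hq]
      have h₁ := below (q + 1) (by omega) false
      have h₂ := below q (by omega)
      have h₃ := h₂ false
      have h₄ := h₂ true
      have h₅ := b₁ false q
      have := nonneg false q false
      have := nonneg false q true
      have := nonneg true q false
      have := nonneg true q true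
      cases β <;> cases δ <;> simp <;> omega
    · rw [show tab _ β q δ = _ from tab_dim _ β δ]
      have h₁ := hj₁ false
      have e : T β q δ = T false q δ := by
        cases β
        · rfl
        · exact hside δ
      rw [e]
      by_cases h : T false q true = 1 <;> cases δ <;> simp [h] <;> omega
    · rw [tab_of_gt (show j < q from hq), above q (by omega)]

end GlobeCell

/-! ### Omega-functors to globes from coefficients on faces -/

namespace Simplex

/-- Linear maps that agree on the faces occurring in a chain agree on the chain. -/
theorem linear_eq_of_support {m : ℕ} {M : Type*} [AddCommGroup M] (L L' : Chain m →ₗ[ℤ] M)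
    (c : Chain m) (h : ∀ σ, c σ ≠ 0 → L (Finsupp.single σ 1) = L' (Finsupp.single σ 1)) :
    L c = L' c := by
  rw [← Finsupp.sum_single c, Finsupp.sum, map_sum, map_sum]
  refine Finset.sum_congr rfl fun σ hσ => ?_
  have e : Finsupp.single σ (c σ) = c σ • Finsupp.single σ (1 : ℤ) := by simp
  rw [e, map_smul, map_smul, h σ (Finsupp.mem_support_iff.1 hσ)]

/-- The pairing of a function on faces with chains. -/
noncomputable def pair {m : ℕ} (f : Finset (Fin (m + 1)) → ℤ) : Chain m →ₗ[ℤ] ℤ :=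
  Finsupp.linearCombination ℤ f

theorem pair_single {m : ℕ} (f : Finset (Fin (m + 1)) → ℤ) (σ : Finset (Fin (m + 1))) (a : ℤ) :
    pair f (Finsupp.single σ a) = a * f σ := by simp [pair]

theorem pair_eq_sum {m : ℕ} (f : Finset (Fin (m + 1)) → ℤ) (c : Chain m) :
    pair f c = ∑ σ, c σ * f σ := by
  rw [pair, Finsupp.linearCombination_apply, Finsupp.sum_fintype _ _ (by simp)]
  rfl

theorem pair_nonneg {m : ℕ} {f : Finset (Fin (m + 1)) → ℤ} {c : Chain m} (hf : ∀ σ, 0 ≤ f σ)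
    (hc : ∀ σ, 0 ≤ c σ) : 0 ≤ pair f c := by
  rw [pair_eq_sum]
  exact Finset.sum_nonneg fun σ _ => mul_nonneg (hc σ) (hf σ)

theorem pair_eq_zero {m : ℕ} {f : Finset (Fin (m + 1)) → ℤ} {c : Chain m}
    (h : ∀ σ, c σ ≠ 0 → f σ = 0) : pair f c = 0 := by
  rw [pair_eq_sum]
  refine Finset.sum_eq_zero fun σ _ => ?_
  by_cases hc : c σ = 0
  · rw [hc, zero_mul]
  · rw [h σ hc, mul_zero]

/-- A linear description of an omega-functor from the `m`-simplex to the `n`-globe: `lam δ σ` is the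
coefficient of the morphism of side `δ` in the image of the face `σ`. -/
structure GlobeRep (m n : ℕ) where
  /-- the coefficients -/
  lam : Bool → Finset (Fin (m + 1)) → ℤ
  nonneg : ∀ δ σ, 0 ≤ lam δ σ
  large : ∀ δ σ, n + 1 < σ.card → lam δ σ = 0
  top : ∀ σ, σ.card = n + 1 → lam true σ = 0
  vertex : ∀ v, lam false {v} + lam true {v} = 1
  bd : ∀ δ σ, 2 ≤ σ.card → pair (lam δ) (bd m (Finsupp.single σ 1)) =
    GlobeCell.sign δ * (lam false σ + lam true σ)

namespace GlobeRep

variable {m n : ℕ} (R : GlobeRep m n)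

/-- The coefficient table of the image of a morphism. -/
noncomputable def table (x : Cell m) (β : Bool) (q : ℕ) (δ : Bool) : ℤ :=
  pair (R.lam δ) (x.chain β q)

theorem bd_singleton (v : Fin (m + 1)) :
    Simplex.bd m (Finsupp.single {v} 1) = Finsupp.single ∅ 1 := by
  rw [bd_single, Finset.sum_singleton, Finset.erase_singleton]
  simp [sgn, Finset.filter_singleton]

/-- Pairing with the coefficients turns the equations of a morphism of the simplex into the
hypotheses of `exists_tab_eq`. Each of these is linear and need only be checked on the faces that
occur. -/
theorem exists_table (x : Cell m) :
    ∃ y : GlobeCell.{u} n, ∀ β q δ, y.tab β q δ = R.table x β q δ := by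
  refine GlobeCell.exists_tab_eq _ (fun β q δ => pair_nonneg (R.nonneg δ) (x.nonneg β q))
    (fun β => ?_) (fun β q δ => ?_) (fun β q δ hq => ?_) (fun β => ?_)
  · have h := linear_eq_of_support (pair (R.lam false) + pair (R.lam true))
      ((Finsupp.lapply ∅).comp (Simplex.bd m)) (x.chain β 0) (fun σ hσ => by
        obtain ⟨v, rfl⟩ := Finset.card_eq_one.1 (x.card_eq β 0 σ hσ)
        rw [LinearMap.comp_apply, bd_singleton, LinearMap.add_apply, pair_single, pair_single,
          one_mul, one_mul, R.vertex]
        simp)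
    refine h.trans ?_
    rw [LinearMap.comp_apply, x.aug]
    simp
  · have h := linear_eq_of_support ((pair (R.lam δ)).comp (Simplex.bd m))
      (GlobeCell.sign δ • (pair (R.lam false) + pair (R.lam true))) (x.chain β (q + 1))
      (fun σ hσ => by
        rw [LinearMap.comp_apply, R.bd δ σ (by rw [x.card_eq β (q + 1) σ hσ]; omega),
          LinearMap.smul_apply, LinearMap.add_apply, pair_single, pair_single, one_mul, one_mul,
          smul_eq_mul])
    rw [LinearMap.comp_apply, x.bd_succ, map_sub] at h
    exact h
  · exact pair_eq_zero fun σ hσ => R.large δ σ (by rw [x.card_eq β q σ hσ]; omega)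
  · exact pair_eq_zero fun σ hσ => R.top σ (x.card_eq β n σ hσ)

/-- The image of a morphism. -/
noncomputable def apply (x : Cell m) : GlobeCell.{u} n := (R.exists_table x).choose

theorem tab_apply (x : Cell m) (β : Bool) (q : ℕ) (δ : Bool) :
    (R.apply x).tab β q δ = pair (R.lam δ) (x.chain β q) :=
  (R.exists_table x).choose_spec β q δ

theorem apply_d (α : Bool) (k : ℕ) (x : Cell m) : R.apply (x.d α k) = (R.apply x).d α k := by
  refine GlobeCell.tab_injective fun β q δ => ?_
  rw [GlobeCell.tab_d, tab_apply, tab_apply, tab_apply]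
  simp only [Cell.d]
  split_ifs
  · rfl
  · rfl
  · exact map_zero _

theorem apply_comp (k : ℕ) (x y : Cell m) (h : x.d true k = y.d false k) :
    R.apply (x.comp k y h) = GlobeCell.comp k (R.apply x) (R.apply y) := by
  refine GlobeCell.tab_injective fun β q δ => ?_
  rw [GlobeCell.tab_comp (by rw [← apply_d, h, apply_d])]
  simp only [tab_apply, Cell.comp]
  split_ifs <;> first | rfl | exact map_add _ _ _

/-- The omega-functor with the given linear description. -/
noncomputable def functor : OmegaFunctor (omegaCat m) (Globe.{u} n) where
  toFun x := R.apply x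
  map_d α k x := R.apply_d α k x
  map_comp k x y h :=
    ⟨(R.apply_d true k x).symm.trans ((congrArg R.apply h).trans (R.apply_d false k y)),
      R.apply_comp k x y h⟩

end GlobeRep

end Simplex

namespace Simplex

variable {n : ℕ}

/-! ### The faces of the simplex as morphisms -/

/-- The faces `τ` of `σ` of dimension `q` such that every vertex of `σ` outside `τ` is preceded by an
even number (for `α = false`), respectively an odd number (for `α = true`), of vertices of `τ`. -/
def atomFaces (σ : Finset (Fin (n + 1))) (α : Bool) (q : ℕ) : Finset (Finset (Fin (n + 1))) :=
  Finset.univ.filter fun τ => τ ⊆ σ ∧ τ.card = q + 1 ∧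
    ∀ j ∈ σ, j ∉ τ → (Odd (τ.filter (· < j)).card ↔ α = true)

theorem mem_atomFaces {σ τ : Finset (Fin (n + 1))} {α : Bool} {q : ℕ} :
    τ ∈ atomFaces σ α q ↔ τ ⊆ σ ∧ τ.card = q + 1 ∧
      ∀ j ∈ σ, j ∉ τ → (Odd (τ.filter (· < j)).card ↔ α = true) := by
  simp [atomFaces]

/-- The chain of the faces that form the `q`-source or the `q`-target of a face. -/
noncomputable def atomChain (σ : Finset (Fin (n + 1))) (α : Bool) (q : ℕ) : Chain n :=
  ∑ τ ∈ atomFaces σ α q, Finsupp.single τ 1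

theorem atomChain_apply (σ : Finset (Fin (n + 1))) (α : Bool) (q : ℕ) (τ : Finset (Fin (n + 1))) :
    atomChain σ α q τ = if τ ∈ atomFaces σ α q then 1 else 0 := by
  simp [atomChain, Finsupp.finsetSum_apply, Finsupp.single_apply]

/-- Adding `j` raises by one the number of preceding vertices exactly for the vertices after `j`, so
the parity condition is reversed beyond `j` and unchanged before it. -/
theorem mem_atomFaces_insert (σ : Finset (Fin (n + 1))) (α : Bool) (q : ℕ)
    (τ : Finset (Fin (n + 1))) (hσ : τ ⊆ σ) (hτ : τ.card = q) (j : Fin (n + 1)) (hj : j ∈ σ \ τ) :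
    insert j τ ∈ atomFaces σ α q ↔
      (∀ k ∈ σ \ τ, k < j → (Odd (τ.filter (· < k)).card ↔ α = true)) ∧
      (∀ k ∈ σ \ τ, j < k → ¬ (Odd (τ.filter (· < k)).card ↔ α = true)) := by
  rw [Finset.mem_sdiff] at hj
  rw [mem_atomFaces]
  simp only [Finset.card_insert_of_notMem hj.2, hτ, Finset.mem_insert, not_or, Finset.mem_sdiff,
    Finset.insert_subset_iff, hj.1, hσ, true_and]
  have hlow : ∀ k, k < j → (insert j τ).filter (· < k) = τ.filter (· < k) := by
    intro k hk
    rw [Finset.filter_insert, if_neg hk.asymm]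
  have hhigh : ∀ k, j < k → ((insert j τ).filter (· < k)).card = (τ.filter (· < k)).card + 1 := by
    intro k hk
    rw [Finset.filter_insert, if_pos hk, Finset.card_insert_of_notMem (by simp [hj.2])]
  constructor
  · refine fun h => ⟨fun k hk hlt => ?_, fun k hk hlt => ?_⟩
    · have := h k hk.1 ⟨hlt.ne, hk.2⟩
      rwa [hlow k hlt] at this
    · have := h k hk.1 ⟨hlt.ne', hk.2⟩
      rw [hhigh k hlt, Nat.odd_add_one] at this
      tauto
  · rintro ⟨h₁, h₂⟩ k hkσ ⟨hkj, hk⟩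
    rcases lt_or_gt_of_ne hkj with hlt | hgt
    · rw [hlow k hlt]
      exact h₁ k ⟨hkσ, hk⟩ hlt
    · have := h₂ k ⟨hkσ, hk⟩ hgt
      rw [hhigh k hgt, Nat.odd_add_one]
      tauto

theorem sgn_eq_ite (τ : Finset (Fin (n + 1))) (j : Fin (n + 1)) :
    sgn τ j = if Odd (τ.filter (· < j)).card then (-1 : ℤ) else 1 := by
  unfold sgn
  split_ifs with h
  · exact h.neg_one_pow
  · exact (Nat.not_odd_iff_even.1 h).neg_one_pow

/-- The faces that contribute at `τ` are the `insert j τ` with `j ∈ σ \ τ`. By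
`mem_atomFaces_insert` they are the places where the parity changes in one prescribed way, and
`alternating_sum` leaves two end terms: whether `τ` lies in the source of `σ`, and whether it lies
in the target. -/
theorem bd_atomChain_apply (σ : Finset (Fin (n + 1))) (α : Bool) (q : ℕ) (τ : Finset (Fin (n + 1)))
    (hσ : τ ⊆ σ) (hτ : τ.card = q) : bd n (atomChain σ α q) τ =
      (if ∀ k ∈ σ \ τ, ¬ Odd (τ.filter (· < k)).card then 1 else 0) -
      (if ∀ k ∈ σ \ τ, Odd (τ.filter (· < k)).card then 1 else 0) := by
  have hsub : σ \ τ ⊆ τᶜ := fun j hj => Finset.mem_compl.2 (Finset.mem_sdiff.1 hj).2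
  rw [bd_apply, ← Finset.sum_subset hsub]
  swap
  · intro j hj hj'
    rw [atomChain_apply, if_neg, mul_zero]
    intro h
    exact hj' (Finset.mem_sdiff.2
      ⟨(mem_atomFaces.1 h).1 (Finset.mem_insert_self _ _), Finset.mem_compl.1 hj⟩)
  cases α
  · refine Eq.trans ?_ ((alternating_sum (fun k => Odd (τ.filter (· < k)).card) (σ \ τ)).trans
      (by congr))
    refine Finset.sum_congr rfl fun j hj => ?_
    rw [atomChain_apply, sgn_eq_ite]
    have e := mem_atomFaces_insert σ false q τ hσ hτ j hj
    simp only [Bool.false_eq_true, iff_false, not_not] at e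
    simp only [e, mul_ite, mul_one, mul_zero]
    congr
  -- The target side is the same sum for the opposite parity, up to a global sign.
  · rw [← neg_sub]
    refine Eq.trans ?_ (congrArg Neg.neg
      ((alternating_sum (fun k => ¬ Odd (τ.filter (· < k)).card) (σ \ τ)).trans
        (by simp only [not_not]; congr)))
    rw [← Finset.sum_neg_distrib]
    refine Finset.sum_congr rfl fun j hj => ?_
    rw [atomChain_apply, sgn_eq_ite]
    have e := mem_atomFaces_insert σ true q τ hσ hτ j hj
    simp only [iff_true] at e
    simp only [e, not_not, mul_ite, mul_one, mul_zero]
    by_cases hp : Odd (τ.filter (· < j)).card <;> simp only [hp, not_true, not_false_iff, if_true,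
      if_false] <;> split_ifs <;> simp

theorem bd_atomChain_eq_zero (σ : Finset (Fin (n + 1))) (α : Bool) (q : ℕ)
    (τ : Finset (Fin (n + 1))) (h : ¬ (τ ⊆ σ ∧ τ.card = q)) : bd n (atomChain σ α q) τ = 0 := by
  rw [bd_apply]
  refine Finset.sum_eq_zero fun j hj => ?_
  rw [Finset.mem_compl] at hj
  rw [atomChain_apply, if_neg, mul_zero]
  intro h'
  obtain ⟨h₁, h₂, -⟩ := mem_atomFaces.1 h'
  rw [Finset.card_insert_of_notMem hj] at h₂
  exact h ⟨(Finset.subset_insert _ _).trans h₁, by omega⟩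

/-- A face of the simplex, as a morphism of its omega-category. -/
noncomputable def atom (σ : Finset (Fin (n + 1))) (hσ : σ.Nonempty) : Cell n where
  chain := atomChain σ
  card_eq α q τ h := by
    rw [atomChain_apply] at h
    by_contra hc
    rw [if_neg fun h' => hc (mem_atomFaces.1 h').2.1] at h
    exact h rfl
  nonneg α q τ := by
    rw [atomChain_apply]
    split_ifs <;> simp
  aug α := by
    ext τ
    by_cases hτ : τ = ∅
    · subst hτ
      rw [bd_atomChain_apply σ α 0 ∅ (Finset.empty_subset _) rfl]
      obtain ⟨v, hv⟩ := hσ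
      have : ¬ ∀ k ∈ σ, False := fun h => h v hv
      simp [this]
    · rw [bd_atomChain_eq_zero σ α 0 τ (fun h => hτ (Finset.card_eq_zero.1 h.2)),
        Finsupp.single_apply, if_neg (Ne.symm hτ)]
  bd_succ α q := by
    ext τ
    rw [Finsupp.sub_apply, atomChain_apply, atomChain_apply]
    by_cases hτ : τ ⊆ σ ∧ τ.card = q + 1
    · rw [bd_atomChain_apply σ α (q + 1) τ hτ.1 hτ.2]
      simp [mem_atomFaces, hτ.1, hτ.2]
    · rw [bd_atomChain_eq_zero σ α (q + 1) τ hτ, if_neg, if_neg, sub_zero]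
      · exact fun h => hτ ⟨(mem_atomFaces.1 h).1, (mem_atomFaces.1 h).2.1⟩
      · exact fun h => hτ ⟨(mem_atomFaces.1 h).1, (mem_atomFaces.1 h).2.1⟩

theorem atom_chain (σ : Finset (Fin (n + 1))) (hσ : σ.Nonempty) (α : Bool) (q : ℕ) :
    (atom σ hσ).chain α q = atomChain σ α q := rfl

theorem topFaces_eq (n : ℕ) (α : Bool) (q : ℕ) : topFaces n α q = atomFaces Finset.univ α q := by
  ext τ
  simp [topFaces, mem_atomFaces]

theorem topChain_eq (n : ℕ) (α : Bool) (q : ℕ) : topChain n α q = atomChain Finset.univ α q := by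
  rw [topChain, topFaces_eq, atomChain]

theorem top_eq (n : ℕ) : top n = atom Finset.univ Finset.univ_nonempty :=
  Cell.ext (funext fun α => funext fun q => topChain_eq n α q)

theorem atomChain_of_card {σ : Finset (Fin (n + 1))} {q : ℕ} (h : σ.card = q + 1) (α : Bool) :
    atomChain σ α q = Finsupp.single σ 1 := by
  have e : atomFaces σ α q = {σ} := by
    ext τ
    rw [mem_atomFaces, Finset.mem_singleton]
    constructor
    · rintro ⟨h₁, h₂, -⟩
      exact Finset.eq_of_subset_of_card_le h₁ (by omega)
    · rintro rfl
      exact ⟨subset_rfl, h, fun j hj hj' => absurd hj hj'⟩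
  rw [atomChain, e, Finset.sum_singleton]

theorem atomChain_of_card_le {σ : Finset (Fin (n + 1))} {q : ℕ} (h : σ.card ≤ q) (α : Bool) :
    atomChain σ α q = 0 := by
  refine Finset.sum_eq_zero fun τ hτ => ?_
  obtain ⟨h₁, h₂, -⟩ := mem_atomFaces.1 hτ
  have := Finset.card_le_card h₁
  omega

theorem bd_single_eq {σ : Finset (Fin (n + 1))} {q : ℕ} (h : σ.card = q + 2) :
    bd n (Finsupp.single σ 1) = atomChain σ false q - atomChain σ true q := by
  have hσ : σ.Nonempty := Finset.card_pos.1 (by omega)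
  rw [← atomChain_of_card (q := q + 1) h false]
  exact (atom σ hσ).bd_succ false q

/-! ### Generation by the faces -/

/-- The key of the Gray order on the faces. -/
def key (σ : Finset (Fin (n + 1))) : Lex (Fin (n + 1) → Bool) :=
  toLex fun j => decide (Odd (σ.filter (· ≤ j)).card)

/-- Let `j` be the first vertex of `σ` missing from `τ`. Before `j` the two keys agree. At `j` the
counts differ by one, so the parities differ, and that of `τ` is prescribed by the side on which `τ`
lies. Hence faces of the source have smaller keys and faces of the target larger ones: the boundary
relation is acyclic. -/
theorem key_lt_or_gt {σ τ : Finset (Fin (n + 1))} {α : Bool} {q : ℕ} (h : τ ∈ atomFaces σ α q)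
    (hne : τ ≠ σ) : if α then key σ < key τ else key τ < key σ := by
  obtain ⟨hsub, -, hgap⟩ := mem_atomFaces.1 h
  have hne' : (σ \ τ).Nonempty := by
    rw [Finset.nonempty_iff_ne_empty, Ne, Finset.sdiff_eq_empty_iff_subset]
    exact fun h => hne (hsub.antisymm h)
  obtain ⟨j, hj, hmin⟩ := Finset.exists_min_image (σ \ τ) _root_.id hne'
  rw [Finset.mem_sdiff] at hj
  have hbelow : ∀ i < j, (i ∈ σ ↔ i ∈ τ) := fun i hi =>
    ⟨fun hσ => by
      by_contra hτ
      exact absurd (hmin i (Finset.mem_sdiff.2 ⟨hσ, hτ⟩)) (not_le.2 hi), fun hτ => hsub hτ⟩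
  have hlt : ∀ i < j, σ.filter (· ≤ i) = τ.filter (· ≤ i) := fun i hi => by
    ext k
    simp only [Finset.mem_filter]
    exact and_congr_left fun hk => hbelow k (hk.trans_lt hi)
  have hτj : τ.filter (· ≤ j) = τ.filter (· < j) := by
    ext k
    simp only [Finset.mem_filter]
    refine and_congr_right fun hk => ⟨fun h => lt_of_le_of_ne h ?_, le_of_lt⟩
    rintro rfl
    exact hj.2 hk
  have hσj : σ.filter (· ≤ j) = insert j (τ.filter (· < j)) := by
    ext k
    simp only [Finset.mem_filter, Finset.mem_insert]
    constructor
    · rintro ⟨h₁, h₂⟩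
      rcases h₂.eq_or_lt with rfl | h₂
      · exact Or.inl rfl
      · exact Or.inr ⟨(hbelow k h₂).1 h₁, h₂⟩
    · rintro (rfl | ⟨h₁, h₂⟩)
      · exact ⟨hj.1, le_rfl⟩
      · exact ⟨hsub h₁, h₂.le⟩
  have hcard : (σ.filter (· ≤ j)).card = (τ.filter (· ≤ j)).card + 1 := by
    rw [hσj, hτj, Finset.card_insert_of_notMem (by simp)]
  have hodd := hgap j hj.1 hj.2
  rw [← hτj] at hodd
  cases α
  · simp only [Bool.false_eq_true, iff_false] at hodd
    refine ⟨j, fun i hi => ?_, ?_⟩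
    · show decide (Odd (τ.filter (· ≤ i)).card) = decide (Odd (σ.filter (· ≤ i)).card)
      rw [hlt i hi]
    · show decide (Odd (τ.filter (· ≤ j)).card) < decide (Odd (σ.filter (· ≤ j)).card)
      rw [hcard, decide_eq_false hodd, decide_eq_true (Nat.odd_add_one.2 hodd)]
      decide
  · simp only [iff_true] at hodd
    refine ⟨j, fun i hi => ?_, ?_⟩
    · show decide (Odd (σ.filter (· ≤ i)).card) = decide (Odd (τ.filter (· ≤ i)).card)
      rw [hlt i hi]
    · show decide (Odd (σ.filter (· ≤ j)).card) < decide (Odd (τ.filter (· ≤ j)).card)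
      rw [hcard, decide_eq_true hodd, decide_eq_false fun h => Nat.odd_add_one.1 h hodd]
      decide

theorem key_lt {σ τ : Finset (Fin (n + 1))} {q : ℕ} (h : τ ∈ atomFaces σ false q)
    (hne : τ ≠ σ) : key τ < key σ := key_lt_or_gt h hne

theorem key_gt {σ τ : Finset (Fin (n + 1))} {q : ℕ} (h : τ ∈ atomFaces σ true q)
    (hne : τ ≠ σ) : key σ < key τ := key_lt_or_gt h hne

/-- Splitting off a face from a morphism. -/
theorem exists_split (x : Cell n) (m : Finset (Fin (n + 1))) (hm : m.Nonempty) (k : ℕ)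
    (hle : ∀ β r, k < r → ∀ τ, atomChain m β r τ ≤ x.chain β r τ)
    (hk : ∀ τ ∈ atomFaces m false k, 1 ≤ bd n (x.chain false (k + 1)) τ) :
    ∃ (w y : Cell n) (h : w.d true k = y.d false k), x = w.comp k y h ∧
      (∀ β r, k < r → w.chain β r = atomChain m β r) ∧
      (∀ β r, k < r → y.chain β r = x.chain β r - atomChain m β r) := by
  -- The middle `k`-face of the decomposition: the `k`-source of `x` with the source of `m` replaced
  -- by its target.
  set z : Chain n := x.chain false k - atomChain m false k + atomChain m true k with hz
  have card_z : ∀ σ, z σ ≠ 0 → σ.card = k + 1 := by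
    intro σ hσ
    by_contra hc
    have h₁ : x.chain false k σ = 0 := by_contra fun h => hc (x.card_eq _ _ _ h)
    have h₂ : ∀ β, atomChain m β k σ = 0 := fun β =>
      by_contra fun h => hc ((atom m hm).card_eq β _ _ h)
    simp [hz, h₁, h₂] at hσ
  -- Here `hk` is needed: as the target of `x` is nonnegative, it makes the `k`-source of `x`
  -- contain every source face of `m`.
  have nonneg_z : ∀ σ, 0 ≤ z σ := by
    intro σ
    have h₁ : atomChain m false k σ ≤ x.chain false k σ := by
      rw [atomChain_apply]
      split_ifs with h
      · have h₂ := hk σ h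
        rw [x.bd_succ, Finsupp.sub_apply] at h₂
        have := x.nonneg true k σ
        omega
      · exact x.nonneg _ _ _
    have h₂ := (atom m hm).nonneg true k σ
    rw [atom_chain] at h₂
    simp only [hz, Finsupp.add_apply, Finsupp.sub_apply]
    omega
  have bd_atom : ∀ β, bd n (atomChain m β k) = bd n (atomChain m false k) := by
    intro β
    rcases Nat.eq_zero_or_pos k with rfl | hk
    · exact ((atom m hm).aug β).trans ((atom m hm).aug false).symm
    · obtain ⟨l, rfl⟩ := Nat.exists_eq_succ_of_ne_zero hk.ne'
      exact ((atom m hm).bd_succ β l).trans ((atom m hm).bd_succ false l).symm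
  have bd_z : bd n z = bd n (x.chain false k) := by
    rw [hz, map_add, map_sub, bd_atom true]
    abel
  have bd_succ_k : ∀ β l, k = l + 1 → bd n (x.chain β k) = x.chain false l - x.chain true l := by
    intro β l hl
    subst hl
    exact x.bd_succ β l
  let w : Cell n :=
    { chain := fun β r => if r < k then x.chain β r else
        if r = k then (if β then z else x.chain false k) else atomChain m β r
      card_eq := fun β r σ hσ => by
        split_ifs at hσ with h₁ h₂ h₃
        · exact x.card_eq _ _ _ hσ
        · rw [h₂]; exact card_z σ hσ
        · rw [h₂]; exact x.card_eq _ _ _ hσ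
        · exact (atom m hm).card_eq β _ _ hσ
      nonneg := fun β r σ => by
        split_ifs
        · exact x.nonneg _ _ _
        · exact nonneg_z σ
        · exact x.nonneg _ _ _
        · exact (atom m hm).nonneg β _ _
      aug := fun β => by
        rcases Nat.eq_zero_or_pos k with rfl | hk
        · cases β
          · simpa using x.aug false
          · simpa [bd_z] using x.aug false
        · simpa [hk] using x.aug β
      bd_succ := fun β r => by
        rcases lt_trichotomy (r + 1) k with h | h | h
        · simp [h, show r < k by omega, x.bd_succ]
        · simp only [h, lt_irrefl, show r < k by omega, if_true, if_false]
          cases β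
          · exact bd_succ_k false r h.symm
          · exact bd_z.trans (bd_succ_k false r h.symm)
        · simp only [show ¬ r + 1 < k by omega, show ¬ r + 1 = k by omega,
            show ¬ r < k by omega, if_false]
          refine ((atom m hm).bd_succ β r).trans ?_
          rcases Nat.lt_or_eq_of_le (Nat.lt_succ_iff.1 h) with h' | h'
          · rw [if_neg (by omega), if_neg (by omega)]
            rfl
          · rw [← h']
            simp only [atom_chain, hz, Bool.false_eq_true, if_false, if_true]
            abel }
  let y : Cell n :=
    { chain := fun β r => if r < k then x.chain β r else
        if r = k then (if β then x.chain true k else z) else x.chain β r - atomChain m β r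
      card_eq := fun β r σ hσ => by
        split_ifs at hσ with h₁ h₂ h₃
        · exact x.card_eq _ _ _ hσ
        · rw [h₂]; exact x.card_eq _ _ _ hσ
        · rw [h₂]; exact card_z σ hσ
        · by_contra hc
          have h₁ : x.chain β r σ = 0 := by_contra fun h => hc (x.card_eq _ _ _ h)
          have h₂ : atomChain m β r σ = 0 := by_contra fun h => hc ((atom m hm).card_eq β _ _ h)
          simp [h₁, h₂] at hσ
      nonneg := fun β r σ => by
        split_ifs
        · exact x.nonneg _ _ _
        · exact x.nonneg _ _ _
        · exact nonneg_z σ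
        · exact sub_nonneg.2 (hle β r (by omega) σ)
      aug := fun β => by
        rcases Nat.eq_zero_or_pos k with rfl | hk
        · cases β
          · simpa [bd_z] using x.aug false
          · simpa using x.aug true
        · simpa [hk] using x.aug β
      bd_succ := fun β r => by
        rcases lt_trichotomy (r + 1) k with h | h | h
        · simp [h, show r < k by omega, x.bd_succ]
        · simp only [h, lt_irrefl, show r < k by omega, if_true, if_false]
          cases β
          · exact bd_z.trans (bd_succ_k false r h.symm)
          · exact bd_succ_k true r h.symm
        · simp only [show ¬ r + 1 < k by omega, show ¬ r + 1 = k by omega,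
            show ¬ r < k by omega, if_false]
          rw [map_sub, x.bd_succ]
          have e := (atom m hm).bd_succ β r
          rw [atom_chain] at e
          rw [e]
          rcases Nat.lt_or_eq_of_le (Nat.lt_succ_iff.1 h) with h' | h'
          · rw [if_neg (by omega), if_neg (by omega)]
            simp only [atom_chain]
            abel
          · rw [← h']
            simp only [atom_chain, hz, Bool.false_eq_true, if_false, if_true]
            abel }
  have hwy : w.d true k = y.d false k := by
    refine Cell.ext (funext fun β => funext fun r => ?_)
    simp only [Cell.d, w, y]
    split_ifs <;> first | rfl | omega | simp_all
  refine ⟨w, y, hwy, Cell.ext (funext fun β => funext fun r => ?_), fun β r hr => ?_,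
    fun β r hr => ?_⟩
  · simp only [Cell.comp, w, y]
    split_ifs with h₁ h₂ h₃ <;> first | rfl | omega | simp_all
  · simp only [w]
    rw [if_neg (by omega), if_neg (by omega)]
  · simp only [y]
    rw [if_neg (by omega), if_neg (by omega)]

end Simplex

namespace Simplex

variable {n : ℕ}

/-- The number of faces in a chain. -/
noncomputable def size : Chain n →ₗ[ℤ] ℤ := pair fun _ => 1

theorem size_eq_sum (c : Chain n) : size c = ∑ σ, c σ := by
  rw [size, pair_eq_sum]
  simp

theorem eq_zero_of_size {c : Chain n} (hc : ∀ σ, 0 ≤ c σ) (h : size c = 0) : c = 0 := by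
  rw [size_eq_sum, Finset.sum_eq_zero_iff_of_nonneg fun σ _ => hc σ] at h
  ext σ
  exact h σ (Finset.mem_univ σ)

theorem size_vertices {c : Chain n} (hc : ∀ σ, c σ ≠ 0 → σ.card = 1) : size c = bd n c ∅ := by
  refine linear_eq_of_support size ((Finsupp.lapply ∅).comp (bd n)) c fun σ hσ => ?_
  obtain ⟨v, rfl⟩ := Finset.card_eq_one.1 (hc σ hσ)
  rw [LinearMap.comp_apply, GlobeRep.bd_singleton, size, pair_single]
  simp

theorem bd_apply_of_card {c : Chain n} {k : ℕ} (hc : ∀ σ, c σ ≠ 0 → σ.card = k + 2)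
    (τ : Finset (Fin (n + 1))) :
    bd n c τ = ∑ σ, c σ * (atomChain σ false k τ - atomChain σ true k τ) := by
  have h := linear_eq_of_support ((Finsupp.lapply τ).comp (bd n))
    (pair fun σ => atomChain σ false k τ - atomChain σ true k τ) c (fun σ hσ => by
      rw [LinearMap.comp_apply, bd_single_eq (hc σ hσ), pair_single, one_mul]
      rfl)
  rw [pair_eq_sum] at h
  exact h

/-- If `m` has minimal key among the faces of a chain, its source is not cancelled in the boundary
of the chain. -/
theorem one_le_bd {c : Chain n} {k : ℕ} (hc : ∀ σ, c σ ≠ 0 → σ.card = k + 2)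
    (hnn : ∀ σ, 0 ≤ c σ) {m : Finset (Fin (n + 1))} (hm : c m ≠ 0)
    (hmin : ∀ σ, c σ ≠ 0 → key m ≤ key σ) {τ : Finset (Fin (n + 1))}
    (hτ : τ ∈ atomFaces m false k) : 1 ≤ bd n c τ := by
  have hcard := (mem_atomFaces.1 hτ).2.1
  have hlt : key τ < key m := key_lt hτ fun e => by
    have := hc m hm
    rw [← e] at this
    omega
  -- `τ` precedes `m` and so every face of the chain, whereas a target face of `σ` comes after `σ`.
  have hpos : ∀ σ, c σ ≠ 0 → atomChain σ true k τ = 0 := by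
    intro σ hσ
    rw [atomChain_apply, if_neg]
    intro h
    have hgt := key_gt h fun e => by
      have := hc σ hσ
      rw [← e] at this
      omega
    exact absurd (hlt.trans_le (hmin σ hσ)) hgt.asymm
  have hterm : ∀ σ, 0 ≤ c σ * (atomChain σ false k τ - atomChain σ true k τ) := by
    intro σ
    by_cases hσ : c σ = 0
    · rw [hσ, zero_mul]
    · rw [hpos σ hσ, sub_zero, atomChain_apply]
      refine mul_nonneg (hnn σ) ?_
      split_ifs <;> simp
  rw [bd_apply_of_card hc]
  refine le_trans ?_ (Finset.single_le_sum (fun σ _ => hterm σ) (Finset.mem_univ m))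
  rw [hpos m hm, sub_zero, atomChain_apply, if_pos hτ, mul_one]
  have := hnn m
  omega

theorem single_apply_le {c : Chain n} (hnn : ∀ σ, 0 ≤ c σ) {m : Finset (Fin (n + 1))}
    (hm : c m ≠ 0) (τ : Finset (Fin (n + 1))) : Finsupp.single m (1 : ℤ) τ ≤ c τ := by
  rw [Finsupp.single_apply]
  have := hnn τ
  split_ifs with h
  · subst h
    omega
  · exact this

/-- A morphism that has the same faces as the face `b` above dimension `q` contains those of `b` in
dimension `q`, together with the same further faces in its source and target. -/
theorem exists_residue (x : Cell n) (b : Finset (Fin (n + 1))) (q : ℕ) (hq : q + 1 < b.card)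
    (h : x.chain false (q + 1) = atomChain b false (q + 1)) :
    ∃ c : Chain n, (∀ σ, 0 ≤ c σ) ∧ ∀ β, x.chain β q = atomChain b β q + c := by
  have hb : b.Nonempty := Finset.card_pos.1 (by omega)
  have h₁ := x.bd_succ false q
  rw [h] at h₁
  have h₂ := ((atom b hb).bd_succ false q).symm.trans h₁
  simp only [atom_chain] at h₂
  refine ⟨x.chain false q - atomChain b false q, fun σ => ?_, fun β => ?_⟩
  · rw [Finsupp.sub_apply, atomChain_apply]
    split_ifs with hσ
    -- The keys of source and target faces of `b` lie on opposite sides of that of `b`, so no face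
    -- is in both. Hence no cancellation occurs at `σ`, and the source of `x` must contain it.
    · have h₃ : σ ∉ atomFaces b true q := by
        intro hσ'
        have hne : σ ≠ b := fun e => by
          have := (mem_atomFaces.1 hσ).2.1
          rw [e] at this
          omega
        exact absurd (key_lt hσ hne) (key_gt hσ' hne).asymm
      have h₄ := DFunLike.congr_fun h₂ σ
      simp only [Finsupp.sub_apply, atomChain_apply, if_pos hσ, if_neg h₃] at h₄
      have := x.nonneg true q σ
      omega
    · rw [sub_zero]
      exact x.nonneg _ _ _
  · cases β
    · abel
    · rw [← sub_eq_zero, ← sub_eq_zero.2 h₂]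
      abel

/-- Induction on the number `N` of extra faces `c` that accompany `b` in degree `q`: split off,
along a `(q-1)`-cell, whichever of `b` and the extra faces has minimal key. In degree `0` there are
no extra faces, by augmentation. -/
theorem generation_step {P : Cell n → Prop}
    (hcomp : ∀ k x y (h : x.d true k = y.d false k), P x → P y → P (x.comp k y h)) {p : ℕ}
    (hlow : ∀ x : Cell n, (∀ β r, p ≤ r → x.chain β r = 0) → P x)
    (b : Finset (Fin (n + 1))) (hb : b.card = p + 1) (q : ℕ) (hq : q < p)
    (H : ∀ x : Cell n, (∀ β r, q ≤ r → x.chain β r = atomChain b β r) → P x) (N : ℕ) :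
    ∀ (x : Cell n) (c : Chain n), (∀ β r, q + 1 ≤ r → x.chain β r = atomChain b β r) →
      (∀ σ, 0 ≤ c σ) → (∀ β, x.chain β q = atomChain b β q + c) → size c = N → P x := by
  have hb' : b.Nonempty := Finset.card_pos.1 (by omega)
  induction N with
  | zero =>
    intro x c hx hc hxc hN
    have h0 := eq_zero_of_size hc hN
    refine H x fun β r hr => ?_
    rcases hr.eq_or_lt with rfl | hr
    · rw [hxc, h0, add_zero]
    · exact hx β r hr
  | succ N ih =>
    intro x c hx hc hxc hN
    have hcc : ∀ σ, c σ ≠ 0 → σ.card = q + 1 := by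
      intro σ hσ
      refine x.card_eq false q σ fun h => ?_
      rw [hxc, Finsupp.add_apply] at h
      have h₁ := hc σ
      have h₂ := (atom b hb').nonneg false q σ
      rw [atom_chain] at h₂
      omega
    obtain _ | k := q
    · rw [size_vertices hcc] at hN
      have h₁ := x.aug false
      have h₂ := (atom b hb').aug false
      rw [hxc, map_add] at h₁
      rw [atom_chain] at h₂
      rw [h₂, add_eq_left] at h₁
      rw [h₁] at hN
      simp at hN
      omega
    have hcne : ∃ σ, c σ ≠ 0 := by
      by_contra hne
      push Not at hne
      rw [size_eq_sum, Finset.sum_eq_zero fun σ _ => hne σ] at hN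
      omega
    obtain ⟨m, hmS, hmin⟩ := Finset.exists_min_image
      (insert b (Finset.univ.filter fun σ => c σ ≠ 0)) key (Finset.insert_nonempty _ _)
    have hminb : key m ≤ key b := hmin b (Finset.mem_insert_self _ _)
    have hminc : ∀ σ, c σ ≠ 0 → key m ≤ key σ := fun σ hσ =>
      hmin σ (Finset.mem_insert_of_mem (by simpa using hσ))
    have hbd : ∀ τ, bd n (x.chain false (k + 1)) τ =
        atomChain b false k τ - atomChain b true k τ + bd n c τ := by
      intro τ
      have e := (atom b hb').bd_succ false k
      simp only [atom_chain] at e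
      rw [hxc, map_add, e]
      rfl
    have hbpos : ∀ τ, key τ < key b → atomChain b true k τ = 0 := by
      intro τ hτ
      rw [atomChain_apply, if_neg]
      intro h
      refine absurd hτ (key_gt h fun e => ?_).asymm
      have := (mem_atomFaces.1 h).2.1
      rw [e] at this
      omega
    have hcard : ∀ τ ∈ atomFaces m false k, key τ < key m := by
      intro τ hτ
      refine key_lt hτ fun e => ?_
      have h₁ := (mem_atomFaces.1 hτ).2.1
      rw [e] at h₁
      rcases Finset.mem_insert.1 hmS with rfl | hm
      · omega
      · have := hcc m (Finset.mem_filter.1 hm).2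
        omega
    by_cases hm : c m = 0
    -- `b` comes first: splitting it off leaves one factor without extra faces in degree `q` and one
    -- without faces in degrees at least `p`.
    · obtain rfl : m = b := by
        rcases Finset.mem_insert.1 hmS with h | h
        · exact h
        · exact absurd hm (Finset.mem_filter.1 h).2
      obtain ⟨w, y, h, rfl, hw, hy⟩ := exists_split x m hb' k (fun β r hr τ => by
        obtain rfl | hr' : r = k + 1 ∨ k + 1 < r := by omega
        · rw [hxc, Finsupp.add_apply]
          have := hc τ
          omega
        · rw [hx β r hr']) (fun τ hτ => by
        have hτb := hcard τ hτ
        have h₁ : 0 ≤ bd n c τ := by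
          rw [bd_apply_of_card hcc]
          refine Finset.sum_nonneg fun σ _ => ?_
          by_cases hσ : c σ = 0
          · rw [hσ, zero_mul]
          · refine mul_nonneg (hc σ) ?_
            have h₂ : atomChain σ true k τ = 0 := by
              rw [atomChain_apply, if_neg]
              intro h
              refine absurd (hτb.trans_le (hminc σ hσ)) (key_gt h fun e => ?_).asymm
              have h₁ := (mem_atomFaces.1 h).2.1
              have h₂ := hcc σ hσ
              rw [e] at h₁
              omega
            rw [h₂, sub_zero, atomChain_apply]
            split_ifs <;> simp
        rw [hbd, hbpos τ hτb, atomChain_apply, if_pos hτ]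
        omega)
      refine hcomp k w y h (H w fun β r hr => hw β r (by omega)) (hlow y fun β r hr => ?_)
      rw [hy β r (by omega), hx β r (by omega), sub_self]
    -- An extra face comes first: it is split off as a factor of lower dimension, and the other
    -- factor has one extra face less.
    · have hmcard := hcc m hm
      obtain ⟨w, y, h, e, hw, hy⟩ := exists_split x m (Finset.card_pos.1 (by omega)) k
        (fun β r hr τ => by
          obtain rfl | hr' : r = k + 1 ∨ k + 1 < r := by omega
          · rw [hxc, Finsupp.add_apply, atomChain_of_card hmcard]
            have h₁ := single_apply_le hc hm τ
            have h₂ := (atom b hb').nonneg β (k + 1) τ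
            rw [atom_chain] at h₂
            omega
          · rw [atomChain_of_card_le (by omega)]
            exact x.nonneg _ _ _) (fun τ hτ => by
        have hτm := hcard τ hτ
        have h₁ := one_le_bd hcc hc hm hminc hτ
        have h₂ := (atom b hb').nonneg false k τ
        rw [atom_chain] at h₂
        rw [hbd, hbpos τ (hτm.trans_le hminb)]
        omega)
      rw [e]
      refine hcomp k w y h (hlow w fun β r hr => ?_) (ih y (c - Finsupp.single m 1)
        (fun β r hr => ?_) (fun σ => ?_) (fun β => ?_) ?_)
      · rw [hw β r (by omega), atomChain_of_card_le (by omega)]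
      · rw [hy β r (by omega), hx β r hr, atomChain_of_card_le (σ := m) (by omega), sub_zero]
      · exact sub_nonneg.2 (single_apply_le hc hm σ)
      · rw [hy β (k + 1) (by omega), hxc, atomChain_of_card hmcard]
        abel
      · rw [map_sub, hN, size, pair_single]
        push_cast
        ring

/-- Induction on the degree from which `x` coincides with `b`. At `0` it is the face itself; one
degree higher, `exists_residue` isolates the extra faces and `generation_step` removes them. -/
theorem generation_single {P : Cell n → Prop}
    (hcomp : ∀ k x y (h : x.d true k = y.d false k), P x → P y → P (x.comp k y h)) {p : ℕ}
    (hlow : ∀ x : Cell n, (∀ β r, p ≤ r → x.chain β r = 0) → P x)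
    (b : Finset (Fin (n + 1))) (hb : b.card = p + 1) (hne : b.Nonempty) (hatom : P (atom b hne))
    (q : ℕ) (hq : q ≤ p) :
    ∀ x : Cell n, (∀ β r, q ≤ r → x.chain β r = atomChain b β r) → P x := by
  induction q with
  | zero =>
    intro x hx
    rwa [show x = atom b hne from
      Cell.ext (funext fun β => funext fun r => hx β r (Nat.zero_le r))]
  | succ q ih =>
    intro x hx
    obtain ⟨c, hc, hxc⟩ := exists_residue x b q (by omega) (hx false (q + 1) le_rfl)
    have hpos : 0 ≤ size c := by
      rw [size_eq_sum]
      exact Finset.sum_nonneg fun σ _ => hc σ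
    exact generation_step hcomp hlow b hb q hq (ih (by omega)) (size c).toNat x c hx hc hxc
      (Int.toNat_of_nonneg hpos).symm

/-- The omega-category of the simplex is generated by the faces. -/
theorem cell_induction {P : Cell n → Prop}
    (hatom : ∀ σ (hσ : σ.Nonempty),
      (∀ y : Cell n, (∀ β r, σ.card ≤ r + 1 → y.chain β r = 0) → P y) → P (atom σ hσ))
    (hcomp : ∀ k x y (h : x.d true k = y.d false k), P x → P y → P (x.comp k y h))
    (x : Cell n) : P x := by
  -- Induction on a strict bound `p` of the degrees that occur, then on the number of faces in the
  -- highest degree.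
  suffices H : ∀ p, ∀ x : Cell n, (∀ β r, p ≤ r → x.chain β r = 0) → P x from
    H (n + 1) x fun β r hr => x.chain_eq_zero β r hr
  intro p
  induction p with
  | zero =>
    intro x hx
    have h := x.aug false
    rw [hx false 0 le_rfl, map_zero] at h
    exact absurd h.symm (by simp)
  | succ p hlow =>
    have hsingle : ∀ (b : Finset (Fin (n + 1))), b.card = p + 1 → ∀ x : Cell n,
        (∀ β r, p ≤ r → x.chain β r = atomChain b β r) → P x := fun b hb =>
      have hne : b.Nonempty := Finset.card_pos.1 (by omega)
      generation_single hcomp hlow b hb hne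
        (hatom b hne fun y hy => hlow y fun β r hr => hy β r (by omega)) p le_rfl
    intro x hx
    have hN : ∃ N : ℕ, size (x.chain false p) = N := by
      refine ⟨(size (x.chain false p)).toNat, (Int.toNat_of_nonneg ?_).symm⟩
      rw [size_eq_sum]
      exact Finset.sum_nonneg fun σ _ => x.nonneg _ _ _
    obtain ⟨N, hN⟩ := hN
    induction N generalizing x with
    | zero =>
      have h0 := eq_zero_of_size (x.nonneg false p) hN
      refine hlow x fun β r hr => ?_
      rcases hr.eq_or_lt with rfl | hr
      · have h := x.bd_succ false p
        rw [hx false _ le_rfl, map_zero, h0, zero_sub, zero_eq_neg] at h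
        cases β
        · exact h0
        · exact h
      · exact hx β r hr
    | succ N ih =>
      have heq : ∀ β, x.chain β p = x.chain false p := by
        intro β
        have h := x.bd_succ false p
        rw [hx false _ le_rfl, map_zero] at h
        cases β
        · rfl
        · exact (sub_eq_zero.1 h.symm).symm
      have hne : (Finset.univ.filter fun σ => x.chain false p σ ≠ 0).Nonempty := by
        by_contra h
        rw [Finset.not_nonempty_iff_eq_empty, Finset.filter_eq_empty_iff] at h
        rw [size_eq_sum, Finset.sum_eq_zero fun σ hσ => not_not.1 (h hσ)] at hN
        omega
      obtain ⟨m, hm, hmin⟩ := Finset.exists_min_image _ key hne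
      replace hm : x.chain false p m ≠ 0 := (Finset.mem_filter.1 hm).2
      have hmcard := x.card_eq _ _ _ hm
      -- In degree `0` augmentation allows only one vertex. Otherwise the face of minimal key is
      -- split off: one factor has that single face in the highest degree, the other has one fewer.
      obtain _ | k := p
      · refine hsingle m hmcard x fun β r hr => ?_
        rcases hr.eq_or_lt with rfl | hr
        · have hz : x.chain false 0 - Finsupp.single m 1 = 0 := by
            refine eq_zero_of_size (fun σ => sub_nonneg.2
              (single_apply_le (x.nonneg false 0) hm σ)) ?_
            rw [map_sub, size_vertices (x.card_eq false 0), x.aug, size, pair_single]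
            simp
          rw [heq, atomChain_of_card hmcard, ← sub_eq_zero, hz]
        · rw [hx β r hr, atomChain_of_card_le (by omega)]
      · obtain ⟨w, y, h, e, hw, hy⟩ := exists_split x m (Finset.card_pos.1 (by omega)) k
          (fun β r hr τ => by
            obtain rfl | hr' : r = k + 1 ∨ k + 1 < r := by omega
            · rw [atomChain_of_card hmcard, heq]
              exact single_apply_le (x.nonneg false _) hm τ
            · rw [atomChain_of_card_le (by omega)]
              exact x.nonneg _ _ _)
          (fun τ hτ => one_le_bd (x.card_eq false (k + 1)) (x.nonneg false _) hm
            (fun σ hσ => hmin σ (by simpa using hσ)) hτ)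
        rw [e]
        refine hcomp k w y h (hsingle m hmcard w fun β r hr => hw β r (by omega))
          (ih y (fun β r hr => ?_) ?_)
        · rw [hy β r (by omega), hx β r hr, atomChain_of_card_le (by omega), sub_zero]
        · rw [hy false _ (by omega), map_sub, hN, atomChain_of_card hmcard, size, pair_single]
          push_cast
          ring

end Simplex

/-! ### Equations satisfied by the tables of the morphisms of a globe -/

namespace GlobeCell

variable {n : ℕ}

theorem tab_nonneg (x : GlobeCell.{u} n) (β : Bool) (q : ℕ) (δ : Bool) : 0 ≤ x.tab β q δ := by
  unfold tab
  split_ifs <;> simp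

theorem tab_large (x : GlobeCell.{u} n) {q : ℕ} (hq : n < q) (β δ : Bool) : x.tab β q δ = 0 :=
  tab_of_gt (x.le.trans_lt hq) β δ

theorem tab_top (x : GlobeCell.{u} n) (β : Bool) : x.tab β n true = 0 := by
  rcases x.le.eq_or_lt with h | h
  · have := x.tab_dim β true
    rwa [h, x.side_top h] at this
  · exact tab_of_gt h β true

theorem tab_aug (x : GlobeCell.{u} n) (β : Bool) : x.tab β 0 false + x.tab β 0 true = 1 := by
  rcases Nat.eq_zero_or_pos x.dim with h | h
  · have h₁ := x.tab_dim β false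
    have h₂ := x.tab_dim β true
    rw [h] at h₁ h₂
    rw [h₁, h₂]
    cases x.side <;> rfl
  · rw [tab_of_lt h, tab_of_lt h]
    cases β <;> rfl

theorem tab_bd (x : GlobeCell.{u} n) (β : Bool) (q : ℕ) (δ : Bool) :
    x.tab false q δ - x.tab true q δ =
      sign δ * (x.tab β (q + 1) false + x.tab β (q + 1) true) := by
  rcases lt_trichotomy q x.dim with h | h | h
  · rw [tab_of_lt h, tab_of_lt h]
    rcases (Nat.succ_le_of_lt h).eq_or_lt with h' | h'
    · have h₁ := x.tab_dim β false
      have h₂ := x.tab_dim β true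
      rw [← h'] at h₁ h₂
      rw [h₁, h₂]
      cases x.side <;> cases δ <;> rfl
    · rw [tab_of_lt h', tab_of_lt h']
      cases β <;> cases δ <;> rfl
  · rw [h, x.tab_dim, x.tab_dim, tab_of_gt (Nat.lt_succ_self _), tab_of_gt (Nat.lt_succ_self _)]
    simp
  · rw [tab_of_gt h, tab_of_gt h, tab_of_gt (by omega), tab_of_gt (by omega)]
    simp

end GlobeCell

/-! ### Linearity of omega-functors from simplices to globes -/

namespace Simplex

variable {m n : ℕ}

theorem atom_d_eq (σ : Finset (Fin (m + 1))) (hσ : σ.Nonempty) (α : Bool) :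
    (atom σ hσ).d α (σ.card - 1) = atom σ hσ := by
  have hc := Finset.card_pos.2 hσ
  refine Cell.ext (funext fun β => funext fun q => ?_)
  simp only [Cell.d, atom_chain]
  split_ifs with h₁ h₂
  · rfl
  · rw [h₂, atomChain_of_card (by omega), atomChain_of_card (by omega)]
  · rw [atomChain_of_card_le (by omega)]

/-- The value of an omega-functor to a globe. -/
def value (φ : OmegaFunctor (omegaCat m) (Globe.{u} n)) (x : Cell m) : GlobeCell.{u} n := φ x

theorem value_d (φ : OmegaFunctor (omegaCat m) (Globe.{u} n)) (α : Bool) (k : ℕ) (x : Cell m) :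
    value φ (x.d α k) = (value φ x).d α k := φ.map_d α k x

theorem value_comp (φ : OmegaFunctor (omegaCat m) (Globe.{u} n)) (k : ℕ) (x y : Cell m)
    (h : x.d true k = y.d false k) : (value φ x).d true k = (value φ y).d false k ∧
      value φ (x.comp k y h) = GlobeCell.comp k (value φ x) (value φ y) :=
  let ⟨h', e⟩ := φ.map_comp k x y h
  ⟨h', e⟩

/-- The coefficients of an omega-functor to a globe. -/
noncomputable def functorLam (φ : OmegaFunctor (omegaCat m) (Globe.{u} n)) (δ : Bool)
    (σ : Finset (Fin (m + 1))) : ℤ :=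
  if h : σ.Nonempty then (value φ (atom σ h)).tab false (σ.card - 1) δ else 0

/-- Every omega-functor from a simplex to a globe is linear. -/
theorem tab_functor (φ : OmegaFunctor (omegaCat m) (Globe.{u} n)) (x : Cell m) :
    ∀ β q δ, (value φ x).tab β q δ = pair (functorLam φ δ) (x.chain β q) := by
  induction x using cell_induction with
  | hatom σ hσ ih =>
    intro β q δ
    have hc := Finset.card_pos.2 hσ
    have hy : ∀ α, (value φ (atom σ hσ)).d α (σ.card - 1) = value φ (atom σ hσ) := fun α => by
      rw [← value_d, atom_d_eq]
    have ht := fun α β q => (congrArg (fun y => GlobeCell.tab y β q δ) (hy α)).symm.trans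
      (GlobeCell.tab_d α (σ.card - 1) (value φ (atom σ hσ)) β q δ)
    -- Below the dimension of `σ` the table is that of a proper source or target, covered by `ih`.
    -- In that dimension the claim is the definition of `functorLam`. Above it both sides vanish.
    rcases lt_trichotomy q (σ.card - 1) with hq | hq | hq
    · have h := ih ((atom σ hσ).d β q) (fun γ r hr => by
        simp only [Cell.d]
        rw [if_neg (by omega), if_neg (by omega)]) β q δ
      rw [value_d, GlobeCell.tab_d, if_neg (lt_irrefl _), if_pos rfl] at h
      rw [h]
      simp [Cell.d]
    · have h := ht false β q
      rw [if_neg (by omega), if_pos hq] at h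
      rw [h, atom_chain, atomChain_of_card (by omega), pair_single, functorLam, dif_pos hσ, one_mul]
    · have h := ht false β q
      rw [if_neg (by omega), if_neg (by omega)] at h
      rw [h, atom_chain, atomChain_of_card_le (by omega), map_zero]
  | hcomp k x y h hx hy =>
    intro β q δ
    obtain ⟨h', e⟩ := value_comp φ k x y h
    rw [e, GlobeCell.tab_comp h', hx, hx, hy, hy]
    simp only [Cell.comp]
    split_ifs <;> first | rfl | exact (map_add _ _ _).symm

/-- The linear description of an omega-functor to a globe. -/
noncomputable def GlobeRep.ofFunctor (φ : OmegaFunctor (omegaCat m) (Globe.{u} n)) :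
    GlobeRep m n where
  lam := functorLam φ
  nonneg δ σ := by
    unfold functorLam
    split_ifs
    · exact GlobeCell.tab_nonneg _ _ _ _
    · exact le_rfl
  large δ σ h := by
    unfold functorLam
    split_ifs
    · exact GlobeCell.tab_large _ (by omega) _ _
    · rfl
  top σ h := by
    unfold functorLam
    split_ifs
    · rw [h]
      exact GlobeCell.tab_top _ _
    · rfl
  vertex v := by
    unfold functorLam
    rw [dif_pos (Finset.singleton_nonempty v), dif_pos (Finset.singleton_nonempty v)]
    exact GlobeCell.tab_aug _ _
  bd δ σ h := by
    have hσ : σ.Nonempty := Finset.card_pos.1 (by omega)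
    obtain ⟨q, hq⟩ := Nat.exists_eq_add_of_le' h
    rw [bd_single_eq hq, map_sub, ← atom_chain σ hσ, ← atom_chain σ hσ, ← tab_functor,
      ← tab_functor, GlobeCell.tab_bd _ false]
    unfold functorLam
    rw [dif_pos hσ, dif_pos hσ, show σ.card - 1 = q + 1 by omega]

/-- Functors to a globe with the same coefficients are equal. -/
theorem globe_functor_ext {φ ψ : OmegaFunctor (omegaCat m) (Globe.{u} n)}
    (h : ∀ δ σ, σ.Nonempty → functorLam φ δ σ = functorLam ψ δ σ) : φ = ψ := by
  refine OmegaFunctor.ext (funext fun x => GlobeCell.tab_injective fun β q δ => ?_)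
  refine (tab_functor φ x β q δ).trans (Eq.trans ?_ (tab_functor ψ x β q δ).symm)
  rw [pair_eq_sum, pair_eq_sum]
  refine Finset.sum_congr rfl fun σ _ => ?_
  by_cases hσ : Cell.chain x β q σ = 0
  · rw [hσ, zero_mul, zero_mul]
  · rw [h δ σ (Finset.card_pos.1 (by rw [Cell.card_eq x β q σ hσ]; omega))]

theorem GlobeRep.tab_functor_apply (R : GlobeRep m n) (x : Cell m) (β : Bool) (q : ℕ) (δ : Bool) :
    (value R.functor.{u} x).tab β q δ = pair (R.lam δ) (x.chain β q) := R.tab_apply x β q δ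

theorem GlobeRep.functorLam_functor (R : GlobeRep m n) (δ : Bool) {σ : Finset (Fin (m + 1))}
    (hσ : σ.Nonempty) : functorLam R.functor.{u} δ σ = R.lam δ σ := by
  have hc := Finset.card_pos.2 hσ
  rw [functorLam, dif_pos hσ, R.tab_functor_apply, atom_chain, atomChain_of_card (by omega),
    pair_single, one_mul]

/-! ### Images of faces under maps of simplices -/

/-- A strictly increasing map preserves the number of vertices that precede a given one, and hence
all the parity conditions. -/
theorem push_atomChain {f : Fin (m + 1) →o Fin (n + 1)} (hf : Function.Injective f)
    (σ : Finset (Fin (m + 1))) (α : Bool) (q : ℕ) :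
    push f (atomChain σ α q) = atomChain (σ.image f) α q := by
  classical
  have hmono : StrictMono f := f.monotone.strictMono_of_injective hf
  have hmem : ∀ τ : Finset (Fin (m + 1)), τ.image f ∈ atomFaces (σ.image f) α q ↔
      τ ∈ atomFaces σ α q := by
    intro τ
    rw [mem_atomFaces, mem_atomFaces, Finset.image_subset_image_iff hf,
      Finset.card_image_of_injective _ hf]
    refine and_congr_right fun _ => and_congr_right fun _ => ?_
    simp only [Finset.forall_mem_image, hf.mem_finset_image]
    refine forall_congr' fun j => forall_congr' fun _ => forall_congr' fun _ => ?_
    rw [Finset.filter_image, Finset.card_image_of_injective _ hf]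
    simp only [hmono.lt_iff_lt]
  rw [atomChain, map_sum]
  simp only [push_single, if_pos hf.injOn]
  rw [atomChain]
  refine Finset.sum_nbij (fun τ => τ.image f) (fun τ hτ => (hmem τ).2 hτ)
    (fun τ _ τ' _ h => Finset.image_injective hf h) (fun ρ hρ => ?_) (fun _ _ => rfl)
  obtain ⟨τ, -, rfl⟩ := Finset.subset_image_iff.1 (mem_atomFaces.1 hρ).1
  exact ⟨τ, (hmem τ).1 hρ, rfl⟩

theorem map_atom {f : Fin (m + 1) →o Fin (n + 1)} (hf : Function.Injective f)
    (σ : Finset (Fin (m + 1))) (hσ : σ.Nonempty) :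
    Cell.map f (atom σ hσ) = atom (σ.image f) (hσ.image f) :=
  Cell.ext (funext fun α => funext fun q => push_atomChain hf σ α q)

/-- A morphism whose sources and targets in each dimension have no face in common is the
top-dimensional face. -/
theorem eq_top_of_disjoint (x : Cell n)
    (h : ∀ q, q < n → ∀ ρ, x.chain false q ρ = 0 ∨ x.chain true q ρ = 0) : x = top n := by
  have huniv : ∀ β, x.chain β n = x.chain false n Finset.univ • Finsupp.single Finset.univ 1 := by
    have heq : x.chain true n = x.chain false n := by
      have h := x.bd_succ false n
      rw [x.chain_eq_zero _ _ (Nat.lt_succ_self n), map_zero] at h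
      exact (sub_eq_zero.1 h.symm).symm
    intro β
    ext ρ
    have hβ : x.chain β n = x.chain false n := by
      cases β
      · rfl
      · exact heq
    rw [hβ, Finsupp.smul_apply, Finsupp.single_apply]
    split_ifs with hρ
    · subst hρ; simp
    · simp only [smul_eq_mul, mul_zero]
      by_contra hne
      refine hρ (Finset.eq_univ_of_card ρ ?_).symm
      rw [x.card_eq _ _ _ hne, Fintype.card_fin]
  set a := x.chain false n Finset.univ with ha
  have ha0 : 0 ≤ a := x.nonneg _ _ _
  -- Descending induction on the degree. The boundary gives the difference of the `q`-source and the
  -- `q`-target; as these have disjoint supports, and so have those of `top n`, the difference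
  -- determines both.
  have key : ∀ k q, q + k = n → ∀ β, x.chain β q = a • topChain n β q := by
    intro k
    induction k with
    | zero =>
      intro q hq β
      obtain rfl : q = n := by omega
      rw [huniv β, topChain_eq, atomChain_of_card (by simp)]
    | succ k ih =>
      intro q hq
      have h₁ := x.bd_succ false q
      have h₂ := Cell.bd_succ (top n) false q
      rw [ih (q + 1) (by omega), map_smul] at h₁
      replace h₂ : bd n (topChain n false (q + 1)) = topChain n false q - topChain n true q := h₂
      rw [h₂] at h₁
      have hρ : ∀ ρ, x.chain false q ρ = a * topChain n false q ρ ∧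
          x.chain true q ρ = a * topChain n true q ρ := by
        intro ρ
        have h₃ := DFunLike.congr_fun h₁ ρ
        simp only [Finsupp.smul_apply, Finsupp.sub_apply, smul_eq_mul] at h₃
        have h₄ := h q (by omega) ρ
        have h₅ := x.nonneg false q ρ
        have h₆ := x.nonneg true q ρ
        have h₇ : ¬ (ρ ∈ topFaces n false q ∧ ρ ∈ topFaces n true q) := by
          rw [topFaces_eq, topFaces_eq]
          rintro ⟨h₈, h₉⟩
          have hne : ρ ≠ Finset.univ := by
            rintro rfl
            have := (mem_atomFaces.1 h₈).2.1
            rw [Finset.card_univ, Fintype.card_fin] at this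
            omega
          exact absurd (key_lt h₈ hne) (key_gt h₉ hne).asymm
        rw [topChain_apply, topChain_apply] at h₃ ⊢
        by_cases e₁ : ρ ∈ topFaces n false q <;> by_cases e₂ : ρ ∈ topFaces n true q
        · exact absurd ⟨e₁, e₂⟩ h₇
        all_goals simp only [e₁, e₂, if_true, if_false] at h₃ ⊢; omega
      intro β
      ext ρ
      cases β
      · exact (hρ ρ).1
      · exact (hρ ρ).2
  have ha1 : a = 1 := by
    have h₁ := x.aug false
    have h₂ : bd n (topChain n false 0) = Finsupp.single ∅ 1 := Cell.aug (top n) false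
    rw [key n 0 (by omega), map_smul, h₂] at h₁
    simpa using DFunLike.congr_fun h₁ ∅
  refine Cell.ext (funext fun β => funext fun q => ?_)
  rcases le_or_gt q n with hq | hq
  · rw [key (n - q) q (by omega), ha1, one_smul]
    rfl
  · rw [x.chain_eq_zero _ _ hq]
    exact (Cell.chain_eq_zero (top n) _ _ hq).symm

theorem exists_of_push_apply_ne_zero {f : Fin (m + 1) → Fin (n + 1)} {c : Chain m}
    {ρ : Finset (Fin (n + 1))} (h : push f c ρ ≠ 0) :
    ∃ σ, c σ ≠ 0 ∧ Set.InjOn f σ ∧ σ.image f = ρ := by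
  classical
  rw [push_apply] at h
  obtain ⟨σ, -, hσ⟩ := Finset.exists_ne_zero_of_sum_ne_zero h
  refine ⟨σ, left_ne_zero_of_mul hσ, ?_⟩
  by_contra hc
  rw [if_neg, mul_zero] at hσ
  · exact hσ rfl
  · intro hc'
    exact hc ⟨hc'.1, by convert hc'.2⟩

/-- A surjective monotone map preserves the top-dimensional face. -/
theorem map_top_of_surjective {f : Fin (m + 1) →o Fin (n + 1)} (hf : Function.Surjective f) :
    Cell.map f (top m) = top n := by
  refine eq_top_of_disjoint _ fun q hq ρ => ?_
  -- A vertex outside `ρ` lifts to a vertex outside a preimage of `ρ`, with the same number of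
  -- predecessors, so the parity condition of a side passes to `ρ`. Below dimension `n` some vertex
  -- is missing, and the two sides exclude each other.
  have key : ∀ β, (Cell.map f (top m)).chain β q ρ ≠ 0 → ρ.card = q + 1 ∧
      ∀ j ∉ ρ, (Odd (ρ.filter (· < j)).card ↔ β = true) := by
    intro β h
    refine ⟨Cell.card_eq _ _ _ _ h, fun j hj => ?_⟩
    obtain ⟨σ, hσ, hinj, rfl⟩ := exists_of_push_apply_ne_zero h
    replace hσ : σ ∈ topFaces m β q := by
      by_contra hc
      refine hσ ?_
      show topChain m β q σ = 0
      rw [topChain_apply, if_neg hc]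
    obtain ⟨i, rfl⟩ := hf j
    have hi : i ∉ σ := fun hi => hj (Finset.mem_image_of_mem f hi)
    rw [topFaces_eq] at hσ
    rw [← (mem_atomFaces.1 hσ).2.2 i (Finset.mem_univ i) hi]
    have e : (σ.image f).filter (· < f i) = (σ.filter (· < i)).image f := by
      rw [Finset.filter_image]
      congr 1
      refine Finset.filter_congr fun k hk => ⟨fun h => ?_, fun h => ?_⟩
      · exact f.monotone.reflect_lt h
      · refine lt_of_le_of_ne (f.monotone h.le) fun e => hj ?_
        rw [← e]
        exact Finset.mem_image_of_mem f hk
    rw [e, Finset.card_image_of_injOn (hinj.mono (by simp; grind))]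
  by_contra hc
  push Not at hc
  obtain ⟨h₁, h₂⟩ := hc
  obtain ⟨hcard, h₁⟩ := key false h₁
  have h₂ := (key true h₂).2
  obtain ⟨j, hj⟩ : ∃ j, j ∉ ρ := by
    by_contra hall
    push Not at hall
    rw [Finset.eq_univ_of_forall hall, Finset.card_univ, Fintype.card_fin] at hcard
    omega
  have := (h₁ j hj).symm.trans (h₂ j hj)
  simp at this

end Simplex

/-! ### Recognizing a morphism of a globe from its coefficients -/

namespace GlobeCell

variable {n : ℕ}

/-- Below the dimension of `x`, the row of one side has no entry on the opposite side; above it all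
entries vanish. So a nonzero entry of side `α` in the opposite row can only come from `x` itself. -/
theorem eq_of_tab_ne_zero {x : GlobeCell.{u} n} {j : ℕ} {α : Bool} (h : x.tab (!α) j α ≠ 0) :
    x.dim = j ∧ x.side = α := by
  rcases lt_trichotomy j x.dim with hj | rfl | hj
  · rw [tab_of_lt hj] at h
    cases α <;> simp at h
  · rw [tab_dim] at h
    exact ⟨rfl, by by_contra h'; exact h (if_neg fun e => h' e.symm)⟩
  · exact absurd (tab_of_gt hj _ _) h

theorem eq_top_of_tab_ne_zero {x : GlobeCell.{u} n} {β δ : Bool} (h : x.tab β n δ ≠ 0) :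
    x = Globe.top n := by
  have hd : x.dim = n := by
    by_contra hd
    exact h (tab_of_gt (lt_of_le_of_ne x.le hd) _ _)
  exact GlobeCell.ext hd (x.side_top hd)

theorem dim_le_of_tab_eq_zero {x : GlobeCell.{u} n} {j : ℕ}
    (h : ∀ q, j < q → ∀ δ, x.tab false q δ = 0) : x.dim ≤ j := by
  by_contra hd
  have := h x.dim (by omega) x.side
  rw [tab_dim, if_pos rfl] at this
  exact one_ne_zero this

theorem side_eq_of_tab_eq_zero {x : GlobeCell.{u} n} {α : Bool}
    (h : x.tab false x.dim (!α) = 0) : x.side = α := by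
  rw [tab_dim] at h
  by_contra h'
  rw [if_pos (by cases α <;> simp_all)] at h
  exact one_ne_zero h

/-- The collapse of the `(n+1)`-globe onto the `n`-globe, on coefficients. -/
theorem tab_collapse (x : GlobeCell.{u} (n + 1)) (β : Bool) (q : ℕ) (δ : Bool) :
    GlobeCell.tab (n := n) (Globe.desc (Globe.top.{u} n) x) β q δ = if q < n then x.tab β q δ else
      if q = n ∧ δ = false then x.tab β n false + x.tab β n true else 0 := by
  refine (tab_d x.side x.dim (⟨n, false, le_rfl, fun _ => rfl⟩ : GlobeCell.{u} n) β q δ).trans ?_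
  simp only [tab]
  have := x.le
  have := x.side
  cases δ <;> cases β <;> cases x.side <;> simp <;> split_ifs <;> first | rfl | omega

end GlobeCell

/-! ### The folding of the simplex onto the globe -/

namespace Simplex

variable {m n : ℕ}

theorem card_low {k : ℕ} (hk : k ≤ n + 1) :
    ((Finset.univ : Finset (Fin (n + 1))).filter fun v => v.val < k).card = k := by
  have : (Finset.univ : Finset (Fin (n + 1))).filter (fun v => v.val < k) =
      (Finset.univ : Finset (Fin k)).image (Fin.castLE hk) := by
    ext v
    simp only [Finset.mem_filter, Finset.mem_univ, true_and, Finset.mem_image]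
    exact ⟨fun h => ⟨⟨v.val, h⟩, rfl⟩, by rintro ⟨a, rfl⟩; exact a.2⟩
  rw [this, Finset.card_image_of_injective _ (Fin.castLE_injective hk), Finset.card_univ,
    Fintype.card_fin]

theorem low_of_forall_mem {σ : Finset (Fin (n + 1))} {k : ℕ} (h : ∀ v : Fin (n + 1), v.val < k → v ∈ σ) :
    (σ.filter fun v => v.val < k) = Finset.univ.filter fun v => v.val < k := by
  ext v
  simp only [Finset.mem_filter, Finset.mem_univ, true_and]
  exact ⟨fun h => h.2, fun hv => ⟨h v hv, hv⟩⟩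

theorem card_filter_ge {σ : Finset (Fin (n + 1))} {k : ℕ} (hk : k ≤ n + 1)
    (h : ∀ v : Fin (n + 1), v.val < k → v ∈ σ) :
    (σ.filter fun v => ¬ v.val < k).card = σ.card - k := by
  have := Finset.card_filter_add_card_filter_not (s := σ) fun v => v.val < k
  rw [low_of_forall_mem h, card_low hk] at this
  omega

/-- The coefficients of the omega-functor from the simplex to the globe that folds the simplex onto
its last two faces. -/
def psiLam (n : ℕ) (δ : Bool) (σ : Finset (Fin (n + 1))) : ℤ :=
  -- A face of dimension `p` counts if it contains the first `p` vertices, which leaves one vertex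
  -- free. Its side is the parity of `p + 1` if that vertex is `p`, and of `p` otherwise. The clause
  -- `σ.card ≤ n` puts the full face on the source side.
  if (∀ v : Fin (n + 1), v.val < σ.card - 1 → v ∈ σ) ∧
    δ = decide (σ.card ≤ n ∧ Odd (if ∃ v ∈ σ, v.val = σ.card - 1 then σ.card else σ.card - 1))
  then 1 else 0

theorem sum_bool_ite (p : Prop) [Decidable p] (s : Bool) :
    (if p ∧ false = s then (1 : ℤ) else 0) + (if p ∧ true = s then (1 : ℤ) else 0) =
      if p then 1 else 0 := by
  cases s <;> simp

theorem pair_bd_single (f : Finset (Fin (n + 1)) → ℤ) (σ : Finset (Fin (n + 1))) :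
    pair f (bd n (Finsupp.single σ 1)) = ∑ j ∈ σ, sgn σ j * f (σ.erase j) := by
  rw [bd_single, map_sum]
  exact Finset.sum_congr rfl fun j _ => pair_single _ _ _

/-- If `σ` of dimension `p + 1` misses one of the first `p` vertices, none of its facets counts.
Otherwise it consists of these and two more, `v < w`, and only the facets without `v` or without `w`
count, with opposite signs. For `v = p` they lie on opposite sides and give the boundary of an
interval; for `v > p` they lie on the same side and cancel, as they should, since `σ` then does not
count. -/
theorem psiLam_bd (δ : Bool) (σ : Finset (Fin (n + 1))) (h : 2 ≤ σ.card) :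
    pair (psiLam n δ) (bd n (Finsupp.single σ 1)) =
      GlobeCell.sign δ * (psiLam n false σ + psiLam n true σ) := by
  obtain ⟨p, hp⟩ := Nat.exists_eq_add_of_le' h
  have hpn : p + 2 ≤ n + 1 := by
    have := Finset.card_le_univ σ
    rwa [Fintype.card_fin, hp] at this
  rw [pair_bd_single]
  have hsum : psiLam n false σ + psiLam n true σ =
      if ∀ v : Fin (n + 1), v.val < p + 1 → v ∈ σ then 1 else 0 := by
    unfold psiLam
    rw [sum_bool_ite, hp]
    rfl
  rw [hsum]
  have hcard : ∀ j ∈ σ, (σ.erase j).card = p + 1 := fun j hj => by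
    rw [Finset.card_erase_of_mem hj]; omega
  have hval : ∀ j ∈ σ, psiLam n δ (σ.erase j) = if (∀ v : Fin (n + 1), v.val < p → v ∈ σ ∧ v ≠ j) ∧
      δ = decide (Odd (if ∃ v ∈ σ, v ≠ j ∧ v.val = p then p + 1 else p)) then 1 else 0 := by
    intro j hj
    unfold psiLam
    rw [hcard j hj]
    refine if_congr (and_congr ?_ ?_) rfl rfl
    · simp [and_comm]
    · have : p + 1 ≤ n := by omega
      simp only [this, true_and, Finset.mem_erase, Nat.add_sub_cancel, and_assoc, and_left_comm]
  by_cases hlow : ∀ v : Fin (n + 1), v.val < p → v ∈ σ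
  swap
  · rw [if_neg fun h => hlow fun v hv => h v (by omega), mul_zero]
    refine Finset.sum_eq_zero fun j hj => ?_
    rw [hval j hj, if_neg fun h => hlow fun v hv => (h.1 v hv).1, mul_zero]
  have hge := card_filter_ge (by omega) hlow
  rw [hp, show p + 2 - p = 2 by omega, Finset.card_eq_two] at hge
  obtain ⟨v, w, hne, hvw⟩ := hge
  wlog hlt : v < w generalizing v w
  · exact this w v hne.symm (by rw [hvw, Finset.pair_comm]) (lt_of_le_of_ne (not_lt.1 hlt) hne.symm)
  have hmem : ∀ j, j ∈ σ ↔ j.val < p ∨ j = v ∨ j = w := by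
    intro j
    have := Finset.ext_iff.1 hvw j
    simp only [Finset.mem_filter, Finset.mem_insert, Finset.mem_singleton] at this
    rw [← this]
    have := hlow j
    tauto
  have hv : p ≤ v.val := by
    have := Finset.ext_iff.1 hvw v
    simp only [Finset.mem_filter, Finset.mem_insert, true_or, iff_true] at this
    omega
  have hltv : v.val < w.val := hlt
  rw [← Finset.sum_subset (s₁ := {v, w}) (fun j hj => (hmem j).2 (by simp at hj; tauto))
    (fun j hj hj' => ?_), Finset.sum_pair hne, hval v ((hmem v).2 (by simp)),
    hval w ((hmem w).2 (by simp))]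
  swap
  · rw [hval j hj, if_neg, mul_zero]
    intro h
    have := (hmem j).1 hj
    simp only [Finset.mem_insert, Finset.mem_singleton] at hj'
    exact (h.1 j (by tauto)).2 rfl
  have s₁ : σ.filter (· < v) = Finset.univ.filter fun u => u.val < p := by
    ext j
    simp only [Finset.mem_filter, hmem, Finset.mem_univ, true_and, Fin.lt_def, Fin.ext_iff]
    omega
  have s₂ : σ.filter (· < w) = insert v (Finset.univ.filter fun u => u.val < p) := by
    ext j
    simp only [Finset.mem_filter, Finset.mem_insert, hmem, Finset.mem_univ, true_and, Fin.lt_def,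
      Fin.ext_iff]
    omega
  have g₁ : sgn σ v = (-1) ^ p := by rw [sgn, s₁, card_low (by omega)]
  have g₂ : sgn σ w = (-1) ^ (p + 1) := by
    rw [sgn, s₂, Finset.card_insert_of_notMem (by simp; omega), card_low (by omega)]
  have l₁ : ∀ u : Fin (n + 1), u.val < p → u ∈ σ ∧ u ≠ v := fun u hu =>
    ⟨hlow u hu, fun e => by rw [e] at hu; omega⟩
  have l₂ : ∀ u : Fin (n + 1), u.val < p → u ∈ σ ∧ u ≠ w := fun u hu =>
    ⟨hlow u hu, fun e => by rw [e] at hu; omega⟩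
  have n₁ : ¬ ∃ u ∈ σ, u ≠ v ∧ u.val = p := by
    rintro ⟨u, hu, huv, e⟩
    rcases (hmem u).1 hu with h | rfl | rfl
    · omega
    · exact huv rfl
    · omega
  rw [g₁, g₂, if_neg n₁]
  by_cases hvp : v.val = p
  · have n₂ : ∃ u ∈ σ, u ≠ w ∧ u.val = p := ⟨v, (hmem v).2 (by simp), hne, hvp⟩
    have n₃ : ∀ u : Fin (n + 1), u.val < p + 1 → u ∈ σ := fun u hu =>
      (hmem u).2 (by rw [Fin.ext_iff, Fin.ext_iff]; omega)
    rw [if_pos n₂, if_pos n₃]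
    simp only [and_iff_right l₁, and_iff_right l₂, Nat.odd_add_one]
    rcases Nat.even_or_odd p with he | ho
    · have := Nat.not_odd_iff_even.2 he
      cases δ <;> simp [pow_succ, he.neg_one_pow, this, GlobeCell.sign]
    · cases δ <;> simp [pow_succ, ho.neg_one_pow, ho, GlobeCell.sign]
  · have n₂ : ¬ ∃ u ∈ σ, u ≠ w ∧ u.val = p := by
      rintro ⟨u, hu, huv, e⟩
      rcases (hmem u).1 hu with h | rfl | rfl
      · omega
      · omega
      · exact huv rfl
    have n₃ : ¬ ∀ u : Fin (n + 1), u.val < p + 1 → u ∈ σ := fun h => by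
      have := (hmem ⟨p, by omega⟩).1 (h ⟨p, by omega⟩ (Nat.lt_succ_self p))
      simp only [Fin.ext_iff] at this
      omega
    rw [if_neg n₂, if_neg n₃]
    simp only [and_iff_right l₁, and_iff_right l₂]
    rw [pow_succ]
    ring

/-- The linear description of the folding of the simplex onto the globe. -/
def psiRep (n : ℕ) : GlobeRep n n where
  lam := psiLam n
  nonneg δ σ := by unfold psiLam; split_ifs <;> simp
  large δ σ h := by
    have := Finset.card_le_univ σ
    rw [Fintype.card_fin] at this
    omega
  top σ h := by simp [psiLam, h]
  vertex v := by
    unfold psiLam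
    rw [sum_bool_ite, if_pos]
    simp
  bd := psiLam_bd

/-- The folding of the simplex onto the globe. -/
noncomputable def psi (n : ℕ) : OmegaFunctor (omegaCat n) (Globe.{u} n) := (psiRep n).functor

theorem functorLam_psi (δ : Bool) {σ : Finset (Fin (n + 1))} (hσ : σ.Nonempty) :
    functorLam (psi.{u} n) δ σ = psiLam n δ σ := (psiRep n).functorLam_functor δ hσ

theorem functorLam_top (φ : OmegaFunctor (omegaCat m) (Globe.{u} n)) (β δ : Bool) :
    (value φ (top m)).tab β m δ = functorLam φ δ Finset.univ := by
  refine (tab_functor φ (top m) β m δ).trans ?_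
  rw [show Cell.chain (top m) β m = topChain m β m from rfl, topChain_eq,
    atomChain_of_card (by simp), pair_single, one_mul]

theorem value_psi_top : value (psi.{u} n) (top n) = Globe.top n := by
  refine GlobeCell.eq_top_of_tab_ne_zero (β := false) (δ := false) ?_
  rw [functorLam_top, functorLam_psi _ Finset.univ_nonempty]
  simp [psiLam]

theorem functorLam_map {l : ℕ} (f : Fin (l + 1) →o Fin (m + 1))
    (φ : OmegaFunctor (omegaCat m) (Globe.{u} n)) (δ : Bool) {σ : Finset (Fin (l + 1))}
    (hσ : σ.Nonempty) : open Classical in functorLam ((map f).trans φ) δ σ =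
      if Set.InjOn f σ then functorLam φ δ (σ.image f) else 0 := by
  have hc := Finset.card_pos.2 hσ
  have h := tab_functor φ (Cell.map f (atom σ hσ)) false (σ.card - 1) δ
  rw [show (Cell.map f (atom σ hσ)).chain false (σ.card - 1) =
    push f (atomChain σ false (σ.card - 1)) from rfl, atomChain_of_card (by omega), push_single] at h
  unfold functorLam
  rw [dif_pos hσ]
  refine h.trans ?_
  split_ifs with hf hσ'
  · rw [pair_single, one_mul, functorLam, dif_pos hσ']
  · exact absurd (hσ.image f) hσ'
  · exact map_zero _

theorem functorLam_collapse (φ : OmegaFunctor (omegaCat m) (Globe.{u} (n + 1))) (δ : Bool)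
    {σ : Finset (Fin (m + 1))} (hσ : σ.Nonempty) :
    functorLam (φ.trans (Globe.desc (Globe.top.{u} n))) δ σ =
      if σ.card ≤ n then functorLam φ δ σ else
        if σ.card = n + 1 ∧ δ = false then functorLam φ false σ + functorLam φ true σ else 0 := by
  have hc := Finset.card_pos.2 hσ
  unfold functorLam
  rw [dif_pos hσ, dif_pos hσ, dif_pos hσ, dif_pos hσ]
  refine (GlobeCell.tab_collapse (value φ (atom σ hσ)) false (σ.card - 1) δ).trans ?_
  by_cases h₁ : σ.card ≤ n
  · rw [if_pos h₁, if_pos (by omega)]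
  · rw [if_neg h₁, if_neg (by omega)]
    by_cases h₂ : σ.card = n + 1
    · simp only [h₂, Nat.add_sub_cancel]
    · rw [if_neg (fun h => h₂ (by omega)), if_neg (fun h => h₂ h.1)]

/-- The degeneracy identifies the vertices `n` and `n + 1`. Below dimension `n`, the coefficients
only involve vertices before `n`, and a face with both identified vertices is too small to contain
the required initial ones. In dimension `n` the collapse of globes forgets the side, and a face
counts exactly if it does not contain both identified vertices. In dimension `n + 1` both
coefficients vanish. -/
theorem psi_collapse : (psi.{u} (n + 1)).trans (Globe.desc (Globe.top.{u} n)) =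
    (map (SimplexCategory.σ (Fin.last n)).toOrderHom).trans (psi.{u} n) := by
  set f : Fin (n + 2) →o Fin (n + 1) := (SimplexCategory.σ (Fin.last n)).toOrderHom with hf
  have hfv : ∀ v, (f v).val = min v.val n := by
    intro v
    show ((Fin.last n).predAbove v).val = _
    unfold Fin.predAbove
    split_ifs with h
    · simp [Fin.lt_def] at h
      simp; omega
    · simp [Fin.lt_def] at h
      simp; omega
  refine globe_functor_ext fun δ σ hσ => ?_
  have hc := Finset.card_pos.2 hσ
  have hcle : σ.card ≤ n + 2 := by
    have := Finset.card_le_univ σ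
    rwa [Fintype.card_fin] at this
  have hinj : Set.InjOn f σ ↔ ¬ (Fin.last (n + 1) ∈ σ ∧ (Fin.last n).castSucc ∈ σ) := by
    constructor
    · rintro h ⟨h₁, h₂⟩
      have := h h₁ h₂ (Fin.ext (by rw [hfv, hfv]; simp))
      simp [Fin.ext_iff] at this
    · intro h a ha b hb hab
      have hab' := congrArg Fin.val hab
      rw [hfv, hfv] at hab'
      by_contra hne
      have hne' : a.val ≠ b.val := fun e => hne (Fin.ext e)
      refine h ?_
      rcases lt_or_gt_of_ne hne' with hlt | hlt
      · have e₁ : a = (Fin.last n).castSucc := Fin.ext (by simp; omega)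
        have e₂ : b = Fin.last (n + 1) := Fin.ext (by simp; omega)
        rw [← e₁, ← e₂]; exact ⟨hb, ha⟩
      · have e₁ : b = (Fin.last n).castSucc := Fin.ext (by simp; omega)
        have e₂ : a = Fin.last (n + 1) := Fin.ext (by simp; omega)
        rw [← e₁, ← e₂]; exact ⟨ha, hb⟩
  rw [functorLam_collapse _ _ hσ, functorLam_map _ _ _ hσ, functorLam_psi _ hσ, functorLam_psi _ hσ,
    functorLam_psi _ hσ, functorLam_psi _ (hσ.image f)]
  have hsum : psiLam (n + 1) false σ + psiLam (n + 1) true σ =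
      if ∀ v : Fin (n + 2), v.val < σ.card - 1 → v ∈ σ then 1 else 0 := by
    unfold psiLam
    rw [sum_bool_ite]
  rw [hsum]
  rcases lt_trichotomy σ.card (n + 1) with hlt | heq | hgt
  · rw [if_pos (by omega)]
    by_cases hi : Set.InjOn f σ
    · rw [if_pos hi]
      unfold psiLam
      rw [Finset.card_image_of_injOn hi]
      have hmem : ∀ (k : ℕ), k < n → ((∃ v ∈ σ, v.val = k) ↔ ∃ v ∈ σ.image f, v.val = k) := by
        intro k hk
        simp only [Finset.mem_image, exists_exists_and_eq_and, hfv]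
        refine exists_congr fun v => and_congr_right fun _ => ?_
        omega
      refine if_congr (and_congr ?_ ?_) rfl rfl
      · constructor
        · intro h v hv
          obtain ⟨w, hw, e⟩ := (hmem v.val (by omega)).1
            ⟨⟨v.val, by omega⟩, h ⟨v.val, by omega⟩ hv, rfl⟩
          rwa [Fin.ext e.symm]
        · intro h v hv
          obtain ⟨w, hw, e⟩ := (hmem v.val (by omega)).2
            ⟨⟨v.val, by omega⟩, h ⟨v.val, by omega⟩ hv, rfl⟩
          rwa [Fin.ext e.symm]
      · rw [if_congr (hmem (σ.card - 1) (by omega)) rfl rfl]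
        have h₁ : σ.card ≤ n := by omega
        have h₂ : σ.card ≤ n + 1 := by omega
        simp [h₁, h₂]
    · rw [if_neg hi]
      rw [hinj, not_not] at hi
      unfold psiLam
      rw [if_neg]
      intro h
      have h₁ := card_filter_ge (by omega) h.1
      have h₂ : ({Fin.last (n + 1), (Fin.last n).castSucc} : Finset (Fin (n + 2))) ⊆
          σ.filter fun v => ¬ v.val < σ.card - 1 := by
        intro v hv
        simp only [Finset.mem_insert, Finset.mem_singleton] at hv
        rw [Finset.mem_filter]
        rcases hv with rfl | rfl
        · exact ⟨hi.1, by simp; omega⟩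
        · exact ⟨hi.2, by simp; omega⟩
      have h₃ := Finset.card_le_card h₂
      rw [Finset.card_pair (by simp [Fin.ext_iff])] at h₃
      exact absurd (h₃.trans h₁.le) (by omega)
  · rw [if_neg (by omega)]
    have e : (∀ v : Fin (n + 2), v.val < σ.card - 1 → v ∈ σ) ↔ Set.InjOn f σ := by
      rw [hinj]
      constructor
      · intro h hh
        have : σ = Finset.univ := by
          refine Finset.eq_univ_of_forall fun v => ?_
          by_cases hv : v.val < σ.card - 1
          · exact h v hv
          · obtain h₁ | h₁ : v.val = n ∨ v.val = n + 1 := by omega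
            · rw [show v = (Fin.last n).castSucc from Fin.ext h₁]; exact hh.2
            · rw [show v = Fin.last (n + 1) from Fin.ext h₁]; exact hh.1
        rw [this, Finset.card_univ, Fintype.card_fin] at heq
        omega
      · intro h v hv
        by_contra hvσ
        obtain ⟨w, hw, hwσ⟩ : ∃ w, v ≠ w ∧ w ∉ σ := by
          by_cases hl : Fin.last (n + 1) ∈ σ
          · refine ⟨(Fin.last n).castSucc, fun e => ?_, fun h' => h ⟨hl, h'⟩⟩
            rw [e] at hv
            simp at hv; omega
          · refine ⟨Fin.last (n + 1), fun e => ?_, hl⟩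
            rw [e] at hv
            simp at hv; omega
        have h₁ : ({v, w} : Finset (Fin (n + 2))) ⊆ σᶜ := by
          intro k hk
          simp only [Finset.mem_insert, Finset.mem_singleton] at hk
          rw [Finset.mem_compl]
          rcases hk with rfl | rfl <;> assumption
        have h₂ := Finset.card_le_card h₁
        rw [Finset.card_pair hw, Finset.card_compl, Fintype.card_fin] at h₂
        omega
    by_cases hi : Set.InjOn f σ
    · rw [if_pos hi, if_pos (e.2 hi)]
      have hu : σ.image f = Finset.univ := by
        refine Finset.eq_univ_of_card _ ?_
        rw [Finset.card_image_of_injOn hi, heq, Fintype.card_fin]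
      rw [hu]
      simp [psiLam, heq]
    · rw [if_neg hi, if_neg (fun h => hi (e.1 h)), ite_self]
  · rw [if_neg (by omega), if_neg (by omega), if_neg]
    rw [hinj, not_not]
    have : σ = Finset.univ := Finset.eq_univ_of_card _ (by rw [Fintype.card_fin]; omega)
    simp [this]

end Simplex

namespace Simplex

variable {m n : ℕ}

/-! ### Evaluation of natural maps -/

/-- A morphism of the globe is determined by the natural operation on morphisms that it defines. -/
theorem eq_of_desc_eq {g g' : Globe.{u} n}
    (h : ∀ (C : NCOmegaCat.{u}) (u : (branchingSemiGlobularCut.{u}.trP n).obj C),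
      Globe.desc u.1 g = Globe.desc u.1 g') : g = g' := by
  let S := BranchModule.ofCat (Globe.{u} n)
  let T : (branchingSemiGlobularCut.{u}.trP n).obj S.ext :=
    ⟨S.arrGerm (Globe.top n), (S.arrGerm.dim_le _).trans (Globe.dim_le _)⟩
  have key : ∀ g : Globe.{u} n, S.branch (Globe.desc T.1 g) = g := by
    intro g
    refine (congrArg S.branch (Globe.map_desc S.arrGerm (Globe.top n) g).symm).trans ?_
    exact (S.branch_arrGerm _).trans (Globe.desc_self n g)
  exact (key g).symm.trans ((congrArg S.branch (h S.ext T)).trans (key g'))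

theorem natOf_ev (φ : OmegaFunctor (omegaCat n) (Globe.{u} n)) :
    natOf φ ≫ branchingSemiGlobularCut.ev n = 𝟙 _ ↔ value φ (top n) = Globe.top n := by
  constructor
  · intro h
    refine eq_of_desc_eq fun C u => ?_
    have h₁ := congrArg (fun ν => (NatTrans.app ν C u).1) h
    exact h₁.trans (Globe.desc_top u.1 u.2).symm
  · intro h
    ext C u
    refine Subtype.ext ?_
    exact (congrArg (Globe.desc u.1) h).trans (Globe.desc_top u.1 u.2)

theorem value_top_of_ev (θ : OmegaFunctor (omegaCat (n + 1)) (Globe.{u} n))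
    (h : natOf θ ≫ branchingSemiGlobularCut.ev (n + 1) = branchingSemiGlobularCut.incl n) :
    value θ (top (n + 1)) = Globe.top n := by
  refine eq_of_desc_eq fun C u => ?_
  have h₁ := congrArg (fun ν => (NatTrans.app ν C u).1) h
  exact h₁.trans (Globe.desc_top u.1 u.2).symm

/-- For an element of dimension at most `n`, the functor that classifies it on the `(n+1)`-globe
factors through the collapse onto the `n`-globe. -/
theorem incl_natOf (φ : OmegaFunctor (omegaCat m) (Globe.{u} (n + 1))) :
    branchingSemiGlobularCut.incl n ≫ natOf φ =
      natOf (φ.trans (Globe.desc (Globe.top n))) := by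
  ext C u
  refine OmegaFunctor.ext (funext fun x => ?_)
  have h := Globe.map_desc (Globe.desc u.1) (Globe.top.{u} n) (φ x)
  exact ((h.trans (congrArg (fun v => Globe.desc v (φ x)) (Globe.desc_top u.1 u.2)))).symm

theorem natOf_degeneracy (φ : OmegaFunctor (omegaCat m) (Globe.{u} n)) (i : Fin (m + 1)) :
    natOf φ ≫ degeneracyMap branchingSemiGlobularCut.F m i =
      natOf ((map (SimplexCategory.σ i).toOrderHom).trans φ) := rfl

/-! ### Lifting omega-functors from the `n`-globe to the `(n+1)`-globe -/

theorem eq_zero_of_pair_eq_zero {f : Finset (Fin (m + 1)) → ℤ} {c : Chain m} (hf : ∀ σ, 0 ≤ f σ)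
    (hc : ∀ σ, 0 ≤ c σ) (h : pair f c = 0) {σ : Finset (Fin (m + 1))} (hσ : c σ ≠ 0) : f σ = 0 := by
  rw [pair_eq_sum, Finset.sum_eq_zero_iff_of_nonneg fun σ _ => mul_nonneg (hc σ) (hf σ)] at h
  exact (mul_eq_zero.1 (h σ (Finset.mem_univ σ))).resolve_left hσ

theorem functorLam_nonneg (φ : OmegaFunctor (omegaCat m) (Globe.{u} n)) (δ : Bool)
    (σ : Finset (Fin (m + 1))) : 0 ≤ functorLam φ δ σ := (GlobeRep.ofFunctor φ).nonneg δ σ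

/-- Such a face omits one vertex, whose parity decides the side. -/
theorem mem_topFaces_iff_not {σ : Finset (Fin (n + 2))} (hσ : σ.card = n + 1) (β : Bool) :
    σ ∈ topFaces (n + 1) β n ↔ σ ∉ topFaces (n + 1) (!β) n := by
  have hc : σᶜ.card = 1 := by
    rw [Finset.card_compl, Fintype.card_fin, hσ]
    omega
  obtain ⟨i, hi⟩ := Finset.card_eq_one.1 hc
  have hmem : ∀ j, j ∉ σ ↔ j = i := fun j => by
    rw [← Finset.mem_compl, hi, Finset.mem_singleton]
  simp only [topFaces, Finset.mem_filter, Finset.mem_univ, true_and, hσ, hmem, forall_eq]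
  cases β <;> simp

theorem pair_topChain (φ : OmegaFunctor (omegaCat m) (Globe.{u} n)) (β δ : Bool) (q : ℕ) :
    pair (functorLam φ δ) (topChain m β q) = (value φ (top m)).tab β q δ :=
  (tab_functor φ (top m) β q δ).symm

/-- The `β`-side of the globe has no cell of the other side, so the coefficients of that side add up
to zero over the faces in `topFaces (n + 1) β n`. Being nonnegative, they all vanish. -/
theorem functorLam_of_mem_topFaces {φ : OmegaFunctor (omegaCat (n + 1)) (Globe.{u} (n + 1))}
    (hφ : value φ (top (n + 1)) = Globe.top (n + 1)) {σ : Finset (Fin (n + 2))} {β : Bool}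
    (hσ : σ ∈ topFaces (n + 1) β n) : functorLam φ (!β) σ = 0 := by
  refine eq_zero_of_pair_eq_zero (c := topChain (n + 1) β n) (functorLam_nonneg φ _) (fun σ => ?_) ?_
    (σ := σ) ?_
  · rw [topChain_apply]; split_ifs <;> simp
  · rw [pair_topChain, hφ]
    refine (GlobeCell.tab_of_lt (Nat.lt_succ_self n) _ _).trans ?_
    cases β <;> rfl
  · rw [topChain_apply, if_pos hσ]; exact one_ne_zero

/-- The coefficients of the lift of an omega-functor. -/
noncomputable def liftLam (θ : OmegaFunctor (omegaCat (n + 1)) (Globe.{u} n)) (δ : Bool)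
    (σ : Finset (Fin (n + 2))) : ℤ :=
  -- Nothing changes below dimension `n`; a face of codimension one is assigned to the side of the
  -- simplex on which it lies; the full face goes to the new top cell.
  if σ.card ≤ n then functorLam θ δ σ
  else if σ.card = n + 1 then (if σ ∈ topFaces (n + 1) δ n then functorLam θ false σ else 0)
  else if δ = false then 1 else 0

theorem liftLam_add (θ : OmegaFunctor (omegaCat (n + 1)) (Globe.{u} n)) {σ : Finset (Fin (n + 2))}
    (hσ : σ.card ≤ n + 1) :
    liftLam θ false σ + liftLam θ true σ = functorLam θ false σ + functorLam θ true σ := by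
  unfold liftLam
  rcases hσ.eq_or_lt with h | h
  · simp only [h, show ¬ n + 1 ≤ n by omega, if_false, if_true]
    have h₀ : functorLam θ true σ = 0 := (GlobeRep.ofFunctor θ).top σ h
    have h₁ := mem_topFaces_iff_not h false
    by_cases h₂ : σ ∈ topFaces (n + 1) true n
    · rw [if_pos h₂, if_neg (fun h' => h₁.1 h' h₂), h₀, add_comm]
    · rw [if_neg h₂, if_pos (h₁.2 h₂), h₀]
  · rw [if_pos (by omega), if_pos (by omega)]

/-- The linear description of the lift of an omega-functor. -/
noncomputable def liftRep (θ : OmegaFunctor (omegaCat (n + 1)) (Globe.{u} n))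
    (hθ : value θ (top (n + 1)) = Globe.top n) : GlobeRep (n + 1) (n + 1) where
  lam := liftLam θ
  nonneg δ σ := by
    unfold liftLam
    split_ifs <;> first | exact functorLam_nonneg _ _ _ | simp
  large δ σ h := by
    have := Finset.card_le_univ σ
    rw [Fintype.card_fin] at this
    omega
  top σ h := by
    unfold liftLam
    rw [if_neg (by omega), if_neg (by omega), if_neg (by simp)]
  vertex v := by
    rw [liftLam_add θ (by simp)]
    exact (GlobeRep.ofFunctor θ).vertex v
  bd δ σ h := by
    have hle : σ.card ≤ n + 2 := by
      have := Finset.card_le_univ σ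
      rwa [Fintype.card_fin] at this
    by_cases hσ : σ.card ≤ n + 1
    · rw [liftLam_add θ hσ]
      refine Eq.trans ?_ ((GlobeRep.ofFunctor θ).bd δ σ h)
      rw [pair_bd_single, pair_bd_single]
      refine Finset.sum_congr rfl fun j hj => ?_
      have e : liftLam θ δ (σ.erase j) = functorLam θ δ (σ.erase j) :=
        if_pos (by rw [Finset.card_erase_of_mem hj]; omega)
      rw [e]
      rfl
    · obtain rfl : σ = Finset.univ := Finset.eq_univ_of_card _ (by rw [Fintype.card_fin]; omega)
      -- As `θ` sends the top to the top of the `n`-globe, its coefficients add up to `1` over the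
      -- source faces, and also over the target faces.
      have hp : ∀ β, pair (liftLam θ δ) (topChain (n + 1) β n) = if β = δ then 1 else 0 := by
        intro β
        have h₁ := pair_topChain θ β false n
        rw [hθ] at h₁
        replace h₁ := h₁.trans (GlobeCell.tab_dim _ _ _)
        rw [topChain, map_sum] at h₁ ⊢
        have h₂ : ∀ σ ∈ topFaces (n + 1) β n, pair (liftLam θ δ) (Finsupp.single σ 1) =
            if β = δ then pair (functorLam θ false) (Finsupp.single σ 1) else 0 := by
          intro σ hσ
          have hc : σ.card = n + 1 := (Finset.mem_filter.1 hσ).2.1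
          rw [pair_single, pair_single, liftLam, if_neg (by omega), if_pos hc]
          split_ifs with h₃ h₄ h₄
          · rfl
          · exfalso
            refine (mem_topFaces_iff_not hc β).1 hσ ?_
            rwa [show (!β) = δ by cases β <;> cases δ <;> simp_all]
          · exact absurd (h₄ ▸ hσ) h₃
          · simp
        rw [Finset.sum_congr rfl h₂]
        split_ifs with h₃
        · exact h₁
        · simp
      rw [bd_single_eq (q := n) (by simp), ← topChain_eq, ← topChain_eq, map_sub, hp, hp]
      have hu : ∀ δ, liftLam θ δ Finset.univ = if δ = false then 1 else 0 := fun δ => by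
        rw [liftLam, if_neg (by simp), if_neg (by simp)]
      rw [hu, hu]
      cases δ <;> simp [GlobeCell.sign]

/-- The collapse of globes only forgets the sides in dimension `n` and the coefficients in dimension
`n + 1`. Sending top to top restores both: `functorLam_of_mem_topFaces` dictates the sides, and only
the full face has dimension `n + 1`. Conversely `liftRep` satisfies the boundary equations. -/
theorem existsUnique_lift (θ : OmegaFunctor (omegaCat (n + 1)) (Globe.{u} n))
    (hθ : value θ (top (n + 1)) = Globe.top n) :
    ∃! φ : OmegaFunctor (omegaCat (n + 1)) (Globe.{u} (n + 1)),
      value φ (top (n + 1)) = Globe.top (n + 1) ∧ φ.trans (Globe.desc (Globe.top n)) = θ := by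
  refine existsUnique_of_exists_of_unique ⟨(liftRep θ hθ).functor, ?_, ?_⟩ ?_
  · refine GlobeCell.eq_top_of_tab_ne_zero (β := false) (δ := false) ?_
    rw [functorLam_top, GlobeRep.functorLam_functor _ _ Finset.univ_nonempty]
    simp [liftRep, liftLam]
  · refine globe_functor_ext fun δ σ hσ => ?_
    rw [functorLam_collapse _ _ hσ, GlobeRep.functorLam_functor _ _ hσ,
      GlobeRep.functorLam_functor _ _ hσ, GlobeRep.functorLam_functor _ _ hσ]
    rcases lt_trichotomy σ.card (n + 1) with h | h | h
    · rw [if_pos (by omega)]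
      exact if_pos (by omega)
    · have h₀ : functorLam θ true σ = 0 := (GlobeRep.ofFunctor θ).top σ h
      rw [if_neg (by omega)]
      cases δ
      · rw [if_pos ⟨h, rfl⟩]
        exact (liftLam_add θ h.le).trans (by rw [h₀, add_zero])
      · rw [if_neg (by simp), h₀]
    · rw [if_neg (by omega), if_neg (by omega)]
      exact ((GlobeRep.ofFunctor θ).large δ σ h).symm
  · rintro φ φ' ⟨h₁, h₂⟩ ⟨h₁', h₂'⟩
    refine globe_functor_ext fun δ σ hσ => ?_
    have h := congrArg (fun χ => functorLam χ δ σ) (h₂.trans h₂'.symm)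
    have hf := congrArg (fun χ => functorLam χ false σ) (h₂.trans h₂'.symm)
    simp only [functorLam_collapse _ _ hσ] at h hf
    have hle : σ.card ≤ n + 2 := by
      have := Finset.card_le_univ σ
      rwa [Fintype.card_fin] at this
    rcases lt_trichotomy σ.card (n + 1) with hc | hc | hc
    · rwa [if_pos (by omega), if_pos (by omega)] at h
    · rw [if_neg (by omega), if_pos ⟨hc, trivial⟩, if_neg (by omega), if_pos ⟨hc, trivial⟩] at hf
      have key : ∀ β, σ ∈ topFaces (n + 1) β n → functorLam φ δ σ = functorLam φ' δ σ := by
        intro β hβ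
        have e₁ := functorLam_of_mem_topFaces h₁ hβ
        have e₂ := functorLam_of_mem_topFaces h₁' hβ
        cases β <;> cases δ <;> simp only [Bool.not_false, Bool.not_true] at e₁ e₂ <;> omega
      by_cases hβ : σ ∈ topFaces (n + 1) true n
      · exact key true hβ
      · exact key false ((mem_topFaces_iff_not hc false).2 hβ)
    · obtain rfl : σ = Finset.univ := Finset.eq_univ_of_card _ (by rw [Fintype.card_fin]; omega)
      rw [← functorLam_top φ false, ← functorLam_top φ' false, h₁, h₁']

/-! ### The operators -/

theorem isSquare_psi : branchingSemiGlobularCut.{u}.IsSquare fun n => natOf (psi n) where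
  sq_ev n := (natOf_ev _).2 value_psi_top
  incl_sq n := by rw [incl_natOf, natOf_degeneracy, psi_collapse]

theorem value_degeneracy_top (φ : OmegaFunctor (omegaCat m) (Globe.{u} n)) (i : Fin (m + 1)) :
    value ((map (SimplexCategory.σ i).toOrderHom).trans φ) (top (m + 1)) = value φ (top m) := by
  refine congrArg (value φ) (map_top_of_surjective ?_)
  exact Fin.predAbove_surjective i

/-- The `0`-globe has only one morphism, which settles degree `0`. In each further degree both
operators correspond to lifts of the same omega-functor, and lifts are unique. -/
theorem eq_psi_of_isSquare {sq : ∀ n, branchingSemiGlobularCut.{u}.trP n ⟶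
    branchingSemiGlobularCut.{u}.simp n} (h : branchingSemiGlobularCut.IsSquare sq) (n : ℕ) :
    sq n = natOf (psi n) := by
  induction n with
  | zero =>
    obtain ⟨φ, hφ⟩ := exists_natOf (sq 0)
    rw [hφ]
    congr 1
    refine OmegaFunctor.ext (funext fun x => ?_)
    have : ∀ g g' : GlobeCell.{u} 0, g = g' := fun g g' => by
      have h₁ := Nat.le_zero.1 g.le
      have h₂ := Nat.le_zero.1 g'.le
      exact GlobeCell.ext (h₁.trans h₂.symm) ((g.side_top h₁).trans (g'.side_top h₂).symm)
    exact this _ _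
  | succ n ih =>
    obtain ⟨φ, hφ⟩ := exists_natOf (sq (n + 1))
    have h₁ := h.sq_ev (n + 1)
    have h₂ := h.incl_sq n
    rw [hφ, natOf_ev] at h₁
    rw [hφ, ih, incl_natOf, natOf_degeneracy] at h₂
    have hθ : value ((map (SimplexCategory.σ (Fin.last n)).toOrderHom).trans (psi.{u} n))
        (top (n + 1)) = Globe.top n := (value_degeneracy_top _ _).trans value_psi_top
    rw [hφ, (existsUnique_lift _ hθ).unique ⟨h₁, natOf_injective h₂⟩ ⟨value_psi_top, psi_collapse⟩]

theorem existsUnique_isSquare :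
    ∃! sq : ∀ n : ℕ, branchingSemiGlobularCut.{u}.trP n ⟶ branchingSemiGlobularCut.{u}.simp n,
      branchingSemiGlobularCut.{u}.IsSquare sq :=
  ⟨_, isSquare_psi, fun _ h => funext fun n => eq_psi_of_isSquare h n⟩

/-- Under the correspondence `natOf`, restriction along the inclusion is the collapse of globes, and
a section of `ev` is an omega-functor that preserves the top. So `existsUnique_lift` applies. -/
theorem existsUnique_dot (n : ℕ)
    (μ : branchingSemiGlobularCut.{u}.simp n ⟶ branchingSemiGlobularCut.{u}.simp (n + 1))
    (sq : branchingSemiGlobularCut.{u}.trP n ⟶ branchingSemiGlobularCut.{u}.simp n)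
    (h : sq ≫ μ ≫ branchingSemiGlobularCut.ev (n + 1) = branchingSemiGlobularCut.incl n) :
    ∃! ν : branchingSemiGlobularCut.{u}.trP (n + 1) ⟶ branchingSemiGlobularCut.{u}.simp (n + 1),
      ν ≫ branchingSemiGlobularCut.ev (n + 1) = 𝟙 (branchingSemiGlobularCut.{u}.trP (n + 1)) ∧
        branchingSemiGlobularCut.incl n ≫ ν = sq ≫ μ := by
  obtain ⟨θ, hθ⟩ := exists_natOf (sq ≫ μ)
  rw [← Category.assoc, hθ] at h
  obtain ⟨φ, ⟨h₁, h₂⟩, hu⟩ := existsUnique_lift θ (value_top_of_ev θ h)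
  refine ⟨natOf φ, ⟨(natOf_ev φ).2 h₁, by rw [incl_natOf, h₂, hθ]⟩, ?_⟩
  rintro ν ⟨hν₁, hν₂⟩
  obtain ⟨χ, rfl⟩ := exists_natOf ν
  rw [natOf_ev] at hν₁
  rw [hθ, incl_natOf] at hν₂
  rw [hu χ ⟨hν₁, natOf_injective hν₂⟩]

end Simplex

namespace Simplex

variable {m n : ℕ}

/-! ### The faces of the operators -/

theorem value_map_top {f : Fin (m + 1) →o Fin (n + 1)} (hf : Function.Injective f) {k : ℕ}
    (φ : OmegaFunctor (omegaCat n) (Globe.{u} k)) (β : Bool) (q : ℕ) (δ : Bool) :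
    (value ((map f).trans φ) (top m)).tab β q δ =
      pair (functorLam φ δ) (atomChain (Finset.univ.image f) β q) := by
  refine (tab_functor φ (Cell.map f (top m)) β q δ).trans ?_
  rw [top_eq, map_atom hf]
  rfl

theorem image_succAbove (i : Fin (n + 2)) :
    (Finset.univ : Finset (Fin (n + 1))).image (SimplexCategory.δ i).toOrderHom =
      Finset.univ.erase i := by
  ext j
  simp only [Finset.mem_image, Finset.mem_univ, true_and, Finset.mem_erase, and_true]
  exact Fin.exists_succAbove_eq_iff

theorem injective_face (i : Fin (n + 2)) : Function.Injective (SimplexCategory.δ i).toOrderHom :=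
  Fin.succAbove_right_injective

theorem functorLam_psi_ne_zero {σ : Finset (Fin (n + 1))} {δ : Bool}
    (h₁ : ∀ v : Fin (n + 1), v.val < σ.card - 1 → v ∈ σ)
    (h₂ : δ = decide (σ.card ≤ n ∧ Odd (if ∃ v ∈ σ, v.val = σ.card - 1 then σ.card else σ.card - 1)))
    (hσ : σ.Nonempty) : functorLam (psi.{u} n) δ σ ≠ 0 := by
  rw [functorLam_psi _ hσ, psiLam, if_pos ⟨h₁, h₂⟩]
  exact one_ne_zero

theorem pair_atomChain_ne_zero {φ : OmegaFunctor (omegaCat m) (Globe.{u} n)}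
    {σ τ : Finset (Fin (m + 1))} {β δ : Bool} {q : ℕ} (hτ : τ ∈ atomFaces σ β q)
    (h : functorLam φ δ τ ≠ 0) : pair (functorLam φ δ) (atomChain σ β q) ≠ 0 := by
  intro h'
  refine h (eq_zero_of_pair_eq_zero (functorLam_nonneg φ δ) (fun ρ => ?_) h' ?_)
  · rw [atomChain_apply]; split_ifs <;> simp
  · rw [atomChain_apply, if_pos hτ]; exact one_ne_zero

/-- The values of the folding of the simplex on its faces of codimension one. -/
theorem value_psi_face (i : Fin (n + 2)) :
    (value ((map (SimplexCategory.δ i).toOrderHom).trans (psi.{u} (n + 1))) (top n)).dim =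
        min i.val n ∧
      (value ((map (SimplexCategory.δ i).toOrderHom).trans (psi.{u} (n + 1))) (top n)).side =
        decide (Odd i.val) := by
  refine GlobeCell.eq_of_tab_ne_zero ?_
  rw [value_map_top (injective_face i), image_succAbove]
  by_cases hi : i.val ≤ n
  -- By `eq_of_tab_ne_zero` a nonzero entry in the opposite row is enough. The witness `{0, ...,
  -- i-1, i+1}` has `i + 1` vertices, all of them before any other vertex of the face, so it is in
  -- the row of parity `i + 1`. It does not contain `i`, so its side is the parity of `i`.
  · let τ : Finset (Fin (n + 2)) := insert ⟨i.val + 1, by omega⟩ (Finset.univ.filter fun v => v.val < i.val)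
    have hmem : ∀ v, v ∈ τ ↔ v.val = i.val + 1 ∨ v.val < i.val := fun v => by
      simp [τ, Fin.ext_iff]
    have hcard : τ.card = i.val + 1 := by
      rw [Finset.card_insert_of_notMem (by simp [Fin.le_def]), card_low (by omega)]
    rw [min_eq_left hi]
    refine pair_atomChain_ne_zero (τ := τ) ?_ (functorLam_psi_ne_zero ?_ ?_ (Finset.insert_nonempty _ _))
    · rw [mem_atomFaces]
      refine ⟨fun v hv => ?_, hcard, fun j hj hj' => ?_⟩
      · rw [hmem] at hv
        simp only [Finset.mem_erase, Finset.mem_univ, and_true, Ne, Fin.ext_iff]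
        omega
      · simp only [Finset.mem_erase, Finset.mem_univ, and_true, Ne, Fin.ext_iff] at hj
        rw [hmem] at hj'
        have e : τ.filter (· < j) = τ := by
          refine Finset.filter_true_of_mem fun v hv => ?_
          rw [hmem] at hv
          rw [Fin.lt_def]
          omega
        rw [e, hcard, Nat.odd_add_one]
        simp
    · intro v hv
      rw [hcard] at hv
      rw [hmem]
      omega
    · rw [hcard, if_neg]
      · simp [hi]
      · rintro ⟨v, hv, e⟩
        rw [hmem] at hv
        omega
  -- For the last face the witness is the face itself, of dimension `n`; it contains the vertex `n`,
  -- so its side is the parity of `n + 1`.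
  · have hin : i = Fin.last (n + 1) := Fin.ext (by simp; omega)
    have hcard : (Finset.univ.erase i).card = n + 1 := by simp
    rw [min_eq_right (by omega)]
    refine pair_atomChain_ne_zero (τ := Finset.univ.erase i) ?_ (functorLam_psi_ne_zero ?_ ?_ ?_)
    · rw [mem_atomFaces]
      exact ⟨subset_rfl, hcard, fun j hj hj' => absurd hj hj'⟩
    · intro v hv
      rw [hcard] at hv
      simp only [Finset.mem_erase, Finset.mem_univ, and_true, Ne, Fin.ext_iff]
      omega
    · rw [hcard, if_pos ⟨⟨n, by omega⟩, by simp [Fin.ext_iff]; omega, rfl⟩, hin]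
      simp
    · exact Finset.card_pos.1 (by omega)

theorem exists_subset_of_push {f : Fin (m + 1) →o Fin (n + 1)} {c : Chain m}
    {ρ : Finset (Fin (n + 1))} (h : push f c ρ ≠ 0) : ρ ⊆ Finset.univ.image f := by
  obtain ⟨σ, -, -, rfl⟩ := exists_of_push_apply_ne_zero h
  exact Finset.image_subset_image (Finset.subset_univ σ)

/-- The values of the folding of the simplex on the morphisms of its faces of codimension one. -/
theorem value_psi_map_face (i : Fin (n + 2)) (x : Cell n) :
    (value (psi.{u} (n + 1)) (Cell.map (SimplexCategory.δ i).toOrderHom x)).dim < min i.val n ∨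
      ((value (psi.{u} (n + 1)) (Cell.map (SimplexCategory.δ i).toOrderHom x)).dim = min i.val n ∧
      (value (psi.{u} (n + 1)) (Cell.map (SimplexCategory.δ i).toOrderHom x)).side =
        decide (Odd i.val)) := by
  -- Faces in the image avoid `i`. So they cannot contain the first `q` vertices if `q > i`, and for
  -- `q = i` the absence of `i` fixes the side. The last face is separate: there `q = n` leaves only
  -- the whole face.
  have key : ∀ (q : ℕ) (δ : Bool), (min i.val n < q ∨ q = min i.val n ∧ δ = !decide (Odd i.val)) →
      (value (psi.{u} (n + 1)) (Cell.map (SimplexCategory.δ i).toOrderHom x)).tab false q δ = 0 := by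
    intro q δ hq
    rw [tab_functor]
    refine pair_eq_zero fun ρ hρ => ?_
    have hc := Cell.card_eq _ _ _ _ hρ
    have hsub := exists_subset_of_push hρ
    rw [image_succAbove] at hsub
    have hiρ : i ∉ ρ := fun h => by simpa using hsub h
    have hle := Finset.card_le_card hsub
    rw [Finset.card_erase_of_mem (Finset.mem_univ i), Finset.card_univ, Fintype.card_fin] at hle
    rw [functorLam_psi _ (Finset.card_pos.1 (by omega)), psiLam, if_neg]
    rintro ⟨h₁, h₂⟩
    rw [hc] at h₁ h₂
    simp only [Nat.add_sub_cancel] at h₁ h₂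
    rcases hq with hq | ⟨hq, hδ⟩
    · exact hiρ (h₁ i (by omega))
    · have hq' : q + 1 ≤ n + 1 := by omega
      simp only [hq', true_and] at h₂
      rw [hδ] at h₂
      by_cases hi : i.val ≤ n
      · rw [if_neg, show q = i.val by omega] at h₂
        · simp at h₂
        · rintro ⟨v, hv, e⟩
          exact hiρ (by rwa [show i = v from Fin.ext (by omega)])
      · rw [if_pos, show q + 1 = i.val by omega] at h₂
        · simp at h₂
        · refine ⟨⟨n, by omega⟩, ?_, by simp; omega⟩
          have : ρ = Finset.univ.erase i := Finset.eq_of_subset_of_card_le hsub (by simp; omega)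
          rw [this]
          simp [Fin.ext_iff]
          omega
  have hd : (value (psi.{u} (n + 1)) (Cell.map (SimplexCategory.δ i).toOrderHom x)).dim ≤
      min i.val n := GlobeCell.dim_le_of_tab_eq_zero fun q hq δ => key q δ (Or.inl hq)
  rcases hd.lt_or_eq with h | h
  · exact Or.inl h
  · exact Or.inr ⟨h, GlobeCell.side_eq_of_tab_eq_zero (key _ _ (Or.inr ⟨h, rfl⟩))⟩

theorem natOf_face_ev_apply (i : Fin (n + 2)) (C : NCOmegaCat.{u})
    (u : (branchingSemiGlobularCut.{u}.trP (n + 1)).obj C) :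
    ((natOf (psi (n + 1)) ≫ faceMap branchingSemiGlobularCut.F n i ≫
        branchingSemiGlobularCut.ev n).app C u).1 =
      (branchingSemiGlobularCut.P.obj C).d (decide (Odd i.val)) (min i.val n) u.1 := by
  have h := value_psi_face.{u} i
  refine (?_ : _ = (branchingSemiGlobularCut.P.obj C).d
    (value ((map (SimplexCategory.δ i).toOrderHom).trans (psi.{u} (n + 1))) (top n)).side
    (value ((map (SimplexCategory.δ i).toOrderHom).trans (psi.{u} (n + 1))) (top n)).dim u.1).trans ?_
  · rfl
  · rw [h.1, h.2]

/-- The faces `n` and `n + 1` both evaluate in degree `n`, on the sides given by the parities of `n`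
and `n + 1`, hence on both sides. -/
theorem last_faces_psi (n : ℕ) :
    ({natOf (psi (n + 1)) ≫ faceMap branchingSemiGlobularCut.F n (Fin.last n).castSucc ≫
        branchingSemiGlobularCut.ev n,
      natOf (psi (n + 1)) ≫ faceMap branchingSemiGlobularCut.F n (Fin.last (n + 1)) ≫
        branchingSemiGlobularCut.ev n} : Set (branchingSemiGlobularCut.{u}.trP (n + 1) ⟶
          branchingSemiGlobularCut.{u}.trP n)) =
      {Functor.whiskerLeft branchingSemiGlobularCut.P (OmegaCat.trBd false n),
        Functor.whiskerLeft branchingSemiGlobularCut.P (OmegaCat.trBd true n)} := by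
  have key : ∀ i : Fin (n + 2), n ≤ i.val → natOf (psi (n + 1)) ≫
      faceMap branchingSemiGlobularCut.F n i ≫ branchingSemiGlobularCut.ev n =
        Functor.whiskerLeft branchingSemiGlobularCut.{u}.P
          (OmegaCat.trBd (decide (Odd i.val)) n) := by
    intro i hi
    ext C u
    refine Subtype.ext ((natOf_face_ev_apply i C u).trans ?_)
    rw [min_eq_right hi]
    rfl
  rw [key _ (by simp), key _ (by simp)]
  simp only [Fin.val_castSucc, Fin.val_last, Nat.odd_add_one]
  by_cases h : Odd n
  · simp only [h, decide_true, not_true, decide_false, Set.pair_comm]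
  · simp only [h, decide_false, not_false_iff, decide_true]

end Simplex

namespace OmegaCat

/-- If the sources and targets of a morphism in degrees below `N` are distinct then they determine
their degrees and sides. -/
theorem d_eq_d_imp {A : OmegaCat.{u}} {x : A} {N : ℕ} (hx : ∀ q, q < N → A.d false q x ≠ A.d true q x)
    {α β : Bool} {j p : ℕ} (hj : j < N) (hp : p < N) (h : A.d β j x = A.d α p x) :
    j = p ∧ β = α := by
  have aux : ∀ {α β : Bool} {j p : ℕ}, j < N → A.d β j x = A.d α p x → ¬ j < p := by
    intro α β j p hj h hlt
    have e : ∀ γ, A.d γ j x = A.d β j x := fun γ => by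
      rw [← A.d_d_lt α γ j p x hlt, ← h, A.d_d_ge β γ j j x le_rfl]
    exact hx j hj ((e false).trans (e true).symm)
  have hjp : j = p := le_antisymm (not_lt.1 (aux hp h.symm)) (not_lt.1 (aux hj h))
  subst hjp
  refine ⟨rfl, ?_⟩
  by_contra hne
  cases α <;> cases β <;> first | exact hne rfl | exact hx j hj h | exact hx j hj h.symm

end OmegaCat

namespace Simplex

variable {n : ℕ}

/-- If `p ≤ n`, the distinct faces of the test element force `p = min i n` and make `α` the parity
of `i`. By `value_psi_map_face` every value of `psi` on the `i`-th face is that cell of the globe or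
one of smaller dimension, and such faces of `u` do not change when `u` is replaced by `d_p^α u`. If
`p > n`, that replacement is trivial. -/
theorem faces_psi (n : ℕ) (i : Fin (n + 2)) (p : ℕ) (α : Bool)
    (h : ∃ (C : NCOmegaCat.{u}) (u : (branchingSemiGlobularCut.{u}.trP (n + 1)).obj C),
      (branchingSemiGlobularCut.P.obj C).dim u.1 = n + 1 ∧
      (∀ q, q ≤ n → (branchingSemiGlobularCut.P.obj C).d false q u.1 ≠
        (branchingSemiGlobularCut.P.obj C).d true q u.1) ∧
      ((natOf (psi (n + 1)) ≫ faceMap branchingSemiGlobularCut.F n i ≫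
        branchingSemiGlobularCut.ev n).app C u).1 = (branchingSemiGlobularCut.P.obj C).d α p u.1) :
    natOf (psi.{u} (n + 1)) ≫ faceMap branchingSemiGlobularCut.F n i =
      Functor.whiskerLeft branchingSemiGlobularCut.P (OmegaCat.trD α p (n + 1)) ≫
        natOf (psi (n + 1)) ≫ faceMap branchingSemiGlobularCut.F n i := by
  obtain ⟨C₀, u₀, -, hd, h⟩ := h
  rw [natOf_face_ev_apply] at h
  ext C u
  refine OmegaFunctor.ext (funext fun x => ?_)
  have goal : ∀ g : GlobeCell.{u} (n + 1), value (psi.{u} (n + 1))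
      (Cell.map (SimplexCategory.δ i).toOrderHom x) = g →
      (branchingSemiGlobularCut.P.obj C).d g.side g.dim u.1 =
        (branchingSemiGlobularCut.P.obj C).d g.side g.dim
          ((branchingSemiGlobularCut.P.obj C).d α p u.1) := by
    intro g hg
    by_cases hp : p ≤ n
    · obtain ⟨hjp, hα⟩ := OmegaCat.d_eq_d_imp (N := n + 1) (fun q hq => hd q (by omega)) (by omega)
        (by omega) h
      have hv := value_psi_map_face.{u} i x
      rw [hg, hjp, hα] at hv
      rcases hv with hv | ⟨hv, hs⟩
      · rw [OmegaCat.d_d_lt _ _ _ _ _ _ hv]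
      · rw [hv, hs, OmegaCat.d_d_ge _ _ _ _ _ _ le_rfl]
    · rw [(OmegaCat.dim_le_iff _ _ p).1 (u.2.trans (by omega)) α]
  exact goal _ rfl

end Simplex

namespace Simplex

variable {m n : ℕ}

/-! ### Homogeneous chains and signs -/

/-- The chains on faces with `d` vertices. -/
noncomputable def homog (n d : ℕ) : Submodule ℤ (Chain n) :=
  Finsupp.supported ℤ ℤ {σ : Finset (Fin (n + 1)) | σ.card = d}

theorem mem_homog {d : ℕ} {c : Chain n} : c ∈ homog n d ↔ ∀ σ, c σ ≠ 0 → σ.card = d := by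
  rw [homog, Finsupp.mem_supported']
  exact forall_congr' fun σ => not_imp_comm

theorem single_mem_homog {d : ℕ} {σ : Finset (Fin (n + 1))} (h : σ.card = d) (a : ℤ) :
    Finsupp.single σ a ∈ homog n d := Finsupp.single_mem_supported ℤ a h

theorem map_mem_homog {d e : ℕ} (L : Chain m →ₗ[ℤ] Chain n)
    (hL : ∀ σ : Finset (Fin (m + 1)), σ.card = d → L (Finsupp.single σ 1) ∈ homog n e) {c : Chain m}
    (hc : c ∈ homog m d) : L c ∈ homog n e := by
  rw [← Finsupp.sum_single c, Finsupp.sum, map_sum]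
  refine Submodule.sum_mem _ fun σ hσ => ?_
  have e : Finsupp.single σ (c σ) = c σ • Finsupp.single σ (1 : ℤ) := by simp
  rw [e, map_smul]
  exact Submodule.smul_mem _ _ (hL σ (mem_homog.1 hc σ (Finsupp.mem_support_iff.1 hσ)))

theorem bd_mem_homog {d : ℕ} {c : Chain n} (hc : c ∈ homog n (d + 1)) : bd n c ∈ homog n d := by
  refine map_mem_homog _ (fun σ hσ => ?_) hc
  rw [bd_single]
  refine Submodule.sum_mem _ fun j hj => single_mem_homog ?_ _
  rw [Finset.card_erase_of_mem hj, hσ, Nat.add_sub_cancel]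

theorem push_mem_homog {d : ℕ} (f : Fin (m + 1) → Fin (n + 1)) {c : Chain m} (hc : c ∈ homog m d) :
    push f c ∈ homog n d := by
  classical
  refine map_mem_homog _ (fun σ hσ => ?_) hc
  rw [push_single]
  split_ifs with h
  · exact single_mem_homog ((Finset.card_image_of_injOn h).trans hσ) _
  · exact Submodule.zero_mem _

theorem map_single_bd {M : Type*} [AddCommGroup M] (L : Chain n →ₗ[ℤ] M) (σ : Finset (Fin (n + 1))) :
    L (bd n (Finsupp.single σ 1)) = ∑ j ∈ σ, sgn σ j • L (Finsupp.single (σ.erase j) 1) := by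
  rw [bd_single, map_sum]
  refine Finset.sum_congr rfl fun j _ => ?_
  rw [smul_single_sgn, map_smul]

theorem sgn_mul_self (σ : Finset (Fin (n + 1))) (j : Fin (n + 1)) : sgn σ j * sgn σ j = 1 := by
  rw [sgn, ← mul_pow, neg_one_mul, neg_neg, one_pow]

theorem card_filter_insert {σ : Finset (Fin (n + 1))} {v : Fin (n + 1)} (hv : v ∉ σ)
    (j : Fin (n + 1)) : ((insert v σ).filter (· < j)).card =
      (σ.filter (· < j)).card + if v < j then 1 else 0 := by
  rw [Finset.filter_insert]
  split_ifs with h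
  · rw [Finset.card_insert_of_notMem (by simp [hv])]
  · rfl

theorem card_filter_erase {σ : Finset (Fin (n + 1))} {v : Fin (n + 1)} (hv : v ∈ σ)
    (j : Fin (n + 1)) : (σ.filter (· < j)).card =
      ((σ.erase v).filter (· < j)).card + if v < j then 1 else 0 := by
  conv_lhs => rw [← Finset.insert_erase hv]
  exact card_filter_insert (Finset.notMem_erase v σ) j

theorem sgn_insert {σ : Finset (Fin (n + 1))} {v : Fin (n + 1)} (hv : v ∉ σ) (j : Fin (n + 1)) :
    sgn (insert v σ) j = if v < j then -sgn σ j else sgn σ j := by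
  unfold sgn
  rw [card_filter_insert hv]
  split_ifs
  · rw [pow_succ, mul_neg_one]
  · rw [add_zero]

theorem sgn_erase {σ : Finset (Fin (n + 1))} {v : Fin (n + 1)} (hv : v ∈ σ) (j : Fin (n + 1)) :
    sgn (σ.erase v) j = if v < j then -sgn σ j else sgn σ j := by
  have h := sgn_insert (Finset.notMem_erase v σ) j
  rw [Finset.insert_erase hv] at h
  split_ifs at h ⊢ <;> rw [h]
  rw [neg_neg]

theorem val_succAbove (p : Fin (n + 1)) (v : Fin n) :
    (p.succAbove v).val = if v.val < p.val then v.val else v.val + 1 := by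
  unfold Fin.succAbove
  simp only [Fin.lt_def, Fin.val_castSucc]
  split_ifs <;> rfl

theorem val_predAbove (p : Fin n) (v : Fin (n + 1)) :
    (p.predAbove v).val = if p.val < v.val then v.val - 1 else v.val := by
  unfold Fin.predAbove
  simp only [Fin.lt_def, Fin.val_castSucc]
  split_ifs <;> rfl

/-! ### The elementary moves -/

section moves

variable (i : Fin n) (k : ℕ)

/-- The map of vertices that sends `i` to `i + 1` and fixes the others. -/
def bump (v : Fin (n + 1)) : Fin (n + 1) := if v = i.castSucc then i.succ else v

/-- The homotopy on the `n`-simplex that defines the move. -/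
noncomputable def moveK : Chain n →ₗ[ℤ] Chain n :=
  Finsupp.linearCombination ℤ fun σ =>
    -- Without the bound `k` this is the usual homotopy from the identity to `bump i`. The bound
    -- restricts the deformation to faces with few vertices before `i`.
    if i.castSucc ∈ σ ∧ i.succ ∉ σ ∧ (σ.filter (· < i.castSucc)).card ≤ k then
      sgn σ i.castSucc • Finsupp.single (insert i.succ σ) (1 : ℤ) else 0

/-- The homotopy on the `(n+1)`-simplex that defines the homotopy of the move. -/
noncomputable def moveZ : Chain (n + 1) →ₗ[ℤ] Chain n :=
  Finsupp.linearCombination ℤ fun σ =>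
    if i.castSucc.castSucc ∉ σ ∧ i.succ.castSucc ∈ σ ∧
        (σ.filter (· < i.castSucc.castSucc)).card ≤ k then
      sgn σ i.castSucc.castSucc •
        push i.succ.predAbove (Finsupp.single (insert i.castSucc.castSucc σ) (1 : ℤ)) else 0

theorem moveK_single (σ : Finset (Fin (n + 1))) : moveK i k (Finsupp.single σ 1) =
    if i.castSucc ∈ σ ∧ i.succ ∉ σ ∧ (σ.filter (· < i.castSucc)).card ≤ k then
      sgn σ i.castSucc • Finsupp.single (insert i.succ σ) (1 : ℤ) else 0 := by
  simp [moveK]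

theorem moveZ_single (σ : Finset (Fin (n + 2))) : moveZ i k (Finsupp.single σ 1) =
    if i.castSucc.castSucc ∉ σ ∧ i.succ.castSucc ∈ σ ∧
        (σ.filter (· < i.castSucc.castSucc)).card ≤ k then
      sgn σ i.castSucc.castSucc •
        push i.succ.predAbove (Finsupp.single (insert i.castSucc.castSucc σ) (1 : ℤ)) else 0 := by
  simp [moveZ]

/-- The move. -/
noncomputable def moveE : Chain n →ₗ[ℤ] Chain n :=
  LinearMap.id + (bd n).comp (moveK i k) + (moveK i k).comp (bd n)

/-- The homotopy of the move. -/
noncomputable def moveT : Chain (n + 1) →ₗ[ℤ] Chain n :=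
  push i.castSucc.predAbove + (bd n).comp (moveZ i k) + (moveZ i k).comp (bd (n + 1))

theorem moveE_apply (c : Chain n) :
    moveE i k c = c + bd n (moveK i k c) + moveK i k (bd n c) := rfl

theorem moveT_apply (c : Chain (n + 1)) :
    moveT i k c = push i.castSucc.predAbove c + bd n (moveZ i k c) + moveZ i k (bd (n + 1) c) := rfl

theorem linearMap_ext {M : Type*} [AddCommGroup M] {L L' : Chain n →ₗ[ℤ] M}
    (h : ∀ σ, L (Finsupp.single σ 1) = L' (Finsupp.single σ 1)) (c : Chain n) : L c = L' c :=
  linear_eq_of_support L L' c fun σ _ => h σ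

theorem push_succAbove_single (j : Fin (n + 2)) (σ : Finset (Fin (n + 1))) :
    push j.succAbove (Finsupp.single σ 1) = Finsupp.single (σ.image j.succAbove) 1 := by
  classical
  rw [push_single, if_pos Fin.succAbove_right_injective.injOn]

theorem bd_push_succAbove (j : Fin (n + 2)) (c : Chain n) :
    bd (n + 1) (push j.succAbove c) = push j.succAbove (bd n c) :=
  push_bd (SimplexCategory.δ j).toOrderHom c

theorem moveZ_push_succ (c : Chain n) : moveZ i k (push i.succ.castSucc.succAbove c) = 0 := by
  refine linearMap_ext (L := (moveZ i k).comp (push i.succ.castSucc.succAbove)) (L' := 0) (fun σ => ?_) c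
  rw [LinearMap.comp_apply, push_succAbove_single, moveZ_single, if_neg]
  · rfl
  · rintro ⟨-, h, -⟩
    obtain ⟨v, -, hv⟩ := Finset.mem_image.1 h
    exact Fin.succAbove_ne _ _ hv

/-- The homotopy is designed as a map on the `(n+1)`-simplex with two prescribed faces: the identity
opposite to `i + 1`, because `moveZ` vanishes on faces without `i + 1`, and the move opposite to `i`
(`moveT_push_castSucc`). -/
theorem moveT_push_succ (c : Chain n) : moveT i k (push i.succ.castSucc.succAbove c) = c := by
  rw [moveT_apply, moveZ_push_succ, bd_push_succAbove, moveZ_push_succ, map_zero, add_zero, add_zero,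
    push_push]
  have : i.castSucc.predAbove ∘ i.succ.castSucc.succAbove = _root_.id := by
    funext v
    refine Fin.ext ?_
    simp only [Function.comp, val_predAbove, val_succAbove, Fin.val_castSucc, Fin.val_succ, _root_.id]
    split_ifs <;> omega
  rw [this, push_id]

theorem card_filter_image_succAbove (σ : Finset (Fin (n + 1))) :
    ((σ.image i.castSucc.castSucc.succAbove).filter (· < i.castSucc.castSucc)).card =
      (σ.filter (· < i.castSucc)).card := by
  rw [Finset.filter_image, Finset.card_image_of_injective _ Fin.succAbove_right_injective]
  congr 1
  refine Finset.filter_congr fun v _ => ?_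
  simp only [Fin.lt_def, val_succAbove, Fin.val_castSucc]
  split_ifs <;> omega

theorem predAbove_comp_succAbove :
    i.succ.predAbove ∘ i.castSucc.castSucc.succAbove = bump i := by
  funext v
  refine Fin.ext ?_
  simp only [Function.comp, val_predAbove, val_succAbove, bump, Fin.val_castSucc, Fin.val_succ,
    Fin.ext_iff, apply_ite Fin.val]
  split_ifs <;> omega

/-- Opposite to `i`, the vertices from `i` on are shifted by one. Adding `i` and then identifying `i
+ 1` with `i + 2` has the effect of `bump i` on the original face, with `i` added. If `i ∈ σ` and `i
+ 1 ∉ σ` this is `insert (i + 1) σ`; if both lie in `σ` it is degenerate. -/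
theorem moveZ_push_castSucc (c : Chain n) :
    moveZ i k (push i.castSucc.castSucc.succAbove c) = moveK i k c := by
  classical
  refine linearMap_ext (L := (moveZ i k).comp (push i.castSucc.castSucc.succAbove)) (fun σ => ?_) c
  rw [LinearMap.comp_apply, push_succAbove_single, moveZ_single, moveK_single,
    card_filter_image_succAbove]
  have h₁ : i.castSucc.castSucc ∉ σ.image i.castSucc.castSucc.succAbove := by
    intro h
    obtain ⟨v, -, hv⟩ := Finset.mem_image.1 h
    exact Fin.succAbove_ne _ _ hv
  have h₂ : i.succ.castSucc ∈ σ.image i.castSucc.castSucc.succAbove ↔ i.castSucc ∈ σ := by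
    rw [Finset.mem_image]
    constructor
    · rintro ⟨v, hv, e⟩
      have e' := congrArg Fin.val e
      simp only [val_succAbove, Fin.val_castSucc, Fin.val_succ] at e'
      rwa [show i.castSucc = v from Fin.ext (by simp only [Fin.val_castSucc]; split_ifs at e' <;> omega)]
    · exact fun h => ⟨_, h, Fin.ext (by simp)⟩
  have h₃ : sgn (σ.image i.castSucc.castSucc.succAbove) i.castSucc.castSucc = sgn σ i.castSucc := by
    rw [sgn, sgn, card_filter_image_succAbove]
  simp only [h₂]
  rw [h₃, push_single, Finset.image_insert, Finset.image_image, predAbove_comp_succAbove]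
  by_cases hlo : i.castSucc ∈ σ
  swap
  · rw [if_neg (fun h => hlo h.2.1), if_neg (fun h => hlo h.1)]
  have hp : i.succ.predAbove i.castSucc.castSucc = i.castSucc :=
    Fin.ext (by simp [val_predAbove])
  by_cases hhi : i.succ ∈ σ
  · rw [if_neg (c := i.castSucc ∈ σ ∧ i.succ ∉ σ ∧ _) (fun h => h.2.1 hhi), if_neg (c := Set.InjOn _ _),
      smul_zero, ite_self]
    intro hinj
    have := hinj (x₁ := i.succ.castSucc) (x₂ := i.castSucc.castSucc.succAbove i.succ)
      (Finset.mem_insert_of_mem (h₂.2 hlo)) (Finset.mem_insert_of_mem (Finset.mem_image_of_mem _ hhi))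
      (Fin.ext (by simp [val_predAbove, val_succAbove]))
    have := congrArg Fin.val this
    simp [val_succAbove] at this
  · rw [if_pos (c := Set.InjOn _ _), hp]
    · have himg : insert i.castSucc (σ.image (bump i)) = insert i.succ σ := by
        ext v
        simp only [Finset.mem_insert, Finset.mem_image, bump]
        constructor
        · rintro (rfl | ⟨w, hw, rfl⟩)
          · exact Or.inr hlo
          · split_ifs
            · exact Or.inl rfl
            · exact Or.inr hw
        · rintro (rfl | hv)
          · exact Or.inr ⟨_, hlo, if_pos rfl⟩
          · by_cases h : v = i.castSucc
            · exact Or.inl h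
            · exact Or.inr ⟨v, hv, if_neg h⟩
      rw [himg]
      simp only [h₁, not_false_iff, true_and, hlo, hhi]
    · have hval : ∀ v ∈ (insert i.castSucc.castSucc (σ.image i.castSucc.castSucc.succAbove) :
          Finset _), v.val ≠ i.val + 2 := by
        intro v hv e
        rcases Finset.mem_insert.1 hv with rfl | hv
        · simp at e
        · obtain ⟨w, hw, rfl⟩ := Finset.mem_image.1 hv
          refine hhi ?_
          simp only [val_succAbove, Fin.val_castSucc] at e
          rwa [show i.succ = w from Fin.ext (by simp only [Fin.val_succ]; split_ifs at e <;> omega)]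
      intro a ha b hb hab
      have h₁ := hval a ha
      have h₂ := hval b hb
      have e := congrArg Fin.val hab
      simp only [val_predAbove, Fin.val_succ] at e
      exact Fin.ext (by split_ifs at e <;> omega)

theorem moveT_push_castSucc (c : Chain n) :
    moveT i k (push i.castSucc.castSucc.succAbove c) = moveE i k c := by
  rw [moveT_apply, moveZ_push_castSucc, bd_push_succAbove, moveZ_push_castSucc, push_push,
    moveE_apply]
  have : i.castSucc.predAbove ∘ i.castSucc.castSucc.succAbove = _root_.id := by
    funext v
    refine Fin.ext ?_
    simp only [Function.comp, val_predAbove, val_succAbove, Fin.val_castSucc, _root_.id]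
    split_ifs <;> omega
  rw [this, push_id]

theorem push_pair_eq_zero {f : Fin (m + 1) → Fin (n + 1)} {σ : Finset (Fin (m + 1))}
    {a b : Fin (m + 1)} (ha : a ∈ σ) (hb : b ∈ σ) (hne : a ≠ b) (h : f a = f b) :
    push f (Finsupp.single σ 1) = 0 := by
  classical
  rw [push_single, if_neg fun hf => hne (hf ha hb h)]

/-- The homotopy of the move on the faces that contain both vertices. -/
theorem moveT_single {σ : Finset (Fin (n + 2))} (h₀ : i.castSucc.castSucc ∈ σ)
    (h₁ : i.succ.castSucc ∈ σ) : moveT i k (Finsupp.single σ 1) =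
      if (σ.filter (· < i.castSucc.castSucc)).card ≤ k then
        push i.succ.predAbove (Finsupp.single σ 1) else 0 := by
  have hne : i.castSucc.castSucc ≠ i.succ.castSucc := by simp [Fin.ext_iff]
  rw [moveT_apply, moveZ_single, if_neg (fun h => h.1 h₀), map_zero, add_zero,
    push_pair_eq_zero h₀ h₁ hne (Fin.ext (by simp)), zero_add, map_single_bd,
    Finset.sum_eq_single_of_mem _ h₀]
  · have hf := card_filter_erase h₀ i.castSucc.castSucc
    rw [if_neg (lt_irrefl _), add_zero] at hf
    rw [moveZ_single, ← hf, Finset.insert_erase h₀, sgn_erase h₀, if_neg (lt_irrefl _)]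
    by_cases hk : (σ.filter (· < i.castSucc.castSucc)).card ≤ k
    · rw [if_pos ⟨Finset.notMem_erase _ _, Finset.mem_erase.2 ⟨hne.symm, h₁⟩, hk⟩, if_pos hk,
        smul_smul, sgn_mul_self, one_smul]
    · rw [if_neg (fun h => hk h.2.2), if_neg hk, smul_zero]
  · intro j hj hji
    rw [moveZ_single, if_neg (fun h => h.1 (Finset.mem_erase.2 ⟨hji.symm, h₀⟩)), smul_zero]

theorem sgn_succ {σ : Finset (Fin (n + 1))} (hlo : i.castSucc ∈ σ) :
    sgn σ i.succ = -sgn σ i.castSucc := by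
  unfold sgn
  rw [show σ.filter (· < i.succ) = insert i.castSucc (σ.filter (· < i.castSucc)) from ?_,
    Finset.card_insert_of_notMem (by simp), pow_succ, mul_neg_one]
  ext v
  simp only [Finset.mem_filter, Finset.mem_insert, Fin.lt_def, Fin.ext_iff, Fin.val_succ,
    Fin.val_castSucc]
  constructor
  · rintro ⟨h, h'⟩
    by_cases e : v.val = i.val
    · exact Or.inl e
    · exact Or.inr ⟨h, by omega⟩
  · rintro (e | ⟨h, h'⟩)
    · exact ⟨by rwa [show v = i.castSucc from Fin.ext e], by omega⟩
    · exact ⟨h, by omega⟩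

/-- The move on the faces with few vertices before the `i`-th one. -/
theorem moveE_single_of_le {σ : Finset (Fin (n + 1))}
    (hk : (σ.filter (· < i.castSucc)).card ≤ k) :
    moveE i k (Finsupp.single σ 1) = push (bump i) (Finsupp.single σ 1) := by
  classical
  have hne : i.castSucc ≠ i.succ := by simp [Fin.ext_iff]
  have hlt : i.castSucc < i.succ := Fin.castSucc_lt_succ
  rw [moveE_apply, map_single_bd]
  by_cases hlo : i.castSucc ∈ σ
  swap
  · have hb : ∀ v ∈ σ, bump i v = v := fun v hv =>
      if_neg fun e : v = i.castSucc => hlo (e ▸ hv)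
    have hinj : Set.InjOn (bump i) σ := fun a ha b hb' e => by rwa [hb a ha, hb b hb'] at e
    rw [moveK_single, if_neg (fun h => hlo h.1), map_zero, add_zero, Finset.sum_eq_zero, add_zero,
      push_single, if_pos hinj, Finset.image_congr (g := _root_.id) (fun v hv => hb v hv), Finset.image_id]
    intro j hj
    rw [moveK_single, if_neg (fun h => hlo (Finset.mem_of_mem_erase h.1)), smul_zero]
  by_cases hhi : i.succ ∈ σ
  -- With both vertices in `σ` the image under `bump` is degenerate, and the facet without `i + 1`
  -- contributes exactly `-σ`.
  · rw [moveK_single, if_neg (fun h => h.2.1 hhi), map_zero, add_zero,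
      Finset.sum_eq_single_of_mem _ hhi,
      push_pair_eq_zero hlo hhi hne (by rw [bump, bump, if_pos rfl, if_neg hne.symm])]
    · have hf := card_filter_erase hhi i.castSucc
      rw [if_neg hlt.asymm, add_zero] at hf
      rw [moveK_single, if_pos ⟨Finset.mem_erase.2 ⟨hne, hlo⟩, Finset.notMem_erase _ _, hf ▸ hk⟩,
        Finset.insert_erase hhi, smul_smul, sgn_erase hhi, if_neg hlt.asymm]
      rw [sgn_succ i hlo, neg_mul, sgn_mul_self]
      simp
    · intro j hj hji
      rw [moveK_single, if_neg (fun h => h.2.1 (Finset.mem_erase.2 ⟨hji.symm, hhi⟩)), smul_zero]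
  -- In the boundary of `insert (i + 1) σ`, the facet `σ` cancels the identity term, the facet
  -- without `i` is the image under `bump`, and the others cancel against the homotopy of the
  -- boundary of `σ`.
  · have hK : moveK i k (Finsupp.single σ 1) =
        sgn σ i.castSucc • Finsupp.single (insert i.succ σ) (1 : ℤ) := by
      rw [moveK_single, if_pos ⟨hlo, hhi, hk⟩]
    have hinj : Set.InjOn (bump i) σ := by
      intro a ha b hb e
      unfold bump at e
      split_ifs at e with h₁ h₂ h₂
      · rw [h₁, h₂]
      · exact absurd (e ▸ hb) hhi
      · exact absurd (e ▸ ha) hhi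
      · exact e
    have himg : σ.image (bump i) = (insert i.succ σ).erase i.castSucc := by
      ext v
      simp only [Finset.mem_image, Finset.mem_erase, Finset.mem_insert, bump]
      constructor
      · rintro ⟨w, hw, rfl⟩
        split_ifs with h
        · exact ⟨hne.symm, Or.inl rfl⟩
        · exact ⟨h, Or.inr hw⟩
      · rintro ⟨h, rfl | hv⟩
        · exact ⟨_, hlo, if_pos rfl⟩
        · exact ⟨v, hv, if_neg h⟩
    rw [hK, map_smul, bd_single, Finset.sum_insert hhi, Finset.erase_insert hhi, push_single,
      if_pos hinj, himg, sgn_insert hhi, if_neg (lt_irrefl _)]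
    rw [sgn_succ i hlo, smul_add, Finset.smul_sum, add_assoc, add_assoc, ← Finset.sum_add_distrib,
      Finset.sum_eq_single_of_mem _ hlo]
    · rw [moveK_single, if_neg (fun h => Finset.notMem_erase _ _ h.1), smul_zero, add_zero,
        smul_single_sgn, smul_smul, sgn_insert hhi, if_neg hlt.asymm, sgn_mul_self, one_smul,
        ← add_assoc, Finsupp.smul_single, smul_eq_mul, mul_neg, sgn_mul_self]
      simp
    · intro j hj hji
      have hf := card_filter_erase hj i.castSucc
      have hjs : j ≠ i.succ := fun e => hhi (e ▸ hj)
      rw [moveK_single, if_pos ⟨Finset.mem_erase.2 ⟨hji.symm, hlo⟩,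
        fun h => hhi (Finset.mem_of_mem_erase h), by omega⟩, smul_single_sgn, smul_smul, smul_smul,
        Finset.erase_insert_of_ne hjs.symm, ← add_smul, sgn_insert hhi, sgn_erase hj]
      have : i.succ < j ↔ ¬ j < i.castSucc := by
        have h₁ : j.val ≠ i.val := fun e => hji (Fin.ext e)
        have h₂ : j.val ≠ i.val + 1 := fun e => hjs (Fin.ext e)
        simp only [Fin.lt_def, Fin.val_succ, Fin.val_castSucc]
        omega
      by_cases hji' : j < i.castSucc
      · rw [if_neg (fun h => this.1 h hji'), if_pos hji', mul_neg, mul_comm, add_neg_cancel, zero_smul]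
      · rw [if_pos (this.2 hji'), if_neg hji', mul_neg, mul_comm, neg_add_cancel, zero_smul]

end moves

end Simplex

namespace Simplex

variable {l m n : ℕ}

/-! ### Linear maps that induce omega-functors -/

/-- A chain map with nonnegative coefficients. -/
structure PosMap (m n : ℕ) where
  /-- the linear map -/
  lin : Chain m →ₗ[ℤ] Chain n
  nonneg : ∀ σ τ, 0 ≤ lin (Finsupp.single σ 1) τ
  homog : ∀ σ, lin (Finsupp.single σ 1) ∈ homog n σ.card
  bd : ∀ c, bd n (lin c) = lin (bd m c)
  empty : lin (Finsupp.single ∅ 1) = Finsupp.single ∅ 1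

namespace PosMap

theorem nonneg_of_nonneg (f : PosMap m n) {c : Chain m} (hc : ∀ σ, 0 ≤ c σ) (τ) :
    0 ≤ f.lin c τ := by
  have h := linear_eq_of_support ((Finsupp.lapply τ).comp f.lin)
    (pair fun σ => f.lin (Finsupp.single σ 1) τ) c fun σ _ => by
      rw [pair_single, one_mul]; rfl
  exact h.symm ▸ pair_nonneg (fun σ => f.nonneg σ τ) hc

theorem lin_mem_homog (f : PosMap m n) {d : ℕ} {c : Chain m} (hc : c ∈ Simplex.homog m d) :
    f.lin c ∈ Simplex.homog n d :=
  map_mem_homog _ (fun σ hσ => hσ ▸ f.homog σ) hc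

/-- The image of a morphism. -/
noncomputable def apply (f : PosMap m n) (x : Cell m) : Cell n where
  chain β q := f.lin (x.chain β q)
  card_eq β q σ h := mem_homog.1 (f.lin_mem_homog (mem_homog.2 (x.card_eq β q))) σ h
  nonneg β q := f.nonneg_of_nonneg (x.nonneg β q)
  aug β := by rw [f.bd, x.aug, f.empty]
  bd_succ β q := by rw [f.bd, x.bd_succ, map_sub]

theorem apply_d (f : PosMap m n) (α : Bool) (k : ℕ) (x : Cell m) :
    f.apply (x.d α k) = (f.apply x).d α k := by
  refine Cell.ext (funext fun β => funext fun q => ?_)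
  simp only [apply, Cell.d]
  split_ifs
  · rfl
  · rfl
  · exact map_zero _

/-- The omega-functor induced by a chain map with nonnegative coefficients. -/
noncomputable def functor (f : PosMap m n) : OmegaFunctor (omegaCat m) (omegaCat n) where
  toFun x := f.apply x
  map_d α k x := f.apply_d α k x
  map_comp k x y h := by
    refine ⟨(f.apply_d true k x).symm.trans ((congrArg f.apply h).trans (f.apply_d false k y)), ?_⟩
    refine Cell.ext (funext fun β => funext fun q => ?_)
    show f.lin (if q < k then Cell.chain x β q else
        if q = k then (if β then Cell.chain y true k else Cell.chain x false k)
        else Cell.chain x β q + Cell.chain y β q) =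
      if q < k then f.lin (Cell.chain x β q) else
        if q = k then (if β then f.lin (Cell.chain y true k) else f.lin (Cell.chain x false k))
        else f.lin (Cell.chain x β q) + f.lin (Cell.chain y β q)
    split_ifs <;> simp

theorem functor_eq {f g : PosMap m n} (h : ∀ c, f.lin c = g.lin c) : f.functor = g.functor :=
  OmegaFunctor.ext (funext fun _ => Cell.ext (funext fun _ => funext fun _ => h _))

/-- The identity. -/
noncomputable def id (n : ℕ) : PosMap n n where
  lin := LinearMap.id
  nonneg σ τ := by
    rw [LinearMap.id_apply, Finsupp.single_apply]
    split_ifs <;> simp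
  homog σ := single_mem_homog rfl 1
  bd _ := rfl
  empty := rfl

/-- Precomposition with a face map. -/
noncomputable def face (f : PosMap (m + 1) n) (j : Fin (m + 2)) : PosMap m n where
  lin := f.lin.comp (push j.succAbove)
  nonneg σ τ := by
    rw [LinearMap.comp_apply, push_succAbove_single]
    exact f.nonneg _ _
  homog σ := by
    rw [LinearMap.comp_apply]
    exact f.lin_mem_homog (push_mem_homog _ (single_mem_homog rfl 1))
  bd c := by rw [LinearMap.comp_apply, f.bd, bd_push_succAbove, LinearMap.comp_apply]
  empty := by
    rw [LinearMap.comp_apply, push_succAbove_single, Finset.image_empty, f.empty]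

theorem functor_face (f : PosMap (m + 1) n) (j : Fin (m + 2)) :
    (map (SimplexCategory.δ j).toOrderHom).trans f.functor = (f.face j).functor := rfl

/-- `f` factors on the faces that do not contain a given vertex `v < k` through the map that sends
`v` and the following vertices to the last one. -/
def Straight (f : PosMap n n) (k : ℕ) : Prop :=
  ∀ v < k, ∀ σ : Finset (Fin (n + 1)), (∀ j ∈ σ, j.val ≠ v) → f.lin (Finsupp.single σ 1) =
    f.lin (push (fun j => if j.val < v then j else Fin.last n) (Finsupp.single σ 1))

/-- If `j` were missing from `σ`, straightness at `j` would let `f` factor, on `σ`, through a map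
that sends both `a` and `b` to the last vertex, and `f` would kill `σ`. -/
theorem Straight.mem {f : PosMap n n} {k : ℕ} (hf : f.Straight k) {σ : Finset (Fin (n + 1))}
    {a b : Fin (n + 1)} (ha : a ∈ σ) (hb : b ∈ σ) (hab : a < b)
    (h : f.lin (Finsupp.single σ 1) ≠ 0) (j : Fin (n + 1)) (hj : j.val < k) (hja : j ≤ a) : j ∈ σ := by
  by_contra hjσ
  have hne : ∀ l ∈ σ, l.val ≠ j.val := fun l hl e => hjσ (Fin.ext e ▸ hl)
  refine h ((hf j.val hj σ hne).trans ?_)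
  rw [push_pair_eq_zero ha hb hab.ne, map_zero]
  have h₁ : ¬ a.val < j.val := not_lt.2 hja
  have h₂ : ¬ b.val < j.val := not_lt.2 (hja.trans hab.le)
  rw [if_neg h₁, if_neg h₂]

/-- The vertices before `i` of a face that contains the first `k` ones. -/
theorem filter_lt_eq {σ : Finset (Fin (n + 1))} {k : ℕ} {i : Fin (n + 1)} (hki : k ≤ i.val)
    (hlow : ∀ j : Fin (n + 1), j.val < k → j ∈ σ) (hk : (σ.filter (· < i)).card ≤ k) :
    σ.filter (· < i) = Finset.univ.filter fun j => j.val < k := by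
  refine (Finset.eq_of_subset_of_card_le (fun j hj => ?_) ?_).symm
  · rw [Finset.mem_filter] at hj ⊢
    exact ⟨hlow j hj.2, Fin.lt_def.2 (lt_of_lt_of_le hj.2 hki)⟩
  · rw [card_low (by omega)]
    exact hk

theorem moveE_single_of_lt {i : Fin n} {k : ℕ} {σ : Finset (Fin (n + 1))}
    (hk : k < (σ.filter (· < i.castSucc)).card) : moveE i k (Finsupp.single σ 1) =
      Finsupp.single σ 1 + ∑ j ∈ σ, sgn σ j • moveK i k (Finsupp.single (σ.erase j) 1) := by
  rw [moveE_apply, moveK_single, if_neg (fun h => absurd h.2.2 (not_le.2 hk)), map_zero, add_zero,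
    map_single_bd]

/-- Straightness of `f` removes the terms of bad sign. Suppose more than `k` vertices of `σ` precede
`i`. A surviving correction term omits some `j < i`, and its image face contains `i` and `i + 1`,
hence by `Straight.mem` the first `k` vertices; these are all that precede `i` once `j` is omitted.
So `j` and `i` come with the same sign, and the product of the signs is `1`. -/
theorem moveE_nonneg (f : PosMap n n) {i : Fin n} {k : ℕ} (hki : k < i.val) (hf : f.Straight k)
    (σ : Finset (Fin (n + 1))) (τ : Finset (Fin (n + 1))) :
    0 ≤ f.lin (moveE i k (Finsupp.single σ 1)) τ := by
  classical
  rcases le_or_gt (σ.filter (· < i.castSucc)).card k with hk | hk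
  · rw [moveE_single_of_le i k hk, push_single]
    split_ifs
    · exact f.nonneg _ _
    · simp
  · rw [moveE_single_of_lt hk, map_add, map_sum, Finsupp.add_apply, Finsupp.finsetSum_apply]
    refine add_nonneg (f.nonneg _ _) (Finset.sum_nonneg fun j hj => ?_)
    rw [map_smul, moveK_single]
    split_ifs with h
    swap
    · simp
    obtain ⟨hlo, hhi, hk'⟩ := h
    rw [map_smul, smul_smul]
    by_cases h0 : f.lin (Finsupp.single (insert i.succ (σ.erase j)) 1) = 0
    · rw [h0]; simp
    have hc := card_filter_erase hj i.castSucc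
    have hji : j < i.castSucc := by
      by_contra hji
      rw [if_neg hji] at hc
      omega
    have hmem := hf.mem (Finset.mem_insert_of_mem hlo) (Finset.mem_insert_self _ _)
      Fin.castSucc_lt_succ h0
    have hlow : ∀ v : Fin (n + 1), v.val < k → v ∈ σ.erase j := by
      intro v hv
      have hvi : v.val < i.val := by omega
      refine Finset.mem_of_mem_insert_of_ne (hmem v hv (Fin.le_def.2 hvi.le)) fun e => ?_
      rw [e, Fin.val_succ] at hvi
      omega
    have hfil := filter_lt_eq (i := i.castSucc) hki.le hlow hk'
    have hjk : k ≤ j.val := by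
      by_contra hjk
      exact Finset.notMem_erase j σ (hlow j (by omega))
    have hs : sgn σ j = sgn (σ.erase j) i.castSucc := by
      unfold sgn
      rw [hfil]
      congr 2
      ext v
      have hv := Finset.ext_iff.1 hfil v
      simp only [Finset.mem_filter, Finset.mem_erase, Finset.mem_univ, true_and] at hv ⊢
      rw [← hv]
      constructor
      · exact fun h => ⟨⟨h.2.ne, h.1⟩, h.2.trans hji⟩
      · intro h
        have := hv.1 h
        exact ⟨h.1.2, Fin.lt_def.2 (by omega)⟩
    rw [hs, sgn_mul_self, one_smul]
    exact f.nonneg _ _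

theorem moveZ_mem_homog (i : Fin n) (k : ℕ) {d : ℕ} {c : Chain (n + 1)}
    (hc : c ∈ Simplex.homog (n + 1) d) : moveZ i k c ∈ Simplex.homog n (d + 1) := by
  refine map_mem_homog _ (fun σ hσ => ?_) hc
  rw [moveZ_single]
  split_ifs with h
  · refine Submodule.smul_mem _ _ (push_mem_homog _ (single_mem_homog ?_ 1))
    rw [Finset.card_insert_of_notMem h.1, hσ]
  · exact Submodule.zero_mem _

theorem moveT_mem_homog (i : Fin n) (k : ℕ) (σ : Finset (Fin (n + 2))) :
    moveT i k (Finsupp.single σ 1) ∈ Simplex.homog n σ.card := by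
  rw [moveT_apply]
  have h := single_mem_homog (σ := σ) rfl 1
  refine Submodule.add_mem _ (Submodule.add_mem _ (push_mem_homog _ h)
    (bd_mem_homog (moveZ_mem_homog i k h))) ?_
  rw [map_single_bd]
  refine Submodule.sum_mem _ fun j hj => Submodule.smul_mem _ _ ?_
  have := moveZ_mem_homog i k (single_mem_homog (σ := σ.erase j) rfl 1)
  rwa [Finset.card_erase_of_mem hj, Nat.sub_add_cancel (Finset.card_pos.2 ⟨j, hj⟩)] at this

theorem exists_image_succAbove {j : Fin (n + 2)} {σ : Finset (Fin (n + 2))} (hj : j ∉ σ) :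
    ∃ ρ : Finset (Fin (n + 1)), ρ.image j.succAbove = σ := by
  refine ⟨Finset.univ.filter fun v => j.succAbove v ∈ σ, ?_⟩
  ext v
  simp only [Finset.mem_image, Finset.mem_filter, Finset.mem_univ, true_and]
  constructor
  · rintro ⟨w, hw, rfl⟩
    exact hw
  · intro hv
    obtain ⟨w, rfl⟩ := Fin.exists_succAbove_eq (x := v) (y := j) fun e => hj (e ▸ hv)
    exact ⟨w, hv, rfl⟩

theorem bd_bd (c : Chain n) : Simplex.bd n (Simplex.bd n c) = 0 := by
  refine linearMap_ext (L := (Simplex.bd n).comp (Simplex.bd n)) (L' := 0) (fun σ => ?_) c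
  rw [LinearMap.comp_apply, LinearMap.zero_apply]
  rcases Nat.lt_or_ge σ.card 2 with h | h
  · obtain h | h : σ.card = 0 ∨ σ.card = 1 := by omega
    · rw [Finset.card_eq_zero.1 h, bd_single, Finset.sum_empty, map_zero]
    · obtain ⟨v, rfl⟩ := Finset.card_eq_one.1 h
      rw [GlobeRep.bd_singleton, bd_single, Finset.sum_empty]
  · obtain ⟨q, hq⟩ := Nat.exists_eq_add_of_le' h
    have hσ : σ.Nonempty := Finset.card_pos.1 (by omega)
    rw [bd_single_eq hq, map_sub, ← atom_chain σ hσ, ← atom_chain σ hσ]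
    obtain _ | q := q
    · rw [Cell.aug, Cell.aug, sub_self]
    · rw [Cell.bd_succ, Cell.bd_succ, sub_self]

/-- The composition with the homotopy of a move. -/
noncomputable def moveT (f : PosMap n n) (i : Fin n) (k : ℕ) (hki : k < i.val) (hf : f.Straight k) :
    PosMap (n + 1) n where
  lin := f.lin.comp (Simplex.moveT i k)
  nonneg σ τ := by
    rw [LinearMap.comp_apply]
    -- A face of the `(n+1)`-simplex without `i + 1` is mapped by `f`, one without `i` by the
    -- composite of `f` and the move, and on one with both vertices `moveT` is zero or a map of
    -- vertices.
    by_cases h₁ : i.succ.castSucc ∈ σ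
    swap
    · obtain ⟨ρ, rfl⟩ := exists_image_succAbove h₁
      rw [← push_succAbove_single, moveT_push_succ]
      exact f.nonneg _ _
    by_cases h₀ : i.castSucc.castSucc ∈ σ
    swap
    · obtain ⟨ρ, rfl⟩ := exists_image_succAbove h₀
      rw [← push_succAbove_single, moveT_push_castSucc]
      exact f.moveE_nonneg hki hf _ _
    classical
    rw [moveT_single i k h₀ h₁, push_single]
    split_ifs
    · exact f.nonneg _ _
    · simp
    · simp
  homog σ := f.lin_mem_homog (moveT_mem_homog i k σ)
  bd c := by
    rw [LinearMap.comp_apply, f.bd, LinearMap.comp_apply, moveT_apply, moveT_apply]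
    simp only [map_add, bd_bd, map_zero, add_zero]
    rw [show push i.castSucc.predAbove (Simplex.bd (n + 1) c) = _ from
      (push_bd (SimplexCategory.σ i.castSucc).toOrderHom c).symm]
    rfl
  empty := by
    rw [LinearMap.comp_apply, moveT_apply, moveZ_single, if_neg (by simp), bd_single,
      Finset.sum_empty, map_zero, map_zero, add_zero, add_zero, push_single, if_pos (by simp),
      Finset.image_empty, f.empty]

/-- The composition with a move. -/
noncomputable def moveE (f : PosMap n n) (i : Fin n) (k : ℕ) (hki : k < i.val) (hf : f.Straight k) :
    PosMap n n := (f.moveT i k hki hf).face i.castSucc.castSucc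

section

variable (f : PosMap n n) (i : Fin n) (k : ℕ) (hki : k < i.val) (hf : f.Straight k)

theorem moveE_lin (c : Chain n) : (f.moveE i k hki hf).lin c = f.lin (Simplex.moveE i k c) :=
  congrArg f.lin (moveT_push_castSucc i k c)

theorem moveT_face_succ :
    ((f.moveT i k hki hf).face i.succ.castSucc).functor = f.functor :=
  functor_eq fun c => congrArg f.lin (moveT_push_succ i k c)

/-- The homotopy produces faces containing `i` and `i + 1` but still not `v`, and by `Straight.mem`
these are killed by `f`. -/
theorem moveE_lin_of_forall_ne {v : ℕ} (hv : v < k) {σ : Finset (Fin (n + 1))}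
    (hσ : ∀ j ∈ σ, j.val ≠ v) :
    (f.moveE i k hki hf).lin (Finsupp.single σ 1) = f.lin (Finsupp.single σ 1) := by
  have hK : ∀ τ : Finset (Fin (n + 1)), (∀ j ∈ τ, j.val ≠ v) →
      f.lin (moveK i k (Finsupp.single τ 1)) = 0 := by
    intro τ hτ
    rw [moveK_single]
    split_ifs with h
    swap
    · exact map_zero _
    rw [map_smul]
    by_contra hne
    have hne' : f.lin (Finsupp.single (insert i.succ τ) 1) ≠ 0 := fun e => hne (by rw [e, smul_zero])
    have hvi : v < i.val := by omega
    have := hf.mem (Finset.mem_insert_of_mem h.1) (Finset.mem_insert_self _ _) Fin.castSucc_lt_succ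
      hne' ⟨v, by omega⟩ hv (Fin.le_def.2 hvi.le)
    rcases Finset.mem_insert.1 this with e | h'
    · have := congrArg Fin.val e
      simp at this
      omega
    · exact hτ _ h' rfl
  rw [moveE_lin, moveE_apply, map_add, map_add, ← f.bd, hK σ hσ, map_zero, add_zero, map_single_bd,
    map_sum, Finset.sum_eq_zero, add_zero]
  intro j _
  rw [map_smul, hK _ fun l hl => hσ l (Finset.mem_of_mem_erase hl), smul_zero]

/-- Straightness below `k` concerns faces that miss a vertex before `k`, and on these the move does
not change `f`. -/
theorem moveE_straight : (f.moveE i k hki hf).Straight k := by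
  classical
  intro v hv σ hσ
  rw [f.moveE_lin_of_forall_ne i k hki hf hv hσ, hf v hv σ hσ, push_single]
  split_ifs with h
  · refine (f.moveE_lin_of_forall_ne i k hki hf hv fun j hj => ?_).symm
    obtain ⟨l, hl, rfl⟩ := Finset.mem_image.1 hj
    split_ifs with h'
    · exact h'.ne
    · rw [Fin.val_last]
      have := i.2
      omega
  · rw [map_zero, map_zero]

/-- A face `τ` with a nonzero contribution contains the first `k` vertices and `i`, and these are
its only vertices up to `i + 1`. Thus it omits both `k` and `i + 1`, preceded by `k` and `k + 1` of
its vertices. These parities differ, so `τ` lies neither in the source nor in the target. -/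
theorem lin_moveK_topChain (hki : k < i.val) (hf : f.Straight k) (β : Bool) (q : ℕ) : f.lin (moveK i k (topChain n β q)) = 0 := by
  rw [topChain, map_sum, map_sum]
  refine Finset.sum_eq_zero fun τ hτ => ?_
  rw [moveK_single]
  split_ifs with h
  swap
  · exact map_zero _
  obtain ⟨hlo, hhi, hk⟩ := h
  rw [map_smul]
  by_contra hne
  have hne' : f.lin (Finsupp.single (insert i.succ τ) 1) ≠ 0 := fun e => hne (by rw [e, smul_zero])
  have hmem := hf.mem (Finset.mem_insert_of_mem hlo) (Finset.mem_insert_self _ _)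
      Fin.castSucc_lt_succ hne'
  have hlow : ∀ v : Fin (n + 1), v.val < k → v ∈ τ := by
    intro v hv
    have hvi : v.val < i.val := by omega
    refine Finset.mem_of_mem_insert_of_ne (hmem v hv (Fin.le_def.2 hvi.le)) fun e => ?_
    rw [e, Fin.val_succ] at hvi
    omega
  have hfil := filter_lt_eq (i := i.castSucc) hki.le hlow hk
  have hkn : k < n + 1 := by omega
  have hkτ : (⟨k, hkn⟩ : Fin (n + 1)) ∉ τ := by
    intro h
    have : (⟨k, hkn⟩ : Fin (n + 1)) ∈ τ.filter (· < i.castSucc) :=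
      Finset.mem_filter.2 ⟨h, Fin.lt_def.2 hki⟩
    rw [hfil, Finset.mem_filter] at this
    exact lt_irrefl _ this.2
  have hk₁ : τ.filter (· < (⟨k, hkn⟩ : Fin (n + 1))) = Finset.univ.filter fun j => j.val < k := by
    ext v
    have := hlow v
    simp only [Finset.mem_filter, Finset.mem_univ, true_and, Fin.lt_def]
    tauto
  have hk₂ : τ.filter (· < i.succ) = insert i.castSucc (Finset.univ.filter fun j => j.val < k) := by
    rw [← hfil]
    ext v
    simp only [Finset.mem_filter, Finset.mem_insert, Fin.lt_def, Fin.val_succ, Fin.val_castSucc]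
    constructor
    · rintro ⟨h, h'⟩
      by_cases e : v.val = i.val
      · exact Or.inl (Fin.ext e)
      · exact Or.inr ⟨h, by omega⟩
    · rintro (rfl | ⟨h, h'⟩)
      · exact ⟨hlo, by simp⟩
      · exact ⟨h, by omega⟩
  have hgap := (Finset.mem_filter.1 hτ).2.2
  have g₁ := hgap _ hkτ
  have g₂ := hgap _ hhi
  rw [hk₁, card_low (by omega)] at g₁
  rw [hk₂, Finset.card_insert_of_notMem (by simp; omega), card_low (by omega), Nat.odd_add_one, g₁] at g₂
  exact iff_not_self g₂.symm

theorem bd_topChain_zero (n : ℕ) (β : Bool) : Simplex.bd n (topChain n β 0) = Finsupp.single ∅ 1 :=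
  Cell.aug (top n) β

theorem bd_topChain_succ (n : ℕ) (β : Bool) (q : ℕ) :
    Simplex.bd n (topChain n β (q + 1)) = topChain n false q - topChain n true q :=
  Cell.bd_succ (top n) β q

theorem moveE_apply_top : (f.moveE i k hki hf).apply (top n) = f.apply (top n) := by
  refine Cell.ext (funext fun β => funext fun q => ?_)
  show (f.moveE i k hki hf).lin (topChain n β q) = f.lin (topChain n β q)
  rw [moveE_lin, moveE_apply, map_add, map_add, ← f.bd, f.lin_moveK_topChain i k hki hf, map_zero,
    add_zero]
  obtain _ | q := q
  · rw [bd_topChain_zero, moveK_single, if_neg (by simp), map_zero, add_zero]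
  · rw [bd_topChain_succ, map_sub, map_sub, f.lin_moveK_topChain i k hki hf,
      f.lin_moveK_topChain i k hki hf, sub_zero, add_zero]

/-- The other faces of the homotopy of a move are thin. -/
theorem moveT_face_thin {j : Fin (n + 2)} (h₀ : j ≠ i.castSucc.castSucc) (h₁ : j ≠ i.succ.castSucc) :
    ((f.moveT i k hki hf).face j).lin (Finsupp.single Finset.univ 1) = 0 := by
  show f.lin (Simplex.moveT i k (push j.succAbove _)) = 0
  have himg : (Finset.univ : Finset (Fin (n + 1))).image j.succAbove = Finset.univ.erase j :=
    image_succAbove j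
  have m₀ : i.castSucc.castSucc ∈ Finset.univ.erase j := Finset.mem_erase.2 ⟨h₀.symm, Finset.mem_univ _⟩
  have m₁ : i.succ.castSucc ∈ Finset.univ.erase j := Finset.mem_erase.2 ⟨h₁.symm, Finset.mem_univ _⟩
  rw [push_succAbove_single, himg, moveT_single i k m₀ m₁]
  -- Without `i + 2`, the face has all `i > k` vertices before `i`, beyond the bound. Otherwise it
  -- contains `i + 1` and `i + 2`, which are identified.
  by_cases h₂ : j = i.succ.succ
  · rw [if_neg, map_zero]
    intro hk
    have : (Finset.univ.erase j).filter (· < i.castSucc.castSucc) =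
        Finset.univ.filter fun v => v.val < i.val := by
      ext v
      simp only [Finset.mem_filter, Finset.mem_erase, Finset.mem_univ, true_and, and_true, Fin.lt_def,
        Fin.val_castSucc]
      refine and_iff_right_of_imp fun h e => ?_
      rw [e, h₂] at h
      simp at h
      omega
    rw [this, card_low (by omega)] at hk
    omega
  · have m₂ : i.succ.succ ∈ Finset.univ.erase j := by simp [Ne.symm h₂]
    rw [push_pair_eq_zero m₁ m₂ (by simp [Fin.ext_iff]) (Fin.ext (by simp)),
      ite_self, map_zero]

end

end PosMap

end Simplex

namespace Simplex

variable {m n : ℕ}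

/-! ### The chains of the nerve of an omega-category -/

/-- The simplicial differential of the nerve of an omega-category. -/
noncomputable def nerveBoundary (n : ℕ) (A : OmegaCat.{v}) :
    (OmegaFunctor (omegaCat (n + 1)) A →₀ ℤ) →+ (OmegaFunctor (omegaCat n) A →₀ ℤ) :=
  ∑ i : Fin (n + 2), ((-1 : ℤ) ^ (i : ℕ)) •
    Cut.chainMap fun x => (map (SimplexCategory.δ i).toOrderHom).trans x

/-- The thin chains of the nerve of an omega-category. -/
noncomputable def nerveThin (n : ℕ) (A : OmegaCat.{v}) :
    AddSubgroup (OmegaFunctor (omegaCat n) A →₀ ℤ) :=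
  AddSubgroup.closure {c | ∃ x : OmegaFunctor (omegaCat n) A,
    A.dim (x (top n)) < n ∧ c = Finsupp.single x 1}

/-- The chains of the nerve of an omega-category that vanish in the reduced complex. -/
noncomputable def nerveNull (n : ℕ) (A : OmegaCat.{v}) :
    AddSubgroup (OmegaFunctor (omegaCat n) A →₀ ℤ) :=
  nerveThin n A ⊔ (nerveThin (n + 1) A).map (nerveBoundary n A)

theorem chainMap_single {S T : Type v} (f : S → T) (x : S) (a : ℤ) :
    Cut.chainMap f (Finsupp.single x a) = Finsupp.single (f x) a := Finsupp.mapDomain_single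

theorem nerveBoundary_single {A : OmegaCat.{v}} (x : OmegaFunctor (omegaCat (n + 1)) A) :
    nerveBoundary n A (Finsupp.single x 1) = ∑ i : Fin (n + 2), ((-1 : ℤ) ^ (i : ℕ)) •
      Finsupp.single ((map (SimplexCategory.δ i).toOrderHom).trans x) 1 := by
  simp only [nerveBoundary, AddMonoidHom.finsetSum_apply, AddMonoidHom.smul_apply]
  exact Finset.sum_congr rfl fun i _ => congrArg _ (chainMap_single _ _ _)

theorem single_mem_nerveThin {A : OmegaCat.{v}} {x : OmegaFunctor (omegaCat n) A}
    (h : A.dim (x (top n)) < n) : Finsupp.single x (1 : ℤ) ∈ nerveThin n A :=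
  AddSubgroup.subset_closure ⟨x, h, rfl⟩

theorem thin_mem_nerveNull {A : OmegaCat.{v}} {c : OmegaFunctor (omegaCat n) A →₀ ℤ}
    (h : c ∈ nerveThin n A) : c ∈ nerveNull n A := AddSubgroup.mem_sup_left h

theorem boundary_mem_nerveNull {A : OmegaCat.{v}} {c : OmegaFunctor (omegaCat (n + 1)) A →₀ ℤ}
    (h : c ∈ nerveThin (n + 1) A) : nerveBoundary n A c ∈ nerveNull n A :=
  AddSubgroup.mem_sup_right ⟨c, h, rfl⟩

/-- Two faces of a thin simplex whose other faces are thin are equal up to sign in the reduced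
complex. -/
theorem sub_mem_nerveNull {A : OmegaCat.{v}} (T : OmegaFunctor (omegaCat (n + 1)) A)
    (hT : A.dim (T (top (n + 1))) < n + 1) (i : Fin (n + 1))
    (h : ∀ j : Fin (n + 2), j ≠ i.castSucc → j ≠ i.succ →
      A.dim (((map (SimplexCategory.δ j).toOrderHom).trans T) (top n)) < n) :
    Finsupp.single ((map (SimplexCategory.δ i.succ).toOrderHom).trans T) 1 -
      Finsupp.single ((map (SimplexCategory.δ i.castSucc).toOrderHom).trans T) 1 ∈
        nerveNull n A := by
  have h₁ := boundary_mem_nerveNull (single_mem_nerveThin hT)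
  rw [nerveBoundary_single, ← Finset.add_sum_erase _ _ (Finset.mem_univ i.castSucc),
    ← Finset.add_sum_erase _ _ (Finset.mem_erase.2
      ⟨(show i.succ ≠ i.castSucc by simp [Fin.ext_iff]), Finset.mem_univ i.succ⟩), ← add_assoc] at h₁
  rw [AddSubgroup.add_mem_cancel_right] at h₁
  · have h₂ := AddSubgroup.zsmul_mem _ h₁ ((-1) ^ (i.val + 1))
    rw [smul_add, smul_smul, smul_smul, Fin.val_castSucc, Fin.val_succ, ← pow_add, ← pow_add,
      (show Odd (i.val + 1 + i.val) by grind).neg_one_pow,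
      (show Even (i.val + 1 + (i.val + 1)) by grind).neg_one_pow, one_smul, neg_one_smul,
      neg_add_eq_sub] at h₂
    exact h₂
  · refine AddSubgroup.sum_mem _ fun j hj => AddSubgroup.zsmul_mem _ (thin_mem_nerveNull
      (single_mem_nerveThin (h j ?_ ?_))) _
    · exact (Finset.mem_erase.1 (Finset.mem_erase.1 hj).2).1
    · exact (Finset.mem_erase.1 hj).1

/-! ### Straightening -/

theorem dim_lt_of_chain {x : Cell (n + 1)} (h : x.chain false (n + 1) Finset.univ = 0) :
    (omegaCat (n + 1)).dim x < n + 1 := by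
  refine Nat.lt_succ_of_le (((omegaCat (n + 1)).dim_le_iff _ _).2 fun α => ?_)
  have h₀ : x.chain false (n + 1) = 0 := by
    ext σ
    by_contra hne
    have hc := x.card_eq _ _ _ hne
    rw [Finset.eq_univ_of_card σ (by rw [hc, Fintype.card_fin])] at hne
    exact hne h
  have h₁ := x.bd_succ false n
  rw [h₀, map_zero] at h₁
  have h₂ : ∀ α β, x.chain α n = x.chain β n := by
    have := sub_eq_zero.1 h₁.symm
    intro α β
    cases α <;> cases β <;> first | rfl | exact this | exact this.symm
  have h₃ := x.bd_succ false (n + 1)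
  rw [x.chain_eq_zero _ (n + 1 + 1) (Nat.lt_succ_self _), map_zero, h₀, zero_sub, zero_eq_neg] at h₃
  refine Cell.ext (funext fun β => funext fun q => ?_)
  show (if q < n then x.chain β q else if q = n then x.chain α n else 0) = x.chain β q
  split_ifs with e₁ e₂
  · rfl
  · rw [e₂]; exact h₂ _ _
  · obtain rfl | e₃ : q = n + 1 ∨ n + 1 < q := by omega
    · cases β
      · exact h₀.symm
      · exact h₃.symm
    · exact (x.chain_eq_zero _ _ e₃).symm

namespace PosMap

/-- The homotopy of the move is an `(n+1)`-simplex in an omega-category of dimension `n`, hence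
thin. Its faces opposite to `i + 1` and `i` are `f` and the moved map, and the others are thin, so
`sub_mem_nerveNull` applies. -/
theorem moveE_null (f : PosMap n n) (i : Fin n) (k : ℕ) (hki : k < i.val) (hf : f.Straight k) :
    Finsupp.single f.functor (1 : ℤ) - Finsupp.single (f.moveE i k hki hf).functor 1 ∈
      nerveNull n (omegaCat n) := by
  have h := sub_mem_nerveNull (f.moveT i k hki hf).functor
    (Nat.lt_succ_of_le (dim_le n _)) i.castSucc fun j h₀ h₁ => ?_
  · rw [functor_face, functor_face, Fin.succ_castSucc, f.moveT_face_succ] at h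
    exact h
  · obtain _ | n := n
    · exact i.elim0
    · refine dim_lt_of_chain ?_
      show ((f.moveT i k hki hf).face j).lin (topChain (n + 1) false (n + 1)) Finset.univ = 0
      rw [topChain_eq, atomChain_of_card (by simp), f.moveT_face_thin i k hki hf h₀
        (by rwa [← Fin.succ_castSucc])]
      rfl

/-- Straightening a simplex at one more vertex. -/
theorem exists_straight_succ (f : PosMap n n) (k : ℕ) (hk : k < n) (hf : f.Straight k) :
    ∃ g : PosMap n n, g.Straight (k + 1) ∧ g.apply (top n) = f.apply (top n) ∧
      Finsupp.single f.functor (1 : ℤ) - Finsupp.single g.functor 1 ∈ nerveNull n (omegaCat n) := by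
  classical
  -- The moves are applied at `n - 1` down to `k + 1`. After the move at `i`, faces with no vertex
  -- in `[k, i)` are mapped as by `f` after sending the vertices from `i` on to the last. For `i = k
  -- + 1` this is straightness at `k`.
  suffices H : ∀ d i, i + d = n → k < i → ∃ g : PosMap n n, g.Straight k ∧
      g.apply (top n) = f.apply (top n) ∧
      Finsupp.single f.functor (1 : ℤ) - Finsupp.single g.functor 1 ∈ nerveNull n (omegaCat n) ∧
      ∀ σ : Finset (Fin (n + 1)), (∀ j ∈ σ, j.val < k ∨ i ≤ j.val) → g.lin (Finsupp.single σ 1) =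
        f.lin (push (fun j => if j.val < i then j else Fin.last n) (Finsupp.single σ 1)) by
    obtain ⟨g, h₁, h₂, h₃, h₄⟩ := H (n - (k + 1)) (k + 1) (by omega) (Nat.lt_succ_self k)
    have h₅ : ∀ σ : Finset (Fin (n + 1)), (∀ j ∈ σ, j.val ≠ k) → g.lin (Finsupp.single σ 1) =
        f.lin (push (fun j => if j.val < k then j else Fin.last n) (Finsupp.single σ 1)) := by
      intro σ hσ
      rw [h₄ σ fun j hj => by have := hσ j hj; omega]
      congr 1
      rw [push_single, push_single]
      have e : Set.EqOn (fun j : Fin (n + 1) => if j.val < k + 1 then j else Fin.last n)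
          (fun j => if j.val < k then j else Fin.last n) σ := by
        intro j hj
        have := hσ j hj
        by_cases hjk : j.val < k
        · simp only [hjk, show j.val < k + 1 by omega, if_true]
        · simp only [hjk, show ¬ j.val < k + 1 by omega, if_false]
      simp only [e.injOn_iff, Finset.image_congr e]
    refine ⟨g, fun v hv σ hσ => ?_, h₂, h₃⟩
    obtain hv | rfl : v < k ∨ v = k := by omega
    · exact h₁ v hv σ hσ
    -- `h₅` has `f` on its right-hand side, straightness has `g`. The two are reconciled by applying
    -- `h₅` again to the collapsed face, since the collapse is idempotent.
    · rw [h₅ σ hσ, push_single]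
      split_ifs with hinj
      · rw [h₅ _ fun j hj => ?_]
        · have e := push_push (fun j : Fin (n + 1) => if j.val < v then j else Fin.last n)
            (fun j : Fin (n + 1) => if j.val < v then j else Fin.last n) (Finsupp.single σ 1)
          rw [push_single, if_pos hinj] at e
          rw [e]
          have e' : (fun j : Fin (n + 1) => if j.val < v then j else Fin.last n) ∘
              (fun j : Fin (n + 1) => if j.val < v then j else Fin.last n) =
              fun j : Fin (n + 1) => if j.val < v then j else Fin.last n := by
            funext j
            simp only [Function.comp]
            split_ifs <;> rfl
          rw [e', push_single, if_pos hinj]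
        · obtain ⟨l, hl, rfl⟩ := Finset.mem_image.1 hj
          split_ifs with h'
          · exact h'.ne
          · rw [Fin.val_last]
            omega
      · rw [map_zero, map_zero]
  intro d
  induction d with
  | zero =>
    intro i hi hki
    refine ⟨f, hf, rfl, by rw [sub_self]; exact AddSubgroup.zero_mem _, fun σ _ => ?_⟩
    rw [show (fun j : Fin (n + 1) => if j.val < i then j else Fin.last n) = _root_.id from ?_, push_id]
    funext j
    split_ifs with h
    · rfl
    · exact Fin.ext (by rw [Fin.val_last]; simp only [_root_.id]; omega)
  | succ d ih =>
    intro i hi hki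
    obtain ⟨g, h₁, h₂, h₃, h₄⟩ := ih (i + 1) (by omega) (by omega)
    let i' : Fin n := ⟨i, by omega⟩
    refine ⟨g.moveE i' k hki h₁, g.moveE_straight i' k hki h₁,
      (g.moveE_apply_top i' k hki h₁).trans h₂, ?_, fun σ hσ => ?_⟩
    · have := AddSubgroup.add_mem _ h₃ (g.moveE_null i' k hki h₁)
      rwa [sub_add_sub_cancel] at this
    -- Only the first `k` vertices can precede `i` in `σ`, so on `σ` the move is just `bump`, and
    -- `bump` followed by the collapse from `i + 1` on is the collapse from `i` on.
    · have hcard : (σ.filter (· < i'.castSucc)).card ≤ k := by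
        rw [← card_low (n := n) (k := k) (by omega)]
        refine Finset.card_le_card fun j hj => ?_
        rw [Finset.mem_filter] at hj ⊢
        refine ⟨Finset.mem_univ _, ?_⟩
        have h₅ := hσ j hj.1
        have h₆ : j.val < i := hj.2
        omega
      rw [moveE_lin, moveE_single_of_le i' k hcard]
      have hcomp : (fun j : Fin (n + 1) => if j.val < i + 1 then j else Fin.last n) ∘ bump i' =
          fun j : Fin (n + 1) => if j.val < i then j else Fin.last n := by
        funext j
        have e : j = i'.castSucc ↔ j.val = i := Fin.ext_iff
        simp only [Function.comp, bump, e]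
        by_cases h : j.val = i
        · simp [h, i']
        · rw [if_neg h]
          split_ifs <;> first | rfl | omega
      have e := push_push (bump i') (fun j : Fin (n + 1) => if j.val < i + 1 then j else Fin.last n)
        (Finsupp.single σ 1)
      rw [hcomp] at e
      rw [← e, push_single]
      split_ifs with hinj
      · refine h₄ _ fun j hj => ?_
        obtain ⟨l, hl, rfl⟩ := Finset.mem_image.1 hj
        have := hσ l hl
        unfold bump
        split_ifs with hl'
        · right
          simp [i']
        · have : l.val ≠ i := fun e => hl' (Fin.ext e)
          omega
      · rw [map_zero, map_zero, map_zero]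

theorem exists_straight (n : ℕ) : ∃ f : PosMap n n, f.Straight n ∧ f.apply (top n) = top n ∧
    Finsupp.single (OmegaFunctor.id (omegaCat n)) (1 : ℤ) - Finsupp.single f.functor 1 ∈
      nerveNull n (omegaCat n) := by
  suffices H : ∀ k, k ≤ n → ∃ f : PosMap n n, f.Straight k ∧ f.apply (top n) = top n ∧
      Finsupp.single (OmegaFunctor.id (omegaCat n)) (1 : ℤ) - Finsupp.single f.functor 1 ∈
        nerveNull n (omegaCat n) from H n le_rfl
  intro k
  induction k with
  | zero =>
    refine fun _ => ⟨PosMap.id n, fun v hv => absurd hv (Nat.not_lt_zero v), rfl, ?_⟩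
    rw [show (PosMap.id n).functor = OmegaFunctor.id (omegaCat n) from rfl, sub_self]
    exact AddSubgroup.zero_mem _
  | succ k ih =>
    intro hk
    obtain ⟨f, h₁, h₂, h₃⟩ := ih (by omega)
    obtain ⟨g, h₄, h₅, h₆⟩ := f.exists_straight_succ k (by omega) h₁
    refine ⟨g, h₄, h₅.trans h₂, ?_⟩
    have := AddSubgroup.add_mem _ h₃ h₆
    rwa [sub_add_sub_cancel] at this

/-- The values of a straight map that preserves the top-dimensional face. -/
theorem Straight.lin_single {f : PosMap n n} (hf : f.Straight n) (htop : f.apply (top n) = top n)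
    {q : ℕ} {σ : Finset (Fin (n + 1))} (hσ : σ.card = q + 1) : f.lin (Finsupp.single σ 1) =
      psiLam n false σ • topChain n false q + psiLam n true σ • topChain n true q := by
  classical
  have htop' : ∀ β, f.lin (topChain n β q) = topChain n β q := fun β =>
    congrFun (congrFun (congrArg Cell.chain htop) β) q
  have hqn : q ≤ n := by
    have := Finset.card_le_univ σ
    rw [Fintype.card_fin] at this
    omega
  -- If `v < q` is missing from `τ`, at most `v` vertices of `τ` come before `v`, so at least two
  -- come after it; straightness at `v` identifies them.
  have hzero : ∀ τ : Finset (Fin (n + 1)), τ.card = q + 1 →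
      (¬ ∀ v : Fin (n + 1), v.val < q → v ∈ τ) → f.lin (Finsupp.single τ 1) = 0 := by
    intro τ hτ h
    push Not at h
    obtain ⟨v, hv, hvτ⟩ := h
    have h₁ : (τ.filter fun j => j.val < v.val).card ≤ v.val := by
      conv_rhs => rw [← card_low (n := n) (k := v.val) (by omega)]
      exact Finset.card_le_card (Finset.filter_subset_filter _ (Finset.subset_univ _))
    have h₂ := Finset.card_filter_add_card_filter_not (s := τ) fun j => j.val < v.val
    obtain ⟨a, ha, b, hb, hab⟩ := Finset.one_lt_card.1
      (show 1 < (τ.filter fun j => ¬ j.val < v.val).card by omega)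
    rw [Finset.mem_filter] at ha hb
    rw [hf v.val (by omega) τ fun j hj e => hvτ (Fin.ext e ▸ hj),
      push_pair_eq_zero ha.1 hb.1 hab, map_zero]
    rw [if_neg ha.2, if_neg hb.2]
  by_cases hlow : ∀ v : Fin (n + 1), v.val < q → v ∈ σ
  swap
  · have h₀ : ∀ δ, psiLam n δ σ = 0 := fun δ => by
      rw [psiLam, if_neg]
      rw [hσ]
      exact fun h => hlow h.1
    rw [hzero σ hσ hlow, h₀, h₀, zero_smul, zero_smul, add_zero]
  -- The side of `σ` under the folding; the claim becomes that `f` sends `σ` to the whole chain of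
  -- that side in degree `q`.
  set s : Bool := decide (q + 1 ≤ n ∧ Odd (if ∃ v ∈ σ, v.val = q then q + 1 else q)) with hs
  have hpsi : ∀ δ, psiLam n δ σ = if δ = s then 1 else 0 := fun δ => by
    unfold psiLam
    rw [hσ]
    simp only [Nat.add_sub_cancel, hs]
    exact if_congr (and_iff_right hlow) rfl rfl
  have hgoal : psiLam n false σ • topChain n false q + psiLam n true σ • topChain n true q =
      topChain n s q := by
    rw [hpsi, hpsi]
    cases s <;> simp
  -- As `f` fixes this chain, it suffices that a single face of it survives under `f` and has the
  -- same image as `σ`.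
  rw [hgoal, ← htop' s]
  rcases hqn.eq_or_lt with rfl | hqn
  · have hu : σ = Finset.univ := Finset.eq_univ_of_card _ (by rw [hσ, Fintype.card_fin])
    rw [topChain_eq, atomChain_of_card (by simp), hu]
  have hs' : s = decide (Odd (if ∃ v ∈ σ, v.val = q then q + 1 else q)) := by
    rw [hs]
    simp only [show q + 1 ≤ n by omega, true_and]
  have hlow1 : ∀ τ : Finset (Fin (n + 1)), τ.card = q + 1 → (∀ v : Fin (n + 1), v.val < q → v ∈ τ) →
      (∃ v ∈ τ, v.val = q) → τ = Finset.univ.filter fun v => v.val < q + 1 := by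
    intro τ hτ h₁ h₂
    refine (Finset.eq_of_subset_of_card_le (fun v hv => ?_) ?_).symm
    · rw [Finset.mem_filter] at hv
      obtain ⟨w, hw, e⟩ := h₂
      by_cases h : v.val < q
      · exact h₁ v h
      · rwa [show v = w from Fin.ext (by omega)]
    · rw [hτ, card_low (by omega)]
  have hlast : (Fin.last n : Fin (n + 1)) ∉ Finset.univ.filter fun v : Fin (n + 1) => v.val < q := by
    simp
    omega
  have hlow2 : ∀ τ : Finset (Fin (n + 1)), τ.card = q + 1 → (∀ v : Fin (n + 1), v.val < q → v ∈ τ) →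
      Fin.last n ∈ τ → τ = insert (Fin.last n) (Finset.univ.filter fun v => v.val < q) := by
    intro τ hτ h₁ h₂
    refine (Finset.eq_of_subset_of_card_le (fun v hv => ?_) ?_).symm
    · rcases Finset.mem_insert.1 hv with rfl | hv
      · exact h₂
      · exact h₁ v (Finset.mem_filter.1 hv).2
    · rw [hτ, Finset.card_insert_of_notMem hlast, card_low (by omega)]
  have hfilter : ∀ τ : Finset (Fin (n + 1)), (∀ v : Fin (n + 1), v.val < q → v ∈ τ) →
      ∀ j : Fin (n + 1), q ≤ j.val → (∀ v ∈ τ, v < j → v.val < q) → (τ.filter (· < j)).card = q := by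
    intro τ h₁ j hj h₂
    rw [← card_low (n := n) (k := q) (by omega)]
    congr 1
    ext v
    simp only [Finset.mem_filter, Finset.mem_univ, true_and]
    exact ⟨fun h => h₂ v h.1 h.2, fun h => ⟨h₁ v h, Fin.lt_def.2 (by omega)⟩⟩
  by_cases hq : ∃ v ∈ σ, v.val = q
  -- Here `σ = {0, ..., q}`. Another face with the first `q` vertices omits `q`, whose parity is
  -- that of the other side.
  · rw [if_pos hq] at hs'
    have hσ' := hlow1 σ hσ hlow hq
    have hall : ∀ j : Fin (n + 1), j ∉ σ → (σ.filter (· < j)).card = q + 1 := by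
      intro j hj
      rw [Finset.filter_true_of_mem, hσ]
      intro v hv
      rw [hσ', Finset.mem_filter] at hv hj
      simp only [Finset.mem_univ, true_and] at hv hj
      exact Fin.lt_def.2 (by omega)
    rw [topChain, map_sum, Finset.sum_eq_single_of_mem σ]
    · rw [topFaces, Finset.mem_filter]
      refine ⟨Finset.mem_univ _, hσ, fun j hj => ?_⟩
      rw [hall j hj, hs', decide_eq_true_eq]
    · intro τ hτ hne
      obtain ⟨hτc, hgap⟩ := (Finset.mem_filter.1 hτ).2
      refine hzero τ hτc fun h => hne ?_
      by_cases hqτ : ∃ v ∈ τ, v.val = q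
      · rw [hσ', hlow1 τ hτc h hqτ]
      · exfalso
        have h₁ := hgap ⟨q, by omega⟩ fun h' => hqτ ⟨_, h', rfl⟩
        rw [hfilter τ h _ le_rfl fun v _ hv => hv, hs', decide_eq_true_eq, Nat.odd_add_one] at h₁
        exact iff_not_self h₁
  -- Straightness at `q` replaces the free vertex of `σ` by the last one, giving `τ₀`. A surviving
  -- face of the chain must not contain `q` and must contain the last vertex, by parity at `q + 1`
  -- and at the last vertex; so it is `τ₀`.
  · rw [if_neg hq] at hs'
    set τ₀ : Finset (Fin (n + 1)) := insert (Fin.last n) (Finset.univ.filter fun v => v.val < q) with hτ₀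
    have hτ₀c : τ₀.card = q + 1 := by
      rw [Finset.card_insert_of_notMem hlast, card_low (by omega)]
    have hfσ : f.lin (Finsupp.single σ 1) = f.lin (Finsupp.single τ₀ 1) := by
      rw [hf q hqn σ fun j hj e => hq ⟨j, hj, e⟩, push_single]
      have himg : σ.image (fun j : Fin (n + 1) => if j.val < q then j else Fin.last n) = τ₀ := by
        ext v
        simp only [Finset.mem_image, hτ₀, Finset.mem_insert, Finset.mem_filter, Finset.mem_univ,
          true_and]
        constructor
        · rintro ⟨w, hw, rfl⟩
          split_ifs with h
          · exact Or.inr h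
          · exact Or.inl rfl
        · rintro (rfl | hv)
          · have : (σ.filter fun v => ¬ v.val < q).card = 1 := by
              rw [card_filter_ge (by omega) hlow, hσ]
              omega
            obtain ⟨w, hw⟩ := Finset.card_eq_one.1 this
            have hw' := Finset.mem_filter.1 (hw ▸ Finset.mem_singleton_self w)
            exact ⟨w, hw'.1, if_neg hw'.2⟩
          · exact ⟨v, hlow v hv, if_pos hv⟩
      rw [himg, if_pos]
      rw [← Finset.card_image_iff, himg, hτ₀c, hσ]
    rw [hfσ, topChain, map_sum, Finset.sum_eq_single_of_mem τ₀]
    · rw [topFaces, Finset.mem_filter]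
      refine ⟨Finset.mem_univ _, hτ₀c, fun j hj => ?_⟩
      rw [hτ₀, Finset.mem_insert, Finset.mem_filter] at hj
      simp only [Finset.mem_univ, true_and, not_or, not_lt] at hj
      rw [hfilter τ₀ (fun v hv => by simp [hτ₀, hv]) j hj.2 fun v hv hvj => ?_, hs',
        decide_eq_true_eq]
      rw [hτ₀, Finset.mem_insert, Finset.mem_filter] at hv
      rcases hv with rfl | hv
      · exact absurd hvj (not_lt.2 (Fin.le_last j))
      · exact hv.2
    · intro τ hτ hne
      obtain ⟨hτc, hgap⟩ := (Finset.mem_filter.1 hτ).2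
      refine hzero τ hτc fun h => ?_
      by_cases hqτ : ∃ v ∈ τ, v.val = q
      · have hτ' := hlow1 τ hτc h hqτ
        have h₁ := hgap ⟨q + 1, Nat.succ_lt_succ hqn⟩ fun h' => by
          rw [hτ', Finset.mem_filter] at h'
          exact lt_irrefl _ h'.2
        rw [Finset.filter_true_of_mem, hτc, hs', decide_eq_true_eq, Nat.odd_add_one] at h₁
        · exact iff_not_self h₁.symm
        · intro v hv
          rw [hτ', Finset.mem_filter] at hv
          exact Fin.lt_def.2 hv.2
      · refine hne (hlow2 τ hτc h ?_)
        by_contra hl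
        have h₁ := hgap (Fin.last n) hl
        rw [Finset.filter_true_of_mem, hτc, hs', decide_eq_true_eq, Nat.odd_add_one] at h₁
        · exact iff_not_self h₁.symm
        · intro v hv
          exact lt_of_le_of_ne (Fin.le_last v) fun e => hl (e ▸ hv)

/-- By `lin_single`, on chains `f` pairs with the coefficients of `psi` and multiplies by the source
and target chains of the top face. This is the table of the face of the top classified by the value
of `psi`. -/
theorem Straight.functor_eq {f : PosMap n n} (hf : f.Straight n) (htop : f.apply (top n) = top n) :
    f.functor = (psi.{u} n).trans (Globe.desc (top n)) := by
  refine OmegaFunctor.ext (funext fun x => Cell.ext (funext fun β => funext fun q => ?_))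
  have h₁ : f.lin (Cell.chain x β q) = pair (psiLam n false) (Cell.chain x β q) • topChain n false q +
      pair (psiLam n true) (Cell.chain x β q) • topChain n true q :=
    linear_eq_of_support f.lin ((pair (psiLam n false)).smulRight (topChain n false q) +
      (pair (psiLam n true)).smulRight (topChain n true q)) _ fun σ hσ => by
        rw [hf.lin_single htop (Cell.card_eq x β q σ hσ), LinearMap.add_apply,
          LinearMap.smulRight_apply, LinearMap.smulRight_apply, pair_single, pair_single, one_mul,
          one_mul]
  have h₂ := fun δ => (psiRep n).tab_functor_apply.{u} x β q δ
  refine h₁.trans ?_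
  have h₃ : ∀ g : GlobeCell.{u} n, (∀ δ, g.tab β q δ = pair (psiLam n δ) (Cell.chain x β q)) →
      pair (psiLam n false) (Cell.chain x β q) • topChain n false q +
        pair (psiLam n true) (Cell.chain x β q) • topChain n true q =
      if q < g.dim then topChain n β q else if q = g.dim then topChain n g.side g.dim else 0 := by
    intro g hg
    rw [← hg, ← hg]
    rcases lt_trichotomy q g.dim with h | h | h
    · rw [GlobeCell.tab_of_lt h, GlobeCell.tab_of_lt h, if_pos h]
      cases β <;> simp
    · rw [h, GlobeCell.tab_dim, GlobeCell.tab_dim, if_neg (lt_irrefl _), if_pos rfl]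
      cases g.side <;> simp
    · rw [GlobeCell.tab_of_gt h, GlobeCell.tab_of_gt h, if_neg h.not_gt, if_neg h.ne']
      simp
  exact h₃ _ h₂

end PosMap

/-- Folding is the identity in the reduced complex of the simplex. -/
theorem id_sub_psi_mem_nerveNull (n : ℕ) :
    Finsupp.single (OmegaFunctor.id (omegaCat n)) (1 : ℤ) -
      Finsupp.single ((psi.{u} n).trans (Globe.desc (top n))) 1 ∈ nerveNull n (omegaCat n) := by
  obtain ⟨f, h₁, h₂, h₃⟩ := PosMap.exists_straight n
  rwa [h₁.functor_eq h₂] at h₃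

end Simplex

namespace Simplex

variable {m n : ℕ}

/-! ### Chains of the nerve and omega-functors -/

/-- The map of chains of nerves induced by an omega-functor. -/
noncomputable def nerveMap (n : ℕ) {A : OmegaCat.{v}} {B : OmegaCat.{w}} (f : OmegaFunctor A B) :
    (OmegaFunctor (omegaCat n) A →₀ ℤ) →+ (OmegaFunctor (omegaCat n) B →₀ ℤ) :=
  Finsupp.mapDomain.addMonoidHom fun x => x.trans f

theorem nerveMap_single {A : OmegaCat.{v}} {B : OmegaCat.{w}} (f : OmegaFunctor A B)
    (x : OmegaFunctor (omegaCat n) A) (a : ℤ) :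
    nerveMap n f (Finsupp.single x a) = Finsupp.single (x.trans f) a := Finsupp.mapDomain_single

theorem nerveMap_trans {A : OmegaCat.{u}} {B : OmegaCat.{v}} {D : OmegaCat.{w}}
    (f : OmegaFunctor A B) (g : OmegaFunctor B D) (c : OmegaFunctor (omegaCat n) A →₀ ℤ) :
    nerveMap n g (nerveMap n f c) = nerveMap n (f.trans g) c := by
  refine DFunLike.congr_fun (f := (nerveMap n g).comp (nerveMap n f)) (Finsupp.addHom_ext fun x a => ?_) c
  rw [AddMonoidHom.comp_apply, nerveMap_single, nerveMap_single, nerveMap_single]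
  rfl

theorem nerveMap_boundary {A : OmegaCat.{v}} {B : OmegaCat.{w}} (f : OmegaFunctor A B)
    (c : OmegaFunctor (omegaCat (n + 1)) A →₀ ℤ) :
    nerveMap n f (nerveBoundary n A c) = nerveBoundary n B (nerveMap (n + 1) f c) := by
  refine DFunLike.congr_fun (f := (nerveMap n f).comp (nerveBoundary n A))
    (g := (nerveBoundary n B).comp (nerveMap (n + 1) f)) (Finsupp.addHom_ext fun x a => ?_) c
  rw [AddMonoidHom.comp_apply, AddMonoidHom.comp_apply, nerveMap_single]
  simp only [nerveBoundary, AddMonoidHom.finsetSum_apply, AddMonoidHom.smul_apply, map_sum]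
  refine Finset.sum_congr rfl fun i _ => ?_
  rw [map_zsmul]
  exact congrArg _ ((congrArg _ (chainMap_single _ _ _)).trans
    ((nerveMap_single _ _ _).trans
      (chainMap_single (fun x => (map (SimplexCategory.δ i).toOrderHom).trans x) (x.trans f) a).symm))

theorem nerveMap_mem_thin {A : OmegaCat.{v}} {B : OmegaCat.{w}} (f : OmegaFunctor A B)
    {c : OmegaFunctor (omegaCat n) A →₀ ℤ} (h : c ∈ nerveThin n A) :
    nerveMap n f c ∈ nerveThin n B := by
  refine (AddSubgroup.closure_le ((nerveThin n B).comap (nerveMap n f))).2 ?_ h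
  rintro _ ⟨x, hx, rfl⟩
  show nerveMap n f (Finsupp.single x 1) ∈ nerveThin n B
  rw [nerveMap_single]
  exact single_mem_nerveThin ((OmegaFunctor.dim_le f _).trans_lt hx)

theorem exists_of_mem_nerveNull {A : OmegaCat.{v}} {c : OmegaFunctor (omegaCat n) A →₀ ℤ}
    (h : c ∈ nerveNull n A) : ∃ τ ∈ nerveThin n A, ∃ ρ ∈ nerveThin (n + 1) A,
      c = τ + nerveBoundary n A ρ := by
  obtain ⟨τ, hτ, _, ⟨ρ, hρ, rfl⟩, e⟩ := AddSubgroup.mem_sup.1 h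
  exact ⟨τ, hτ, ρ, hρ, e.symm⟩

/-! ### Natural families of chains -/

variable {I : Type w} {E : I → OmegaCat.{v}} (R : ∀ i j, OmegaFunctor (E i) (E j) → Prop)

/-- The natural families of chains, with respect to given omega-functors. -/
noncomputable def naturalChains (n : ℕ) :
    AddSubgroup (∀ i, OmegaFunctor (omegaCat n) (E i) →₀ ℤ) where
  carrier := {c | ∀ i j f, R i j f → nerveMap n f (c i) = c j}
  zero_mem' _ _ _ _ := map_zero _
  add_mem' h h' i j f hf := (map_add _ _ _).trans (congrArg₂ _ (h i j f hf) (h' i j f hf))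
  neg_mem' h i j f hf := (map_neg _ _).trans (congrArg _ (h i j f hf))

/-- The natural families of chains that are naturally zero in the reduced complex. -/
noncomputable def naturalNull (n : ℕ) :
    AddSubgroup (∀ i, OmegaFunctor (omegaCat n) (E i) →₀ ℤ) where
  carrier := {c | ∃ τ ∈ naturalChains R n, ∃ ρ ∈ naturalChains R (n + 1), ∀ i,
    τ i ∈ nerveThin n (E i) ∧ ρ i ∈ nerveThin (n + 1) (E i) ∧
      c i = τ i + nerveBoundary n (E i) (ρ i)}
  zero_mem' := ⟨0, AddSubgroup.zero_mem _, 0, AddSubgroup.zero_mem _, fun i =>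
    ⟨AddSubgroup.zero_mem _, AddSubgroup.zero_mem _, by simp⟩⟩
  add_mem' := by
    rintro c c' ⟨τ, hτ, ρ, hρ, h⟩ ⟨τ', hτ', ρ', hρ', h'⟩
    refine ⟨τ + τ', AddSubgroup.add_mem _ hτ hτ', ρ + ρ', AddSubgroup.add_mem _ hρ hρ', fun i =>
      ⟨AddSubgroup.add_mem _ (h i).1 (h' i).1, AddSubgroup.add_mem _ (h i).2.1 (h' i).2.1, ?_⟩⟩
    rw [Pi.add_apply, Pi.add_apply, Pi.add_apply, map_add, (h i).2.2, (h' i).2.2]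
    abel
  neg_mem' := by
    rintro c ⟨τ, hτ, ρ, hρ, h⟩
    refine ⟨-τ, AddSubgroup.neg_mem _ hτ, -ρ, AddSubgroup.neg_mem _ hρ, fun i =>
      ⟨AddSubgroup.neg_mem _ (h i).1, AddSubgroup.neg_mem _ (h i).2.1, ?_⟩⟩
    rw [Pi.neg_apply, Pi.neg_apply, Pi.neg_apply, map_neg, (h i).2.2]
    abel

/-- The natural families of simplices. -/
def NaturalSimplex (s : ∀ i, OmegaFunctor (omegaCat n) (E i)) : Prop :=
  ∀ i j f, R i j f → (s i).trans f = s j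

/-- The natural families of morphisms. -/
def NaturalElement (a : ∀ i, E i) : Prop := ∀ i j f, R i j f → OmegaFunctor.toFun f (a i) = a j

/-- The folded simplex with a given value at the top-dimensional face. -/
noncomputable def fold (n : ℕ) {A : OmegaCat.{v}} (a : A) : OmegaFunctor (omegaCat n) A :=
  (psi.{v} n).trans (Globe.desc a)

variable {R}

theorem NaturalSimplex.chain {s : ∀ i, OmegaFunctor (omegaCat n) (E i)} (h : NaturalSimplex R s) :
    (fun i => Finsupp.single (s i) (1 : ℤ)) ∈ naturalChains R n := fun i j f hf =>
  (nerveMap_single _ _ _).trans (congrArg (Finsupp.single · 1) (h i j f hf))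

theorem NaturalSimplex.top {s : ∀ i, OmegaFunctor (omegaCat n) (E i)} (h : NaturalSimplex R s) :
    NaturalElement R fun i => s i (Simplex.top n) := fun i j f hf =>
  congrArg (fun s : OmegaFunctor (omegaCat n) (E j) => s (Simplex.top n)) (h i j f hf)

theorem NaturalSimplex.precomp {s : ∀ i, OmegaFunctor (omegaCat n) (E i)} (h : NaturalSimplex R s)
    (g : OmegaFunctor (omegaCat m) (omegaCat n)) : NaturalSimplex R fun i => g.trans (s i) :=
  fun i j f hf => congrArg g.trans (h i j f hf)

theorem NaturalElement.d {a : ∀ i, E i} (h : NaturalElement R a) (α : Bool) (k : ℕ) :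
    NaturalElement R fun i => (E i).d α k (a i) := fun i j f hf =>
  (OmegaFunctor.map_d f α k (a i)).trans (congrArg _ (h i j f hf))

theorem single_mem_naturalNull {s : ∀ i, OmegaFunctor (omegaCat n) (E i)}
    (hs : NaturalSimplex R s) (h : ∀ i, (E i).dim (s i (top n)) < n) :
    (fun i => Finsupp.single (s i) (1 : ℤ)) ∈ naturalNull R n :=
  ⟨_, hs.chain, 0, AddSubgroup.zero_mem _, fun i => ⟨single_mem_nerveThin (h i),
    AddSubgroup.zero_mem _, by rw [Pi.zero_apply, map_zero, add_zero]⟩⟩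

theorem boundary_mem_naturalNull {s : ∀ i, OmegaFunctor (omegaCat (n + 1)) (E i)}
    (hs : NaturalSimplex R s) (h : ∀ i, (E i).dim (s i (top (n + 1))) < n + 1) :
    (fun i => nerveBoundary n (E i) (Finsupp.single (s i) (1 : ℤ))) ∈ naturalNull R n :=
  ⟨0, AddSubgroup.zero_mem _, _, hs.chain, fun i => ⟨AddSubgroup.zero_mem _,
    single_mem_nerveThin (h i), by rw [Pi.zero_apply, zero_add]⟩⟩

/-- Folding is naturally the identity in the reduced complex. -/
theorem sub_fold_mem_naturalNull {s : ∀ i, OmegaFunctor (omegaCat n) (E i)}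
    (hs : NaturalSimplex R s) : (fun i => Finsupp.single (s i) (1 : ℤ) -
      Finsupp.single (fold n (s i (top n))) 1) ∈ naturalNull R n := by
  -- The witnesses for the identity of the simplex are pushed forward along each `s i`, which makes
  -- them natural.
  obtain ⟨τ, hτ, ρ, hρ, e⟩ := exists_of_mem_nerveNull (id_sub_psi_mem_nerveNull.{v} n)
  refine ⟨fun i => nerveMap n (s i) τ, fun i j f hf => ?_, fun i => nerveMap (n + 1) (s i) ρ,
    fun i j f hf => ?_, fun i => ⟨nerveMap_mem_thin _ hτ, nerveMap_mem_thin _ hρ, ?_⟩⟩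
  · rw [nerveMap_trans, hs i j f hf]
  · rw [nerveMap_trans, hs i j f hf]
  · rw [← nerveMap_boundary, ← map_add, ← e, map_sub, nerveMap_single, nerveMap_single]
    refine congrArg (fun s => _ - Finsupp.single s (1 : ℤ)) (OmegaFunctor.ext (funext fun x => (Globe.map_desc (s i) (top n) (psi.{v} n x)).symm))

/-- The relation between the folded faces of a thin simplex. -/
theorem sum_fold_mem_naturalNull {s : ∀ i, OmegaFunctor (omegaCat (n + 1)) (E i)}
    (hs : NaturalSimplex R s) (h : ∀ i, (E i).dim (s i (top (n + 1))) < n + 1)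
    (S : Finset (Fin (n + 2))) (hS : ∀ k ∉ S, ∀ i,
      (E i).dim (s i (map (SimplexCategory.δ k).toOrderHom (top n))) < n) :
    ∑ k ∈ S, (-1 : ℤ) ^ (k : ℕ) • (fun i => Finsupp.single
      (fold n (s i (map (SimplexCategory.δ k).toOrderHom (top n)))) (1 : ℤ)) ∈ naturalNull R n := by
  classical
  have hk := fun k : Fin (n + 2) => hs.precomp (map (SimplexCategory.δ k).toOrderHom)
  have h₁ := boundary_mem_naturalNull hs h
  have e : (fun i => nerveBoundary n (E i) (Finsupp.single (s i) (1 : ℤ))) =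
      ∑ k : Fin (n + 2), (-1 : ℤ) ^ (k : ℕ) • fun i => Finsupp.single
        ((map (SimplexCategory.δ k).toOrderHom).trans (s i)) (1 : ℤ) := by
    funext i
    rw [nerveBoundary_single, Finset.sum_apply]
    rfl
  -- In the boundary of the thin simplex the faces outside `S` are thin and can be dropped; those in
  -- `S` are then replaced by their foldings.
  rw [e, ← Finset.sum_add_sum_compl S, AddSubgroup.add_mem_cancel_right] at h₁
  · have h₂ := AddSubgroup.sum_mem (naturalNull R n) (t := S) fun k _ =>
      AddSubgroup.zsmul_mem _ (sub_fold_mem_naturalNull (hk k)) ((-1) ^ (k : ℕ))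
    have h₃ := AddSubgroup.sub_mem _ h₁ h₂
    rw [← Finset.sum_sub_distrib] at h₃
    convert h₃ using 1
    refine Finset.sum_congr rfl fun k _ => ?_
    rw [← smul_sub]
    congr 1
    funext i
    simp only [Pi.sub_apply, sub_sub_cancel]
    rfl
  · exact AddSubgroup.sum_mem _ fun k hk' => AddSubgroup.zsmul_mem _
      (single_mem_naturalNull (hk k) (hS k (Finset.mem_compl.1 hk'))) _

end Simplex

/-! ### Pairs of morphisms of two globes glued along a cell -/

namespace GlobeCell

variable {m n q : ℕ}

/-- Whether a pair of morphisms of two globes represents a morphism of the globes glued along the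
`q`-target of the first and the `q`-source of the second. -/
def Glued (q : ℕ) (g : GlobeCell.{u} m) (h : GlobeCell.{u} n) : Prop :=
  -- The three kinds of morphisms of the glued globes: common ones, up to the `q`-source of the
  -- first globe; those of the second globe, paired with the `q`-target of the first; and those of
  -- higher dimension in the first, alone if `h` is the `q`-source of the second globe, otherwise
  -- composed with `h`.
  (g.dim = h.dim ∧ g.side = h.side ∧ (g.dim < q ∨ g.dim = q ∧ g.side = false)) ∨
    (g.dim = q ∧ g.side = true ∧ q ≤ h.dim) ∨
      (q < g.dim ∧ (q < h.dim ∨ h.dim = q ∧ h.side = false))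

theorem tab_add (x : GlobeCell.{u} n) (β : Bool) (r : ℕ) :
    x.tab β r false + x.tab β r true = if r ≤ x.dim then 1 else 0 := by
  rcases lt_trichotomy r x.dim with h | h | h
  · rw [tab_of_lt h, tab_of_lt h, if_pos h.le]
    cases β <;> rfl
  · rw [h, tab_dim, tab_dim, if_pos le_rfl]
    cases x.side <;> rfl
  · rw [tab_of_gt h, tab_of_gt h, if_neg h.not_ge]
    rfl

/-- The condition on coefficients for a pair of morphisms to be glued. -/
theorem glued_of_tab {g : GlobeCell.{u} m} {h : GlobeCell.{u} n}
    (hlt : ∀ r, r < q → ∀ β δ, g.tab β r δ = h.tab β r δ)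
    (hle : ∀ β, g.tab β q false ≤ h.tab β q false)
    (hadd : g.tab false q false + g.tab false q true = h.tab false q false + h.tab false q true) :
    Glued q g h := by
  -- Equal total mass up to degree `q` means that both morphisms stop at the same dimension below
  -- `q`, or both reach `q`.
  have hdim : ∀ r, r ≤ q → (r ≤ g.dim ↔ r ≤ h.dim) := by
    intro r hr
    have e : g.tab false r false + g.tab false r true = h.tab false r false + h.tab false r true := by
      rcases hr.lt_or_eq with hr | rfl
      · rw [hlt r hr, hlt r hr]
      · exact hadd
    rw [tab_add, tab_add] at e
    by_cases h₁ : r ≤ g.dim <;> by_cases h₂ : r ≤ h.dim <;> simp [h₁, h₂] at e ⊢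
  unfold Glued
  rcases lt_trichotomy g.dim q with hg | hg | hg
  · have e : g.dim = h.dim := by
      have h₁ := (hdim g.dim hg.le).1 le_rfl
      have h₂ := (hdim (g.dim + 1) hg).not.1 (by omega)
      omega
    refine Or.inl ⟨e, ?_, Or.inl hg⟩
    have h₁ := hlt g.dim hg false false
    have h₂ := h.tab_dim false false
    rw [tab_dim, e, h₂] at h₁
    revert h₁
    cases g.side <;> cases h.side <;> simp
  · have hq : q ≤ h.dim := (hdim q le_rfl).1 hg.ge
    by_cases hs : g.side = true
    · exact Or.inr (Or.inl ⟨hg, hs, hq⟩)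
    · have hs' : g.side = false := by simpa using hs
      have h₀ : ∀ β, g.tab β q false = 1 := fun β => by
        have := g.tab_dim β false
        rw [hg, hs'] at this
        exact this
      have h₁ := hle true
      rw [h₀] at h₁
      rcases hq.eq_or_lt with hq | hq
      · have h₂ := h.tab_dim true false
        rw [← hq] at h₂
        rw [h₂] at h₁
        refine Or.inl ⟨hg.trans hq, ?_, Or.inr ⟨hg, hs'⟩⟩
        rw [hs']
        revert h₁
        cases h.side <;> simp
      · rw [tab_of_lt hq] at h₁
        simp at h₁
  · have hq : q ≤ h.dim := (hdim q le_rfl).1 hg.le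
    refine Or.inr (Or.inr ⟨hg, ?_⟩)
    rcases hq.eq_or_lt with hq | hq
    · have h₁ := hle false
      have h₂ := h.tab_dim false false
      rw [← hq] at h₂
      rw [h₂, tab_of_lt hg] at h₁
      refine Or.inr ⟨hq.symm, ?_⟩
      revert h₁
      cases h.side <;> simp
    · exact Or.inl hq

end GlobeCell

/-! ### The omega-functor defined by two glued functors to globes -/

namespace Globe

variable {m n q : ℕ} {E : OmegaCat.{v}}

theorem d_face_of_lt {u : E} {g : GlobeCell.{u} m} (h : q < g.dim) (α : Bool) :
    E.d α q (face u g) = E.d α q u := E.d_d_lt _ _ _ _ _ h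

theorem face_match {u v : E} (huv : E.d true q u = E.d false q v) {g : GlobeCell.{u} m}
    {h : GlobeCell.{u} n} (hg : q < g.dim) (hh : q < h.dim) :
    E.d true q (face u g) = E.d false q (face v h) := by
  rw [d_face_of_lt hg, d_face_of_lt hh, huv]

/-- The morphism represented by a pair of morphisms of two globes. -/
def glue {u v : E} (huv : E.d true q u = E.d false q v) (g : GlobeCell.{u} m)
    (h : GlobeCell.{u} n) : E :=
  if hg : q < g.dim then
    if hh : q < h.dim then E.comp q (face u g) (face v h) (face_match huv hg hh) else face u g
  else if g.dim = q ∧ g.side = true then face v h else face u g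

variable {u v : E} (huv : E.d true q u = E.d false q v)

theorem glue_comp {g : GlobeCell.{u} m} {h : GlobeCell.{u} n} (hg : q < g.dim) (hh : q < h.dim) :
    glue huv g h = E.comp q (face u g) (face v h) (face_match huv hg hh) := by
  unfold glue
  rw [dif_pos hg, dif_pos hh]

theorem glue_left {g : GlobeCell.{u} m} {h : GlobeCell.{u} n} (hg : q < g.dim) (hh : h.dim ≤ q) :
    glue huv g h = face u g := by
  unfold glue
  rw [dif_pos hg, dif_neg hh.not_gt]

theorem glue_right {g : GlobeCell.{u} m} {h : GlobeCell.{u} n} (hg : g.dim = q)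
    (hs : g.side = true) : glue huv g h = face v h := by
  unfold glue
  rw [dif_neg (by omega), if_pos ⟨hg, hs⟩]

theorem glue_start {g : GlobeCell.{u} m} {h : GlobeCell.{u} n}
    (hg : g.dim < q ∨ g.dim = q ∧ g.side = false) : glue huv g h = face u g := by
  unfold glue
  rw [dif_neg (by omega), if_neg]
  rintro ⟨h₁, h₂⟩
  rcases hg with h | ⟨_, h⟩
  · omega
  · rw [h] at h₂
    cases h₂

theorem dim_face_le (u : E) (g : GlobeCell.{u} m) : E.dim (face u g) ≤ g.dim := E.dim_d_le _ _ _

theorem dim_glue_le {N : ℕ} {g : GlobeCell.{u} m} {h : GlobeCell.{u} n} (hg : g.dim ≤ N)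
    (hh : h.dim ≤ N) : E.dim (glue huv g h) ≤ N := by
  have h₁ := (dim_face_le u g).trans hg
  have h₂ := (dim_face_le v h).trans hh
  unfold glue
  split_ifs with hg' hh'
  · refine (E.dim_le_iff _ _).2 fun α => ?_
    obtain ⟨h', e⟩ := E.d_comp α N q (face u g) (face v h) (face_match huv hg' hh') (by omega)
    rw [e]
    exact E.comp_congr ((E.dim_le_iff _ _).1 h₁ α) ((E.dim_le_iff _ _).1 h₂ α) _ _
  · exact h₁
  · exact h₂
  · exact h₁

theorem d_lower {k : ℕ} (hk : k < q) (α : Bool) (huv : E.d true q u = E.d false q v) :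
    E.d α k u = E.d α k v := by
  rw [← E.d_d_lt true α k q u hk, huv, E.d_d_lt _ _ _ _ _ hk]

/-- Below degree `q` the faces of `u` and `v` agree; in degree `q` a composite has its source in `u`
and its target in `v`; above `q` faces distribute over the composite. -/
theorem glued_d {g : GlobeCell.{u} m} {h : GlobeCell.{u} n} (H : GlobeCell.Glued q g h) (α : Bool)
    (k : ℕ) : glue huv (g.d α k) (h.d α k) = E.d α k (glue huv g h) := by
  rcases H with ⟨h₁, h₂, h₃⟩ | ⟨h₁, h₂, h₃⟩ | ⟨h₁, h₂⟩
  · rw [glue_start huv h₃, glue_start, face_d]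
    rcases lt_or_ge k g.dim with hk | hk
    · left
      rw [GlobeCell.dim_d]
      omega
    · rw [GlobeCell.d_of_ge α hk]
      exact h₃
  · rw [glue_right huv h₁ h₂, ← face_d]
    rcases lt_or_ge k q with hk | hk
    · rw [glue_start, face_d, face_d]
      · unfold face
        rw [h₁, E.d_d_lt _ _ _ _ _ hk, E.d_d_lt _ _ _ _ _ (hk.trans_le h₃), d_lower hk α huv]
      · left
        rw [GlobeCell.dim_d]
        omega
    · rw [GlobeCell.d_of_ge α (h₁.trans_le hk), glue_right huv h₁ h₂]
  · have hq : q ≤ h.dim := by omega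
    have hl : ∀ k, k < q → E.d α k (glue huv g h) = E.d α k u := by
      intro k hk
      rcases h₂ with h₂ | ⟨h₂, _⟩
      · rw [glue_comp huv h₁ h₂, E.d_comp_of_lt α hk, d_face_of_lt (hk.trans h₁)]
      · rw [glue_left huv h₁ h₂.le, d_face_of_lt (hk.trans h₁)]
    rcases lt_trichotomy k q with hk | rfl | hk
    · rw [hl k hk, glue_start, face_d, d_face_of_lt (hk.trans h₁)]
      left
      rw [GlobeCell.dim_d]
      omega
    · have hd : g.d α k = ⟨k, α, h₁.le.trans g.le, fun e => absurd g.le (by omega)⟩ :=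
        GlobeCell.d_of_lt α h₁
      cases α
      · rw [glue_start huv (by rw [hd]; exact Or.inr ⟨rfl, rfl⟩), face_d]
        rcases h₂ with h₂ | ⟨h₂, _⟩
        · rw [glue_comp huv h₁ h₂, E.d_source_comp]
        · rw [glue_left huv h₁ h₂.le]
      · rw [glue_right huv (by rw [hd]) (by rw [hd]), face_d]
        rcases h₂ with h₂ | ⟨h₂, h₃⟩
        · rw [glue_comp huv h₁ h₂, E.d_target_comp]
        · rw [glue_left huv h₁ h₂.le, d_face_of_lt h₁, huv]
          unfold face
          rw [h₂, h₃, E.d_d_ge _ _ _ _ _ le_rfl]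
    · have hg' : q < (g.d α k).dim := by rw [GlobeCell.dim_d]; omega
      rcases h₂ with h₂ | ⟨h₂, h₃⟩
      · have hh' : q < (h.d α k).dim := by rw [GlobeCell.dim_d]; omega
        rw [glue_comp huv hg' hh', glue_comp huv h₁ h₂]
        obtain ⟨h', e⟩ := E.d_comp α k q (face u g) (face v h) (face_match huv h₁ h₂) (by omega)
        rw [e]
        exact E.comp_congr (face_d u α k g) (face_d v α k h) _ _
      · rw [GlobeCell.d_of_ge α (h₂.trans_le hk.le), glue_left huv hg' h₂.le,
          glue_left huv h₁ h₂.le, face_d]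

/-- Of two composable morphisms of a globe one is a unit. If it is on the same side in both
components, the glued morphism is a unit too. If not, then either `k > q`, where the claim is the
exchange law (`above`) or again a unit law, or `k = q`, where the composite of the two components is
the definition of `glue`. -/
theorem glued_comp {g g' : GlobeCell.{u} m} {h h' : GlobeCell.{u} n} (H : GlobeCell.Glued q g h)
    {k : ℕ} (hg : g.d true k = g'.d false k)
    (hh : h.d true k = h'.d false k)
    (e : E.d true k (glue huv g h) = E.d false k (glue huv g' h')) :
    glue huv (GlobeCell.comp k g g') (GlobeCell.comp k h h') =
      E.comp k (glue huv g h) (glue huv g' h') e := by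
  have left : g.dim ≤ k → h.dim ≤ k → GlobeCell.comp k g g' = g' → GlobeCell.comp k h h' = h' →
      glue huv (GlobeCell.comp k g g') (GlobeCell.comp k h h') =
        E.comp k (glue huv g h) (glue huv g' h') e := fun h₁ h₂ h₃ h₄ => by
    rw [h₃, h₄]
    exact (E.comp_of_left_eq e
      (((E.dim_le_iff _ _).1 (dim_glue_le huv h₁ h₂) true).symm.trans e)).symm
  have right : g'.dim ≤ k → h'.dim ≤ k → GlobeCell.comp k g g' = g → GlobeCell.comp k h h' = h →
      glue huv (GlobeCell.comp k g g') (GlobeCell.comp k h h') =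
        E.comp k (glue huv g h) (glue huv g' h') e := fun h₁ h₂ h₃ h₄ => by
    rw [h₃, h₄]
    exact (E.comp_of_right_eq e
      (((E.dim_le_iff _ _).1 (dim_glue_le huv h₁ h₂) false).symm.trans e.symm)).symm
  have above : q < k → q < g.dim → q < h.dim → q < g'.dim → q < h'.dim →
      glue huv (GlobeCell.comp k g g') (GlobeCell.comp k h h') =
        E.comp k (glue huv g h) (glue huv g' h') e := fun hk h₁ h₂ h₃ h₄ => by
    have hug : E.d true k (face u g) = E.d false k (face u g') := by
      rw [← face_d, hg, face_d]
    have hvh : E.d true k (face v h) = E.d false k (face v h') := by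
      rw [← face_d, hh, face_d]
    have h₅ : q < (GlobeCell.comp k g g').dim := by unfold GlobeCell.comp; split_ifs <;> assumption
    have h₆ : q < (GlobeCell.comp k h h').dim := by unfold GlobeCell.comp; split_ifs <;> assumption
    have e' := e
    rw [glue_comp huv h₁ h₂, glue_comp huv h₃ h₄] at e'
    have h₇ := face_match huv h₅ h₆
    rw [face_comp u k g g' hg hug, face_comp v k h h' hh hvh] at h₇
    rw [glue_comp huv h₅ h₆]
    refine (E.comp_congr (face_comp u k g g' hg hug) (face_comp v k h h' hh hvh) _ h₇).trans ?_
    refine (E.exchange k q _ _ _ _ hk.ne' (face_match huv h₁ h₂) (face_match huv h₃ h₄) hug hvh e'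
      h₇).symm.trans ?_
    exact E.comp_congr (glue_comp huv h₁ h₂).symm (glue_comp huv h₃ h₄).symm _ _
  rcases GlobeCell.unit_of_match hg with ⟨h₁, e₁⟩ | ⟨h₁, h₁', e₁⟩ <;>
    rcases GlobeCell.unit_of_match hh with ⟨h₂, e₂⟩ | ⟨h₂, h₂', e₂⟩
  · exact left h₁ h₂ (GlobeCell.comp_left h₁ _) (GlobeCell.comp_left h₂ _)
  · rcases le_or_gt g'.dim k with hg' | hg'
    · refine right hg' h₂' ?_ (GlobeCell.comp_right h₂ _)
      rw [GlobeCell.comp_left h₁, e₁, GlobeCell.d_of_ge _ hg']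
    · rw [GlobeCell.d_of_lt _ hg'] at e₁
      rw [GlobeCell.d_of_lt _ h₂] at e₂
      have d₁ : g.dim = k := by rw [e₁]
      have d₂ : h'.dim = k := by rw [e₂]
      have d₃ : g.side = false := by rw [e₁]
      have hk : q < k := by
        rcases H with ⟨h₃, _⟩ | ⟨_, h₃, _⟩ | ⟨h₃, _⟩
        · omega
        · rw [d₃] at h₃
          cases h₃
        · omega
      exact above hk (by omega) (by omega) (by omega) (by omega)
  · rcases le_or_gt h'.dim k with hh' | hh'
    · refine right h₁' hh' (GlobeCell.comp_right h₁ _) ?_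
      rw [GlobeCell.comp_left h₂, e₂, GlobeCell.d_of_ge _ hh']
    · rw [GlobeCell.d_of_lt _ h₁] at e₁
      rw [GlobeCell.d_of_lt _ hh'] at e₂
      have d₁ : g'.dim = k := by rw [e₁]
      have d₂ : h.dim = k := by rw [e₂]
      have d₃ : g'.side = true := by rw [e₁]
      have hk : q ≤ k := by
        rcases H with ⟨h₃, _⟩ | ⟨_, h₃, _⟩ | ⟨h₃, _⟩ <;> omega
      rcases hk.eq_or_lt with rfl | hk
      · have c₁ := GlobeCell.comp_right h₁ g'
        have c₂ := GlobeCell.comp_left h₂ h'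
        rw [c₁, c₂, glue_comp huv h₁ hh']
        exact E.comp_congr (glue_left huv h₁ h₂).symm (glue_right huv d₁ d₃).symm _ _
      · exact above hk (by omega) (by omega) (by omega) (by omega)
  · exact right h₁' h₂' (GlobeCell.comp_right h₁ _) (GlobeCell.comp_right h₂ _)

/-- The omega-functor to an omega-category given by two omega-functors to globes and two composable
morphisms. -/
def glueFunctor {X : OmegaCat.{w}} (a : OmegaFunctor X (Globe.{u} m)) (b : OmegaFunctor X (Globe.{u} n))
    (hab : ∀ x, GlobeCell.Glued q (a x) (b x)) : OmegaFunctor X E where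
  toFun x := glue huv (a x) (b x)
  map_d α k x := (congrArg₂ (glue huv) (a.map_d α k x) (b.map_d α k x)).trans
    (glued_d huv (hab x) α k)
  map_comp k x y h := by
    obtain ⟨ha, ea⟩ := a.map_comp k x y h
    obtain ⟨hb, eb⟩ := b.map_comp k x y h
    have e := (glued_d huv (hab x) true k).symm.trans ((congrArg₂ (glue huv) ha hb).trans
      (glued_d huv (hab y) false k))
    exact ⟨e, (congrArg₂ (glue huv) ea eb).trans (glued_comp huv (hab x) ha hb e)⟩

theorem map_glue {F : OmegaCat.{w}} (f : OmegaFunctor E F) (huv' : F.d true q (f u) = F.d false q (f v))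
    (g : GlobeCell.{u} m) (h : GlobeCell.{u} n) : f (glue huv g h) = glue huv' g h := by
  unfold glue
  split_ifs
  · exact (f.map_comp q _ _ _).2.trans (F.comp_congr (f.map_d _ _ _) (f.map_d _ _ _) _ _)
  all_goals exact f.map_d _ _ _

end Globe

namespace Simplex

variable {m n n' q : ℕ}

/-! ### Folding and degeneracies -/

theorem value_psi_of_surjective {f : Fin (m + 1) →o Fin (n + 1)} (hf : Function.Surjective f) :
    value (psi.{u} n) (Cell.map f (top m)) = Globe.top n :=
  (congrArg (value (psi.{u} n)) (map_top_of_surjective hf)).trans value_psi_top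

/-- A monotone map whose image omits exactly `j` is a surjection followed by the face map at `j`,
and surjections preserve the top. -/
theorem value_psi_of_range {f : Fin (m + 1) →o Fin (n + 2)} {j : Fin (n + 2)}
    (hf : ∀ w, (∃ v, f v = w) ↔ w ≠ j) :
    (value (psi.{u} (n + 1)) (Cell.map f (top m))).dim = min j.val n ∧
      (value (psi.{u} (n + 1)) (Cell.map f (top m))).side = decide (Odd j.val) := by
  have hne : ∀ v, f v ≠ j := fun v => (hf _).1 ⟨v, rfl⟩
  choose g hg using fun v => Fin.exists_succAbove_eq (hne v)
  let g' : Fin (m + 1) →o Fin (n + 1) :=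
    ⟨g, fun a b hab => by
      rw [← (Fin.strictMono_succAbove j).le_iff_le, hg, hg]
      exact f.monotone hab⟩
  have hs : Function.Surjective g' := fun w => by
    obtain ⟨v, hv⟩ := (hf (j.succAbove w)).2 (Fin.succAbove_ne j w)
    refine ⟨v, Fin.succAbove_right_injective (p := j) ?_⟩
    exact (hg v).trans hv
  have e : Cell.map f (top m) = Cell.map (SimplexCategory.δ j).toOrderHom (top n) := by
    rw [← map_top_of_surjective hs]
    refine (congrArg (fun f => Cell.map f (top m)) (?_ : f =
      (SimplexCategory.δ j).toOrderHom.comp g')).trans (map_map_apply _ _ _).symm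
    exact OrderHom.ext _ _ (funext fun v => (hg v).symm)
  rw [e]
  exact value_psi_face j

/-- A map of vertices that fixes the first `q` vertices and preserves the others. -/
def FixesBelow (q : ℕ) (f : Fin (m + 1) → Fin (n + 1)) : Prop :=
  (∀ v, v.val < q → (f v).val = v.val) ∧ ∀ v, q ≤ v.val → q ≤ (f v).val

/-- In dimension `p ≤ q` only faces with the first `p` vertices count, and `f` neither moves these
nor sends other vertices among them. Such a face has one further vertex, so `f` is injective on it,
and the side depends only on whether that vertex goes to `p`. -/
theorem functorLam_of_fixesBelow {f : Fin (m + 1) →o Fin (n + 1)} (hf : FixesBelow q f) (hq : q < n)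
    {σ : Finset (Fin (m + 1))} {p : ℕ} (hσ : σ.card = p + 1) (hp : p ≤ q) (δ : Bool) :
    functorLam ((map f).trans (psi.{u} n)) δ σ = if (∀ v : Fin (m + 1), v.val < p → v ∈ σ) ∧
      δ = decide (Odd (if ∃ v ∈ σ, (f v).val = p then p + 1 else p)) then 1 else 0 := by
  classical
  have hne : σ.Nonempty := Finset.card_pos.1 (by omega)
  have hm : p + 1 ≤ m + 1 := by
    have := Finset.card_le_univ σ
    rw [Fintype.card_fin] at this
    omega
  have hlow : (∀ v : Fin (n + 1), v.val < p → v ∈ σ.image f) ↔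
      ∀ v : Fin (m + 1), v.val < p → v ∈ σ := by
    constructor
    · intro h v hv
      obtain ⟨w, hw, e⟩ := Finset.mem_image.1 (h ⟨v.val, by omega⟩ hv)
      have e' : (f w).val = v.val := congrArg Fin.val e
      rcases lt_or_ge w.val q with hw' | hw'
      · rwa [show v = w from Fin.ext (e'.symm.trans (hf.1 w hw'))]
      · have := hf.2 w hw'
        omega
    · intro h v hv
      refine Finset.mem_image.2 ⟨⟨v.val, by omega⟩, h _ hv, Fin.ext ?_⟩
      exact hf.1 _ (show v.val < q by omega)
  rw [functorLam_map f _ δ hne]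
  by_cases h : ∀ v : Fin (m + 1), v.val < p → v ∈ σ
  · have hinj : Set.InjOn f σ := by
      intro a ha b hb hab
      by_contra hne'
      have hab' := congrArg Fin.val hab
      have hcard := card_filter_ge (show p ≤ m + 1 by omega) h
      have h₁ : ∀ a b : Fin (m + 1), (f a).val = (f b).val → a ≠ b → p ≤ a.val := by
        intro a b e hne
        by_contra hlt
        have h₂ := hf.1 a (by omega)
        rcases lt_or_ge b.val q with hb | hb
        · exact hne (Fin.ext (by rw [← h₂, e, hf.1 b hb]))
        · have := hf.2 b hb
          omega
      have h₂ : 1 < (σ.filter fun v => ¬ v.val < p).card :=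
        Finset.one_lt_card.2 ⟨a, Finset.mem_filter.2 ⟨ha, (h₁ a b hab' hne').not_gt⟩, b,
          Finset.mem_filter.2 ⟨hb, (h₁ b a hab'.symm (Ne.symm hne')).not_gt⟩, hne'⟩
      rw [hcard, hσ] at h₂
      omega
    rw [if_pos hinj, functorLam_psi _ (hne.image f), psiLam, Finset.card_image_of_injOn hinj, hσ]
    simp only [Nat.add_sub_cancel, hlow, Finset.exists_mem_image, show p + 1 ≤ n by omega, true_and]
  · refine Eq.trans ?_ (if_neg fun h' => h h'.1).symm
    split_ifs with hinj
    · rw [functorLam_psi _ (hne.image f), psiLam, Finset.card_image_of_injOn hinj, hσ]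
      simp only [Nat.add_sub_cancel, hlow]
      exact if_neg fun h' => h h'.1
    · rfl

/-- The hypotheses of `glued_of_tab` are linear in the coefficients, so they follow from the same
conditions on faces. -/
theorem glued_of_lam {a : OmegaFunctor (omegaCat m) (Globe.{u} n)}
    {b : OmegaFunctor (omegaCat m) (Globe.{u} n')}
    (hlt : ∀ σ : Finset (Fin (m + 1)), σ.Nonempty → σ.card ≤ q → ∀ δ, functorLam a δ σ = functorLam b δ σ)
    (hle : ∀ σ : Finset (Fin (m + 1)), σ.card = q + 1 → functorLam a false σ ≤ functorLam b false σ)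
    (hadd : ∀ σ : Finset (Fin (m + 1)), σ.card = q + 1 → functorLam a false σ + functorLam a true σ =
      functorLam b false σ + functorLam b true σ) (x : Cell m) :
    GlobeCell.Glued q (value a x) (value b x) := by
  refine GlobeCell.glued_of_tab (fun r hr β δ => ?_) (fun β => ?_) ?_
  · rw [tab_functor, tab_functor]
    refine linear_eq_of_support _ _ _ fun σ hσ => ?_
    have := x.card_eq β r σ hσ
    rw [pair_single, pair_single, hlt σ (Finset.card_pos.1 (by omega)) (by omega)]
  · rw [tab_functor, tab_functor, pair_eq_sum, pair_eq_sum]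
    refine Finset.sum_le_sum fun σ _ => ?_
    by_cases hσ : x.chain β q σ = 0
    · rw [hσ, zero_mul, zero_mul]
    · exact mul_le_mul_of_nonneg_left (hle σ (x.card_eq β q σ hσ)) (x.nonneg β q σ)
  · rw [tab_functor, tab_functor, tab_functor, tab_functor]
    refine linear_eq_of_support (pair (functorLam a false) + pair (functorLam a true))
      (pair (functorLam b false) + pair (functorLam b true)) _ fun σ hσ => ?_
    have := hadd σ (x.card_eq _ q σ hσ)
    simpa only [LinearMap.add_apply, pair_single, one_mul] using this

section

variable {f : Fin (m + 1) →o Fin (n + 1)} {f' : Fin (m + 1) →o Fin (n' + 1)}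

theorem functorLam_congr_of_fixesBelow (hf : FixesBelow q f) (hf' : FixesBelow q f') (hq : q < n)
    (hq' : q < n') {σ : Finset (Fin (m + 1))} (hσ : σ.Nonempty) (hc : σ.card ≤ q) (δ : Bool) :
    functorLam ((map f).trans (psi.{u} n)) δ σ = functorLam ((map f').trans (psi.{u} n')) δ σ := by
  have h : σ.card = σ.card - 1 + 1 := by have := Finset.card_pos.2 hσ; omega
  rw [functorLam_of_fixesBelow hf hq h (by omega), functorLam_of_fixesBelow hf' hq' h (by omega)]
  have e : ∀ v : Fin (m + 1), (f v).val = σ.card - 1 ↔ (f' v).val = σ.card - 1 := by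
    intro v
    rcases lt_or_ge v.val q with hv | hv
    · rw [hf.1 v hv, hf'.1 v hv]
    · have := hf.2 v hv
      have := hf'.2 v hv
      omega
  simp only [e]

theorem functorLam_add_of_fixesBelow (hf : FixesBelow q f) (hf' : FixesBelow q f') (hq : q < n)
    (hq' : q < n') {σ : Finset (Fin (m + 1))} (hσ : σ.card = q + 1) :
    functorLam ((map f).trans (psi.{u} n)) false σ + functorLam ((map f).trans (psi.{u} n)) true σ =
      functorLam ((map f').trans (psi.{u} n')) false σ +
        functorLam ((map f').trans (psi.{u} n')) true σ := by
  classical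
  rw [functorLam_of_fixesBelow hf hq hσ le_rfl, functorLam_of_fixesBelow hf hq hσ le_rfl,
    functorLam_of_fixesBelow hf' hq' hσ le_rfl, functorLam_of_fixesBelow hf' hq' hσ le_rfl,
    sum_bool_ite, sum_bool_ite]

/-- In dimension `q` the two functors can only differ in whether the free vertex of `σ` goes to `q`,
which changes the side from the parity of `q` to that of `q + 1`. By `hff'` this happens more often
for `f'`. -/
theorem functorLam_le_of_fixesBelow (hf : FixesBelow q f) (hf' : FixesBelow q f') (hq : q < n)
    (hq' : q < n') (hff' : ∀ v, (f v).val = q → (f' v).val = q) {σ : Finset (Fin (m + 1))}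
    (hσ : σ.card = q + 1) :
    functorLam ((map f').trans (psi.{u} n')) (decide (Odd q)) σ ≤
      functorLam ((map f).trans (psi.{u} n)) (decide (Odd q)) σ := by
  rw [functorLam_of_fixesBelow hf hq hσ le_rfl, functorLam_of_fixesBelow hf' hq' hσ le_rfl]
  by_cases h : ∃ v ∈ σ, (f v).val = q
  · have h' : ∃ v ∈ σ, (f' v).val = q := h.imp fun v hv => ⟨hv.1, hff' v hv.2⟩
    rw [if_pos h, if_pos h']
  · rw [if_neg h]
    by_cases h₁ : ∀ v : Fin (m + 1), v.val < q → v ∈ σ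
    · refine le_trans ?_ (if_pos ⟨h₁, rfl⟩).ge
      split_ifs <;> norm_num
    · refine (if_neg fun h' => h₁ h'.1).le.trans ?_
      split_ifs <;> norm_num

/-- The functor with fewer coefficients on the source side in degree `q` has to be the first
component. By the preceding inequality this is the one of `f'` for even `q`; for odd `q` the
inequality is on the target side and the order is reversed. -/
theorem glued_of_even (hf : FixesBelow q f) (hf' : FixesBelow q f') (hq : q < n)
    (hq' : q < n') (hff' : ∀ v, (f v).val = q → (f' v).val = q) (he : Even q)
    (x : omegaCat m) : GlobeCell.Glued q ((map f').trans (psi.{u} n') x) ((map f).trans (psi.{u} n) x) := by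
  refine glued_of_lam (fun σ hσ hc δ => functorLam_congr_of_fixesBelow hf' hf hq' hq hσ hc δ)
    (fun σ hσ => ?_) (fun σ hσ => functorLam_add_of_fixesBelow hf' hf hq' hq hσ) x
  have h := functorLam_le_of_fixesBelow.{u} hf hf' hq hq' hff' hσ
  rwa [decide_eq_false (Nat.not_odd_iff_even.2 he)] at h

theorem glued_of_odd (hf : FixesBelow q f) (hf' : FixesBelow q f') (hq : q < n)
    (hq' : q < n') (hff' : ∀ v, (f v).val = q → (f' v).val = q) (ho : Odd q)
    (x : omegaCat m) : GlobeCell.Glued q ((map f).trans (psi.{u} n) x) ((map f').trans (psi.{u} n') x) := by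
  refine glued_of_lam (fun σ hσ hc δ => functorLam_congr_of_fixesBelow hf hf' hq hq' hσ hc δ)
    (fun σ hσ => ?_) (fun σ hσ => functorLam_add_of_fixesBelow hf hf' hq hq' hσ) x
  have h := functorLam_le_of_fixesBelow.{u} hf hf' hq hq' hff' hσ
  have h₁ := functorLam_add_of_fixesBelow.{u} hf hf' hq hq' hσ
  rw [decide_eq_true ho] at h
  omega

end

end Simplex

namespace Globe

variable {a b q : ℕ} {E : OmegaCat.{v}} {x y : E} (hxy : E.d true q x = E.d false q y)

theorem face_top (hx : E.dim x ≤ a) : face x (top.{u} a) = x := (E.dim_le_iff _ _).1 hx _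

theorem glue_top_top (ha : q < a) (hb : q < b) (hx : E.dim x ≤ a) (hy : E.dim y ≤ b) :
    glue hxy (top.{u} a) (top.{u} b) = E.comp q x y hxy :=
  (glue_comp hxy ha hb).trans (E.comp_congr (face_top hx) (face_top hy) _ _)

theorem glue_top_left (ha : q < a) (hx : E.dim x ≤ a) {h : GlobeCell.{u} b} (hh : h.dim ≤ q) :
    glue hxy (top.{u} a) h = x :=
  (glue_left hxy ha hh).trans (face_top hx)

theorem glue_top_right (hy : E.dim y ≤ b) {g : GlobeCell.{u} a} (hg : g.dim = q)
    (hs : g.side = true) : glue hxy g (top.{u} b) = y :=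
  (glue_right hxy hg hs).trans (face_top hy)

end Globe

namespace Simplex

variable {n q : ℕ}

/-! ### Additivity -/

/-- The value at a face of the simplex of the composite of a folding and a map of simplices. -/
noncomputable def faceValue {a : ℕ} (f : Fin (n + 3) →o Fin (a + 1)) (k : Fin (n + 3)) :
    GlobeCell.{u} a :=
  value (psi.{u} a) (Cell.map (f.comp (SimplexCategory.δ k).toOrderHom) (top (n + 1)))

theorem faceValue_of_surjective {a : ℕ} {f : Fin (n + 3) →o Fin (a + 1)} {k : Fin (n + 3)}
    (h : ∀ w, ∃ v, v ≠ k ∧ f v = w) : faceValue.{u} f k = Globe.top a :=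
  value_psi_of_surjective fun w => by
    obtain ⟨v, hv, e⟩ := h w
    obtain ⟨v', rfl⟩ := Fin.exists_succAbove_eq hv
    exact ⟨v', e⟩

theorem faceValue_of_range {a : ℕ} {f : Fin (n + 3) →o Fin (a + 2)} {k : Fin (n + 3)}
    {j : Fin (a + 2)} (h : ∀ w, (∃ v, v ≠ k ∧ f v = w) ↔ w ≠ j) :
    (faceValue.{u} f k).dim = min j.val a ∧ (faceValue.{u} f k).side = decide (Odd j.val) :=
  value_psi_of_range fun w => by
    rw [← h w]
    constructor
    · rintro ⟨v, e⟩
      exact ⟨k.succAbove v, Fin.succAbove_ne k v, e⟩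
    · rintro ⟨v, hv, e⟩
      obtain ⟨v', rfl⟩ := Fin.exists_succAbove_eq hv
      exact ⟨v', e⟩

/-- The degeneracy map as a map of vertices. -/
noncomputable def degeneracy (i : Fin (n + 2)) : Fin (n + 3) →o Fin (n + 2) :=
  (SimplexCategory.σ i).toOrderHom

theorem val_degeneracy (i : Fin (n + 2)) (v : Fin (n + 3)) :
    (degeneracy i v).val = if i.val < v.val then v.val - 1 else v.val := val_predAbove i v

theorem fixesBelow_degeneracy {i : Fin (n + 2)} (h : q ≤ i.val) : FixesBelow q (degeneracy i) := by
  refine ⟨fun v hv => ?_, fun v hv => ?_⟩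
  · rw [val_degeneracy, if_neg (by omega)]
  · rw [val_degeneracy]
    split_ifs <;> omega

theorem faceValue_degeneracy_self {i : Fin (n + 2)} {k : Fin (n + 3)}
    (h : k.val = i.val ∨ k.val = i.val + 1) : faceValue.{u} (degeneracy i) k = Globe.top (n + 1) := by
  refine faceValue_of_surjective fun w => ?_
  by_cases hw : w.val < k.val
  · refine ⟨w.castSucc, fun e => ?_, Fin.ext ?_⟩
    · have := congrArg Fin.val e
      rw [Fin.val_castSucc] at this
      omega
    · rw [val_degeneracy, Fin.val_castSucc, if_neg (by omega)]
  · refine ⟨w.succ, fun e => ?_, Fin.ext ?_⟩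
    · have := congrArg Fin.val e
      rw [Fin.val_succ] at this
      omega
    · rw [val_degeneracy, Fin.val_succ, if_pos (by omega), Nat.add_sub_cancel]

theorem faceValue_degeneracy_lt {i : Fin (n + 2)} {k : Fin (n + 3)} (h : k.val < i.val) :
    (faceValue.{u} (degeneracy i) k).dim = k.val ∧
      (faceValue.{u} (degeneracy i) k).side = decide (Odd k.val) := by
  have := faceValue_of_range.{u} (f := degeneracy i) (k := k) (j := ⟨k.val, by omega⟩) fun w => ?_
  · rw [this.1, this.2]
    exact ⟨min_eq_left (show k.val ≤ n by omega), rfl⟩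
  · simp only [ne_eq, Fin.ext_iff, val_degeneracy]
    constructor
    · rintro ⟨v, hv, e⟩
      split_ifs at e <;> omega
    · intro hw
      by_cases hwi : w.val ≤ i.val
      · exact ⟨w.castSucc, by rw [Fin.val_castSucc]; omega, by
          rw [Fin.val_castSucc, if_neg (by omega)]⟩
      · exact ⟨w.succ, by rw [Fin.val_succ]; omega, by
          rw [Fin.val_succ, if_pos (by omega), Nat.add_sub_cancel]⟩

theorem faceValue_degeneracy_gt {i : Fin (n + 2)} {k : Fin (n + 3)} (h : i.val + 1 < k.val) :
    (faceValue.{u} (degeneracy i) k).dim = min (k.val - 1) n ∧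
      (faceValue.{u} (degeneracy i) k).side = decide (Odd (k.val - 1)) := by
  refine faceValue_of_range.{u} (f := degeneracy i) (k := k) (j := ⟨k.val - 1, by omega⟩) fun w => ?_
  simp only [ne_eq, Fin.ext_iff, val_degeneracy]
  constructor
  · rintro ⟨v, hv, e⟩
    split_ifs at e <;> omega
  · intro hw
    by_cases hwi : w.val ≤ i.val
    · exact ⟨w.castSucc, by rw [Fin.val_castSucc]; omega, by
        rw [Fin.val_castSucc, if_neg (by omega)]⟩
    · exact ⟨w.succ, by rw [Fin.val_succ]; omega, by
        rw [Fin.val_succ, if_pos (by omega), Nat.add_sub_cancel]⟩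

/-- The map of vertices that collapses the vertices from `q` to the last but one. -/
def collapse (n q : ℕ) (hq : q < n) : Fin (n + 3) →o Fin (q + 2) where
  toFun v := ⟨if v.val < q then v.val else if v.val < n + 2 then q else q + 1, by split_ifs <;> omega⟩
  monotone' v w h := by
    have : v.val ≤ w.val := h
    show (if v.val < q then v.val else if v.val < n + 2 then q else q + 1) ≤
      if w.val < q then w.val else if w.val < n + 2 then q else q + 1
    split_ifs <;> omega

theorem val_collapse (hq : q < n) (v : Fin (n + 3)) : (collapse n q hq v).val =
    if v.val < q then v.val else if v.val < n + 2 then q else q + 1 := rfl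

theorem fixesBelow_collapse (hq : q < n) : FixesBelow q (collapse n q hq) := by
  refine ⟨fun v hv => ?_, fun v hv => ?_⟩
  · rw [val_collapse, if_pos hv]
  · rw [val_collapse]
    split_ifs <;> omega

theorem faceValue_collapse (hq : q < n) {k : Fin (n + 3)} (hk : k.val = n + 1) :
    faceValue.{u} (collapse n q hq) k = Globe.top (q + 1) := by
  refine faceValue_of_surjective fun w => ?_
  by_cases hw : w.val ≤ q
  · refine ⟨⟨w.val, by omega⟩, fun e => ?_, Fin.ext ?_⟩
    · have : w.val = k.val := congrArg Fin.val e
      omega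
    · show (if w.val < q then w.val else if w.val < n + 2 then q else q + 1) = w.val
      split_ifs <;> omega
  · refine ⟨Fin.last (n + 2), fun e => ?_, Fin.ext ?_⟩
    · have : n + 2 = k.val := congrArg Fin.val e
      omega
    · rw [val_collapse, Fin.val_last, if_neg (by omega), if_neg (lt_irrefl _)]
      omega

theorem faceValue_collapse_last (hq : q < n) {k : Fin (n + 3)} (hk : k.val = n + 2) :
    (faceValue.{u} (collapse n q hq) k).dim = q ∧
      (faceValue.{u} (collapse n q hq) k).side = decide (Odd (q + 1)) := by
  have := faceValue_of_range.{u} (f := collapse n q hq) (k := k) (j := Fin.last (q + 1)) fun w => ?_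
  · rw [this.1, this.2]
    exact ⟨min_eq_right (Nat.le_succ q), rfl⟩
  · simp only [ne_eq, Fin.ext_iff, val_collapse, Fin.val_last]
    constructor
    · rintro ⟨v, hv, e⟩
      split_ifs at e <;> omega
    · intro hw
      refine ⟨⟨w.val, by omega⟩, by show ¬ w.val = k.val; omega, ?_⟩
      show (if w.val < q then w.val else if w.val < n + 2 then q else q + 1) = w.val
      split_ifs <;> omega

variable {I : Type w} {E : I → OmegaCat.{v}} {R : ∀ i j, OmegaFunctor (E i) (E j) → Prop}

/-- The family of chains of the folded simplices with given values. -/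
noncomputable def foldChain (n : ℕ) (a : ∀ i, E i) : ∀ i, OmegaFunctor (omegaCat n) (E i) →₀ ℤ :=
  fun i => Finsupp.single (fold n (a i)) 1

/-- The relation given by gluing two foldings. -/
theorem sum_glue_mem_naturalNull {a b : ℕ} {f : Fin (n + 3) →o Fin (a + 1)}
    {g : Fin (n + 3) →o Fin (b + 1)} (ha : a ≤ n + 1) (hb : b ≤ n + 1)
    (H : ∀ x : omegaCat (n + 2), GlobeCell.Glued q ((map f).trans (psi.{v} a) x)
      ((map g).trans (psi.{v} b) x)) {U V : ∀ i, E i} (hU : NaturalElement R U)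
    (hV : NaturalElement R V) (huv : ∀ i, (E i).d true q (U i) = (E i).d false q (V i))
    (S : Finset (Fin (n + 3))) (hS : ∀ k ∉ S, (faceValue.{v} f k).dim ≤ n ∧
      (faceValue.{v} g k).dim ≤ n) :
    ∑ k ∈ S, (-1 : ℤ) ^ (k : ℕ) • foldChain (n + 1) (fun i => Globe.glue (huv i)
      (faceValue.{v} f k) (faceValue.{v} g k)) ∈ naturalNull R (n + 1) := by
  have hs : NaturalSimplex R fun i => Globe.glueFunctor (huv i) _ _ H := fun i j φ hφ =>
    OmegaFunctor.ext (funext fun x => by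
      have e : OmegaFunctor.toFun φ (U i) = U j := hU i j φ hφ
      have e' : OmegaFunctor.toFun φ (V i) = V j := hV i j φ hφ
      have h := huv j
      rw [← e, ← e'] at h
      refine (Globe.map_glue (huv i) φ h _ _).trans ?_
      show Globe.glue h _ _ = Globe.glue (huv j) _ _
      congr 1)
  have hv : ∀ (k : Fin (n + 3)) (c : ℕ) (f : Fin (n + 3) →o Fin (c + 1)),
      (map f).trans (psi.{v} c) (map (SimplexCategory.δ k).toOrderHom (top (n + 1))) =
        faceValue.{v} f k := fun k c f =>
    congrArg (value (psi.{v} c)) (map_map_apply (SimplexCategory.δ k).toOrderHom f (top (n + 1)))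
  have hg : ∀ (k : Fin (n + 3)) i, Globe.glueFunctor (huv i) _ _ H
      (map (SimplexCategory.δ k).toOrderHom (top (n + 1))) =
        Globe.glue (huv i) (faceValue.{v} f k) (faceValue.{v} g k) := fun k i =>
    congrArg₂ (Globe.glue (huv i)) (hv k a f) (hv k b g)
  -- The glued simplex is thin: it is an `(n+2)`-simplex whose values come from globes of dimension
  -- at most `n + 1`.
  have h := sum_fold_mem_naturalNull hs (fun i => Nat.lt_succ_of_le
    (Globe.dim_glue_le (huv i) ((GlobeCell.le _).trans ha) ((GlobeCell.le _).trans hb))) S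
    fun k hk i => by
      rw [hg]
      exact Nat.lt_succ_of_le (Globe.dim_glue_le (huv i) (hS k hk).1 (hS k hk).2)
  simp only [hg] at h
  exact h

theorem mem_of_neg_one_pow_smul_mem {G : Type*} [AddCommGroup G] {H : AddSubgroup G} {k : ℕ} {x : G}
    (h : (-1 : ℤ) ^ k • x ∈ H) : x ∈ H := by
  have := AddSubgroup.zsmul_mem _ h ((-1) ^ k)
  rwa [smul_smul, ← mul_pow, neg_one_mul, neg_neg, one_pow, one_smul] at this

theorem dim_faceValue_degeneracy_le {i : Fin (n + 2)} {k : Fin (n + 3)} (h : k.val ≠ i.val)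
    (h' : k.val ≠ i.val + 1) : (faceValue.{u} (degeneracy i) k).dim ≤ n := by
  rcases lt_or_gt_of_ne h with h | h
  · rw [(faceValue_degeneracy_lt h).1]
    omega
  · rw [(faceValue_degeneracy_gt (by omega)).1]
    exact min_le_right _ _

/-- The relation given by gluing the foldings of two successive degeneracies. -/
theorem three_faces_mem_naturalNull {a b : Fin (n + 2)} (ha : a.val = q ∨ a.val = q + 1)
    (hb : b.val = q ∨ b.val = q + 1) (hq : q ≤ n)
    (H : ∀ x : omegaCat (n + 2), GlobeCell.Glued q ((map (degeneracy a)).trans (psi.{v} (n + 1)) x)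
      ((map (degeneracy b)).trans (psi.{v} (n + 1)) x)) {U V X Y Z : ∀ i, E i}
    (hU : NaturalElement R U) (hV : NaturalElement R V)
    (huv : ∀ i, (E i).d true q (U i) = (E i).d false q (V i))
    (hX : ∀ i, ∀ k : Fin (n + 3), k.val = q → Globe.glue (huv i) (faceValue.{v} (degeneracy a) k)
      (faceValue.{v} (degeneracy b) k) = X i)
    (hY : ∀ i, ∀ k : Fin (n + 3), k.val = q + 1 → Globe.glue (huv i)
      (faceValue.{v} (degeneracy a) k) (faceValue.{v} (degeneracy b) k) = Y i)
    (hZ : ∀ i, ∀ k : Fin (n + 3), k.val = q + 2 → Globe.glue (huv i)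
      (faceValue.{v} (degeneracy a) k) (faceValue.{v} (degeneracy b) k) = Z i) :
    foldChain (n + 1) X - foldChain (n + 1) Y + foldChain (n + 1) Z ∈ naturalNull R (n + 1) := by
  -- A degeneracy at `q` or `q + 1` is full only on its faces between `q` and `q + 2`; all other
  -- faces have values of dimension at most `n`.
  have h := sum_glue_mem_naturalNull le_rfl le_rfl H hU hV huv
    {⟨q, by omega⟩, ⟨q + 1, by omega⟩, ⟨q + 2, by omega⟩} fun k hk => by
      simp only [Finset.mem_insert, Finset.mem_singleton, Fin.ext_iff, not_or] at hk
      exact ⟨dim_faceValue_degeneracy_le (by omega) (by omega),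
        dim_faceValue_degeneracy_le (by omega) (by omega)⟩
  rw [Finset.sum_insert (by simp [Fin.ext_iff]), Finset.sum_insert (by simp [Fin.ext_iff]),
    Finset.sum_singleton] at h
  simp only [hX _ ⟨q, _⟩ rfl, hY _ ⟨q + 1, _⟩ rfl, hZ _ ⟨q + 2, _⟩ rfl] at h
  refine mem_of_neg_one_pow_smul_mem (k := q) ?_
  convert h using 1
  simp only [pow_succ, smul_sub, smul_add, mul_neg, mul_one, neg_neg, neg_smul]
  abel

/-- The relation given by gluing two foldings, when only the last two faces are not thin. -/
theorem two_faces_mem_naturalNull {a b : ℕ} {f : Fin (n + 3) →o Fin (a + 1)}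
    {g : Fin (n + 3) →o Fin (b + 1)} (ha : a ≤ n + 1) (hb : b ≤ n + 1)
    (H : ∀ x : omegaCat (n + 2), GlobeCell.Glued q ((map f).trans (psi.{v} a) x)
      ((map g).trans (psi.{v} b) x)) {U V X Y : ∀ i, E i}
    (hf : ∀ k : Fin (n + 3), k.val < n + 1 → (faceValue.{v} f k).dim ≤ n)
    (hg : ∀ k : Fin (n + 3), k.val < n + 1 → (faceValue.{v} g k).dim ≤ n)
    (hU : NaturalElement R U) (hV : NaturalElement R V)
    (huv : ∀ i, (E i).d true q (U i) = (E i).d false q (V i))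
    (hX : ∀ i, ∀ k : Fin (n + 3), k.val = n + 1 → Globe.glue (huv i) (faceValue.{v} f k)
      (faceValue.{v} g k) = X i)
    (hY : ∀ i, ∀ k : Fin (n + 3), k.val = n + 2 → Globe.glue (huv i) (faceValue.{v} f k)
      (faceValue.{v} g k) = Y i) :
    foldChain (n + 1) Y - foldChain (n + 1) X ∈ naturalNull R (n + 1) := by
  have h := sum_glue_mem_naturalNull ha hb H hU hV huv
    {⟨n + 1, by omega⟩, ⟨n + 2, by omega⟩} fun k hk => by
      simp only [Finset.mem_insert, Finset.mem_singleton, Fin.ext_iff, not_or] at hk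
      exact ⟨hf k (by omega), hg k (by omega)⟩
  rw [Finset.sum_insert (by simp [Fin.ext_iff]), Finset.sum_singleton] at h
  simp only [hX _ ⟨n + 1, _⟩ rfl, hY _ ⟨n + 2, _⟩ rfl] at h
  refine mem_of_neg_one_pow_smul_mem (k := n) ?_
  convert h using 1
  simp only [pow_succ, smul_sub, mul_neg, mul_one, neg_neg, neg_smul]
  abel

theorem degeneracy_eq_imp {a b : Fin (n + 2)} (ha : a.val = q) (hb : q < b.val) (v : Fin (n + 3))
    (h : (degeneracy b v).val = q) : (degeneracy a v).val = q := by
  rw [val_degeneracy] at h ⊢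
  split_ifs at h ⊢ <;> omega

theorem collapse_eq_imp (hq : q < n) {a : Fin (n + 2)} (ha : a.val = n + 1) (v : Fin (n + 3))
    (h : (degeneracy a v).val = q) : (collapse n q hq v).val = q := by
  rw [val_degeneracy] at h
  rw [val_collapse]
  split_ifs at h ⊢ <;> omega

/-- Composites of folded simplices are naturally additive in the reduced complex. -/
theorem add_sub_comp_mem_naturalNull {U V : ∀ i, E i} (hU : NaturalElement R U)
    (hV : NaturalElement R V) (huv : ∀ i, (E i).d true q (U i) = (E i).d false q (V i))
    (dU : ∀ i, (E i).dim (U i) ≤ n + 1) (dV : ∀ i, (E i).dim (V i) ≤ n + 1) (hq : q ≤ n) :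
    foldChain (n + 1) U + foldChain (n + 1) V -
      foldChain (n + 1) (fun i => (E i).comp q (U i) (V i) (huv i)) ∈ naturalNull R (n + 1) := by
  -- The degeneracies at `q` and `q + 1` are glued for the main relation. The last degeneracy `c` is
  -- glued with the collapse onto the `(q+1)`-simplex for the correcting one.
  let a : Fin (n + 2) := ⟨q, by omega⟩
  let b : Fin (n + 2) := ⟨q + 1, by omega⟩
  let c : Fin (n + 2) := ⟨n + 1, by omega⟩
  have fa : FixesBelow q (degeneracy a) := fixesBelow_degeneracy le_rfl
  have fb : FixesBelow q (degeneracy b) := fixesBelow_degeneracy (Nat.le_succ q)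
  have fc : FixesBelow q (degeneracy c) := fixesBelow_degeneracy (hq.trans (Nat.le_succ n))
  have hab := degeneracy_eq_imp (n := n) (q := q) (a := a) (b := b) rfl (Nat.lt_succ_self q)
  have hq' : q < n + 1 := Nat.lt_succ_of_le hq
  have hc : ∀ k : Fin (n + 3), k.val < n + 1 → (faceValue.{v} (degeneracy c) k).dim ≤ n :=
    fun k hk => dim_faceValue_degeneracy_le hk.ne (by show k.val ≠ n + 1 + 1; omega)
  have hW : ∀ (h : q < n) (k : Fin (n + 3)), k.val < n + 1 →
      (faceValue.{v} (collapse n q h) k).dim ≤ n := fun h k _ => (GlobeCell.le _).trans h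
  have hY : ∀ i, ∀ k : Fin (n + 3), k.val = q + 1 → ∀ a b : Fin (n + 2), a.val = q ∨ a.val = q + 1 →
      b.val = q ∨ b.val = q + 1 → Globe.glue (huv i) (faceValue.{v} (degeneracy a) k)
        (faceValue.{v} (degeneracy b) k) = (E i).comp q (U i) (V i) (huv i) :=
    fun i k hk a b ha hb => by
      rw [faceValue_degeneracy_self (by omega), faceValue_degeneracy_self (by omega),
        Globe.glue_top_top (huv i) hq' hq' (dU i) (dV i)]
  rcases Nat.even_or_odd q with he | ho
  · have ho' : decide (Odd (q + 1)) = true := decide_eq_true he.add_one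
    have h0 : decide (Odd q) = false := decide_eq_false (Nat.not_odd_iff_even.2 he)
    have hX : ∀ i, ∀ k : Fin (n + 3), k.val = q → Globe.glue (huv i)
        (faceValue.{v} (degeneracy a) k) (faceValue.{v} (degeneracy b) k) = U i := fun i k hk => by
      rw [faceValue_degeneracy_self (Or.inl hk)]
      have := (faceValue_degeneracy_lt.{v} (i := b) (k := k) (by show k.val < q + 1; omega)).1
      exact Globe.glue_top_left (huv i) hq' (dU i) (by omega)
    have hd : ∀ k : Fin (n + 3), k.val = q + 2 → (faceValue.{v} (degeneracy a) k).dim = min (q + 1) n ∧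
        (faceValue.{v} (degeneracy a) k).side = true := fun k hk => by
      have := faceValue_degeneracy_gt.{v} (i := a) (k := k) (by show q + 1 < k.val; omega)
      rw [show k.val - 1 = q + 1 by omega, ho'] at this
      exact this
    -- For even `q`, the faces `q` and `q + 1` are `U` and `U *_q V`; the face `q + 2` is `V` if `q
    -- = n`, and depends on `t_{q+1} U` otherwise.
    have T₁ := fun Z => three_faces_mem_naturalNull (R := R) (Z := Z) (Or.inl rfl) (Or.inr rfl) hq
      (glued_of_even.{v} fb fa hq' hq' hab he) hU hV huv hX
      (fun i k hk => hY i k hk a b (Or.inl rfl) (Or.inr rfl))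
    rcases hq.eq_or_lt with rfl | hqn
    · have h := T₁ V fun i k hk => by
        rw [faceValue_degeneracy_self (i := b) (Or.inr hk)]
        refine Globe.glue_top_right (huv i) (dV i) ?_ (hd k hk).2
        rw [(hd k hk).1]
        omega
      rwa [sub_add_eq_add_sub] at h
    -- Now the face `q + 2` is `t_{q+1} U *_q V`. The second thin simplex has this composite and `V`
    -- as its last two faces and thin faces elsewhere, so it replaces the composite by `V`.
    · have hwv : ∀ i, (E i).d true q ((E i).d true (q + 1) (U i)) = (E i).d false q (V i) :=
        fun i => by rw [(E i).d_d_lt _ _ _ _ _ (Nat.lt_succ_self q), huv]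
      have h₁ := T₁ (fun i => (E i).comp q _ _ (hwv i)) fun i k hk => by
        rw [faceValue_degeneracy_self (i := b) (Or.inr hk)]
        have hdim : (faceValue.{v} (degeneracy a) k).dim = q + 1 := by
          rw [(hd k hk).1]
          omega
        refine (Globe.glue_comp (huv i) (hdim ▸ Nat.lt_succ_self q) hq').trans ?_
        refine (E i).comp_congr ?_ (Globe.face_top (dV i)) _ _
        rw [Globe.face, hdim, (hd k hk).2]
      have h₂ := two_faces_mem_naturalNull (R := R) (Y := V)
        (X := fun i => (E i).comp q _ _ (hwv i)) (Nat.succ_le_succ hq) le_rfl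
        (glued_of_even.{v} fc (fixesBelow_collapse hqn) hq' (Nat.lt_succ_self q)
          (collapse_eq_imp hqn rfl) he) (hW hqn) hc (hU.d true (q + 1)) hV hwv
        (fun i k hk => by
          rw [faceValue_collapse hqn hk, faceValue_degeneracy_self (i := c) (Or.inl hk)]
          exact Globe.glue_top_top (hwv i) (Nat.lt_succ_self q) hq' ((E i).dim_d_le _ _ _) (dV i))
        (fun i k hk => by
          rw [faceValue_degeneracy_self (i := c) (Or.inr hk)]
          have h := faceValue_collapse_last.{v} hqn hk
          exact Globe.glue_top_right (hwv i) (dV i) h.1 (h.2.trans ho'))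
      have h := AddSubgroup.add_mem _ h₁ h₂
      convert h using 1
      abel
  -- For odd `q` the roles are exchanged: the face `q` is `V`, and the face `q + 2` is `U`, or `U
  -- *_q s_{q+1} V` if `q < n`.
  · have ho' : decide (Odd (q + 1)) = false :=
      decide_eq_false (Nat.not_odd_iff_even.2 (ho.add_one))
    have h0 : decide (Odd q) = true := decide_eq_true ho
    have hX : ∀ i, ∀ k : Fin (n + 3), k.val = q → Globe.glue (huv i)
        (faceValue.{v} (degeneracy b) k) (faceValue.{v} (degeneracy a) k) = V i := fun i k hk => by
      rw [faceValue_degeneracy_self (i := a) (Or.inl hk)]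
      have := faceValue_degeneracy_lt.{v} (i := b) (k := k) (by show k.val < q + 1; omega)
      rw [hk, h0] at this
      exact Globe.glue_top_right (huv i) (dV i) this.1 this.2
    have hd : ∀ k : Fin (n + 3), k.val = q + 2 → (faceValue.{v} (degeneracy a) k).dim = min (q + 1) n ∧
        (faceValue.{v} (degeneracy a) k).side = false := fun k hk => by
      have := faceValue_degeneracy_gt.{v} (i := a) (k := k) (by show q + 1 < k.val; omega)
      rw [show k.val - 1 = q + 1 by omega, ho'] at this
      exact this
    have T₁ := fun Z => three_faces_mem_naturalNull (R := R) (Z := Z) (Or.inr rfl) (Or.inl rfl) hq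
      (glued_of_odd.{v} fb fa hq' hq' hab ho) hU hV huv hX
      (fun i k hk => hY i k hk b a (Or.inr rfl) (Or.inl rfl))
    rcases hq.eq_or_lt with rfl | hqn
    · have h := T₁ U fun i k hk => by
        rw [faceValue_degeneracy_self (i := b) (Or.inr hk)]
        refine Globe.glue_top_left (huv i) hq' (dU i) ?_
        rw [(hd k hk).1]
        omega
      convert h using 1
      abel
    · have huw : ∀ i, (E i).d true q (U i) = (E i).d false q ((E i).d false (q + 1) (V i)) :=
        fun i => by rw [(E i).d_d_lt _ _ _ _ _ (Nat.lt_succ_self q), huv]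
      have h₁ := T₁ (fun i => (E i).comp q _ _ (huw i)) fun i k hk => by
        rw [faceValue_degeneracy_self (i := b) (Or.inr hk)]
        have hdim : (faceValue.{v} (degeneracy a) k).dim = q + 1 := by
          rw [(hd k hk).1]
          omega
        refine (Globe.glue_comp (huv i) hq' (hdim ▸ Nat.lt_succ_self q)).trans ?_
        refine (E i).comp_congr (Globe.face_top (dU i)) ?_ _ _
        rw [Globe.face, hdim, (hd k hk).2]
      have h₂ := two_faces_mem_naturalNull (R := R) (Y := U)
        (X := fun i => (E i).comp q _ _ (huw i)) le_rfl (Nat.succ_le_succ hq)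
        (glued_of_odd.{v} fc (fixesBelow_collapse hqn) hq' (Nat.lt_succ_self q)
          (collapse_eq_imp hqn rfl) ho) hc (hW hqn) hU (hV.d false (q + 1)) huw
        (fun i k hk => by
          rw [faceValue_collapse hqn hk, faceValue_degeneracy_self (i := c) (Or.inl hk)]
          exact Globe.glue_top_top (huw i) hq' (Nat.lt_succ_self q) (dU i) ((E i).dim_d_le _ _ _))
        (fun i k hk => by
          rw [faceValue_degeneracy_self (i := c) (Or.inr hk)]
          have h := faceValue_collapse_last.{v} hqn hk
          exact Globe.glue_top_left (huw i) hq' (dU i) h.1.le)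
      have h := AddSubgroup.add_mem _ h₁ h₂
      convert h using 1
      abel

end Simplex

/-! ### Transfer to the branching semi-globular cut -/

namespace Simplex

variable {n q : ℕ}

/-- Three simplices of the nerve of an omega-category, such that the third evaluates to a composite
of the first two. -/
structure ComposableTriple (n q : ℕ) where
  /-- the omega-category -/
  cat : OmegaCat.{u}
  /-- the first simplex -/
  x : OmegaFunctor (omegaCat n) cat
  /-- the second simplex -/
  y : OmegaFunctor (omegaCat n) cat
  /-- the third simplex -/
  z : OmegaFunctor (omegaCat n) cat
  composable : cat.d true q (x (top n)) = cat.d false q (y (top n))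
  comp_eq : cat.comp q (x (top n)) (y (top n)) composable = z (top n)

/-- The omega-functors that map a triple of simplices to another. -/
def ComposableTriple.Hom (s t : ComposableTriple.{u} n q) (f : OmegaFunctor s.cat t.cat) : Prop :=
  s.x.trans f = t.x ∧ s.y.trans f = t.y ∧ s.z.trans f = t.z

/-- Each of the three simplices is naturally equivalent to its folding, and foldings are additive.
Indexing by all composable triples at once makes the witnesses functorial for every map of triples.
-/
theorem add_sub_mem_naturalNull (hq : q < n) :
    (fun s : ComposableTriple.{u} n q => Finsupp.single s.x (1 : ℤ) + Finsupp.single s.y 1 -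
      Finsupp.single s.z 1) ∈ naturalNull ComposableTriple.Hom n := by
  obtain ⟨n, rfl⟩ := Nat.exists_eq_add_of_lt hq
  have hx : NaturalSimplex ComposableTriple.Hom (ComposableTriple.x (n := q + n + 1) (q := q)) :=
    fun _ _ _ h => h.1
  have hy : NaturalSimplex ComposableTriple.Hom (ComposableTriple.y (n := q + n + 1) (q := q)) :=
    fun _ _ _ h => h.2.1
  have hz : NaturalSimplex ComposableTriple.Hom (ComposableTriple.z (n := q + n + 1) (q := q)) :=
    fun _ _ _ h => h.2.2
  have h₁ := AddSubgroup.sub_mem _ (AddSubgroup.add_mem _ (sub_fold_mem_naturalNull hx)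
    (sub_fold_mem_naturalNull hy)) (sub_fold_mem_naturalNull hz)
  have h₂ := add_sub_comp_mem_naturalNull (n := q + n) hx.top hy.top
    (fun s => s.composable)
    (fun s => (OmegaFunctor.dim_le s.x _).trans (dim_le _ _))
    (fun s => (OmegaFunctor.dim_le s.y _).trans (dim_le _ _)) (Nat.le_add_right q n)
  have h := AddSubgroup.add_mem _ h₁ h₂
  convert h using 1
  funext s
  simp only [Pi.add_apply, Pi.sub_apply, foldChain, s.comp_eq]
  abel

theorem toReduced_eq_iff {C : NCOmegaCat.{u}} {c c' : branchingSemiGlobularCut.Chains n C} :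
    branchingSemiGlobularCut.toReduced n C c = branchingSemiGlobularCut.toReduced n C c' ↔
      c - c' ∈ nerveNull n C.semiPath := by
  refine (QuotientAddGroup.eq_iff_sub_mem).trans ?_
  rfl

theorem folding_psi_reduced (n : ℕ) (C : NCOmegaCat.{u}) (c : branchingSemiGlobularCut.Chains n C) :
    branchingSemiGlobularCut.toReduced n C (Cut.chainMap
      ((branchingSemiGlobularCut.folding (fun n => natOf (psi n)) n).app C) c) =
        branchingSemiGlobularCut.toReduced n C c := by
  refine DFunLike.congr_fun (f := (branchingSemiGlobularCut.toReduced n C).comp (Cut.chainMap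
    ((branchingSemiGlobularCut.folding (fun n => natOf (psi n)) n).app C)))
    (Finsupp.addHom_ext' fun x => AddMonoidHom.ext_int ?_) c
  refine Eq.symm (toReduced_eq_iff.2 ?_)
  -- A single simplex is treated as a family over one point whose only map is the identity, so
  -- naturality is vacuous.
  have hs : NaturalSimplex (I := Unit) (fun _ _ f => f = OmegaFunctor.id C.semiPath)
      (fun _ : Unit => (x : OmegaFunctor (omegaCat n) C.semiPath)) := by
    rintro _ _ _ rfl
    rfl
  obtain ⟨τ, _, ρ, _, h⟩ := sub_fold_mem_naturalNull hs
  obtain ⟨h₁, h₂, h₃⟩ := h ()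
  have h₄ := AddSubgroup.add_mem _ (thin_mem_nerveNull h₁) (boundary_mem_nerveNull h₂)
  rw [← h₃] at h₄
  have e := chainMap_single ((branchingSemiGlobularCut.folding (fun n => natOf (psi n)) n).app C) x 1
  exact (congrArg (fun c => Finsupp.single x (1 : ℤ) - c ∈ nerveNull n C.semiPath) e).mpr h₄

/-- A morphism of non-contracting omega-categories induces a map of composable triples, so the
witnesses of `add_sub_mem_naturalNull` restrict to natural ones. -/
theorem add_eq_natural (hq : q < n) :
    ∃ (τ : ∀ (C : NCOmegaCat.{u}) (x y z : (branchingSemiGlobularCut.simp n).obj C),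
        branchingSemiGlobularCut.Composes n q C x y z → branchingSemiGlobularCut.Chains n C)
      (ρ : ∀ (C : NCOmegaCat.{u}) (x y z : (branchingSemiGlobularCut.simp n).obj C),
        branchingSemiGlobularCut.Composes n q C x y z → branchingSemiGlobularCut.Chains (n + 1) C),
      (∀ C x y z h, τ C x y z h ∈ branchingSemiGlobularCut.thin n C ∧
        ρ C x y z h ∈ branchingSemiGlobularCut.thin (n + 1) C ∧
          Finsupp.single x 1 + Finsupp.single y 1 - Finsupp.single z 1 =
            τ C x y z h + branchingSemiGlobularCut.boundary n C (ρ C x y z h)) ∧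
      ∀ (C D : NCOmegaCat.{u}) (f : C ⟶ D) x y z h h',
        τ D ((branchingSemiGlobularCut.simp n).map f x) ((branchingSemiGlobularCut.simp n).map f y)
            ((branchingSemiGlobularCut.simp n).map f z) h' =
            Cut.chainMap ((branchingSemiGlobularCut.simp n).map f) (τ C x y z h) ∧
          ρ D ((branchingSemiGlobularCut.simp n).map f x) ((branchingSemiGlobularCut.simp n).map f y)
            ((branchingSemiGlobularCut.simp n).map f z) h' =
            Cut.chainMap ((branchingSemiGlobularCut.simp (n + 1)).map f) (ρ C x y z h) := by
  obtain ⟨τ, hτ, ρ, hρ, h⟩ := add_sub_mem_naturalNull.{u} hq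
  let t : ∀ (C : NCOmegaCat.{u}) (x y z : (branchingSemiGlobularCut.simp n).obj C),
      branchingSemiGlobularCut.Composes n q C x y z → ComposableTriple.{u} n q :=
    fun C x y z h => ⟨C.semiPath, x, y, z, h.1, h.2⟩
  refine ⟨fun C x y z h => τ (t C x y z h), fun C x y z h => ρ (t C x y z h),
    fun C x y z h' => h (t C x y z h'), fun C D f x y z h h' => ?_⟩
  have hf : ComposableTriple.Hom (t C x y z h) (t D _ _ _ h') (NCOmegaCat.semiPathMap f) :=
    ⟨rfl, rfl, rfl⟩
  exact ⟨(hτ _ _ _ hf).symm, (hρ _ _ _ hf).symm⟩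

/-- The omega-category of the `0`-simplex has only the morphism `top 0`, the criterion
`eq_top_of_disjoint` being vacuous there; the operator of `psi 0` provides preimages. -/
theorem ev_zero_bijective (C : NCOmegaCat.{u}) :
    Function.Bijective ((branchingSemiGlobularCut.ev 0).app C) := by
  refine ⟨fun x y h => OmegaFunctor.ext (funext fun c => ?_), fun b =>
    ⟨(natOf (psi 0)).app C b, congrArg (fun η => η.app C b) (isSquare_psi.sq_ev 0)⟩⟩
  have hc : c = top 0 := eq_top_of_disjoint (n := 0) c fun q hq => absurd hq (Nat.not_lt_zero q)
  rw [hc]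
  exact congrArg Subtype.val h

theorem degeneracy_ev (n : ℕ) (i : Fin (n + 1)) :
    degeneracyMap branchingSemiGlobularCut.{u}.F n i ≫ branchingSemiGlobularCut.ev (n + 1) =
      branchingSemiGlobularCut.ev n ≫ branchingSemiGlobularCut.incl n := by
  ext C x
  refine Subtype.ext ?_
  exact congrArg (OmegaFunctor.toFun (A := omegaCat n) (B := C.semiPath) x)
    (map_top_of_surjective (f := (SimplexCategory.σ i).toOrderHom) (Fin.predAbove_surjective i))

end Simplex

theorem mainTheorem4 :
    branchingSemiGlobularCut.{u}.IsRegular ∧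
      ∃! sq : ∀ n : ℕ, branchingSemiGlobularCut.{u}.trP n ⟶ branchingSemiGlobularCut.{u}.simp n,
        branchingSemiGlobularCut.{u}.IsSquare sq := by
  refine ⟨?_, Simplex.existsUnique_isSquare⟩
  exact
    { point := ⟨𝟭 _, rfl⟩
      ev_zero := Simplex.ev_zero_bijective
      degeneracy_ev := Simplex.degeneracy_ev
      dot := fun n μ sq _ h => Simplex.existsUnique_dot n μ sq h
      last_faces := fun sq h n => by
        rw [Simplex.eq_psi_of_isSquare h (n + 1)]
        exact Simplex.last_faces_psi n
      faces := fun sq h n i p α => by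
        rw [Simplex.eq_psi_of_isSquare h (n + 1)]
        exact Simplex.faces_psi n i p α
      folding_eq := fun sq h n C c => by
        obtain rfl : sq = fun n => Simplex.natOf (Simplex.psi n) := funext (Simplex.eq_psi_of_isSquare h)
        exact Simplex.folding_psi_reduced n C c
      add_eq := fun n q hq C x y z h => by
        obtain ⟨τ, ρ, hτ, _⟩ := Simplex.add_eq_natural.{u} hq
        obtain ⟨h₁, h₂, h₃⟩ := hτ C x y z h
        rw [← map_add, Simplex.toReduced_eq_iff, h₃]
        exact AddSubgroup.add_mem _ (Simplex.thin_mem_nerveNull h₁) (Simplex.boundary_mem_nerveNull h₂)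
      add_eq_natural := fun n q hq => Simplex.add_eq_natural hq }
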